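/- **Setting.** Let $\alpha\in(1,2)$, let $k\ge 3$ be an integer, let $N\ge 1$, and let $b_1,\dots,b_N>0$. Put $C_\alpha=\frac{\Gamma(\alpha/2)}{2^{1-\alpha}\Gamma((2-\alpha)/2)}$ and $\Xi_\alpha=\frac{(\alpha+2)\Gamma(1-\frac\alpha2)\Gamma(3-\frac\alpha2)}{\Gamma(2-\alpha)}$, and write $e(x)=(\cos x,\sin x)$, $e^\perp(x)=(-\sin x,\cos x)$. *Point vortices.* The parameters of $N$ point vortices at rest are the $3N$ real coordinates $\lambda=(w_{i1},w_{i2},\gamma_i)_{1\le i\le N}$ of the positions $w_i\in\mathbb R^2$ and strengths $\gamma_i$ (the angular and linear velocities are fixed: $\Omega=U=0$). Define $\mathcal P^\alpha(\lambda)\in\mathbb R^{2N}$ by $$\mathcal P^\alpha_i(\lambda)=-\frac{\alpha C_\alpha}{2}\sum_{j\ne i}\gamma_j\frac{w_i-w_j}{|w_i-w_j|^{\alpha+2}} .$$ Let $\lambda^*$ be a stationary equilibrium: $\mathcal P^\alpha(\lambda^*)=0$, with $w_i^*$ pairwise distinct and all $\gamma_i^*\neq0$. Assume that $\lambda^*$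 is non-degenerate: the coordinates can be reordered as $\lambda=(\lambda_1,\lambda_2)$ with $\lambda_1\in\mathbb R^{2N-3}$ and $\operatorname{codim}\operatorname{ran}D_{\lambda_1}\mathcal P^\alpha(\lambda^*)=3$. Fix such a splitting. *Function spaces.* $X^{k+\alpha-1}$ is the space of functions $\sum_{n\ge2}(a_n\cos nx+d_n\sin nx)$ in the Sobolev space $H^{k+\alpha-1}$ of the circle, normed by $(\sum_n n^{2(k+\alpha-1)}(a_n^2+d_n^2))^{1/2}$; $\mathcal X^{k+\alpha-1}$ is its $N$-fold product with the maximum norm and $\mathcal B_X$ the open unit ball of the latter. *Contour equation.* For $f\in\mathcal B_X$ let $R_i=1+\varepsilon|\varepsilon|^\alpha b_i^{1+\alpha}f_i$, $z_i(x)=w_i+\varepsilon b_iR_i(x)e(x)$, and $$M_{ij}(x,y)=\big(R_i(x)R_j(y)+R_i'(x)R_j'(y)\big)\sin(x-y)+\big(R_i(x)R_j'(y)-R_i'(x)R_j(y)\big)\cos(x-y).$$ For $\varepsilon\ne0$ put $$\mathcal F^\alpha_i(\varepsilon,f,\lambda)(x)=\frac{C_\alpha\gamma_i}{2\pi\varepsilon|\varepsilon|^\alpha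 b_i^{1+\alpha}R_i(x)}\int_0^{2\pi}\frac{M_{ii}(x,y)\,dy}{\big((R_i(x)-R_i(y))^2+4R_i(x)R_i(y)\sin^2\frac{x-y}2\big)^{\alpha/2}}+\frac{C_\alpha}{2\pi\varepsilon R_i(x)}\sum_{j\ne i}\frac{\gamma_j}{b_j}\int_0^{2\pi}\frac{M_{ij}(x,y)\,dy}{|z_i(x)-z_j(y)|^\alpha},$$ and for $\varepsilon=0$ let $\mathcal F^\alpha$ be the continuous extension $$\mathcal F^\alpha_i(0,f,\lambda)(x)=\frac{C_\alpha\gamma_i}{2\pi}\int_0^{2\pi}\frac{(1-\frac\alpha2)f_i(x-y)\sin y-(f_i'(x)-f_i'(x-y))\cos y}{(4\sin^2\frac y2)^{\alpha/2}}\,dy+\mathcal P_i^\alpha(\lambda)\cdot e^\perp(x).$$ For $\varepsilon\neq0$, $\mathcal F^\alpha=0$ is the contour dynamics equation saying that the patches $\mathcal D_i^\varepsilon=w_i+\varepsilon b_i\mathcal O_i^\varepsilon$, with $\mathcal O_i^\varepsilon$ the domain containing $0$ bounded by $x\mapsto R_i(x)e(x)$, carrying the densities $\gamma_i/(\varepsilon^2b_i^2)$,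 are stationary for the gSQG equation. **Theorem.** There is $\varepsilon_1>0$ such that there is a unique $C^1$ map $(f,\lambda_1):(-\varepsilon_1,\varepsilon_1)\to\mathcal B_X\times\mathbb R^{2N-3}$ with $\lambda_1(0)=\lambda_1^*$ and $$\mathcal F^\alpha\big(\varepsilon,f(\varepsilon),(\lambda_1(\varepsilon),\lambda_2^*)\big)=0\qquad\text{for all }\varepsilon\in(-\varepsilon_1,\varepsilon_1).$$ As $\varepsilon\to0$, $\lambda_1(\varepsilon)=\lambda_1^*+o(\varepsilon)$, and in the norm of $\mathcal X^{k+\alpha-1}$ $$f_i(\varepsilon,x)=\varepsilon\,\frac{b_i\,\Xi_\alpha}{4}\sum_{j\ne i}\frac{\gamma_j^*}{\gamma_i^*}\,\frac{\big((w_j^*-w_i^*)\cdot e(x)\big)^2-\big((w_j^*-w_i^*)\cdot e^\perp(x)\big)^2}{|w_j^*-w_i^*|^{\alpha+4}}+o(\varepsilon).$$ For all $\varepsilon\in(-\varepsilon_1,\varepsilon_1)\setminus\{0\}$ one has $R_i>0$, the closures of the domains $\mathcal O_i^\varepsilon$ are strictly convex, and the closures of the patches $\mathcal D_1^\varepsilon,\dots,\mathcal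 D_N^\varepsilon$ (with $w_i=w_i(\varepsilon)$) are pairwise disjoint. -/

import Mathlib

open Set Filter Topology Asymptotics
open scoped BigOperators

namespace GSQG

noncomputable section

/-- The Euclidean plane. -/
abbrev Plane := EuclideanSpace ℝ (Fin 2)

/-- The radial unit vector `(cos x, sin x)`. -/
def radial (x : ℝ) : Plane := !₂[Real.cos x, Real.sin x]

/-- The angular unit vector `(-sin x, cos x)`. -/
def angular (x : ℝ) : Plane := !₂[-Real.sin x, Real.cos x]

/-- The constant of the gSQG kernel `(C_α / 2π) |x|^{-α}`. -/
def kernelConst (α : ℝ) : ℝ :=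
  Real.Gamma (α / 2) / ((2 : ℝ) ^ (1 - α) * Real.Gamma ((2 - α) / 2))

/-- Labels of the scalar parameters of `N` vortices: `(0, i)` and `(1, i)` label the two
coordinates of the position `w_i`, and `(2, i)` labels the strength `γ_i`. -/
abbrev Coord (N : ℕ) := Fin 3 × Fin N

/-- Parameters of `N` point vortices (the angular and linear velocities are fixed to be zero). -/
abbrev Param (N : ℕ) := Coord N → ℝ

/-- The position `w_i`. -/
def pos {N : ℕ} (lam : Param N) (i : Fin N) : Plane := !₂[lam (0, i), lam (1, i)]

/-- The strength `γ_i` (the circulation is `π γ_i`). -/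
def strength {N : ℕ} (lam : Param N) (i : Fin N) : ℝ := lam (2, i)

/-- The map whose zeros are the stationary configurations of `N` point vortices:
`P_i = - (α C_α / 2) ∑_{j ≠ i} γ_j (w_i - w_j) / |w_i - w_j|^{α + 2}`. -/
def pointVortexMap {N : ℕ} (α : ℝ) (lam : Param N) (i : Fin N) : Plane :=
  -((α * kernelConst α / 2) •
    ∑ j ∈ Finset.univ.erase i,
      (strength lam j / ‖pos lam i - pos lam j‖ ^ (α + 2)) • (pos lam i - pos lam j))

/-- The splitting `λ = (λ₁, λ₂)` of the parameters: the coordinates labelled by `S` are the free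
ones and are given by `μ`, the others are taken from `lam`. -/
def glue {N : ℕ} (S : Finset (Coord N)) (lam : Param N) (μ : S → ℝ) : Param N :=
  fun c => if h : c ∈ S then μ ⟨c, h⟩ else lam c

/-- The free part `λ₁` of `λ`. -/
def freePart {N : ℕ} (S : Finset (Coord N)) (lam : Param N) : S → ℝ := fun c => lam c

/-- The partial derivative `D_{λ₁} P` at `lam`. -/
def partialDeriv {N : ℕ} (α : ℝ) (S : Finset (Coord N)) (lam : Param N) :
    (S → ℝ) →L[ℝ] (Fin N → Plane) :=
  fderiv ℝ (fun μ : S → ℝ => pointVortexMap α (glue S lam μ)) (freePart S lam)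

/-- `lam` is a stationary equilibrium of `N` point vortices at distinct points with nonzero
strengths. -/
structure IsStationary {N : ℕ} (α : ℝ) (lam : Param N) : Prop where
  distinct : Function.Injective (pos lam)
  strength_ne_zero : ∀ i, strength lam i ≠ 0
  equilibrium : ∀ i, pointVortexMap α lam i = 0

/-- The equilibrium `lam` is non-degenerate in the stationary sense for the choice `S` of free
coordinates: there are `2N - 3` of them, and the range of `D_{λ₁} P` has codimension `3`. -/
structure IsNondegenerate {N : ℕ} (α : ℝ) (lam : Param N) (S : Finset (Coord N)) : Prop where
  card_free : S.card + 3 = 2 * N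
  codim_range : Module.finrank ℝ
    ((Fin N → Plane) ⧸ LinearMap.range (partialDeriv α S lam).toLinearMap) = 3

/-- The space of the real functions `∑_{n ≥ 2} (a_n cos (n x) + d_n sin (n x))` in the Sobolev
space `H^s` of the circle, with norm `(∑ n^{2s} (a_n² + d_n²))^{1/2}`. An element is
stored through the square-summable sequence `n ↦ n^s (a_n, d_n)`, `n ≥ 2` (indexed from `0`), so
that the space is a Hilbert space isometric to `ℓ²`. -/
@[nolint unusedArguments]
abbrev XSpace (_s : ℝ) := lp (fun _ : ℕ => Plane) 2

/-- The function represented by an element of `XSpace s`. -/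
def toFun (s : ℝ) (c : XSpace s) (x : ℝ) : ℝ :=
  ∑' n : ℕ, ((n : ℝ) + 2) ^ (-s) *
    (c n 0 * Real.cos (((n : ℝ) + 2) * x) + c n 1 * Real.sin (((n : ℝ) + 2) * x))

/-- The radius function `R(x) = 1 + ε |ε|^α b^{1+α} f(x)` of a perturbed unit disc. -/
def radius (α ε b : ℝ) (f : ℝ → ℝ) (x : ℝ) : ℝ :=
  1 + ε * |ε| ^ α * b ^ (1 + α) * f x

/-- `- z'(x)^⊥ · ζ'(y)` for the curves `z = R (cos, sin)` and `ζ = T (cos, sin)`. -/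
def crossTerm (R T : ℝ → ℝ) (x y : ℝ) : ℝ :=
  (R x * T y + deriv R x * deriv T y) * Real.sin (x - y)
    + (R x * deriv T y - deriv R x * T y) * Real.cos (x - y)

/-- The contribution of the `i`-th patch to the contour equation on its own boundary (`ε ≠ 0`). -/
def selfTerm (α ε b γ : ℝ) (f : ℝ → ℝ) (x : ℝ) : ℝ :=
  kernelConst α * γ / (2 * Real.pi * (ε * |ε| ^ α) * b ^ (1 + α) * radius α ε b f x) *
    ∫ y in (0 : ℝ)..(2 * Real.pi),
      crossTerm (radius α ε b f) (radius α ε b f) x y /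
        ((radius α ε b f x - radius α ε b f y) ^ 2
          + 4 * radius α ε b f x * radius α ε b f y * Real.sin ((x - y) / 2) ^ 2) ^ (α / 2)

/-- The point `w + ε b R(x) (cos x, sin x)` of the boundary of a patch. -/
def boundaryPoint (α ε b : ℝ) (w : Plane) (f : ℝ → ℝ) (x : ℝ) : Plane :=
  w + (ε * b * radius α ε b f x) • radial x

/-- The contribution of the other patches to the contour equation on the boundary of the `i`-th
patch (`ε ≠ 0`). -/
def interactionTerm {N : ℕ} (α : ℝ) (b : Fin N → ℝ) (ε : ℝ) (f : Fin N → ℝ → ℝ)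
    (lam : Param N) (i : Fin N) (x : ℝ) : ℝ :=
  kernelConst α / (2 * Real.pi * ε * radius α ε (b i) (f i) x) *
    ∑ j ∈ Finset.univ.erase i, strength lam j / b j *
      ∫ y in (0 : ℝ)..(2 * Real.pi),
        crossTerm (radius α ε (b i) (f i)) (radius α ε (b j) (f j)) x y /
          ‖boundaryPoint α ε (b i) (pos lam i) (f i) x
            - boundaryPoint α ε (b j) (pos lam j) (f j) y‖ ^ α

/-- The linear operator which is the value of `selfTerm` in the limit `ε → 0`. -/
def selfTermZero (α γ : ℝ) (f : ℝ → ℝ) (x : ℝ) : ℝ :=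
  kernelConst α * γ * (1 - α / 2) / (2 * Real.pi) *
      (∫ y in (0 : ℝ)..(2 * Real.pi),
        f (x - y) * Real.sin y / (4 * Real.sin (y / 2) ^ 2) ^ (α / 2))
    - kernelConst α * γ / (2 * Real.pi) *
      ∫ y in (0 : ℝ)..(2 * Real.pi),
        (deriv f x - deriv f (x - y)) * Real.cos y / (4 * Real.sin (y / 2) ^ 2) ^ (α / 2)

/-- The contour functional for stationary patches. For `ε ≠ 0`, `functional … i x` is, up to a
nonzero factor, the normal velocity at the boundary point with angle `x` of the `i`-th patch
generated by the patches of density `γ_j / (ε² b_j²)` bounded by the curves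
`w_j + ε b_j R_j(x) (cos x, sin x)`. For `ε = 0` it is the continuous extension. -/
def functional {N : ℕ} (α : ℝ) (b : Fin N → ℝ) (ε : ℝ) (f : Fin N → ℝ → ℝ)
    (lam : Param N) (i : Fin N) (x : ℝ) : ℝ :=
  if ε = 0 then
    selfTermZero α (strength lam i) (f i) x + inner ℝ (pointVortexMap α lam i) (angular x)
  else
    selfTerm α ε (b i) (strength lam i) (f i) x + interactionTerm α b ε f lam i x

/-- The domain `O` containing the origin and bounded by the curve `R(x) (cos x, sin x)`. -/
def starDomain (R : ℝ → ℝ) : Set Plane :=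
  {p | ∃ x r : ℝ, 0 ≤ r ∧ r < R x ∧ p = r • radial x}

/-- The patch `D = w + ε b O`, where `O` is bounded by the curve `R(x) (cos x, sin x)`. -/
def patch (α ε b : ℝ) (w : Plane) (f : ℝ → ℝ) : Set Plane :=
  (fun p : Plane => w + (ε * b) • p) '' starDomain (radius α ε b f)

/-- The constant `Ξ_α`. -/
def xiConst (α : ℝ) : ℝ :=
  (α + 2) * Real.Gamma (1 - α / 2) * Real.Gamma (3 - α / 2) / Real.Gamma (2 - α)

/-- The leading coefficient of the boundary perturbation of the `i`-th patch:
`(b_i Ξ_α / 4) ∑_{j ≠ i} (γ_j / γ_i) ((d·e(x))² - (d·e'(x))²) / |d|^{α+4}` with `d = w_j - w_i`,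
`e = (cos, sin)`. The numerator is `Re (d̄² e^{2ix})` in complex notation. -/
def firstOrder {N : ℕ} (α : ℝ) (b : Fin N → ℝ) (lam : Param N) (i : Fin N) (x : ℝ) : ℝ :=
  b i * (xiConst α / 4) *
    ∑ j ∈ Finset.univ.erase i, strength lam j / strength lam i *
      ((inner ℝ (pos lam j - pos lam i) (radial x) ^ 2
        - inner ℝ (pos lam j - pos lam i) (angular x) ^ 2)
        / ‖pos lam j - pos lam i‖ ^ (α + 4))

/-- `(f, λ₁)` is a `C¹` curve on `(-ε₁, ε₁)` with values in the product of the open unit ball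
of `(X^s)^N` and the space of the free parameters, issuing from `λ₁*` at `ε = 0`, along which the
contour functional vanishes. -/
structure IsSolutionCurve {N : ℕ} (α s : ℝ) (b : Fin N → ℝ) (S : Finset (Coord N))
    (lam : Param N) (ε₁ : ℝ) (f : ℝ → Fin N → XSpace s) (lam₁ : ℝ → S → ℝ) : Prop where
  contDiffOn : ContDiffOn ℝ 1 (fun ε => (f ε, lam₁ ε)) (Ioo (-ε₁) ε₁)
  mem_ball : ∀ ε ∈ Ioo (-ε₁) ε₁, ‖f ε‖ < 1
  initial : lam₁ 0 = freePart S lam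
  zero : ∀ ε ∈ Ioo (-ε₁) ε₁, ∀ (i : Fin N) (x : ℝ),
    functional α b ε (fun j => toFun s (f ε j)) (glue S lam (lam₁ ε)) i x = 0

end

end GSQG

set_option linter.unusedSectionVars false

/-! Let H_i be the contour functional multiplied by the radius R_i. At ε = 0 it splits as H_i = (C_α
γ_i / 2π) L f_i + P_i · e^⊥, where L is a Fourier multiplier acting on e^{inx} by -i n (K_n - K_1),
with K_n = ∫ (1 - cos nh) |2 sin(h/2)|^{-α} dh. A two-term recursion shows that K_n is strictly
increasing, and K_n is comparable to n^{α-1}. Hence L is invertible of order α on the modes n ≥ 2,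
and it produces no mode of index one. The linearised problem therefore decouples: the modes n ≥ 2
determine f, and mode one determines λ₁ through D = D_{λ₁} P. A dimension count makes D injective,
with a left inverse A. The implicit function theorem applies to the pair (modes n ≥ 2 of H, A of
mode one of H); see `contourMap`, `isInvertible_contourDeriv` and `exists_branch`.

This reduced equation ignores the means of the H_i and three combinations of their first modes. They
are recovered from conservation laws. The integral of z' × ζ' |z - ζ|^{-α} over two closed curves
vanishes, and so does its integral against φ(z) - φ(ζ) when φ is affine or |z|². Both follow from
antisymmetry and Stokes' theorem on the torus (`ClosedCurve.stokes`), the singular kernel being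
regularised first. So the H_i have mean zero and their linear and angular momenta vanish. At ε = 0
the momenta become those of point vortices; their common kernel contains ran D and has the same
dimension, and A is injective on ran D. Thus A together with the momenta is injective on first modes
near λ*, and zeros of the reduced equation are true zeros (`eventually_totalH_eq_zero`).

All maps live in ℓ¹ spaces of Fourier coefficients with weight ρ^|n|, which are Banach algebras. A
profile is stored as g ∈ ℓ¹ with amplitudes n^{-α} ρ^{-n} g_n, so that L becomes a diagonal operator
bounded above and below. The powers -α/2 of squared distances are binomial series in the algebra of
bounded functions of the angle difference h = x - y with values in the Wiener algebra, so continuous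
differentiability is formal; |ε|^α is C¹ because α > 1. The choice ρ = 2 yields existence: these
analytic profiles embed in every Sobolev space and have the two derivatives needed for convexity and
for the flux bounds. The choice ρ = 1 yields uniqueness: by Cauchy-Schwarz its profile space
contains the Sobolev space, so the local uniqueness of the implicit function theorem applies to any
competing curve, and connectedness of the interval spreads it.

For unperturbed discs the ε-derivative of H contains only mode two. Hence λ₁'(0) = 0, and f'(0) is
that mode divided by K_2 - K_1; a beta integral gives Ξ_α (K_2 - K_1) = π α (α + 2), whence
`prof_firstCoord`. Strict convexity is positivity of the polar curvature for radii close to 1 with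
small first and second derivatives, made global by a Sturm comparison of 1/R with trigonometric
functions. -/

namespace GSQG

noncomputable section

/-! ### Absolutely summable families of complex numbers -/

/-- Absolutely summable families of complex numbers, regarded as a real Banach space. -/
abbrev Summ (ι : Type) := lp (fun _ : ι => ℂ) 1

namespace Summ

variable {ι : Type} {E F : Type*} [NormedAddCommGroup E] [NormedSpace ℝ E] [CompleteSpace E]
  [NormedAddCommGroup F] [NormedSpace ℝ F]

theorem hasSum_norm (g : Summ ι) : HasSum (fun i => ‖g i‖) ‖g‖ := by
  have := lp.hasSum_norm (p := 1) (by simp) g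
  simpa using this

/-- The inclusion of the `i`-th summand. -/
def single [DecidableEq ι] (i : ι) : ℂ →L[ℝ] Summ ι :=
  lp.singleContinuousLinearMap ℝ (fun _ : ι => ℂ) 1 i

theorem norm_single_apply [DecidableEq ι] (i : ι) (z : ℂ) : ‖single i z‖ = ‖z‖ := by
  have h : (0 : ENNReal) < 1 := zero_lt_one
  exact lp.norm_single (E := fun _ : ι => ℂ) (p := 1) h i z

theorem single_apply [DecidableEq ι] (i j : ι) (z : ℂ) :
    single i z j = if j = i then z else 0 := by
  simp only [single, lp.singleContinuousLinearMap_apply, lp.single_apply, Pi.single_apply]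

theorem single_apply_self [DecidableEq ι] (i : ι) (z : ℂ) : single i z i = z := by
  simp [single_apply]

/-- Finitely supported families are dense in ℓ¹. Operator identities below are therefore checked one
mode at a time. -/
theorem clm_ext [DecidableEq ι] {A B : Summ ι →L[ℝ] F}
    (h : ∀ i z, A (single i z) = B (single i z)) : A = B := by
  refine lp.ext_continuousLinearMap (by simp) fun i => ?_
  exact ContinuousLinearMap.ext (h i)

theorem summable_lift {v : ι → ℂ →L[ℝ] E} {C : ℝ} (h : ∀ i, ‖v i‖ ≤ C) (g : Summ ι) :
    Summable fun i => v i (g i) := by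
  refine Summable.of_norm_bounded ((hasSum_norm g).summable.mul_left C) fun i => ?_
  exact (v i).le_of_opNorm_le (h i) _

/-- The continuous linear map given on the `i`-th summand by `v i`, for a bounded family `v`. -/
def lift (v : ι → ℂ →L[ℝ] E) (C : ℝ) (h : ∀ i, ‖v i‖ ≤ C) : Summ ι →L[ℝ] E :=
  LinearMap.mkContinuous
    { toFun := fun g => ∑' i, v i (g i)
      map_add' := fun f g => by
        rw [← (summable_lift h f).tsum_add (summable_lift h g)]
        simp
      map_smul' := fun c g => by
        rw [RingHom.id_apply, ← (summable_lift h g).tsum_const_smul]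
        refine tsum_congr fun i => ?_
        rw [← map_smul]; rfl } C fun g => by
    refine tsum_of_norm_bounded ((hasSum_norm g).mul_left C) fun i => ?_
    exact (v i).le_of_opNorm_le (h i) _

theorem hasSum_lift {v : ι → ℂ →L[ℝ] E} {C : ℝ} (h : ∀ i, ‖v i‖ ≤ C) (g : Summ ι) :
    HasSum (fun i => v i (g i)) (lift v C h g) :=
  (summable_lift h g).hasSum

theorem norm_lift_le {v : ι → ℂ →L[ℝ] E} {C : ℝ} (h : ∀ i, ‖v i‖ ≤ C) (hC : 0 ≤ C) :
    ‖lift v C h‖ ≤ C :=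
  LinearMap.mkContinuous_norm_le _ hC _

theorem lift_single [DecidableEq ι] {v : ι → ℂ →L[ℝ] E} {C : ℝ} (h : ∀ i, ‖v i‖ ≤ C) (i : ι)
    (z : ℂ) : lift v C h (single i z) = v i z := by
  refine (hasSum_lift h _).unique ?_
  have := hasSum_ite_eq i (v i z)
  refine this.congr_fun ?_ |> id
  intro j
  by_cases hj : j = i
  · subst hj; simp [single_apply]
  · simp [single_apply, hj]

end Summ

/-! ### The weighted Wiener algebra -/

/-- The Wiener algebra of Fourier series `∑ a_n e^{inx}` with `∑ ρ^|n| ‖a_n‖ < ∞`; an element is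
stored through the sequence `ρ^|n| a_n`. -/
def Wiener (_ρ : ℝ) : Type := Summ ℤ

namespace Wiener

variable {ρ : ℝ}

instance : NormedAddCommGroup (Wiener ρ) := inferInstanceAs (NormedAddCommGroup (Summ ℤ))
instance : NormedSpace ℝ (Wiener ρ) := inferInstanceAs (NormedSpace ℝ (Summ ℤ))
instance : CompleteSpace (Wiener ρ) := inferInstanceAs (CompleteSpace (Summ ℤ))

/-- The stored sequence of weighted coefficients. -/
def raw (a : Wiener ρ) (n : ℤ) : ℂ := (show Summ ℤ from a) n

/-- The weight `ρ^|n|`. -/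
def wt (ρ : ℝ) (n : ℤ) : ℝ := ρ ^ n.natAbs

variable [hρ : Fact (1 ≤ ρ)]

variable (ρ) in
theorem wt_ge_one (n : ℤ) : 1 ≤ wt ρ n := one_le_pow₀ hρ.out

variable (ρ) in
theorem wt_pos (n : ℤ) : 0 < wt ρ n := lt_of_lt_of_le one_pos (wt_ge_one ρ n)

/-- Submultiplicativity of the weight is what bounds the convolution product by 1, and so makes the
weighted space a Banach algebra. -/
theorem wt_add_le (m n : ℤ) : wt ρ (m + n) ≤ wt ρ m * wt ρ n := by
  rw [wt, wt, wt, ← pow_add]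
  exact pow_le_pow_right₀ hρ.out (Int.natAbs_add_le m n)

theorem wt_neg (n : ℤ) : wt ρ (-n) = wt ρ n := by simp [wt]

theorem wt_natCast (n : ℕ) : wt ρ n = ρ ^ n := by simp [wt]

/-- The inclusion of the `n`-th (weighted) Fourier coefficient. -/
def sgl (n : ℤ) : ℂ →L[ℝ] Wiener ρ := Summ.single (ι := ℤ) n

variable (ρ) in
/-- The product of two monomials. -/
def monoMul (m n : ℤ) : ℂ →L[ℝ] ℂ →L[ℝ] Wiener ρ :=
  (wt ρ (m + n) / (wt ρ m * wt ρ n)) •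
    (ContinuousLinearMap.compL ℝ ℂ ℂ (Wiener ρ) (sgl (m + n)) ∘L ContinuousLinearMap.mul ℝ ℂ)

theorem monoMul_apply (m n : ℤ) (z z' : ℂ) :
    monoMul ρ m n z z' = (wt ρ (m + n) / (wt ρ m * wt ρ n)) • sgl (m + n) (z * z') := rfl

theorem norm_monoMul_le (m n : ℤ) : ‖monoMul ρ m n‖ ≤ 1 := by
  refine ContinuousLinearMap.opNorm_le_bound₂ _ zero_le_one fun z z' => ?_
  rw [monoMul_apply, norm_smul, one_mul]
  have h1 : ‖sgl (ρ := ρ) (m + n) (z * z')‖ = ‖z‖ * ‖z'‖ := by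
    rw [← norm_mul]; exact Summ.norm_single_apply _ _
  have h2 : ‖wt ρ (m + n) / (wt ρ m * wt ρ n)‖ ≤ 1 := by
    rw [Real.norm_of_nonneg (div_nonneg (wt_pos ρ _).le
      (mul_nonneg (wt_pos ρ _).le (wt_pos ρ _).le))]
    exact div_le_one_of_le₀ (wt_add_le m n) (mul_nonneg (wt_pos ρ _).le (wt_pos ρ _).le)
  rw [h1]
  exact mul_le_of_le_one_left (by positivity) h2

variable (ρ) in
/-- Multiplication by a monomial. -/
def monoMulLeft (m : ℤ) : Wiener ρ →L[ℝ] ℂ →L[ℝ] Wiener ρ :=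
  Summ.lift (ι := ℤ) (fun n => (monoMul ρ m n).flip) 1 fun n => by
    rw [ContinuousLinearMap.opNorm_flip]; exact norm_monoMul_le m n

variable (ρ) in
/-- The convolution product. -/
def mulL : Wiener ρ →L[ℝ] Wiener ρ →L[ℝ] Wiener ρ :=
  Summ.lift (ι := ℤ) (fun m => (monoMulLeft ρ m).flip) 1 fun m => by
    rw [ContinuousLinearMap.opNorm_flip]; exact Summ.norm_lift_le _ zero_le_one

theorem norm_mulL_le : ‖mulL ρ‖ ≤ 1 := Summ.norm_lift_le _ zero_le_one

theorem mulL_sgl (m n : ℤ) (z z' : ℂ) : mulL ρ (sgl m z) (sgl n z') = monoMul ρ m n z z' := by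
  have h1 : mulL ρ (sgl m z) = (monoMulLeft ρ m).flip z := Summ.lift_single _ m z
  rw [h1, ContinuousLinearMap.flip_apply]
  have h2 : monoMulLeft ρ m (sgl n z') = (monoMul ρ m n).flip z' := Summ.lift_single _ n z'
  rw [h2, ContinuousLinearMap.flip_apply]

theorem clm_ext {F : Type*} [NormedAddCommGroup F] [NormedSpace ℝ F] {A B : Wiener ρ →L[ℝ] F}
    (h : ∀ n z, A (sgl n z) = B (sgl n z)) : A = B :=
  Summ.clm_ext (ι := ℤ) h

variable (ρ) in
/-- The value at `x` of the function represented by an element of the Wiener algebra. -/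
def evL (x : ℝ) : Wiener ρ →L[ℝ] ℂ :=
  Summ.lift (ι := ℤ) (fun n => ContinuousLinearMap.mul ℝ ℂ
    (((wt ρ n)⁻¹ : ℝ) * Complex.exp (n * x * Complex.I))) 1 fun n => by
    refine ContinuousLinearMap.opNorm_le_bound _ zero_le_one fun z => ?_
    have : ‖Complex.exp (n * x * Complex.I)‖ = 1 := by
      have := Complex.norm_exp_ofReal_mul_I (n * x)
      push_cast at this; exact this
    rw [ContinuousLinearMap.mul_apply', norm_mul, norm_mul, this, mul_one]
    gcongr
    rw [Complex.norm_real, norm_inv, Real.norm_of_nonneg (wt_pos ρ n).le]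
    exact inv_le_one_of_one_le₀ (wt_ge_one ρ n)

theorem evL_sgl (x : ℝ) (n : ℤ) (z : ℂ) :
    evL ρ x (sgl n z) = ((wt ρ n)⁻¹ : ℝ) * Complex.exp (n * x * Complex.I) * z :=
  Summ.lift_single _ n z

/-- Both sides are continuous and bilinear, so monomials suffice, and for them the weights cancel.
-/
theorem evL_mulL (x : ℝ) (a b : Wiener ρ) :
    evL ρ x (mulL ρ a b) = evL ρ x a * evL ρ x b := by
  have key : ContinuousLinearMap.compL ℝ _ _ _ (evL ρ x) ∘L mulL ρ =
      (ContinuousLinearMap.compL ℝ _ _ _).flip (evL ρ x) ∘L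
        (ContinuousLinearMap.mul ℝ ℂ ∘L evL ρ x) := by
    refine clm_ext fun m z => clm_ext fun n z' => ?_
    change evL ρ x (mulL ρ (sgl m z) (sgl n z')) = evL ρ x (sgl m z) * evL ρ x (sgl n z')
    rw [mulL_sgl, monoMul_apply, map_smul, evL_sgl, evL_sgl, evL_sgl]
    have h1 := (wt_pos ρ (m + n)).ne'
    have h2 := (wt_pos ρ m).ne'
    have h3 := (wt_pos ρ n).ne'
    have : Complex.exp ((m + n : ℤ) * x * Complex.I) =
        Complex.exp (m * x * Complex.I) * Complex.exp (n * x * Complex.I) := by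
      rw [← Complex.exp_add]; congr 1; push_cast; ring
    rw [this, Complex.real_smul]
    push_cast
    have h1' : (wt ρ (m + n) : ℂ) ≠ 0 := by exact_mod_cast h1
    have h2' : (wt ρ m : ℂ) ≠ 0 := by exact_mod_cast h2
    have h3' : (wt ρ n : ℂ) ≠ 0 := by exact_mod_cast h3
    field_simp
  exact DFunLike.congr_fun (DFunLike.congr_fun key a) b

theorem norm_evL_le (x : ℝ) : ‖evL ρ x‖ ≤ 1 := Summ.norm_lift_le _ zero_le_one

/-- The (unweighted) Fourier coefficient of index `n`. -/
def coef (n : ℤ) : Wiener ρ →L[ℝ] ℂ :=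
  (wt ρ n)⁻¹ • ((lp.evalCLM ℝ (fun _ : ℤ => ℂ) 1 n : Summ ℤ →L[ℝ] ℂ) : Wiener ρ →L[ℝ] ℂ)

theorem coef_sgl (n m : ℤ) (z : ℂ) :
    coef n (sgl (ρ := ρ) m z) = if n = m then ((wt ρ n)⁻¹ : ℝ) * z else 0 := by
  have : coef n (sgl (ρ := ρ) m z) = (wt ρ n)⁻¹ • (Summ.single (ι := ℤ) m z n) := rfl
  rw [this, Summ.single_apply]
  split_ifs <;> simp

theorem continuous_evL (a : Wiener ρ) : Continuous fun x => evL ρ x a := by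
  have h : (fun x => evL ρ x a) = fun x : ℝ => ∑' n : ℤ, ((ContinuousLinearMap.mul ℝ ℂ
    (((wt ρ n)⁻¹ : ℝ) * Complex.exp (n * x * Complex.I))) (raw a n)) := rfl
  rw [h]
  refine continuous_tsum (u := fun n => ‖raw a n‖) (fun n => ?_)
    (Summ.hasSum_norm (ι := ℤ) a).summable fun n x => ?_
  · simp only [ContinuousLinearMap.mul_apply']; fun_prop
  · have : ‖Complex.exp (n * x * Complex.I)‖ = 1 := by
      have := Complex.norm_exp_ofReal_mul_I (n * x)
      push_cast at this; exact this
    rw [ContinuousLinearMap.mul_apply', norm_mul, norm_mul, this, mul_one]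
    refine mul_le_of_le_one_left (norm_nonneg _) ?_
    rw [Complex.norm_real, norm_inv, Real.norm_of_nonneg (wt_pos ρ n).le]
    exact inv_le_one_of_one_le₀ (wt_ge_one ρ n)

theorem integral_exp_int (n : ℤ) : ∫ x in (0 : ℝ)..(2 * Real.pi), Complex.exp (n * x * Complex.I)
    = if n = 0 then ((2 * Real.pi : ℝ) : ℂ) else 0 := by
  split_ifs with h
  · subst h; simp
  · have hc : (n * Complex.I : ℂ) ≠ 0 := by simp [h]
    have := integral_exp_mul_complex (a := 0) (b := 2 * Real.pi) hc
    have e : (fun x : ℝ => Complex.exp (n * x * Complex.I)) =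
        fun x : ℝ => Complex.exp (n * Complex.I * x) := by
      ext x; congr 1; ring
    rw [e, this]
    have : Complex.exp (n * Complex.I * ((2 * Real.pi : ℝ) : ℂ)) = 1 := by
      rw [Complex.exp_eq_one_iff]; exact ⟨n, by push_cast; ring⟩
    rw [this]; simp

/-- Orthogonality of exponentials on monomials, extended by continuity and linearity in the element
of the algebra. -/
theorem integral_evL_mul_exp (a : Wiener ρ) (m : ℤ) :
    ∫ x in (0 : ℝ)..(2 * Real.pi), evL ρ x a * Complex.exp (-(m * x * Complex.I)) =
      2 * Real.pi * coef m a := by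
  have hcont : ∀ a : Wiener ρ,
      Continuous fun x : ℝ => evL ρ x a * Complex.exp (-(m * x * Complex.I)) :=
    fun a => (continuous_evL a).mul (by fun_prop)
  let A : Wiener ρ →L[ℝ] ℂ := LinearMap.mkContinuous
    { toFun := fun a => ∫ x in (0 : ℝ)..(2 * Real.pi),
        evL ρ x a * Complex.exp (-(m * x * Complex.I))
      map_add' := fun a b => by
        rw [← intervalIntegral.integral_add ((hcont a).intervalIntegrable _ _)
          ((hcont b).intervalIntegrable _ _)]
        simp [add_mul]
      map_smul' := fun c a => by
        rw [RingHom.id_apply, ← intervalIntegral.integral_smul]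
        simp only [map_smul, smul_mul_assoc] } (2 * Real.pi) fun a => by
      refine (intervalIntegral.norm_integral_le_of_norm_le_const (C := ‖a‖) fun x _ => ?_).trans
        (by rw [sub_zero, abs_of_nonneg (by positivity)]; linarith)
      have : ‖Complex.exp (-(m * x * Complex.I))‖ = 1 := by
        have := Complex.norm_exp_ofReal_mul_I (-(m * x))
        rw [← this]; congr 2; push_cast; ring
      rw [norm_mul, this, mul_one]
      exact ((evL ρ x).le_of_opNorm_le (norm_evL_le x) a).trans_eq (one_mul _)
  have : A = (2 * Real.pi) • coef m := by
    refine clm_ext fun n z => ?_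
    change ∫ x in (0 : ℝ)..(2 * Real.pi), evL ρ x (sgl n z) * Complex.exp (-(m * x * Complex.I))
      = (2 * Real.pi) • coef m (sgl n z)
    have e : (fun x : ℝ => evL ρ x (sgl n z) * Complex.exp (-(m * x * Complex.I))) =
         fun x : ℝ => (((wt ρ n)⁻¹ : ℝ) * z) * Complex.exp ((n - m : ℤ) * x * Complex.I) := by
      ext x
      have : Complex.exp ((n - m : ℤ) * x * Complex.I) =
          Complex.exp (n * x * Complex.I) * Complex.exp (-(m * x * Complex.I)) := by
        rw [← Complex.exp_add]; congr 1; push_cast; ring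
      rw [evL_sgl, this]; ring
    rw [e, intervalIntegral.integral_const_mul, integral_exp_int, coef_sgl]
    by_cases h : m = n
    · subst h
      rw [if_pos (by simp), if_pos rfl, Complex.real_smul]; push_cast; ring
    · rw [if_neg (by omega), if_neg h]; simp
  have h2 := DFunLike.congr_fun this a
  change _ = (2 * Real.pi) • coef m a at h2
  rw [Complex.real_smul] at h2
  push_cast at h2
  exact h2

theorem ext_coef {a b : Wiener ρ} (h : ∀ n, coef n a = coef n b) : a = b := by
  refine lp.ext (funext fun n => ?_)
  have : (wt ρ n)⁻¹ • (raw a n) = (wt ρ n)⁻¹ • (raw b n) := h n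
  exact smul_right_injective ℂ (inv_ne_zero (wt_pos ρ n).ne') this

/-- Values determine Fourier coefficients. This reduces the ring axioms, and later all identities in
the algebra, to pointwise identities of functions. -/
theorem ext_evL {a b : Wiener ρ} (h : ∀ x, evL ρ x a = evL ρ x b) : a = b := by
  refine ext_coef fun n => ?_
  have h1 := integral_evL_mul_exp a n
  have h2 := integral_evL_mul_exp b n
  simp only [h] at h1
  rw [h2] at h1
  exact (mul_left_cancel₀ (by simp [Real.pi_ne_zero]) h1).symm

instance : NormedCommRing (Wiener ρ) :=
  { (inferInstance : NormedAddCommGroup (Wiener ρ)) with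
    mul := fun a b => mulL ρ a b
    one := sgl 0 1
    left_distrib := fun a b c => map_add (mulL ρ a) b c
    right_distrib := fun a b c => by
      change mulL ρ (a + b) c = mulL ρ a c + mulL ρ b c
      rw [map_add]; rfl
    zero_mul := fun a => by
      change mulL ρ 0 a = 0
      rw [map_zero]; rfl
    mul_zero := fun a => map_zero (mulL ρ a)
    mul_assoc := fun a b c => ext_evL fun x => by
      change evL ρ x (mulL ρ (mulL ρ a b) c) = evL ρ x (mulL ρ a (mulL ρ b c))
      simp only [evL_mulL]; ring
    one_mul := fun a => ext_evL fun x => by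
      change evL ρ x (mulL ρ (sgl 0 1) a) = evL ρ x a
      rw [evL_mulL, evL_sgl]; simp [wt]
    mul_one := fun a => ext_evL fun x => by
      change evL ρ x (mulL ρ a (sgl 0 1)) = evL ρ x a
      rw [evL_mulL, evL_sgl]; simp [wt]
    mul_comm := fun a b => ext_evL fun x => by
      change evL ρ x (mulL ρ a b) = evL ρ x (mulL ρ b a)
      rw [evL_mulL, evL_mulL, mul_comm]
    norm_mul_le := fun a b => by
      refine ((mulL ρ).le_opNorm₂ a b).trans ?_
      have := norm_mulL_le (ρ := ρ)
      have h : 0 ≤ ‖a‖ * ‖b‖ := by positivity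
      nlinarith }

theorem mul_def (a b : Wiener ρ) : a * b = mulL ρ a b := rfl

theorem one_def : (1 : Wiener ρ) = sgl 0 1 := rfl

instance : NormedAlgebra ℝ (Wiener ρ) :=
  { Algebra.ofModule (R := ℝ) (A := Wiener ρ)
      (fun r a b => by
        rw [mul_def, mul_def, map_smul]; rfl)
      (fun r a b => by rw [mul_def, mul_def, map_smul]) with
    norm_smul_le := fun r a => norm_smul_le r a }

instance : NormOneClass (Wiener ρ) := ⟨by
  rw [one_def]; exact (Summ.norm_single_apply _ _).trans (by simp)⟩

variable (ρ) in
/-- Evaluation at `x` as an algebra homomorphism. -/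
def ev (x : ℝ) : Wiener ρ →ₐ[ℝ] ℂ :=
  AlgHom.ofLinearMap (evL ρ x : Wiener ρ →ₗ[ℝ] ℂ)
    (by change evL ρ x (sgl 0 1) = 1; rw [evL_sgl]; simp [wt])
    (fun a b => evL_mulL x a b)

theorem ev_eq (x : ℝ) (a : Wiener ρ) : ev ρ x a = evL ρ x a := rfl

end Wiener

end

end GSQG

/-! ### Real waves and the modes of index at least two -/

namespace GSQG

noncomputable section

namespace Wiener

variable {ρ : ℝ} [hρ : Fact (1 ≤ ρ)]

/-- The real trigonometric function `Re (z e^{inx})` as an element of the Wiener algebra. -/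
def wave (n : ℕ) : ℂ →L[ℝ] Wiener ρ :=
  (1 / 2 * ρ ^ n) • (sgl (ρ := ρ) (n : ℤ) + sgl (ρ := ρ) (-(n : ℤ)) ∘L (Complex.conjCLE : ℂ →L[ℝ] ℂ))

theorem wave_apply (n : ℕ) (z : ℂ) : wave (ρ := ρ) n z =
    (1 / 2 * ρ ^ n) • (sgl (n : ℤ) z + sgl (-(n : ℤ)) (starRingEnd ℂ z)) := rfl

theorem norm_wave_le (n : ℕ) : ‖wave (ρ := ρ) n‖ ≤ ρ ^ n := by
  have h0 : 0 ≤ ρ ^ n := pow_nonneg (zero_le_one.trans hρ.out) n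
  refine ContinuousLinearMap.opNorm_le_bound _ h0 fun z => ?_
  rw [wave_apply, norm_smul, Real.norm_of_nonneg (by positivity)]
  have h1 : ‖sgl (ρ := ρ) (n : ℤ) z‖ = ‖z‖ := Summ.norm_single_apply _ _
  have h2 : ‖sgl (ρ := ρ) (-(n : ℤ)) (starRingEnd ℂ z)‖ = ‖z‖ :=
    (Summ.norm_single_apply _ _).trans (by simp)
  have := norm_add_le (sgl (ρ := ρ) (n : ℤ) z) (sgl (ρ := ρ) (-(n : ℤ)) (starRingEnd ℂ z))
  rw [h1, h2] at this
  nlinarith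

theorem ev_wave (x : ℝ) (n : ℕ) (z : ℂ) :
    ev ρ x (wave n z) = ((z * Complex.exp (n * x * Complex.I)).re : ℂ) := by
  have h0 : (ρ : ℂ) ≠ 0 := by
    exact_mod_cast (lt_of_lt_of_le one_pos hρ.out).ne'
  rw [wave_apply, map_smul, map_add, ev_eq, ev_eq, evL_sgl, evL_sgl, wt_neg, wt_natCast,
    Complex.re_eq_add_conj, Complex.real_smul, map_mul, ← Complex.exp_conj]
  have : (starRingEnd ℂ) (n * x * Complex.I) = ((-(n : ℤ) : ℤ) : ℂ) * x * Complex.I := by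
    simp
  rw [this]
  push_cast
  field_simp

theorem coef_wave (m : ℤ) (n : ℕ) (z : ℂ) (hm : 0 < m) :
    coef m (wave (ρ := ρ) n z) = if m = n then z / 2 else 0 := by
  have h0 : (ρ : ℂ) ≠ 0 := by
    exact_mod_cast (lt_of_lt_of_le one_pos hρ.out).ne'
  rw [wave_apply, map_smul, map_add, coef_sgl, coef_sgl, if_neg (by omega : ¬ m = -(n : ℤ))]
  split_ifs with h
  · subst h
    rw [wt_natCast, Complex.real_smul]
    push_cast
    field_simp
    ring
  · simp

theorem integral_ev_mul_exp (a : Wiener ρ) (m : ℤ) :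
    ∫ x in (0 : ℝ)..(2 * Real.pi), ev ρ x a * Complex.exp (-(m * x * Complex.I)) =
      2 * Real.pi * coef m a := integral_evL_mul_exp a m

theorem integral_ev (a : Wiener ρ) :
    ∫ x in (0 : ℝ)..(2 * Real.pi), ev ρ x a = 2 * Real.pi * coef 0 a := by
  simpa using integral_ev_mul_exp a 0

/-- Real-valued elements have Hermitian coefficients. -/
theorem coef_neg_of_real (a : Wiener ρ) (h : ∀ x, (ev ρ x a).im = 0) (m : ℤ) :
    coef (-m) a = starRingEnd ℂ (coef m a) := by
  have h1 := integral_ev_mul_exp a (-m)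
  have h2 := congrArg (starRingEnd ℂ) (integral_ev_mul_exp a m)
  have hpi : (2 * Real.pi : ℂ) ≠ 0 := by simp [Real.pi_ne_zero]
  rw [map_mul, ← intervalIntegral.intervalIntegral_conj] at h2
  have e : ∀ x : ℝ, (starRingEnd ℂ) (ev ρ x a * Complex.exp (-(m * x * Complex.I))) =
      ev ρ x a * Complex.exp (-(((-m : ℤ) : ℂ) * x * Complex.I)) := fun x => by
    rw [map_mul, Complex.conj_eq_iff_im.2 (h x), ← Complex.exp_conj]
    simp
  simp only [e] at h2
  rw [h1] at h2
  have e2 : (starRingEnd ℂ) (2 * Real.pi : ℂ) = 2 * Real.pi := by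
    rw [map_mul, Complex.conj_ofReal, map_ofNat]
  rw [e2] at h2
  exact mul_left_cancel₀ hpi h2

/-- A real-valued element whose modes of index `0`, `2`, `3`, … vanish is a multiple of a unit
wave. -/
theorem eq_wave_one (a : Wiener ρ) (h : ∀ x, (ev ρ x a).im = 0) (h0 : coef 0 a = 0)
    (h2 : ∀ n : ℕ, coef ((n : ℤ) + 2) a = 0) : a = wave 1 (2 * coef 1 a) := by
  have hw : ∀ x, (ev ρ x (wave 1 (2 * coef 1 a))).im = 0 := fun x => by
    rw [ev_wave, Complex.ofReal_im]
  have pos : ∀ m : ℤ, 0 < m → coef m a = coef m (wave (ρ := ρ) 1 (2 * coef 1 a)) := by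
    intro m hm
    rw [coef_wave m 1 _ hm]
    split_ifs with h1
    · rw [h1]; simp
    · have := h2 (m - 2).toNat
      rwa [Int.toNat_of_nonneg (by push_cast at h1; omega), sub_add_cancel] at this
  refine ext_coef fun m => ?_
  rcases lt_trichotomy m 0 with hm | hm | hm
  · have := pos (-m) (by omega)
    have e := coef_neg_of_real a h (-m)
    have e' := coef_neg_of_real _ hw (-m)
    rw [neg_neg] at e e'
    rw [e, e', this]
  · subst hm
    rw [h0, wave_apply, map_smul, map_add, coef_sgl, coef_sgl]
    simp
  · exact pos m hm

/-- The modes of index at least two, in the weighted normalisation. -/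
def high : Wiener ρ →L[ℝ] Summ ℕ :=
  LinearMap.mkContinuous
    { toFun := fun a => ⟨fun n : ℕ => raw a ((n : ℤ) + 2), by
        have := (Summ.hasSum_norm (ι := ℤ) a).summable
        refine memℓp_gen ?_
        have h2 := this.comp_injective (i := fun n : ℕ => (n : ℤ) + 2)
          (fun m n h => by simpa using h)
        simp only [ENNReal.toReal_one, Real.rpow_one]
        exact h2⟩
      map_add' := fun a b => rfl
      map_smul' := fun c a => rfl } 1 fun a => by
    rw [one_mul]
    have h1 := Summ.hasSum_norm (ι := ℤ) a
    refine hasSum_le_inj (fun n : ℕ => (n : ℤ) + 2) (fun m n h => by simpa using h)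
      (fun c _ => norm_nonneg _) (fun n => ?_) (Summ.hasSum_norm _) h1
    exact le_rfl

theorem high_apply (a : Wiener ρ) (n : ℕ) :
    high a n = (ρ ^ (n + 2) : ℝ) * coef ((n : ℤ) + 2) a := by
  have h0 : (ρ : ℂ) ≠ 0 := by
    exact_mod_cast (lt_of_lt_of_le one_pos hρ.out).ne'
  change raw a ((n : ℤ) + 2) = _ * (wt ρ ((n : ℤ) + 2))⁻¹ • raw a ((n : ℤ) + 2)
  have : wt ρ ((n : ℤ) + 2) = ρ ^ (n + 2) := by
    rw [← wt_natCast]; norm_cast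
  rw [this, Complex.real_smul]
  push_cast
  field_simp

theorem coef_high_eq_zero {a : Wiener ρ} (h : high a = 0) (n : ℕ) :
    coef ((n : ℤ) + 2) a = 0 := by
  have h0 : (ρ : ℂ) ≠ 0 := by
    exact_mod_cast (lt_of_lt_of_le one_pos hρ.out).ne'
  have := high_apply a n
  rw [h] at this
  have h1 : ((ρ ^ (n + 2) : ℝ) : ℂ) ≠ 0 := by push_cast; exact pow_ne_zero _ h0
  exact (mul_eq_zero.1 this.symm).resolve_left h1

theorem high_wave_one (z : ℂ) : high (wave (ρ := ρ) 1 z) = 0 := by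
  refine lp.ext (funext fun n => ?_)
  have := high_apply (wave (ρ := ρ) 1 z) n
  rw [coef_wave _ _ _ (by omega), if_neg (by push_cast; omega), mul_zero] at this
  exact this

theorem high_wave (n : ℕ) (z : ℂ) :
    high (wave (ρ := ρ) (n + 2) z) = Summ.single n ((ρ ^ (n + 2) : ℝ) * (z / 2)) := by
  refine lp.ext (funext fun m => ?_)
  have := high_apply (wave (ρ := ρ) (n + 2) z) m
  rw [coef_wave _ _ _ (by omega)] at this
  rw [this]
  rw [Summ.single_apply]
  by_cases h : m = n
  · subst h; simp
  · rw [if_neg (by push_cast; omega), if_neg h, mul_zero]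

theorem continuous_ev (a : Wiener ρ) : Continuous fun x => ev ρ x a := continuous_evL a

end Wiener

end

end GSQG

/-! ### Chord length and moments of the singular kernel -/

namespace GSQG

noncomputable section

open MeasureTheory

/-- The distance of two points of the unit circle at angle `h ∈ [0, 2π]`. -/
def chord (h : ℝ) : ℝ := 2 * Real.sin (h / 2)

theorem chord_pos {h : ℝ} (hh : h ∈ Ioo 0 (2 * Real.pi)) : 0 < chord h :=
  mul_pos two_pos (Real.sin_pos_of_pos_of_lt_pi (by linarith [hh.1]) (by linarith [hh.2]))

theorem chord_nonneg {h : ℝ} (hh : h ∈ Icc 0 (2 * Real.pi)) : 0 ≤ chord h :=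
  mul_nonneg two_pos.le (Real.sin_nonneg_of_nonneg_of_le_pi (by linarith [hh.1]) (by linarith [hh.2]))

theorem continuous_chord : Continuous chord := by unfold chord; fun_prop

theorem hasDerivAt_chord (h : ℝ) : HasDerivAt chord (Real.cos (h / 2)) h := by
  have := ((Real.hasDerivAt_sin (h / 2)).comp h ((hasDerivAt_id h).div_const 2)).const_mul 2
  refine this.congr_deriv ?_
  ring

theorem chord_reflect (h : ℝ) : chord (2 * Real.pi - h) = chord h := by
  rw [chord, chord, show (2 * Real.pi - h) / 2 = Real.pi - h / 2 by ring, Real.sin_pi_sub]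

theorem chord_zero : chord 0 = 0 := by simp [chord]

theorem chord_two_pi : chord (2 * Real.pi) = 0 := by
  have := chord_reflect 0; rwa [sub_zero, chord_zero] at this

theorem chord_ge {h : ℝ} (h0 : 0 ≤ h) (h1 : h ≤ Real.pi) : 2 / Real.pi * h ≤ chord h := by
  have := Real.mul_le_sin (x := h / 2) (by linarith) (by linarith)
  unfold chord
  calc 2 / Real.pi * h = 2 * (2 / Real.pi * (h / 2)) := by ring
    _ ≤ _ := by linarith

theorem chord_le {h : ℝ} (h0 : 0 ≤ h) : chord h ≤ h := by
  have := Real.sin_le (x := h / 2) (by linarith)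
  unfold chord; linarith

theorem cos_eq_chord (h : ℝ) : Real.cos h = 1 - chord h ^ 2 / 2 := by
  have := Real.cos_sq' (h / 2)
  have h2 := Real.cos_two_mul (h / 2)
  rw [show 2 * (h / 2) = h by ring] at h2
  rw [h2, this, chord]; ring

theorem sin_eq_chord (h : ℝ) : Real.sin h = chord h * Real.cos (h / 2) := by
  have h2 := Real.sin_two_mul (h / 2)
  rw [show 2 * (h / 2) = h by ring] at h2
  rw [h2, chord]

theorem four_sin_sq_rpow {h : ℝ} (hh : h ∈ Ioo 0 (2 * Real.pi)) (α : ℝ) :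
    (4 * Real.sin (h / 2) ^ 2) ^ (α / 2) = chord h ^ α := by
  have : 4 * Real.sin (h / 2) ^ 2 = chord h ^ (2 : ℝ) := by
    rw [Real.rpow_two, chord]; ring
  rw [this, ← Real.rpow_mul (chord_pos hh).le]
  congr 1; ring

theorem integral_reflect {E : Type*} [NormedAddCommGroup E] [NormedSpace ℝ E] (F : ℝ → E) :
    ∫ h in (0 : ℝ)..(2 * Real.pi), F (2 * Real.pi - h) = ∫ h in (0 : ℝ)..(2 * Real.pi), F h := by
  rw [intervalIntegral.integral_comp_sub_left]; simp

/-- A function on the half circle with integrable extension by reflection. -/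
theorem intervalIntegrable_of_reflect {E : Type*} [NormedAddCommGroup E] {F : ℝ → E}
    (h1 : IntervalIntegrable F volume 0 Real.pi)
    (h2 : IntervalIntegrable (fun h => F (2 * Real.pi - h)) volume 0 Real.pi) :
    IntervalIntegrable F volume 0 (2 * Real.pi) := by
  refine h1.trans ?_
  have := h2.comp_sub_left (2 * Real.pi)
  simp only [sub_sub_cancel] at this
  rw [sub_zero, show 2 * Real.pi - Real.pi = Real.pi by ring] at this
  exact this.symm

theorem continuousOn_chord_rpow (β : ℝ) :
    ContinuousOn (fun h => chord h ^ β) (Ioo 0 (2 * Real.pi)) := fun _ hh =>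
  (continuous_chord.continuousAt.rpow_const (Or.inl (chord_pos hh).ne')).continuousWithinAt

theorem intervalIntegrable_of_bound {E : Type*} [NormedAddCommGroup E] {F : ℝ → E} {G : ℝ → ℝ}
    (hG : IntervalIntegrable G volume 0 (2 * Real.pi))
    (hF : ContinuousOn F (Ioo 0 (2 * Real.pi)))
    (hb : ∀ h ∈ Ioo 0 (2 * Real.pi), ‖F h‖ ≤ G h) :
    IntervalIntegrable F volume 0 (2 * Real.pi) := by
  rw [intervalIntegrable_iff_integrableOn_Ioo_of_le (by positivity)] at hG ⊢
  exact hG.mono' (hF.aestronglyMeasurable measurableSet_Ioo)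
    ((ae_restrict_iff' measurableSet_Ioo).2 (Eventually.of_forall hb))

theorem integral_congr_Ioo {E : Type*} [NormedAddCommGroup E] [NormedSpace ℝ E] {F G : ℝ → E}
    {a b : ℝ} (hab : a ≤ b) (h : ∀ x ∈ Ioo a b, F x = G x) :
    ∫ x in a..b, F x = ∫ x in a..b, G x := by
  rw [intervalIntegral.integral_of_le hab, intervalIntegral.integral_of_le hab,
    integral_Ioc_eq_integral_Ioo, integral_Ioc_eq_integral_Ioo]
  exact setIntegral_congr_fun measurableSet_Ioo h

theorem intervalIntegrable_chord_rpow {β : ℝ} (hβ : -1 < β) :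
    IntervalIntegrable (fun h => chord h ^ β) volume 0 (2 * Real.pi) := by
  rcases le_or_gt 0 β with h0 | h0
  · exact (continuous_chord.rpow_const fun _ => Or.inr h0).intervalIntegrable _ _
  · have hI : IntervalIntegrable (fun h => chord h ^ β) volume 0 Real.pi := by
      have hG : IntervalIntegrable (fun h : ℝ => (2 / Real.pi) ^ β * h ^ β) volume 0 Real.pi :=
        (intervalIntegral.intervalIntegrable_rpow' hβ).const_mul _
      rw [intervalIntegrable_iff_integrableOn_Ioo_of_le Real.pi_pos.le] at hG ⊢
      refine hG.mono' (((continuousOn_chord_rpow β).mono ?_).aestronglyMeasurable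
        measurableSet_Ioo) ((ae_restrict_iff' measurableSet_Ioo).2 (Eventually.of_forall ?_))
      · exact Ioo_subset_Ioo_right (by linarith [Real.pi_pos])
      · intro h hh
        have hc := chord_pos (h := h) ⟨hh.1, by linarith [hh.2, Real.pi_pos]⟩
        rw [Real.norm_of_nonneg (Real.rpow_nonneg hc.le _),
          ← Real.mul_rpow (by positivity) hh.1.le]
        exact Real.rpow_le_rpow_of_nonpos (mul_pos (by positivity) hh.1)
          (chord_ge hh.1.le hh.2.le) h0.le
    refine intervalIntegrable_of_reflect hI ?_
    simpa only [chord_reflect] using hI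

theorem hasDerivAt_chord_rpow {h : ℝ} (hh : h ∈ Ioo 0 (2 * Real.pi)) (p : ℝ) :
    HasDerivAt (fun h => chord h ^ p) (p * chord h ^ (p - 1) * Real.cos (h / 2)) h := by
  refine ((hasDerivAt_chord h).rpow_const (p := p) (Or.inl (chord_pos hh).ne')).congr_deriv ?_
  ring

section

variable {α : ℝ} (hα : α ∈ Ioo (1 : ℝ) 2)

include hα

theorem continuous_chord_two_sub : Continuous fun h => chord h ^ (2 - α) :=
  continuous_chord.rpow_const fun _ => Or.inr (by linarith [hα.2])

theorem intervalIntegrable_chord_one_sub :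
    IntervalIntegrable (fun h => chord h ^ (1 - α)) volume 0 (2 * Real.pi) :=
  intervalIntegrable_chord_rpow (by linarith [hα.2])

theorem chord_rpow_two_sub {h : ℝ} (hh : h ∈ Ioo 0 (2 * Real.pi)) :
    chord h ^ (2 - α) = chord h ^ (1 - α) * chord h := by
  rw [← Real.rpow_add_one (chord_pos hh).ne']; congr 1; ring

theorem chord_rpow_one_sub {h : ℝ} (hh : h ∈ Ioo 0 (2 * Real.pi)) :
    chord h ^ (1 - α) = chord h ^ (-α) * chord h := by
  rw [← Real.rpow_add_one (chord_pos hh).ne']; congr 1; ring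

/-- The difference `K_{n+1} - K_n` of consecutive moments of the kernel. -/
theorem moment_diff_rec (n : ℕ) :
    ((n : ℝ) + 2 - α / 2) *
        (∫ h in (0 : ℝ)..(2 * Real.pi), chord h ^ (1 - α) * Real.sin (((n : ℝ) + 3 / 2) * h)) =
      (n + α / 2) *
        ∫ h in (0 : ℝ)..(2 * Real.pi), chord h ^ (1 - α) * Real.sin (((n : ℝ) + 1 / 2) * h) := by
  have hi : ∀ c : ℝ, IntervalIntegrable (fun h => chord h ^ (1 - α) * Real.sin (c * h))
      volume 0 (2 * Real.pi) := fun c =>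
    (intervalIntegrable_chord_one_sub hα).mul_continuousOn (by fun_prop)
  -- The recursion is the vanishing integral of the derivative of chord^{2-α} sin((n+1)h). With
  -- chord = 2 sin(h/2), product-to-sum formulas turn that derivative into the two half-integer
  -- sines.
  have key := intervalIntegral.integral_eq_sub_of_hasDerivAt_of_le (a := 0) (b := 2 * Real.pi)
    (f := fun h => chord h ^ (2 - α) * Real.sin ((n + 1 : ℝ) * h))
    (f' := fun h => ((n : ℝ) + 2 - α / 2) *
        (chord h ^ (1 - α) * Real.sin (((n : ℝ) + 3 / 2) * h)) -
      (n + α / 2) * (chord h ^ (1 - α) * Real.sin (((n : ℝ) + 1 / 2) * h))) (by positivity)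
    ((continuous_chord_two_sub hα).mul (by fun_prop)).continuousOn
    (fun h hh => by
      have h1 := hasDerivAt_chord_rpow hh (2 - α)
      have h2 : HasDerivAt (fun h : ℝ => Real.sin ((n + 1 : ℝ) * h))
          (Real.cos ((n + 1 : ℝ) * h) * (n + 1)) h := by
        have := ((hasDerivAt_id h).const_mul (n + 1 : ℝ)).sin
        simpa using this
      refine (h1.mul h2).congr_deriv ?_
      rw [chord_rpow_two_sub hα hh, show 2 - α - 1 = 1 - α by ring,
        show ((n : ℝ) + 3 / 2) * h = (n + 1 : ℝ) * h + h / 2 by ring,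
        show ((n : ℝ) + 1 / 2) * h = (n + 1 : ℝ) * h - h / 2 by ring,
        Real.sin_add, Real.sin_sub]
      simp only [chord]
      ring)
    (((hi _).const_mul _).sub ((hi _).const_mul _))
  rw [intervalIntegral.integral_sub ((hi _).const_mul _) ((hi _).const_mul _),
    intervalIntegral.integral_const_mul, intervalIntegral.integral_const_mul] at key
  rw [chord_zero, chord_two_pi, Real.zero_rpow (by linarith [hα.2])] at key
  linarith

end

/-- The moments `∫ (1 - cos (n h)) |2 sin (h/2)|^{-α} dh`. -/
def moment (α : ℝ) (n : ℕ) : ℝ :=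
  ∫ h in (0 : ℝ)..(2 * Real.pi), (1 - Real.cos (n * h)) * chord h ^ (-α)

theorem norm_one_sub_exp_le (n : ℕ) {h : ℝ} (hh : 0 ≤ h) :
    ‖(1 : ℂ) - Complex.exp (-(n * h * Complex.I))‖ ≤ n * h := by
  have := Real.norm_exp_I_mul_ofReal_sub_one_le (x := -(n * h))
  rw [norm_sub_rev]
  refine (le_trans (le_of_eq ?_) this).trans (le_of_eq ?_)
  · congr 3; push_cast; ring
  · rw [norm_neg, Real.norm_of_nonneg (by positivity)]

theorem norm_one_sub_exp_le_two (n : ℕ) (h : ℝ) :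
    ‖(1 : ℂ) - Complex.exp (-(n * h * Complex.I))‖ ≤ 2 := by
  refine (norm_sub_le _ _).trans ?_
  have : ‖Complex.exp (-(n * h * Complex.I))‖ = 1 := by
    have := Complex.norm_exp_ofReal_mul_I (-(n * h))
    rw [← this]; congr 2; push_cast; ring
  rw [this, norm_one]; norm_num

theorem one_sub_exp_reflect (n : ℕ) (h : ℝ) :
    Complex.exp (-(n * ((2 * Real.pi - h : ℝ) : ℂ) * Complex.I)) =
      starRingEnd ℂ (Complex.exp (-(n * h * Complex.I))) := by
  rw [← Complex.exp_conj]
  have : -(n * ((2 * Real.pi - h : ℝ) : ℂ) * Complex.I) =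
      starRingEnd ℂ (-(n * h * Complex.I)) - (n : ℕ) * (2 * Real.pi * Complex.I) := by
    simp; ring
  rw [this, Complex.exp_periodic.sub_nat_mul_eq n]

/-- The weight function which measures the `L¹` size of a difference quotient of order `α`. -/
def diffKernel (α : ℝ) (n : ℕ) (h : ℝ) : ℝ :=
  ‖(1 : ℂ) - Complex.exp (-(n * h * Complex.I))‖ * chord h ^ (-α)

theorem diffKernel_reflect (α : ℝ) (n : ℕ) (h : ℝ) :
    diffKernel α n (2 * Real.pi - h) = diffKernel α n h := by
  rw [diffKernel, diffKernel, one_sub_exp_reflect, chord_reflect]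
  congr 1
  rw [← map_one (starRingEnd ℂ), ← map_sub, RCLike.norm_conj, map_one]

section

variable {α : ℝ} (hα : α ∈ Ioo (1 : ℝ) 2)

include hα

theorem diffKernel_le_near (n : ℕ) {h : ℝ} (h0 : 0 < h) (h1 : h ≤ Real.pi) :
    diffKernel α n h ≤ n * (2 / Real.pi) ^ (-α) * h ^ (1 - α) := by
  have hc : chord h ^ (-α) ≤ (2 / Real.pi) ^ (-α) * h ^ (-α) := by
    rw [← Real.mul_rpow (by positivity) h0.le]
    exact Real.rpow_le_rpow_of_nonpos (by positivity) (chord_ge h0.le h1) (by linarith [hα.1])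
  have e : h ^ (1 - α) = h * h ^ (-α) := by
    rw [mul_comm, ← Real.rpow_add_one h0.ne']; congr 1; ring
  calc diffKernel α n h ≤ (n * h) * ((2 / Real.pi) ^ (-α) * h ^ (-α)) := by
        refine mul_le_mul (norm_one_sub_exp_le n h0.le) hc ?_ (by positivity)
        exact Real.rpow_nonneg (chord_nonneg ⟨h0.le, by linarith [Real.pi_pos]⟩) _
    _ = _ := by rw [e]; ring

theorem diffKernel_le_far (n : ℕ) {h : ℝ} (h0 : 0 < h) (h1 : h ≤ Real.pi) :
    diffKernel α n h ≤ 2 * (2 / Real.pi) ^ (-α) * h ^ (-α) := by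
  have hc : chord h ^ (-α) ≤ (2 / Real.pi) ^ (-α) * h ^ (-α) := by
    rw [← Real.mul_rpow (by positivity) h0.le]
    exact Real.rpow_le_rpow_of_nonpos (by positivity) (chord_ge h0.le h1) (by linarith [hα.1])
  calc diffKernel α n h ≤ 2 * ((2 / Real.pi) ^ (-α) * h ^ (-α)) := by
        refine mul_le_mul (norm_one_sub_exp_le_two n h) hc ?_ two_pos.le
        exact Real.rpow_nonneg (chord_nonneg ⟨h0.le, by linarith [Real.pi_pos]⟩) _
    _ = _ := by ring

theorem continuousOn_diffKernel (n : ℕ) :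
    ContinuousOn (diffKernel α n) (Ioo 0 (2 * Real.pi)) := by
  unfold diffKernel
  exact ContinuousOn.mul (by fun_prop) (continuousOn_chord_rpow _)

theorem intervalIntegrable_diffKernel_half (n : ℕ) :
    IntervalIntegrable (diffKernel α n) volume 0 Real.pi := by
  have hG : IntervalIntegrable (fun h : ℝ => n * (2 / Real.pi) ^ (-α) * h ^ (1 - α)) volume 0
      Real.pi := (intervalIntegral.intervalIntegrable_rpow' (by linarith [hα.2])).const_mul _
  rw [intervalIntegrable_iff_integrableOn_Ioo_of_le Real.pi_pos.le] at hG ⊢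
  refine hG.mono' (((continuousOn_diffKernel hα n).mono ?_).aestronglyMeasurable
    measurableSet_Ioo) ((ae_restrict_iff' measurableSet_Ioo).2 (Eventually.of_forall ?_))
  · exact Ioo_subset_Ioo_right (by linarith [Real.pi_pos])
  · intro h hh
    rw [Real.norm_of_nonneg]
    · exact diffKernel_le_near hα n hh.1 hh.2.le
    · exact mul_nonneg (norm_nonneg _) (Real.rpow_nonneg
        (chord_nonneg ⟨hh.1.le, by linarith [hh.2, Real.pi_pos]⟩) _)

theorem intervalIntegrable_diffKernel (n : ℕ) :
    IntervalIntegrable (diffKernel α n) volume 0 (2 * Real.pi) := by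
  refine intervalIntegrable_of_reflect (intervalIntegrable_diffKernel_half hα n) ?_
  simpa only [diffKernel_reflect] using intervalIntegrable_diffKernel_half hα n

theorem integral_diffKernel_eq (n : ℕ) :
    ∫ h in (0 : ℝ)..(2 * Real.pi), diffKernel α n h = 2 * ∫ h in (0 : ℝ)..Real.pi,
      diffKernel α n h := by
  have h1 := intervalIntegrable_diffKernel_half hα n
  have h3 := intervalIntegrable_diffKernel hα n
  have h2 : IntervalIntegrable (diffKernel α n) volume Real.pi (2 * Real.pi) := h1.symm.trans h3
  rw [← intervalIntegral.integral_add_adjacent_intervals h1 h2]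
  have := intervalIntegral.integral_comp_sub_left (a := 0) (b := Real.pi) (diffKernel α n)
    (2 * Real.pi)
  simp only [diffKernel_reflect, sub_zero] at this
  rw [show 2 * Real.pi - Real.pi = Real.pi by ring] at this
  rw [← this]; ring

/-- A constant such that `∫ diffKernel α n ≤ C n^{α-1}`. -/
theorem exists_integral_diffKernel_le : ∃ C : ℝ, 0 < C ∧ ∀ n : ℕ, 1 ≤ n →
    ∫ h in (0 : ℝ)..(2 * Real.pi), diffKernel α n h ≤ C * (n : ℝ) ^ (α - 1) := by
  have ha1 : 0 < α - 1 := by linarith [hα.1]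
  have ha2 : 0 < 2 - α := by linarith [hα.2]
  -- The half period is split at h = 1/n. Below it |1 - e^{-inh}| ≤ nh gives n^{α-1}/(2-α); above it
  -- the bound 2 gives at most 2 n^{α-1}/(α-1). The outer factor 2 accounts for the reflected half.
  refine ⟨2 * (2 / Real.pi) ^ (-α) * (1 / (2 - α) + 2 / (α - 1)), by positivity, fun n hn => ?_⟩
  have hn0 : (0 : ℝ) < n := by exact_mod_cast hn
  have hn1 : (1 : ℝ) ≤ n := by exact_mod_cast hn
  have hinv : (1 : ℝ) / n ≤ 1 := by rw [div_le_one hn0]; exact hn1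
  have hpi : (1 : ℝ) / n ≤ Real.pi := hinv.trans (by linarith [Real.pi_gt_three])
  have hI := intervalIntegrable_diffKernel_half hα n
  have hI1 : IntervalIntegrable (diffKernel α n) volume 0 (1 / n) :=
    hI.mono_set (by rw [uIcc_of_le (by positivity), uIcc_of_le Real.pi_pos.le]
                    exact Icc_subset_Icc_right hpi)
  have hI2 : IntervalIntegrable (diffKernel α n) volume (1 / n) Real.pi := hI1.symm.trans hI
  have hp : 0 < (1 : ℝ) / n := by positivity
  have e1 : ∫ h in (0 : ℝ)..(1 / n), diffKernel α n h ≤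
      (2 / Real.pi) ^ (-α) * (1 / (2 - α)) * (n : ℝ) ^ (α - 1) := by
    have hm := intervalIntegral.integral_mono_on_of_le_Ioo (μ := volume) hp.le hI1
      (g := fun h : ℝ => n * (2 / Real.pi) ^ (-α) * h ^ (1 - α))
      ((intervalIntegral.intervalIntegrable_rpow' (by linarith)).const_mul _)
      (fun h hh => diffKernel_le_near hα n hh.1 (hh.2.le.trans hpi))
    refine hm.trans (le_of_eq ?_)
    rw [intervalIntegral.integral_const_mul, integral_rpow (Or.inl (by linarith)),
      Real.zero_rpow (by linarith), show 1 - α + 1 = 2 - α by ring, one_div (n : ℝ),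
      Real.inv_rpow hn0.le, ← Real.rpow_neg hn0.le,
      show α - 1 = -(2 - α) + 1 by ring, Real.rpow_add_one hn0.ne']
    ring
  have e2 : ∫ h in (1 / n : ℝ)..Real.pi, diffKernel α n h ≤
      (2 / Real.pi) ^ (-α) * (2 / (α - 1)) * (n : ℝ) ^ (α - 1) := by
    have h0not : (0 : ℝ) ∉ uIcc (1 / (n : ℝ)) Real.pi := by
      rw [uIcc_of_le hpi]; intro h; exact absurd h.1 (not_le.2 hp)
    have hm := intervalIntegral.integral_mono_on_of_le_Ioo (μ := volume) hpi hI2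
      (g := fun h : ℝ => 2 * (2 / Real.pi) ^ (-α) * h ^ (-α))
      ((intervalIntegral.intervalIntegrable_rpow (Or.inr h0not)).const_mul _)
      (fun h hh => diffKernel_le_far hα n (hp.trans hh.1) hh.2.le)
    refine hm.trans ?_
    rw [intervalIntegral.integral_const_mul,
      integral_rpow (Or.inr ⟨by linarith [hα.1], h0not⟩), one_div (n : ℝ),
      Real.inv_rpow hn0.le, ← Real.rpow_neg hn0.le, show -(-α + 1) = α - 1 by ring]
    have hpos : 0 ≤ Real.pi ^ (-α + 1) := Real.rpow_nonneg Real.pi_pos.le _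
    have : (Real.pi ^ (-α + 1) - (n : ℝ) ^ (α - 1)) / (-α + 1) ≤ (n : ℝ) ^ (α - 1) / (α - 1) := by
      rw [show -α + 1 = -(α - 1) by ring, div_neg, ← neg_div, show -(α - 1) = -α + 1 by ring]
      gcongr
      linarith
    calc 2 * (2 / Real.pi) ^ (-α) * ((Real.pi ^ (-α + 1) - (n : ℝ) ^ (α - 1)) / (-α + 1))
        ≤ 2 * (2 / Real.pi) ^ (-α) * ((n : ℝ) ^ (α - 1) / (α - 1)) := by gcongr
      _ = _ := by ring
  rw [integral_diffKernel_eq hα, ← intervalIntegral.integral_add_adjacent_intervals hI1 hI2]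
  nlinarith [e1, e2]

theorem re_one_sub_exp (n : ℕ) (h : ℝ) :
    ((1 : ℂ) - Complex.exp (-(n * h * Complex.I))).re = 1 - Real.cos (n * h) := by
  have : -(n * h * Complex.I) = ((-(n * h) : ℝ) : ℂ) * Complex.I := by push_cast; ring
  rw [this, Complex.sub_re, Complex.exp_ofReal_mul_I_re, Real.cos_neg]; simp

theorem intervalIntegrable_moment (n : ℕ) :
    IntervalIntegrable (fun h => (1 - Real.cos (n * h)) * chord h ^ (-α)) volume 0
      (2 * Real.pi) := by
  refine intervalIntegrable_of_bound (intervalIntegrable_diffKernel hα n)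
    (ContinuousOn.mul (by fun_prop) (continuousOn_chord_rpow _)) fun h hh => ?_
  rw [norm_mul, Real.norm_of_nonneg (Real.rpow_nonneg (chord_pos hh).le _), diffKernel,
    ← re_one_sub_exp hα]
  gcongr
  · exact Real.rpow_nonneg (chord_pos hh).le _
  · exact Complex.abs_re_le_norm _

/-- A difference of cosines contributes a factor sin(h/2), which raises the power of the chord from
-α to the integrable 1-α. -/
theorem moment_succ_sub (n : ℕ) : moment α (n + 1) - moment α n =
    ∫ h in (0 : ℝ)..(2 * Real.pi), chord h ^ (1 - α) * Real.sin (((n : ℝ) + 1 / 2) * h) := by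
  rw [moment, moment, ← intervalIntegral.integral_sub (intervalIntegrable_moment hα _)
    (intervalIntegrable_moment hα _)]
  refine integral_congr_Ioo (by positivity) fun h hh => ?_
  rw [chord_rpow_one_sub hα hh]
  push_cast
  rw [show ((n : ℝ) + 1) * h = ((n : ℝ) + 1 / 2) * h + h / 2 by ring,
    show (n : ℝ) * h = ((n : ℝ) + 1 / 2) * h - h / 2 by ring, Real.cos_add, Real.cos_sub]
  simp only [chord]; ring

theorem moment_zero : moment α 0 = 0 := by simp [moment]

theorem moment_one : moment α 1 = 1 / 2 * ∫ h in (0 : ℝ)..(2 * Real.pi), chord h ^ (2 - α) := by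
  rw [moment, ← intervalIntegral.integral_const_mul]
  refine integral_congr_Ioo (by positivity) fun h hh => ?_
  rw [chord_rpow_two_sub hα hh, chord_rpow_one_sub hα hh, Nat.cast_one, one_mul, cos_eq_chord]
  ring

theorem moment_rec (n : ℕ) : ((n : ℝ) + 2 - α / 2) * (moment α (n + 2) - moment α (n + 1)) =
    (n + α / 2) * (moment α (n + 1) - moment α n) := by
  have h1 := moment_succ_sub hα n
  have h2 := moment_succ_sub hα (n + 1)
  have := moment_diff_rec hα n
  rw [h1, show n + 2 = n + 1 + 1 by ring, h2, ← this]
  push_cast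
  congr 5; ext h; congr 3; ring

theorem integral_chord_two_sub_pos : 0 < ∫ h in (0 : ℝ)..(2 * Real.pi), chord h ^ (2 - α) := by
  refine intervalIntegral.intervalIntegral_pos_of_pos_on
    ((continuous_chord_two_sub hα).intervalIntegrable _ _) (fun h hh => ?_) (by positivity)
  exact Real.rpow_pos_of_pos (chord_pos hh) _

theorem moment_one_pos : 0 < moment α 1 := by
  rw [moment_one hα]; have := integral_chord_two_sub_pos hα; positivity

/-- Both coefficients of the recursion are positive for 1 < α < 2, so the sign of the first
increment K_1 - K_0 = K_1 propagates. -/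
theorem moment_lt_succ (n : ℕ) : moment α n < moment α (n + 1) := by
  induction n with
  | zero => rw [moment_zero hα]; exact moment_one_pos hα
  | succ n ih =>
    have h := moment_rec hα n
    have h1 : 0 < (n : ℝ) + 2 - α / 2 := by
      have : (0 : ℝ) ≤ n := n.cast_nonneg
      linarith [hα.2]
    have h2 : 0 < (n : ℝ) + α / 2 := by
      have : (0 : ℝ) ≤ n := n.cast_nonneg
      linarith [hα.1]
    have h3 : 0 < moment α (n + 1) - moment α n := sub_pos.2 ih
    have h4 : 0 < moment α (n + 2) - moment α (n + 1) := by
      have := mul_pos h2 h3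
      rw [← h] at this
      exact (mul_pos_iff_of_pos_left h1).1 this
    exact sub_pos.1 h4

theorem moment_strictMono : StrictMono (moment α) := strictMono_nat_of_lt_succ (moment_lt_succ hα)

theorem moment_two_sub_one : moment α 2 - moment α 1 =
    α / (2 * (4 - α)) * ∫ h in (0 : ℝ)..(2 * Real.pi), chord h ^ (2 - α) := by
  have h := moment_rec hα 0
  rw [moment_zero hα, moment_one hα] at h
  have : (4 - α) ≠ 0 := by linarith [hα.2]
  rw [moment_one hα]
  push_cast at h
  field_simp at h ⊢
  linarith

/-- On the half period the chord is at most h, and the substitution t = nh extracts n^{α-1}. What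
remains is an integral of a nonnegative function over [0, nπ], bounded below by its part over [0,
π]. -/
theorem exists_moment_ge : ∃ c : ℝ, 0 < c ∧ ∀ n : ℕ, 1 ≤ n →
    c * (n : ℝ) ^ (α - 1) ≤ moment α n := by
  have hint : ∀ b : ℝ, 0 ≤ b → IntervalIntegrable (fun t : ℝ => (1 - Real.cos t) * t ^ (-α))
      volume 0 b := by
    intro b hb
    have hG : IntervalIntegrable (fun h : ℝ => h ^ (1 - α)) volume 0 b :=
      intervalIntegral.intervalIntegrable_rpow' (by linarith [hα.2])
    rw [intervalIntegrable_iff_integrableOn_Ioo_of_le hb] at hG ⊢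
    refine hG.mono' (ContinuousOn.aestronglyMeasurable ?_
      measurableSet_Ioo) ((ae_restrict_iff' measurableSet_Ioo).2 (Eventually.of_forall ?_))
    · refine ContinuousOn.mul (by fun_prop) fun t ht => ?_
      exact (Real.continuousAt_rpow_const _ _ (Or.inl ht.1.ne')).continuousWithinAt
    · intro t ht
      have e : t ^ (1 - α) = t * t ^ (-α) := by
        rw [mul_comm, ← Real.rpow_add_one ht.1.ne']; congr 1; ring
      rw [e, norm_mul, Real.norm_of_nonneg (Real.rpow_nonneg ht.1.le _)]
      refine mul_le_mul_of_nonneg_right ?_ (Real.rpow_nonneg ht.1.le _)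
      have := norm_one_sub_exp_le 1 ht.1.le
      have h2 := re_one_sub_exp hα 1 t
      have h3 := Complex.abs_re_le_norm ((1 : ℂ) - Complex.exp (-((1 : ℕ) * t * Complex.I)))
      rw [h2] at h3
      simp only [Nat.cast_one, one_mul] at h3 this
      exact h3.trans this
  have hpos : 0 < ∫ t in (0 : ℝ)..Real.pi, (1 - Real.cos t) * t ^ (-α) := by
    refine intervalIntegral.intervalIntegral_pos_of_pos_on (hint _ Real.pi_pos.le) (fun t ht => ?_)
      Real.pi_pos
    refine mul_pos (sub_pos.2 ?_) (Real.rpow_pos_of_pos ht.1 _)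
    rw [← Real.cos_zero]
    exact Real.cos_lt_cos_of_nonneg_of_le_pi le_rfl ht.2.le ht.1
  refine ⟨_, hpos, fun n hn => ?_⟩
  have hn0 : (0 : ℝ) < n := by exact_mod_cast hn
  have hn1 : (1 : ℝ) ≤ n := by exact_mod_cast hn
  have hI := intervalIntegrable_moment hα n
  have hI1 : IntervalIntegrable (fun h => (1 - Real.cos (n * h)) * chord h ^ (-α)) volume 0
      Real.pi := hI.mono_set (by
        rw [uIcc_of_le (by positivity), uIcc_of_le (by positivity)]
        exact Icc_subset_Icc_right (by linarith [Real.pi_pos]))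
  have hI2 : IntervalIntegrable (fun h => (1 - Real.cos (n * h)) * chord h ^ (-α)) volume
      Real.pi (2 * Real.pi) := hI1.symm.trans hI
  have s1 : ∫ h in (0 : ℝ)..Real.pi, (1 - Real.cos (n * h)) * chord h ^ (-α) ≤ moment α n := by
    rw [moment, ← intervalIntegral.integral_add_adjacent_intervals hI1 hI2]
    have : 0 ≤ ∫ h in Real.pi..(2 * Real.pi), (1 - Real.cos (n * h)) * chord h ^ (-α) := by
      refine intervalIntegral.integral_nonneg (by linarith [Real.pi_pos]) fun h hh => ?_
      refine mul_nonneg (sub_nonneg.2 (Real.cos_le_one _)) (Real.rpow_nonneg (chord_nonneg ?_) _)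
      exact ⟨Real.pi_pos.le.trans hh.1, hh.2⟩
    linarith
  have s2 : ∫ h in (0 : ℝ)..Real.pi, (1 - Real.cos (n * h)) * h ^ (-α) ≤
      ∫ h in (0 : ℝ)..Real.pi, (1 - Real.cos (n * h)) * chord h ^ (-α) := by
    refine intervalIntegral.integral_mono_on_of_le_Ioo Real.pi_pos.le ?_ hI1 fun h hh => ?_
    · have hb := (hint (n * Real.pi) (by positivity)).comp_mul_left (c := (n : ℝ))
      have hb' := hb.const_mul ((n : ℝ) ^ α)
      rw [zero_div, mul_div_cancel_left₀ _ hn0.ne'] at hb'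
      refine hb'.congr fun h hh => ?_
      rw [uIoc_of_le Real.pi_pos.le] at hh
      rw [Real.mul_rpow hn0.le hh.1.le, Real.rpow_neg hn0.le]
      have := (Real.rpow_pos_of_pos hn0 α).ne'
      field_simp
    · refine mul_le_mul_of_nonneg_left ?_ (sub_nonneg.2 (Real.cos_le_one _))
      exact Real.rpow_le_rpow_of_nonpos (chord_pos ⟨hh.1, by linarith [hh.2, Real.pi_pos]⟩)
        (chord_le hh.1.le) (by linarith [hα.1])
  have s3 : ∫ h in (0 : ℝ)..Real.pi, (1 - Real.cos (n * h)) * h ^ (-α) =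
      (n : ℝ) ^ (α - 1) * ∫ t in (0 : ℝ)..(n * Real.pi), (1 - Real.cos t) * t ^ (-α) := by
    have := intervalIntegral.integral_comp_mul_left (a := 0) (b := Real.pi)
      (fun t : ℝ => (1 - Real.cos t) * t ^ (-α)) hn0.ne'
    rw [mul_zero] at this
    rw [show (n : ℝ) ^ (α - 1) = (n : ℝ) ^ α * (n : ℝ)⁻¹ by
      rw [Real.rpow_sub_one hn0.ne', div_eq_mul_inv], mul_assoc, ← smul_eq_mul (n : ℝ)⁻¹, ← this,
      ← intervalIntegral.integral_const_mul]
    refine integral_congr_Ioo Real.pi_pos.le fun h hh => ?_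
    rw [Real.mul_rpow hn0.le hh.1.le, Real.rpow_neg hn0.le]
    have := (Real.rpow_pos_of_pos hn0 α).ne'
    field_simp
  have s4 : ∫ t in (0 : ℝ)..Real.pi, (1 - Real.cos t) * t ^ (-α) ≤
      ∫ t in (0 : ℝ)..(n * Real.pi), (1 - Real.cos t) * t ^ (-α) := by
    have hle : Real.pi ≤ n * Real.pi := le_mul_of_one_le_left Real.pi_pos.le hn1
    have hi2 := (hint Real.pi Real.pi_pos.le).symm.trans (hint (n * Real.pi) (by positivity))
    rw [← intervalIntegral.integral_add_adjacent_intervals (hint _ Real.pi_pos.le) hi2]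
    have : 0 ≤ ∫ t in Real.pi..(n * Real.pi), (1 - Real.cos t) * t ^ (-α) := by
      refine intervalIntegral.integral_nonneg hle fun h hh => ?_
      exact mul_nonneg (sub_nonneg.2 (Real.cos_le_one _))
        (Real.rpow_nonneg (Real.pi_pos.le.trans hh.1) _)
    linarith
  calc _ = (n : ℝ) ^ (α - 1) * ∫ t in (0 : ℝ)..Real.pi, (1 - Real.cos t) * t ^ (-α) := mul_comm _ _
    _ ≤ _ := by
      refine (mul_le_mul_of_nonneg_left s4 (by positivity)).trans ?_
      rw [← s3]; exact s2.trans s1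

/-- The spectral gap of the linearised operator. -/
theorem exists_moment_sub_ge : ∃ c : ℝ, 0 < c ∧ ∀ n : ℕ, 2 ≤ n →
    c * (n : ℝ) ^ (α - 1) ≤ moment α n - moment α 1 := by
  obtain ⟨c, hc, h⟩ := exists_moment_ge hα
  have h1 := moment_one_pos hα
  have h2 : moment α 1 < moment α 2 := moment_lt_succ hα 1
  have h2' : 0 < moment α 2 := h1.trans h2
  -- Since K_2 ≤ K_n, one has K_1 ≤ (K_1/K_2) K_n, so subtracting K_1 costs only the fixed factor 1
  -- - K_1/K_2 > 0.
  refine ⟨c * (1 - moment α 1 / moment α 2), mul_pos hc ?_, fun n hn => ?_⟩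
  · rw [sub_pos, div_lt_one h2']; exact h2
  · have h3 : moment α 2 ≤ moment α n := (moment_strictMono hα).monotone hn
    have h4 := h n (by omega)
    have h5 : 0 ≤ 1 - moment α 1 / moment α 2 := by
      rw [sub_nonneg, div_le_one h2']; exact h2.le
    have h6 : moment α 1 ≤ moment α 1 / moment α 2 * moment α n := by
      rw [div_mul_eq_mul_div, le_div_iff₀ h2']
      exact mul_le_mul_of_nonneg_left h3 h1.le
    calc c * (1 - moment α 1 / moment α 2) * (n : ℝ) ^ (α - 1)
        = (1 - moment α 1 / moment α 2) * (c * (n : ℝ) ^ (α - 1)) := by ring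
      _ ≤ (1 - moment α 1 / moment α 2) * moment α n := mul_le_mul_of_nonneg_left h4 h5
      _ ≤ _ := by linarith

end

end

end GSQG

/-! ### The symbol of the linearised self-interaction and the constant Ξ_α -/

namespace GSQG

noncomputable section

open MeasureTheory

section

variable {α : ℝ} (hα : α ∈ Ioo (1 : ℝ) 2)

include hα

theorem intervalIntegrable_one_sub_exp (n : ℕ) :
    IntervalIntegrable (fun h : ℝ => ((1 : ℂ) - Complex.exp (-(n * h * Complex.I))) *
      (chord h ^ (-α) : ℝ)) volume 0 (2 * Real.pi) := by
  refine intervalIntegrable_of_bound (intervalIntegrable_diffKernel hα n) ?_ fun h hh => ?_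
  · exact ContinuousOn.mul (by fun_prop)
      (Complex.continuous_ofReal.comp_continuousOn (continuousOn_chord_rpow _))
  · rw [norm_mul, Complex.norm_real, Real.norm_of_nonneg (Real.rpow_nonneg (chord_pos hh).le _)]
    exact le_rfl

/-- The reflection h ↦ 2π - h conjugates the integrand, so the integral is real and equals its
cosine part. -/
theorem integral_one_sub_exp (n : ℕ) :
    ∫ h in (0 : ℝ)..(2 * Real.pi), ((1 : ℂ) - Complex.exp (-(n * h * Complex.I))) *
      (chord h ^ (-α) : ℝ) = moment α n := by
  have hI := intervalIntegrable_one_sub_exp hα n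
  refine Complex.ext ?_ ?_
  · have := intervalIntegral.intervalIntegral_re hI
    change _ = (∫ h in (0 : ℝ)..(2 * Real.pi), _ : ℂ).re at this
    rw [← this, Complex.ofReal_re, moment]
    refine intervalIntegral.integral_congr fun h _ => ?_
    simp only [RCLike.re_to_complex]
    rw [Complex.re_mul_ofReal, re_one_sub_exp hα]
  · have hr := integral_reflect (fun h : ℝ => ((1 : ℂ) - Complex.exp (-(n * h * Complex.I))) *
      (chord h ^ (-α) : ℝ))
    have : ∀ h : ℝ, ((1 : ℂ) - Complex.exp (-(n * ((2 * Real.pi - h : ℝ) : ℂ) * Complex.I))) *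
        (chord (2 * Real.pi - h) ^ (-α) : ℝ) =
        starRingEnd ℂ (((1 : ℂ) - Complex.exp (-(n * h * Complex.I))) * (chord h ^ (-α) : ℝ)) := by
      intro h
      rw [one_sub_exp_reflect, chord_reflect, map_mul, map_sub, map_one, Complex.conj_ofReal]
    simp only [this] at hr
    rw [intervalIntegral.intervalIntegral_conj] at hr
    rw [Complex.ofReal_im]
    exact Complex.conj_eq_iff_im.1 hr

theorem intervalIntegrable_cos_half_exp (n : ℕ) :
    IntervalIntegrable (fun h : ℝ => ((chord h ^ (1 - α) * Real.cos (h / 2) : ℝ) : ℂ) *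
      Complex.exp (-(n * h * Complex.I))) volume 0 (2 * Real.pi) := by
  refine IntervalIntegrable.mul_continuousOn ?_ (by fun_prop)
  have h : IntervalIntegrable (fun h : ℝ => chord h ^ (1 - α) * Real.cos (h / 2)) volume 0
      (2 * Real.pi) := (intervalIntegrable_chord_one_sub hα).mul_continuousOn (by fun_prop)
  exact ⟨h.1.ofReal, h.2.ofReal⟩

/-- Integration by parts: chord^{1-α} cos(h/2) is a multiple of the derivative of chord^{2-α}, which
vanishes at both ends because α < 2. -/
theorem integral_cos_half_exp (n : ℕ) :
    (1 - α / 2 : ℝ) * ∫ h in (0 : ℝ)..(2 * Real.pi),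
      ((chord h ^ (1 - α) * Real.cos (h / 2) : ℝ) : ℂ) * Complex.exp (-(n * h * Complex.I)) =
    (n * Complex.I) / 2 * ∫ h in (0 : ℝ)..(2 * Real.pi),
      ((chord h ^ (2 - α) : ℝ) : ℂ) * Complex.exp (-(n * h * Complex.I)) := by
  have hi1 := intervalIntegrable_cos_half_exp hα n
  have hi2 : IntervalIntegrable (fun h : ℝ => ((chord h ^ (2 - α) : ℝ) : ℂ) *
      Complex.exp (-(n * h * Complex.I))) volume 0 (2 * Real.pi) := by
    have := continuous_chord_two_sub hα
    exact Continuous.intervalIntegrable (by fun_prop) _ _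
  have key := intervalIntegral.integral_eq_sub_of_hasDerivAt_of_le (a := 0) (b := 2 * Real.pi)
    (f := fun h => ((chord h ^ (2 - α) : ℝ) : ℂ) * Complex.exp (-(n * h * Complex.I)))
    (f' := fun h : ℝ => ((2 - α : ℝ) : ℂ) * (((chord h ^ (1 - α) * Real.cos (h / 2) : ℝ) : ℂ) *
        Complex.exp (-(n * h * Complex.I))) -
      (n * Complex.I) * (((chord h ^ (2 - α) : ℝ) : ℂ) * Complex.exp (-(n * h * Complex.I))))
    (by positivity)
    (by
      have := continuous_chord_two_sub hα
      exact Continuous.continuousOn (by fun_prop))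
    (fun h hh => by
      have h1 := (hasDerivAt_chord_rpow hh (2 - α)).ofReal_comp
      have h2 : HasDerivAt (fun h : ℝ => Complex.exp (-(n * h * Complex.I)))
          (Complex.exp (-(n * h * Complex.I)) * (-(n * Complex.I))) h := by
        have : HasDerivAt (fun h : ℝ => -(n * (h : ℂ) * Complex.I)) (-(n * Complex.I)) h := by
          have := ((hasDerivAt_id h).ofReal_comp.const_mul (n : ℂ)).mul_const (-Complex.I)
          simpa using this
        exact this.cexp
      refine (h1.mul h2).congr_deriv ?_
      rw [show 2 - α - 1 = 1 - α by ring]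
      push_cast
      ring)
    ((hi1.const_mul _).sub (hi2.const_mul _))
  rw [intervalIntegral.integral_sub (hi1.const_mul _) (hi2.const_mul _),
    intervalIntegral.integral_const_mul, intervalIntegral.integral_const_mul] at key
  rw [chord_zero, chord_two_pi, Real.zero_rpow (by linarith [hα.2])] at key
  simp only [Complex.ofReal_zero, zero_mul, sub_zero] at key
  have e := sub_eq_zero.1 key
  have : ((1 - α / 2 : ℝ) : ℂ) = ((2 - α : ℝ) : ℂ) / 2 := by push_cast; ring
  rw [this, div_mul_eq_mul_div, e]
  ring

/-- The mode n = 0 of the integration by parts. The integrand is the order-zero term of the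
self-interaction, so the vanishing says that a disc is stationary and permits division by the size
of the perturbation. -/
theorem integral_cos_half : ∫ h in (0 : ℝ)..(2 * Real.pi),
    chord h ^ (1 - α) * Real.cos (h / 2) = 0 := by
  have h := integral_cos_half_exp hα 0
  simp only [CharP.cast_eq_zero, zero_mul, neg_zero, Complex.exp_zero, mul_one, zero_div] at h
  rw [intervalIntegral.integral_ofReal, ← Complex.ofReal_mul, Complex.ofReal_eq_zero] at h
  exact (mul_eq_zero.1 h).resolve_left (by linarith [hα.2])

/-- The symbol of the linearised operator. -/
theorem symbol_eq (n : ℕ) :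
    (1 - α / 2 : ℝ) * (∫ h in (0 : ℝ)..(2 * Real.pi),
      ((chord h ^ (1 - α) * Real.cos (h / 2) : ℝ) : ℂ) * Complex.exp (-(n * h * Complex.I))) -
    n * Complex.I * (∫ h in (0 : ℝ)..(2 * Real.pi), (Real.cos h : ℂ) *
      (((1 : ℂ) - Complex.exp (-(n * h * Complex.I))) * (chord h ^ (-α) : ℝ))) =
    -(n * Complex.I) * ((moment α n - moment α 1 : ℝ) : ℂ) := by
  rw [integral_cos_half_exp hα]
  have hc := continuous_chord_two_sub hα
  have hi1 := intervalIntegrable_one_sub_exp hα n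
  have hi2 : IntervalIntegrable (fun h : ℝ => ((chord h ^ (2 - α) : ℝ) : ℂ) *
      Complex.exp (-(n * h * Complex.I))) volume 0 (2 * Real.pi) :=
    Continuous.intervalIntegrable (by fun_prop) _ _
  have hi3 : IntervalIntegrable (fun h : ℝ => ((chord h ^ (2 - α) : ℝ) : ℂ)) volume 0
      (2 * Real.pi) := Continuous.intervalIntegrable (by fun_prop) _ _
  -- The identity cos h = 1 - chord²/2 separates the moment K_n from integrals of chord^{2-α}. The
  -- oscillating one cancels against the integration by parts, and the other is K_1.
  have e : ∫ h in (0 : ℝ)..(2 * Real.pi), (Real.cos h : ℂ) *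
      (((1 : ℂ) - Complex.exp (-(n * h * Complex.I))) * (chord h ^ (-α) : ℝ)) =
      ∫ h in (0 : ℝ)..(2 * Real.pi), ((((1 : ℂ) - Complex.exp (-(n * h * Complex.I))) *
        (chord h ^ (-α) : ℝ)) - 1 / 2 * (((chord h ^ (2 - α) : ℝ) : ℂ) -
        ((chord h ^ (2 - α) : ℝ) : ℂ) * Complex.exp (-(n * h * Complex.I)))) := by
    refine integral_congr_Ioo (by positivity) fun h hh => ?_
    rw [chord_rpow_two_sub hα hh, chord_rpow_one_sub hα hh, cos_eq_chord]
    push_cast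
    ring
  rw [e, intervalIntegral.integral_sub hi1 ((hi3.sub hi2).const_mul _),
    intervalIntegral.integral_const_mul, intervalIntegral.integral_sub hi3 hi2,
    integral_one_sub_exp hα, intervalIntegral.integral_ofReal, moment_one hα]
  push_cast
  ring

theorem integral_beta {a : ℝ} (ha : 0 < a) :
    ∫ x in Ioo (0 : ℝ) 1, x ^ (a - 1) * (1 - x) ^ (a - 1) =
      Real.Gamma a * Real.Gamma a / Real.Gamma (a + a) := by
  have h := ProbabilityTheory.beta_eq_betaIntegralReal a a ha ha
  rw [ProbabilityTheory.beta] at h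
  rw [h, Complex.betaIntegral, intervalIntegral.integral_of_le (by norm_num),
      ← integral_Ioc_eq_integral_Ioo, ← RCLike.re_to_complex, ← integral_re]
  · refine setIntegral_congr_fun measurableSet_Ioc fun x hx => ?_
    norm_cast
    rw [← Complex.ofReal_cpow, ← Complex.ofReal_cpow, RCLike.re_to_complex,
        Complex.re_mul_ofReal, Complex.ofReal_re]
    · linarith [hx.2]
    · exact hx.1.le
  · have := Complex.betaIntegral_convergent (u := a) (v := a) (by simpa) (by simpa)
    rwa [intervalIntegrable_iff_integrableOn_Ioc_of_le (by simp)] at this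

/-- The substitution x = (1 - cos(h/2))/2 gives x(1-x) = (chord/4)² and dx = (chord/8) dh. This
produces the beta integral B(a, a) with a = (3-α)/2, and Legendre's duplication formula removes
Γ(a). -/
theorem integral_chord_two_sub :
    ∫ h in (0 : ℝ)..(2 * Real.pi), chord h ^ (2 - α) =
      2 * Real.pi * Real.Gamma (3 - α) / Real.Gamma (2 - α / 2) ^ 2 := by
  set a : ℝ := (3 - α) / 2 with ha
  have ha0 : 0 < a := by rw [ha]; linarith [hα.2]
  have himg : (fun h : ℝ => (1 - Real.cos (h / 2)) / 2) '' Ioo 0 (2 * Real.pi) = Ioo 0 1 := by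
    ext x
    constructor
    · rintro ⟨h, hh, rfl⟩
      have h1 : Real.cos (h / 2) < 1 := by
        rw [← Real.cos_zero]
        exact Real.cos_lt_cos_of_nonneg_of_le_pi le_rfl (by linarith [hh.2]) (by linarith [hh.1])
      have h2 : -1 < Real.cos (h / 2) := by
        rw [← Real.cos_pi]
        exact Real.cos_lt_cos_of_nonneg_of_le_pi (by linarith [hh.1]) le_rfl (by linarith [hh.2])
      constructor <;> simp only <;> linarith
    · intro hx
      refine ⟨2 * Real.arccos (1 - 2 * x), ⟨?_, ?_⟩, ?_⟩
      · have := Real.arccos_pos.2 (show 1 - 2 * x < 1 by linarith [hx.1])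
        linarith
      · have : Real.arccos (1 - 2 * x) < Real.pi := by
          refine lt_of_le_of_ne (Real.arccos_le_pi _) fun h => ?_
          rw [Real.arccos_eq_pi] at h
          linarith [hx.2]
        linarith
      · simp only
        rw [mul_div_cancel_left₀ _ two_ne_zero, Real.cos_arccos (by linarith [hx.2])
          (by linarith [hx.1])]
        ring
  have hinj : InjOn (fun h : ℝ => (1 - Real.cos (h / 2)) / 2) (Ioo 0 (2 * Real.pi)) := by
    intro x hx y hy hxy
    have : Real.cos (x / 2) = Real.cos (y / 2) := by simp only at hxy; linarith
    have := Real.injOn_cos ⟨by linarith [hx.1], by linarith [hx.2]⟩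
      ⟨by linarith [hy.1], by linarith [hy.2]⟩ this
    linarith
  have key := integral_image_eq_integral_abs_deriv_smul (measurableSet_Ioo (a := (0 : ℝ))
    (b := 2 * Real.pi)) (f := fun h : ℝ => (1 - Real.cos (h / 2)) / 2)
    (f' := fun h => Real.sin (h / 2) / 4) (fun h _ => by
      have := ((((hasDerivAt_id h).div_const 2).cos).const_sub 1).div_const 2
      refine (this.congr_deriv ?_).hasDerivWithinAt
      simp; ring) hinj (fun x => x ^ (a - 1) * (1 - x) ^ (a - 1))
  rw [himg, integral_beta hα ha0] at key
  have e : ∫ h in Ioo (0 : ℝ) (2 * Real.pi), |Real.sin (h / 2) / 4| •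
      (((1 - Real.cos (h / 2)) / 2) ^ (a - 1) * (1 - (1 - Real.cos (h / 2)) / 2) ^ (a - 1)) =
      ∫ h in Ioo (0 : ℝ) (2 * Real.pi), 1 / (2 * 4 ^ (2 - α)) * chord h ^ (2 - α) := by
    refine setIntegral_congr_fun measurableSet_Ioo fun h hh => ?_
    have hc := chord_pos hh
    have h1 : |Real.sin (h / 2) / 4| = chord h / 8 := by
      rw [abs_of_pos (by have := hc; unfold chord at this; linarith), chord]; ring
    have h2 : 0 ≤ (1 - Real.cos (h / 2)) / 2 := by linarith [Real.cos_le_one (h / 2)]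
    have h3 : 0 ≤ 1 - (1 - Real.cos (h / 2)) / 2 := by linarith [Real.neg_one_le_cos (h / 2)]
    have h4 : (1 - Real.cos (h / 2)) / 2 * (1 - (1 - Real.cos (h / 2)) / 2) =
        (chord h / 4) ^ (2 : ℝ) := by
      rw [Real.rpow_two, chord]
      have := Real.sin_sq_add_cos_sq (h / 2)
      linear_combination -1 / 4 * this
    rw [h1, ← Real.mul_rpow h2 h3, h4, ← Real.rpow_mul (by positivity),
      show 2 * (a - 1) = 1 - α by rw [ha]; ring, Real.div_rpow hc.le (by norm_num), smul_eq_mul,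
      chord_rpow_two_sub hα hh, show (2 - α : ℝ) = (1 - α) + 1 by ring,
      Real.rpow_add_one (by norm_num : (4 : ℝ) ≠ 0)]
    have : (4 : ℝ) ^ (1 - α) ≠ 0 := (Real.rpow_pos_of_pos (by norm_num) _).ne'
    field_simp
    norm_num
  rw [e, integral_const_mul, ← integral_Ioc_eq_integral_Ioo,
    ← intervalIntegral.integral_of_le (by positivity)] at key
  have dup := Real.Gamma_mul_Gamma_add_half a
  rw [show a + 1 / 2 = 2 - α / 2 by rw [ha]; ring, show 2 * a = 3 - α by rw [ha]; ring,
    show 1 - (3 - α) = -(2 - α) by ring] at dup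
  rw [show a + a = 3 - α by rw [ha]; ring] at key
  have g1 : 0 < Real.Gamma (2 - α / 2) := Real.Gamma_pos_of_pos (by linarith [hα.2])
  have g2 : 0 < Real.Gamma (3 - α) := Real.Gamma_pos_of_pos (by linarith [hα.2])
  generalize Real.Gamma (2 - α / 2) = G2 at *
  generalize Real.Gamma (3 - α) = G3 at *
  have hG : Real.Gamma a = G3 * 2 ^ (-(2 - α)) * √Real.pi /
      G2 := by rw [← dup]; field_simp
  have h4 : (4 : ℝ) ^ (2 - α) = 2 ^ (2 - α) * 2 ^ (2 - α) := by
    rw [← Real.mul_rpow (by norm_num) (by norm_num)]; norm_num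
  have h2 : (2 : ℝ) ^ (2 - α) ≠ 0 := (Real.rpow_pos_of_pos (by norm_num) _).ne'
  have hpi := Real.mul_self_sqrt Real.pi_pos.le
  rw [hG, h4, Real.rpow_neg (by norm_num)] at key
  field_simp at key
  rw [Real.sq_sqrt Real.pi_pos.le] at key
  rw [eq_div_iff (by positivity)]
  linarith

/-- This converts the spectral gap at mode two into the constant of the asymptotic expansion: the
gamma functions of the evaluated chord integral cancel those of Ξ_α. -/
theorem xiConst_mul_gap : xiConst α * (moment α 2 - moment α 1) = Real.pi * α * (α + 2) := by
  rw [moment_two_sub_one hα, integral_chord_two_sub hα, xiConst]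
  have e1 : Real.Gamma (3 - α) = (2 - α) * Real.Gamma (2 - α) := by
    rw [← Real.Gamma_add_one (by linarith [hα.2])]; congr 1; ring
  have e2 : Real.Gamma (3 - α / 2) = (2 - α / 2) * Real.Gamma (2 - α / 2) := by
    rw [← Real.Gamma_add_one (by linarith [hα.2])]; congr 1; ring
  have e3 : Real.Gamma (2 - α / 2) = (1 - α / 2) * Real.Gamma (1 - α / 2) := by
    rw [← Real.Gamma_add_one (by linarith [hα.2])]; congr 1; ring
  have g1 : 0 < Real.Gamma (2 - α) := Real.Gamma_pos_of_pos (by linarith [hα.2])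
  have g2 : 0 < Real.Gamma (1 - α / 2) := Real.Gamma_pos_of_pos (by linarith [hα.2])
  have h1 : (4 - α) ≠ 0 := by linarith [hα.2]
  have h2 : (2 - α) ≠ 0 := by linarith [hα.2]
  have h3 : (1 - α / 2) ≠ 0 := by linarith [hα.2]
  rw [e2, e1, e3]
  generalize Real.Gamma (1 - α / 2) = G1 at *
  generalize Real.Gamma (2 - α) = G2 at *
  field_simp
  ring

end

end

end GSQG

namespace GSQG

noncomputable section

open MeasureTheory

/-! ### The binomial series in a Banach algebra -/

/-- The coefficients of the power series of `((1 + t)^{-α/2} - 1) / t`. -/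
def binomCoeff (α : ℝ) (n : ℕ) : ℝ := Ring.choose (-(α / 2)) (n + 1)

theorem choose_succ_mul (r : ℝ) (n : ℕ) :
    Ring.choose r (n + 1) * (n + 1) = Ring.choose r n * (r - n) := by
  rw [Ring.choose_eq_smul, Ring.choose_eq_smul, descPochhammer_succ_right, Polynomial.smeval_mul,
    Polynomial.smeval_sub, Polynomial.smeval_X, Polynomial.smeval_natCast, Nat.factorial_succ]
  have h1 : (n.factorial : ℝ) ≠ 0 := by exact_mod_cast n.factorial_ne_zero
  have h2 : (n + 1 : ℝ) ≠ 0 := by positivity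
  simp only [smul_eq_mul, nsmul_eq_mul, pow_zero, pow_one, mul_one]
  push_cast
  field_simp

/-- Each step of the recursion multiplies by (-α/2 - n)/(n+1), of modulus at most 1 because α ≤ 2.
The series therefore converge in the whole unit ball of any Banach algebra. -/
theorem abs_choose_le_one {α : ℝ} (hα : α ∈ Ioo (1 : ℝ) 2) (n : ℕ) :
    |Ring.choose (-(α / 2)) n| ≤ 1 := by
  induction n with
  | zero => simp
  | succ n ih =>
    have h := choose_succ_mul (-(α / 2)) n
    have h2 : (0 : ℝ) < n + 1 := by positivity
    have h3 : |(-(α / 2) - n : ℝ)| ≤ n + 1 := by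
      rw [abs_le]; constructor <;> linarith [hα.1, hα.2, (n.cast_nonneg : (0 : ℝ) ≤ n)]
    have h4 := congrArg abs h
    rw [abs_mul, abs_mul, abs_of_pos h2] at h4
    have h5 : |Ring.choose (-(α / 2)) n| * |(-(α / 2) - n : ℝ)| ≤ 1 * (n + 1) :=
      mul_le_mul ih h3 (abs_nonneg _) zero_le_one
    rw [← h4] at h5
    exact le_of_mul_le_mul_right h5 h2

theorem binomCoeff_zero (α : ℝ) : binomCoeff α 0 = -(α / 2) := by
  simp [binomCoeff]

theorem binomCoeff_one (α : ℝ) : binomCoeff α 1 = α / 2 * (α / 2 + 1) / 2 := by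
  have := choose_succ_mul (-(α / 2)) 1
  rw [Ring.choose_one_right] at this
  rw [binomCoeff]
  push_cast at this
  linarith

section

variable {A : Type*} [NormedCommRing A] [NormedAlgebra ℝ A] [CompleteSpace A] [NormOneClass A]

/-- The function `((1 + a)^{-α/2} - 1) / a` on the unit ball of a Banach algebra. -/
def psi (α : ℝ) (a : A) : A := ∑' n, binomCoeff α n • a ^ n

variable {α : ℝ} (hα : α ∈ Ioo (1 : ℝ) 2)

include hα

theorem hasSum_psi {a : A} (ha : ‖a‖ < 1) : HasSum (fun n => binomCoeff α n • a ^ n) (psi α a) := by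
  refine (Summable.of_norm_bounded (summable_geometric_of_lt_one (norm_nonneg a) ha)
    fun n => ?_).hasSum
  rw [norm_smul]
  calc ‖binomCoeff α n‖ * ‖a ^ n‖ ≤ 1 * ‖a‖ ^ n :=
        mul_le_mul (abs_choose_le_one hα _) (norm_pow_le a n) (norm_nonneg _) zero_le_one
    _ = _ := one_mul _

/-- Bounded coefficients give radius of convergence at least 1, and a power series is analytic at
its centre. -/
theorem contDiffAt_psi : ContDiffAt ℝ 1 (psi α : A → A) 0 := by
  have h1 : (1 : ENNReal) ≤ (FormalMultilinearSeries.ofScalars A (binomCoeff α)).radius := by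
    have := (FormalMultilinearSeries.ofScalars A (binomCoeff α)).le_radius_of_bound (r := 1) 1
      (fun n => by
        rw [FormalMultilinearSeries.ofScalars_norm, NNReal.coe_one, one_pow, mul_one]
        exact abs_choose_le_one hα _)
    simpa using this
  have h2 := (FormalMultilinearSeries.ofScalars A (binomCoeff α)).hasFPowerSeriesOnBall
    (lt_of_lt_of_le one_pos h1)
  have h3 : (FormalMultilinearSeries.ofScalars A (binomCoeff α)).sum = (psi α : A → A) :=
    FormalMultilinearSeries.ofScalarsSum_eq_tsum (binomCoeff α)
  rw [h3] at h2
  exact h2.analyticAt.contDiffAt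

theorem psi_zero : psi α (0 : A) = algebraMap ℝ A (-(α / 2)) := by
  have h1 := hasSum_psi (A := A) hα (a := 0) (by simp)
  refine h1.unique ?_
  have := hasSum_ite_eq (0 : ℕ) (algebraMap ℝ A (-(α / 2)))
  refine this.congr_fun ?_ |> id
  intro n
  rcases n with _ | n
  · simp [binomCoeff_zero, Algebra.algebraMap_eq_smul_one]
  · simp

/-- A continuous character can be applied term by term. This identifies the abstract series in the
algebra with the scalar function at each pair (x, h). -/
theorem map_psi (χ : A →L[ℝ] ℂ) (h1 : χ 1 = 1) (hm : ∀ a b, χ (a * b) = χ a * χ b) {a : A}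
    (ha : ‖a‖ < 1) {t : ℝ} (ht : χ a = t) (ht1 : |t| < 1) : χ (psi α a) = (psi α t : ℝ) := by
  have hp : ∀ n : ℕ, χ (a ^ n) = ((t ^ n : ℝ) : ℂ) := by
    intro n
    induction n with
    | zero => simp [h1]
    | succ n ih => rw [pow_succ, hm, ih, ht, pow_succ]; push_cast; ring
  have e1 := (hasSum_psi hα ha).map χ χ.continuous
  have e2 := (hasSum_psi (A := ℝ) hα (a := t) ht1).map Complex.ofRealCLM
    Complex.ofRealCLM.continuous
  refine e1.unique (e2.congr_fun ?_ |> id)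
  intro n
  simp [hp]

end

/-- The binomial series with its constant term split off; the form 1 + t ψ(t) exposes the factor t
that is divided out later. -/
theorem one_add_mul_psi {α : ℝ} (hα : α ∈ Ioo (1 : ℝ) 2) {t : ℝ} (ht : |t| < 1) :
    1 + t * psi α t = (1 + t) ^ (-(α / 2)) := by
  have hball : t ∈ Metric.eball (0 : ℝ) 1 := by
    rw [mem_eball_zero_iff, ← ofReal_norm, ENNReal.ofReal_lt_one]
    exact ht
  have h1 := (Real.one_add_rpow_hasFPowerSeriesOnBall_zero (a := -(α / 2))).hasSum hball
  rw [zero_add] at h1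
  have e2 : (fun n => (binomialSeries ℝ (-(α / 2))) n fun _ => t) =
      fun n => Ring.choose (-(α / 2)) n * t ^ n := by
    funext n
    rw [binomialSeries, FormalMultilinearSeries.ofScalars_apply_eq, smul_eq_mul]
  rw [e2] at h1
  have h3 := (hasSum_psi (A := ℝ) hα (a := t) ht).mul_left t
  have e4 : (fun n => t * binomCoeff α n • t ^ n) =
      fun n => Ring.choose (-(α / 2)) (n + 1) * t ^ (n + 1) := by
    funext n
    rw [smul_eq_mul, binomCoeff, pow_succ]; ring
  rw [e4] at h3
  have h5 := (hasSum_nat_add_iff (f := fun n => Ring.choose (-(α / 2)) n * t ^ n) 1).1 h3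
  rw [Finset.sum_range_one, Ring.choose_zero_right, pow_zero, mul_one, add_comm] at h5
  exact h5.unique h1

end

/-! ### Kernels with values in the Wiener algebra; profiles, shifts and difference quotients -/

noncomputable section

open MeasureTheory Wiener

theorem integrable_of_hasSum {β E : Type*} [MeasurableSpace β] {μ : Measure β}
    [NormedAddCommGroup E] {F : ℕ → β → E} {f : β → E}
    (hF : ∀ n, Integrable (F n) μ) (hs : Summable fun n => ∫ a, ‖F n a‖ ∂μ)
    (hm : AEStronglyMeasurable f μ) (hf : ∀ᵐ a ∂μ, HasSum (fun n => F n a) (f a)) :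
    Integrable f μ := by
  refine ⟨hm, ?_⟩
  have h1 : ∫⁻ a, ∑' n, ‖F n a‖ₑ ∂μ < ⊤ := by
    rw [lintegral_tsum fun n => (hF n).1.enorm]
    have : ∀ n, ∫⁻ a, ‖F n a‖ₑ ∂μ = ENNReal.ofReal (∫ a, ‖F n a‖ ∂μ) := fun n => by
      rw [ofReal_integral_norm_eq_lintegral_enorm (hF n)]
    simp only [this]
    exact hs.tsum_ofReal_lt_top
  refine lt_of_le_of_lt (lintegral_mono_ae ?_) h1
  filter_upwards [hf] with a ha
  rw [← ha.tsum_eq]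
  exact enorm_tsum_le_tsum_enorm

/-- Bounded functions of an angle `h` with values in the Wiener algebra. -/
abbrev Kern (ρ : ℝ) [Fact (1 ≤ ρ)] := BoundedContinuousFunction ℝ (Wiener ρ)

section

variable (α ρ : ℝ) [hα : Fact (α ∈ Ioo (1 : ℝ) 2)] [hρ : Fact (1 ≤ ρ)]

/-- The weights relating the coefficients of a profile to the norm of its coordinates. -/
def cw (n : ℕ) : ℝ := (((n : ℝ) + 2) ^ α)⁻¹ * (ρ ^ (n + 2))⁻¹

theorem cw_pos (n : ℕ) : 0 < cw α ρ n := by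
  have : 0 < ρ := lt_of_lt_of_le one_pos hρ.out
  unfold cw; positivity

variable {α ρ}

theorem cw_mul_le {n : ℕ} {K C : ℝ} (h : K ≤ C * ((n : ℝ) + 2) ^ α) :
    cw α ρ n * (ρ ^ (n + 2) * K) ≤ C := by
  have h1 : 0 < ρ := lt_of_lt_of_le one_pos hρ.out
  have h2 : 0 < ((n : ℝ) + 2) ^ α := by positivity
  rw [cw]
  calc (((n : ℝ) + 2) ^ α)⁻¹ * (ρ ^ (n + 2))⁻¹ * (ρ ^ (n + 2) * K) = (((n : ℝ) + 2) ^ α)⁻¹ * K := by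
        field_simp
    _ ≤ (((n : ℝ) + 2) ^ α)⁻¹ * (C * ((n : ℝ) + 2) ^ α) := by gcongr
    _ = C := by field_simp

theorem le_rpow (n : ℕ) : (n : ℝ) + 2 ≤ ((n : ℝ) + 2) ^ α := by
  have := Real.rpow_le_rpow_of_exponent_le (x := (n : ℝ) + 2) (by linarith [n.cast_nonneg (α := ℝ)])
    hα.out.1.le
  rwa [Real.rpow_one] at this

/-- The wave `Re (z φ(h) e^{inx})` with an amplitude depending on `h`. -/
def waveK (n : ℕ) (φ : BoundedContinuousFunction ℝ ℂ) : ℂ →L[ℝ] Kern ρ :=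
  (wave n).compLeftContinuousBounded ℝ ∘L
    ((ContinuousLinearMap.toSpanSingleton ℂ φ).restrictScalars ℝ)

theorem waveK_apply (n : ℕ) (φ : BoundedContinuousFunction ℝ ℂ) (z : ℂ) (h : ℝ) :
    waveK (ρ := ρ) n φ z h = wave n (z * φ h) := rfl

theorem norm_waveK_le (n : ℕ) (φ : BoundedContinuousFunction ℝ ℂ) :
    ‖waveK (ρ := ρ) n φ‖ ≤ ρ ^ n * ‖φ‖ := by
  have h0 : 0 ≤ ρ ^ n := pow_nonneg (zero_le_one.trans hρ.out) n
  have hb : ∀ (z : ℂ) (h : ℝ), ‖wave (ρ := ρ) n (z * φ h)‖ ≤ ρ ^ n * ‖φ‖ * ‖z‖ := by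
    intro z h
    have h1 := (wave (ρ := ρ) n).le_of_opNorm_le (norm_wave_le n) (z * φ h)
    rw [norm_mul] at h1
    have h2 := mul_le_mul_of_nonneg_left (φ.norm_coe_le_norm h) (norm_nonneg z)
    have h3 := mul_le_mul_of_nonneg_left h2 h0
    refine (h1.trans h3).trans (le_of_eq ?_)
    ring
  refine ContinuousLinearMap.opNorm_le_bound _ (mul_nonneg h0 (norm_nonneg _)) fun z => ?_
  exact (BoundedContinuousFunction.norm_le
    (mul_nonneg (mul_nonneg h0 (norm_nonneg _)) (norm_nonneg _))).2 (hb z)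

/-- The operator which multiplies the modes of a profile by given functions of `h`. -/
def liftK (φ : ℕ → BoundedContinuousFunction ℝ ℂ) (hφ : ∀ n : ℕ, ‖φ n‖ ≤ (n : ℝ) + 2) :
    Summ ℕ →L[ℝ] Kern ρ :=
  Summ.lift (fun n => cw α ρ n • waveK (n + 2) (φ n)) 1 fun n => by
    rw [norm_smul, Real.norm_of_nonneg (cw_pos α ρ n).le]
    refine (mul_le_mul_of_nonneg_left (norm_waveK_le _ _) (cw_pos α ρ n).le).trans ?_
    refine cw_mul_le ?_
    rw [one_mul]
    exact (hφ n).trans (le_rpow n)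

theorem hasSum_liftK (φ : ℕ → BoundedContinuousFunction ℝ ℂ)
    (hφ : ∀ n : ℕ, ‖φ n‖ ≤ (n : ℝ) + 2) (g : Summ ℕ) (h x : ℝ) :
    HasSum (fun n : ℕ => ((cw α ρ n * (g n * φ n h *
      Complex.exp (((n : ℂ) + 2) * x * Complex.I)).re : ℝ) : ℂ))
      (ev ρ x (liftK (α := α) φ hφ g h)) := by
  have h1 := Summ.hasSum_lift (v := fun n => cw α ρ n • waveK (ρ := ρ) (n + 2) (φ n)) (C := 1)
    (by
      intro n
      rw [norm_smul, Real.norm_of_nonneg (cw_pos α ρ n).le]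
      refine (mul_le_mul_of_nonneg_left (norm_waveK_le _ _) (cw_pos α ρ n).le).trans ?_
      refine cw_mul_le ?_
      rw [one_mul]
      exact (hφ n).trans (le_rpow n)) g
  have h2 := h1.map (BoundedContinuousFunction.evalCLM ℝ h) (ContinuousLinearMap.continuous _)
  have h3 := h2.map (evL ρ x) (ContinuousLinearMap.continuous _)
  refine Eq.mp ?_ h3
  congr 1
  funext n
  change ev ρ x (cw α ρ n • waveK (ρ := ρ) (n + 2) (φ n) (g n) h) = _
  rw [map_smul, waveK_apply, ev_wave, Complex.real_smul]
  push_cast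
  rfl

/-- A bounded continuous function of modulus at most `C`. -/
def bcf {E : Type*} [NormedAddCommGroup E] (f : ℝ → E) (hf : Continuous f) (C : ℝ)
    (hC : ∀ h, ‖f h‖ ≤ C) : BoundedContinuousFunction ℝ E :=
  BoundedContinuousFunction.ofNormedAddCommGroup f hf C hC

theorem bcf_apply {E : Type*} [NormedAddCommGroup E] (f : ℝ → E) (hf : Continuous f) (C : ℝ)
    (hC : ∀ h, ‖f h‖ ≤ C) (h : ℝ) : bcf f hf C hC h = f h := rfl

theorem norm_bcf_le {E : Type*} [NormedAddCommGroup E] (f : ℝ → E) (hf : Continuous f) (C : ℝ)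
    (hC : ∀ h, ‖f h‖ ≤ C) (h0 : 0 ≤ C) : ‖bcf f hf C hC‖ ≤ C :=
  BoundedContinuousFunction.norm_ofNormedAddCommGroup_le _ h0 hC

theorem norm_exp_neg (n : ℂ) (hn : n.im = 0) (h : ℝ) :
    ‖Complex.exp (-(n * h * Complex.I))‖ = 1 := by
  have e : n = (n.re : ℂ) := Complex.ext rfl (by simp [hn])
  have := Complex.norm_exp_ofReal_mul_I (-(n.re * h))
  rw [← this, e]; congr 2; push_cast; simp

theorem norm_nat_add_two_mul_I (n : ℕ) : ‖((n : ℂ) + 2) * Complex.I‖ = (n : ℝ) + 2 := by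
  rw [norm_mul, Complex.norm_I, mul_one]
  have : ((n : ℂ) + 2) = ((n + 2 : ℕ) : ℂ) := by push_cast; rfl
  rw [this, Complex.norm_natCast]; push_cast; rfl

/-- The translation factors `e^{-inh}`. -/
def phiShift (n : ℕ) : BoundedContinuousFunction ℝ ℂ :=
  bcf (fun h => Complex.exp (-(((n : ℂ) + 2) * h * Complex.I))) (by fun_prop) 1 fun h =>
    (norm_exp_neg _ (by simp) h).le

theorem norm_phiShift_le (n : ℕ) : ‖phiShift n‖ ≤ 1 := norm_bcf_le _ _ _ _ zero_le_one

/-- The factors of the difference quotient `(f(x) - f(x-h)) / (2 sin (h/2))`. -/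
def phiDiff (n : ℕ) : BoundedContinuousFunction ℝ ℂ :=
  bcf (fun h => Complex.I * Complex.exp (-(1 / 2 * h * Complex.I)) *
    ∑ k ∈ Finset.range (n + 2), Complex.exp (-((k : ℂ) * h * Complex.I))) (by fun_prop)
    (n + 2) fun h => by
      rw [norm_mul, norm_mul, Complex.norm_I, norm_exp_neg (1 / 2) (by norm_num), one_mul, one_mul]
      refine (norm_sum_le _ _).trans ?_
      have : ∀ k : ℕ, ‖Complex.exp (-((k : ℂ) * h * Complex.I))‖ = 1 :=
        fun k => norm_exp_neg (k : ℂ) (by simp) h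
      simp [this]

theorem norm_phiDiff_le (n : ℕ) : ‖phiDiff n‖ ≤ (n : ℝ) + 2 := norm_bcf_le _ _ _ _ (by positivity)

/-- With q = e^{-ih}, one has 1 - q = chord · i e^{-ih/2}, and the rest of 1 - q^{n+2} is a
geometric sum. Writing the quotient as that sum makes it continuous through the zeros of the chord
and bounded by n+2. -/
theorem chord_mul_phiDiff (n : ℕ) (h : ℝ) :
    (chord h : ℂ) * phiDiff n h = 1 - phiShift n h := by
  rw [phiDiff, phiShift, bcf_apply, bcf_apply]
  have h1 : (chord h : ℂ) * (Complex.I * Complex.exp (-(1 / 2 * h * Complex.I))) =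
      1 - Complex.exp (-(h * Complex.I)) := by
    have : (chord h : ℂ) = 2 * Complex.sin (h / 2) := by rw [chord]; push_cast; rfl
    rw [this, Complex.sin]
    have e1 : Complex.exp (-(h / 2 : ℂ) * Complex.I) * Complex.exp (-(1 / 2 * h * Complex.I)) =
        Complex.exp (-(h * Complex.I)) := by rw [← Complex.exp_add]; congr 1; ring
    have e2 : Complex.exp ((h / 2 : ℂ) * Complex.I) * Complex.exp (-(1 / 2 * h * Complex.I)) =
        1 := by
      rw [← Complex.exp_add, show (h / 2 : ℂ) * Complex.I + -(1 / 2 * h * Complex.I) = 0 by ring,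
        Complex.exp_zero]
    linear_combination (-1 : ℂ) * e1 + e2 + (Complex.exp (-(h / 2 : ℂ) * Complex.I) *
      Complex.exp (-(1 / 2 * h * Complex.I)) - Complex.exp ((h / 2 : ℂ) * Complex.I) *
      Complex.exp (-(1 / 2 * h * Complex.I))) * (Complex.I_sq)
  rw [← mul_assoc, h1]
  have h2 : ∀ k : ℕ, Complex.exp (-((k : ℂ) * h * Complex.I)) = Complex.exp (-(h * Complex.I)) ^ k := by
    intro k; rw [← Complex.exp_nat_mul]; congr 1; ring
  simp only [h2]
  have h3 : Complex.exp (-(((n : ℂ) + 2) * h * Complex.I)) =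
      Complex.exp (-(h * Complex.I)) ^ (n + 2) := by rw [← h2]; congr 1; push_cast; ring
  rw [h3]
  have := mul_neg_geom_sum (Complex.exp (-(h * Complex.I))) (n + 2)
  exact this

variable (α ρ)

/-- The operator `f ↦ f(x)`. -/
def opF : Summ ℕ →L[ℝ] Kern ρ := liftK (α := α) (fun _ => 1) fun n => by
  rw [norm_one]; linarith [n.cast_nonneg (α := ℝ)]

/-- The operator `f ↦ f'(x)`. -/
def opD : Summ ℕ →L[ℝ] Kern ρ :=
  liftK (α := α) (fun n => (((n : ℂ) + 2) * Complex.I) • 1) fun n => by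
    rw [norm_smul, norm_nat_add_two_mul_I, norm_one, mul_one]

/-- The operator `f ↦ f(x - h)`. -/
def opFh : Summ ℕ →L[ℝ] Kern ρ := liftK (α := α) phiShift fun n =>
  (norm_phiShift_le n).trans (by linarith [n.cast_nonneg (α := ℝ)])

/-- The operator `f ↦ f'(x - h)`. -/
def opDh : Summ ℕ →L[ℝ] Kern ρ :=
  liftK (α := α) (fun n => (((n : ℂ) + 2) * Complex.I) • phiShift n) fun n => by
    rw [norm_smul, norm_nat_add_two_mul_I]
    exact mul_le_of_le_one_right (by positivity) (norm_phiShift_le n)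

/-- The operator `f ↦ (f(x) - f(x - h)) / (2 sin (h/2))`. -/
def opQ : Summ ℕ →L[ℝ] Kern ρ := liftK (α := α) phiDiff norm_phiDiff_le

/-- The function with coordinates `g`. -/
def prof (g : Summ ℕ) (x : ℝ) : ℝ :=
  ∑' n : ℕ, cw α ρ n * (g n * Complex.exp (((n : ℂ) + 2) * x * Complex.I)).re

/-- The derivative of `prof g`. -/
def dprof (g : Summ ℕ) (x : ℝ) : ℝ :=
  ∑' n : ℕ, cw α ρ n * (g n * (((n : ℂ) + 2) * Complex.I) *
    Complex.exp (((n : ℂ) + 2) * x * Complex.I)).re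

variable {α ρ}

theorem hasSum_ofReal_unique {f : ℕ → ℝ} {z : ℂ} (h : HasSum (fun n => (f n : ℂ)) z) :
    z = ((∑' n, f n : ℝ) : ℂ) := by
  rw [Complex.ofReal_tsum]; exact h.tsum_eq.symm

theorem ev_opF (g : Summ ℕ) (h x : ℝ) : ev ρ x (opF α ρ g h) = prof α ρ g x := by
  have := hasSum_ofReal_unique (hasSum_liftK (α := α) (ρ := ρ) (fun _ => 1) (fun n => by
    rw [norm_one]; linarith [n.cast_nonneg (α := ℝ)]) g h x)
  refine this.trans ?_
  rw [prof]
  congr 2; funext n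
  change cw α ρ n * (g n * 1 * _).re = _
  rw [mul_one]

theorem ev_opD (g : Summ ℕ) (h x : ℝ) : ev ρ x (opD α ρ g h) = dprof α ρ g x := by
  have := hasSum_ofReal_unique (hasSum_liftK (α := α) (ρ := ρ)
    (fun n => (((n : ℂ) + 2) * Complex.I) • 1) (fun n => by
    rw [norm_smul, norm_nat_add_two_mul_I, norm_one, mul_one]) g h x)
  refine this.trans ?_
  rw [dprof]
  simp

theorem exp_shift (n : ℕ) (h x : ℝ) :
    Complex.exp (-(((n : ℂ) + 2) * h * Complex.I)) * Complex.exp (((n : ℂ) + 2) * x * Complex.I) =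
    Complex.exp (((n : ℂ) + 2) * ((x - h : ℝ) : ℂ) * Complex.I) := by
  rw [← Complex.exp_add]; congr 1; push_cast; ring

theorem ev_opFh (g : Summ ℕ) (h x : ℝ) : ev ρ x (opFh α ρ g h) = prof α ρ g (x - h) := by
  have := hasSum_ofReal_unique (hasSum_liftK (α := α) (ρ := ρ) phiShift (fun n =>
    (norm_phiShift_le n).trans (by linarith [n.cast_nonneg (α := ℝ)])) g h x)
  refine this.trans ?_
  rw [prof]
  congr 2; funext n
  rw [mul_assoc, phiShift, bcf_apply, exp_shift]

theorem ev_opDh (g : Summ ℕ) (h x : ℝ) : ev ρ x (opDh α ρ g h) = dprof α ρ g (x - h) := by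
  have := hasSum_ofReal_unique (hasSum_liftK (α := α) (ρ := ρ)
    (fun n => (((n : ℂ) + 2) * Complex.I) • phiShift n) (fun n => by
    rw [norm_smul, norm_nat_add_two_mul_I]
    exact mul_le_of_le_one_right (by positivity) (norm_phiShift_le n)) g h x)
  refine this.trans ?_
  rw [dprof]
  congr 2; funext n
  change cw α ρ n * (g n * ((((n : ℂ) + 2) * Complex.I) * phiShift n h) * _).re = _
  rw [← mul_assoc (g n), mul_assoc _ (phiShift n h), phiShift, bcf_apply, exp_shift]

theorem chord_mul_ev_opQ (g : Summ ℕ) (h x : ℝ) :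
    (chord h : ℂ) * ev ρ x (opQ α ρ g h) = ((prof α ρ g x - prof α ρ g (x - h) : ℝ) : ℂ) := by
  have h1 := (hasSum_liftK (α := α) (ρ := ρ) phiDiff norm_phiDiff_le g h x).mul_left (chord h : ℂ)
  have h2 := hasSum_liftK (α := α) (ρ := ρ) (fun _ => 1) (fun n => by
    rw [norm_one]; linarith [n.cast_nonneg (α := ℝ)]) g h x
  have h3 := hasSum_liftK (α := α) (ρ := ρ) phiShift (fun n =>
    (norm_phiShift_le n).trans (by linarith [n.cast_nonneg (α := ℝ)])) g h x
  have h4 := h2.sub h3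
  have e : ev ρ x (liftK (α := α) (fun _ => 1) (fun n => by
    rw [norm_one]; linarith [n.cast_nonneg (α := ℝ)]) g h) - ev ρ x (liftK (α := α) phiShift (fun n =>
    (norm_phiShift_le n).trans (by linarith [n.cast_nonneg (α := ℝ)])) g h) =
    ((prof α ρ g x - prof α ρ g (x - h) : ℝ) : ℂ) := by
    have a1 := ev_opF (α := α) (ρ := ρ) g h x
    have a2 := ev_opFh (α := α) (ρ := ρ) g h x
    push_cast
    rw [← a1, ← a2]; rfl
  rw [e] at h4
  refine h1.unique (Eq.mp ?_ h4)
  refine congrArg (fun F : ℕ → ℂ => HasSum F _) ?_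
  funext n
  symm
  rw [← Complex.ofReal_sub, ← Complex.ofReal_mul, ← mul_sub, ← Complex.sub_re, ← sub_mul, ← mul_sub]
  congr 1
  rw [show (1 : BoundedContinuousFunction ℝ ℂ) h = 1 from rfl, ← chord_mul_phiDiff, mul_left_comm]
  congr 1
  rw [← Complex.re_ofReal_mul]
  congr 1; ring

theorem exists_opQ_real (g : Summ ℕ) (h x : ℝ) : ∃ q : ℝ, ev ρ x (opQ α ρ g h) = q :=
  ⟨_, hasSum_ofReal_unique (hasSum_liftK (α := α) (ρ := ρ) phiDiff norm_phiDiff_le g h x)⟩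

/-- Since α ≥ 1, one derivative of a profile still has an absolutely convergent Fourier series, for
every ρ ≥ 1. -/
theorem summable_cw_mul (g : Summ ℕ) : Summable fun n : ℕ => cw α ρ n * (((n : ℝ) + 2) * ‖g n‖) := by
  refine Summable.of_nonneg_of_le (fun n => mul_nonneg (cw_pos α ρ n).le (by positivity))
    (fun n => ?_) (Summ.hasSum_norm g).summable
  have h1 := cw_mul_le (α := α) (ρ := ρ) (n := n) (K := (n : ℝ) + 2) (C := 1)
    (by rw [one_mul]; exact le_rpow n)
  have h2 : cw α ρ n * ((n : ℝ) + 2) ≤ 1 := by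
    refine le_trans ?_ h1
    refine mul_le_mul_of_nonneg_left ?_ (cw_pos α ρ n).le
    exact le_mul_of_one_le_left (by positivity) (one_le_pow₀ hρ.out)
  calc cw α ρ n * (((n : ℝ) + 2) * ‖g n‖) = cw α ρ n * ((n : ℝ) + 2) * ‖g n‖ := by ring
    _ ≤ 1 * ‖g n‖ := by gcongr
    _ = _ := one_mul _

theorem norm_exp_pos (n : ℕ) (x : ℝ) : ‖Complex.exp (((n : ℂ) + 2) * x * Complex.I)‖ = 1 := by
  have := Complex.norm_exp_ofReal_mul_I (((n : ℝ) + 2) * x)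
  rw [← this]; congr 2; push_cast; ring

theorem hasDerivAt_exp_mul (n : ℕ) (x : ℝ) :
    HasDerivAt (fun x : ℝ => Complex.exp (((n : ℂ) + 2) * x * Complex.I))
      ((((n : ℂ) + 2) * Complex.I) * Complex.exp (((n : ℂ) + 2) * x * Complex.I)) x := by
  have : HasDerivAt (fun x : ℝ => ((n : ℂ) + 2) * (x : ℂ) * Complex.I)
      (((n : ℂ) + 2) * Complex.I) x := by
    have := ((hasDerivAt_id x).ofReal_comp.const_mul ((n : ℂ) + 2)).mul_const Complex.I
    simpa using this
  exact this.cexp.congr_deriv (mul_comm _ _)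

theorem hasDerivAt_re_term (n : ℕ) (z : ℂ) (c x : ℝ) :
    HasDerivAt (fun x : ℝ => c * (z * Complex.exp (((n : ℂ) + 2) * x * Complex.I)).re)
      (c * (z * (((n : ℂ) + 2) * Complex.I) * Complex.exp (((n : ℂ) + 2) * x * Complex.I)).re) x := by
  have h1 := (hasDerivAt_exp_mul n x).const_mul z
  have h2 := (Complex.reCLM.hasFDerivAt.comp_hasDerivAt x h1).const_mul c
  refine h2.congr_deriv ?_
  simp only [Complex.reCLM_apply]
  congr 2; ring

theorem hasDerivAt_prof (g : Summ ℕ) (x : ℝ) : HasDerivAt (prof α ρ g) (dprof α ρ g x) x := by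
  refine hasDerivAt_tsum (summable_cw_mul (α := α) (ρ := ρ) g)
    (fun n y => hasDerivAt_re_term n (g n) (cw α ρ n) y) (fun n y => ?_) (y₀ := 0) ?_ x
  · rw [norm_mul, Real.norm_of_nonneg (cw_pos α ρ n).le]
    refine mul_le_mul_of_nonneg_left ((Complex.abs_re_le_norm _).trans ?_) (cw_pos α ρ n).le
    rw [norm_mul, norm_mul, norm_exp_pos, norm_nat_add_two_mul_I, mul_one, mul_comm]
  · refine Summable.of_norm_bounded (summable_cw_mul (α := α) (ρ := ρ) g) fun n => ?_
    rw [norm_mul, Real.norm_of_nonneg (cw_pos α ρ n).le]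
    refine mul_le_mul_of_nonneg_left ((Complex.abs_re_le_norm _).trans ?_) (cw_pos α ρ n).le
    rw [norm_mul, norm_exp_pos, mul_one]
    exact le_mul_of_one_le_left (norm_nonneg _) (by linarith [n.cast_nonneg (α := ℝ)])

theorem deriv_prof (g : Summ ℕ) : deriv (prof α ρ g) = dprof α ρ g :=
  funext fun x => (hasDerivAt_prof g x).deriv

theorem continuous_prof (g : Summ ℕ) : Continuous (prof α ρ g) :=
  continuous_iff_continuousAt.2 fun x => (hasDerivAt_prof g x).continuousAt

theorem continuous_dprof (g : Summ ℕ) : Continuous (dprof α ρ g) := by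
  have h : (fun x => ev ρ x (opD α ρ g 0)) = fun x => (dprof α ρ g x : ℂ) :=
    funext fun x => ev_opD g 0 x
  have h2 := continuous_ev (opD α ρ g 0)
  rw [h] at h2
  exact (Complex.continuous_re.comp h2).congr fun x => Complex.ofReal_re _

theorem exp_periodic_two_pi (n : ℕ) (x : ℝ) :
    Complex.exp (((n : ℂ) + 2) * ((x + 2 * Real.pi : ℝ) : ℂ) * Complex.I) =
      Complex.exp (((n : ℂ) + 2) * x * Complex.I) := by
  have : ((n : ℂ) + 2) * ((x + 2 * Real.pi : ℝ) : ℂ) * Complex.I =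
      ((n : ℂ) + 2) * x * Complex.I + ((n + 2 : ℕ) : ℂ) * (2 * Real.pi * Complex.I) := by
    push_cast; ring
  rw [this, Complex.exp_periodic.nat_mul (n + 2)]

theorem periodic_prof (g : Summ ℕ) : Function.Periodic (prof α ρ g) (2 * Real.pi) := fun x => by
  unfold prof; simp only [exp_periodic_two_pi]

theorem periodic_dprof (g : Summ ℕ) : Function.Periodic (dprof α ρ g) (2 * Real.pi) := fun x => by
  unfold dprof; simp only [exp_periodic_two_pi]

end

end

/-! ### Integration of kernels against weights, and the singular operator -/

noncomputable section

open MeasureTheory Wiener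

section

variable {ρ : ℝ} [hρ : Fact (1 ≤ ρ)]

/-- A scalar function of `h` as an element of the algebra of kernels. -/
def ker (φ : BoundedContinuousFunction ℝ ℝ) : Kern ρ :=
  (Algebra.linearMap ℝ (Wiener ρ)).mkContinuous 1 (fun r => by
    rw [Algebra.linearMap_apply, norm_algebraMap', one_mul]) |>.compLeftContinuousBounded ℝ φ

theorem ker_apply (φ : BoundedContinuousFunction ℝ ℝ) (h : ℝ) :
    ker (ρ := ρ) φ h = algebraMap ℝ (Wiener ρ) (φ h) := rfl

theorem ev_ker (φ : BoundedContinuousFunction ℝ ℝ) (h x : ℝ) :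
    ev ρ x (ker φ h) = (φ h : ℂ) := by
  rw [ker_apply, AlgHom.commutes]; rfl

theorem intervalIntegrable_smul_kern {κ : ℝ → ℝ}
    (hκ : IntervalIntegrable κ volume 0 (2 * Real.pi)) (G : Kern ρ) :
    IntervalIntegrable (fun h => κ h • G h) volume 0 (2 * Real.pi) := by
  rw [intervalIntegrable_iff] at hκ ⊢
  exact hκ.smul_continuousOn_of_subset G.continuous.continuousOn measurableSet_Ioc isCompact_uIcc
    Ioc_subset_Icc_self

/-- Integration over a period against a scalar weight. -/
def intK (κ : ℝ → ℝ) (hκ : IntervalIntegrable κ volume 0 (2 * Real.pi)) :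
    Kern ρ →L[ℝ] Wiener ρ :=
  LinearMap.mkContinuous
    { toFun := fun G => ∫ h in (0 : ℝ)..(2 * Real.pi), κ h • G h
      map_add' := fun G G' => by
        rw [← intervalIntegral.integral_add (intervalIntegrable_smul_kern hκ G)
          (intervalIntegrable_smul_kern hκ G')]
        refine intervalIntegral.integral_congr fun h _ => ?_
        exact smul_add _ _ _
      map_smul' := fun c G => by
        rw [RingHom.id_apply, ← intervalIntegral.integral_smul]
        refine intervalIntegral.integral_congr fun h _ => ?_
        change κ h • (c • G h) = c • (κ h • G h)
        exact smul_comm _ _ _ } (∫ h in (0 : ℝ)..(2 * Real.pi), ‖κ h‖) fun G => by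
    refine (intervalIntegral.norm_integral_le_of_norm_le (by positivity)
      (g := fun h => ‖κ h‖ * ‖G‖) (Eventually.of_forall fun h _ => ?_) (hκ.norm.mul_const _)).trans
      (le_of_eq ?_)
    · rw [norm_smul]
      exact mul_le_mul_of_nonneg_left (G.norm_coe_le_norm h) (norm_nonneg _)
    · rw [intervalIntegral.integral_mul_const]

theorem intK_apply (κ : ℝ → ℝ) (hκ : IntervalIntegrable κ volume 0 (2 * Real.pi)) (G : Kern ρ) :
    intK κ hκ G = ∫ h in (0 : ℝ)..(2 * Real.pi), κ h • G h := rfl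

theorem ev_intervalIntegral {F : ℝ → Wiener ρ}
    (hF : IntervalIntegrable F volume 0 (2 * Real.pi)) (x : ℝ) :
    ev ρ x (∫ h in (0 : ℝ)..(2 * Real.pi), F h) = ∫ h in (0 : ℝ)..(2 * Real.pi), ev ρ x (F h) :=
  ((evL ρ x).intervalIntegral_comp_comm hF).symm

theorem ev_intK (κ : ℝ → ℝ) (hκ : IntervalIntegrable κ volume 0 (2 * Real.pi)) (G : Kern ρ)
    (x : ℝ) : ev ρ x (intK κ hκ G) = ∫ h in (0 : ℝ)..(2 * Real.pi), (κ h : ℂ) * ev ρ x (G h) := by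
  rw [intK_apply, ev_intervalIntegral (intervalIntegrable_smul_kern hκ G)]
  refine intervalIntegral.integral_congr fun h _ => ?_
  rw [map_smul, Complex.real_smul]

theorem ev_intK_real {κ : ℝ → ℝ} (hκ : IntervalIntegrable κ volume 0 (2 * Real.pi)) {G : Kern ρ}
    {x : ℝ} {r : ℝ → ℝ} (hr : ∀ h ∈ Ioo 0 (2 * Real.pi), ev ρ x (G h) = r h) :
    ev ρ x (intK κ hκ G) = ((∫ h in (0 : ℝ)..(2 * Real.pi), κ h * r h : ℝ) : ℂ) := by
  rw [ev_intK, ← intervalIntegral.integral_ofReal]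
  refine integral_congr_Ioo (by positivity) fun h hh => ?_
  rw [hr h hh]; push_cast; rfl

theorem continuous_ev_kern (G : Kern ρ) (x : ℝ) : Continuous fun h => ev ρ x (G h) :=
  (evL ρ x).continuous.comp G.continuous

theorem intervalIntegrable_of_ev {κ : ℝ → ℝ} (hκ : IntervalIntegrable κ volume 0 (2 * Real.pi))
    {G : Kern ρ} {x : ℝ} {r : ℝ → ℝ} (hr : ∀ h ∈ Ioo 0 (2 * Real.pi), ev ρ x (G h) = r h) :
    IntervalIntegrable (fun h => κ h * r h) volume 0 (2 * Real.pi) := by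
  have h1 : IntervalIntegrable (fun h => κ h * (ev ρ x (G h)).re) volume 0 (2 * Real.pi) :=
    hκ.mul_continuousOn (Complex.continuous_re.comp (continuous_ev_kern G x)).continuousOn
  rw [intervalIntegrable_iff_integrableOn_Ioo_of_le (by positivity)] at h1 ⊢
  refine h1.congr_fun (fun h hh => ?_) measurableSet_Ioo
  simp only [hr h hh, Complex.ofReal_re]

/-- A weight depending on h alone acts on each mode by a scalar, the integral of the weight against
the amplitude. This makes the linearisation diagonal. -/
theorem intK_ker_mul_waveK (κ : ℝ → ℝ) (hκ : IntervalIntegrable κ volume 0 (2 * Real.pi))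
    (φ : BoundedContinuousFunction ℝ ℝ) (m : ℕ) (ψ : BoundedContinuousFunction ℝ ℂ) (z : ℂ) :
    intK (ρ := ρ) κ hκ (ker φ * waveK m ψ z) =
      wave m (z * ∫ h in (0 : ℝ)..(2 * Real.pi), ((κ h * φ h : ℝ) : ℂ) * ψ h) := by
  rw [intK_apply, ← intervalIntegral.integral_const_mul]
  have hi : IntervalIntegrable (fun h => z * (((κ h * φ h : ℝ) : ℂ) * ψ h)) volume 0
      (2 * Real.pi) := by
    have h1 : IntervalIntegrable (fun h => κ h * φ h) volume 0 (2 * Real.pi) :=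
      hκ.mul_continuousOn φ.continuous.continuousOn
    have h2 : IntervalIntegrable (fun h => ((κ h * φ h : ℝ) : ℂ)) volume 0 (2 * Real.pi) :=
      ⟨h1.1.ofReal, h1.2.ofReal⟩
    exact (h2.mul_continuousOn ψ.continuous.continuousOn).const_mul z
  rw [← (wave (ρ := ρ) m).intervalIntegral_comp_comm hi]
  refine intervalIntegral.integral_congr fun h _ => ?_
  change κ h • (ker (ρ := ρ) φ h * waveK (ρ := ρ) m ψ z h) = wave m (z * (((κ h * φ h : ℝ) : ℂ) * ψ h))
  rw [ker_apply, waveK_apply, Algebra.algebraMap_eq_smul_one, smul_mul_assoc, one_mul, smul_smul,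
    ← map_smul, Complex.real_smul]
  congr 1; ring

end

section

variable (α ρ : ℝ) [hα : Fact (α ∈ Ioo (1 : ℝ) 2)] [hρ : Fact (1 ≤ ρ)]

/-- The amplitude of the singular difference quotient of the derivative. -/
def singAmp (n : ℕ) (h : ℝ) : ℂ :=
  (((n : ℂ) + 2) * Complex.I) * ((1 - phiShift n h) * (chord h ^ (-α) : ℝ))

variable {α ρ}

theorem phiShift_eq (n : ℕ) (h : ℝ) :
    phiShift n h = Complex.exp (-(((n + 2 : ℕ) : ℂ) * h * Complex.I)) := by
  rw [phiShift, bcf_apply]; push_cast; rfl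

theorem intervalIntegrable_singAmp (n : ℕ) :
    IntervalIntegrable (singAmp α n) volume 0 (2 * Real.pi) := by
  have := (intervalIntegrable_one_sub_exp hα.out (n + 2)).const_mul (((n : ℂ) + 2) * Complex.I)
  simp only [← phiShift_eq] at this
  exact this

theorem norm_singAmp (n : ℕ) {h : ℝ} (hh : h ∈ Ioo 0 (2 * Real.pi)) :
    ‖singAmp α n h‖ = ((n : ℝ) + 2) * diffKernel α (n + 2) h := by
  rw [singAmp, norm_mul, norm_nat_add_two_mul_I, norm_mul, Complex.norm_real,
    Real.norm_of_nonneg (Real.rpow_nonneg (chord_pos hh).le _), diffKernel, phiShift_eq]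

variable (α) in
/-- The constant in the bound for the singular operator. -/
def singBound : ℝ := (exists_integral_diffKernel_le hα.out).choose

/-- The derivative contributes n and the integral of the difference quotient contributes n^{α-1}.
The total order α is exactly what the normalisation of the profiles compensates. -/
theorem integral_norm_singAmp_le (n : ℕ) :
    ∫ h in (0 : ℝ)..(2 * Real.pi), ‖singAmp α n h‖ ≤ singBound α * ((n : ℝ) + 2) ^ α := by
  have h1 := (exists_integral_diffKernel_le hα.out).choose_spec.2 (n + 2) (by omega)
  rw [integral_congr_Ioo (by positivity) fun h hh => norm_singAmp n hh,
    intervalIntegral.integral_const_mul]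
  have h2 : (((n + 2 : ℕ) : ℝ)) = (n : ℝ) + 2 := by push_cast; rfl
  rw [h2] at h1
  have h3 : ((n : ℝ) + 2) ^ α = ((n : ℝ) + 2) * ((n : ℝ) + 2) ^ (α - 1) := by
    rw [mul_comm, ← Real.rpow_add_one (by positivity)]; congr 1; ring
  rw [h3]
  calc _ ≤ ((n : ℝ) + 2) * (singBound α * ((n : ℝ) + 2) ^ (α - 1)) :=
        mul_le_mul_of_nonneg_left h1 (by positivity)
    _ = _ := by ring

theorem intervalIntegrable_singIntegrand (n : ℕ) (z : ℂ) (G : Kern ρ) :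
    IntervalIntegrable (fun h => G h * wave (ρ := ρ) (n + 2) (z * singAmp α n h)) volume 0
      (2 * Real.pi) := by
  refine IntervalIntegrable.continuousOn_mul ?_ G.continuous.continuousOn
  have h1 := (intervalIntegrable_singAmp (α := α) n).const_mul z
  exact ⟨(wave (ρ := ρ) (n + 2)).integrable_comp h1.1, (wave (ρ := ρ) (n + 2)).integrable_comp h1.2⟩

variable (α ρ) in
/-- The contribution of a single mode to the singular operator. -/
def singTerm (n : ℕ) : ℂ →L[ℝ] Kern ρ →L[ℝ] Wiener ρ :=
  LinearMap.mkContinuous₂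
    (LinearMap.mk₂ ℝ (fun z G => ∫ h in (0 : ℝ)..(2 * Real.pi),
        G h * wave (ρ := ρ) (n + 2) (z * singAmp α n h))
      (fun z z' G => by
        rw [← intervalIntegral.integral_add (intervalIntegrable_singIntegrand n z G)
          (intervalIntegrable_singIntegrand n z' G)]
        refine intervalIntegral.integral_congr fun h _ => ?_
        rw [add_mul, map_add, mul_add])
      (fun c z G => by
        rw [← intervalIntegral.integral_smul]
        refine intervalIntegral.integral_congr fun h _ => ?_
        rw [smul_mul_assoc, map_smul, mul_smul_comm])
      (fun z G G' => by
        rw [← intervalIntegral.integral_add (intervalIntegrable_singIntegrand n z G)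
          (intervalIntegrable_singIntegrand n z G')]
        refine intervalIntegral.integral_congr fun h _ => ?_
        exact add_mul _ _ _)
      (fun c z G => by
        rw [← intervalIntegral.integral_smul]
        refine intervalIntegral.integral_congr fun h _ => ?_
        change (c • G h) * wave (ρ := ρ) (n + 2) (z * singAmp α n h) =
          c • (G h * wave (ρ := ρ) (n + 2) (z * singAmp α n h))
        exact smul_mul_assoc _ _ _))
    (ρ ^ (n + 2) * ∫ h in (0 : ℝ)..(2 * Real.pi), ‖singAmp α n h‖) fun z G => by
    have h0 : 0 ≤ ρ ^ (n + 2) := pow_nonneg (zero_le_one.trans hρ.out) _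
    have hb : ∀ h, ‖G h * wave (ρ := ρ) (n + 2) (z * singAmp α n h)‖ ≤
        ρ ^ (n + 2) * ‖z‖ * ‖G‖ * ‖singAmp α n h‖ := by
      intro h
      have h1 := (wave (ρ := ρ) (n + 2)).le_of_opNorm_le (norm_wave_le (n + 2)) (z * singAmp α n h)
      rw [norm_mul] at h1
      have h2 := (norm_mul_le (G h) (wave (ρ := ρ) (n + 2) (z * singAmp α n h))).trans
        (mul_le_mul (G.norm_coe_le_norm h) h1 (norm_nonneg _) (norm_nonneg _))
      refine h2.trans (le_of_eq ?_)
      ring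
    refine (intervalIntegral.norm_integral_le_of_norm_le (by positivity)
      (g := fun h => ρ ^ (n + 2) * ‖z‖ * ‖G‖ * ‖singAmp α n h‖)
      (Eventually.of_forall fun h _ => hb h)
      ((intervalIntegrable_singAmp n).norm.const_mul _)).trans (le_of_eq ?_)
    rw [intervalIntegral.integral_const_mul]
    ring

theorem singTerm_apply (n : ℕ) (z : ℂ) (G : Kern ρ) : singTerm α ρ n z G =
    ∫ h in (0 : ℝ)..(2 * Real.pi), G h * wave (ρ := ρ) (n + 2) (z * singAmp α n h) := rfl

theorem norm_singTerm_le (n : ℕ) (z : ℂ) (G : Kern ρ) :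
    ‖cw α ρ n • singTerm α ρ n z G‖ ≤ ‖z‖ * (singBound α * ‖G‖) := by
  have h0 : 0 ≤ ρ ^ (n + 2) := pow_nonneg (zero_le_one.trans hρ.out) _
  have h1 : ‖singTerm α ρ n‖ ≤ ρ ^ (n + 2) * ∫ h in (0 : ℝ)..(2 * Real.pi), ‖singAmp α n h‖ :=
    LinearMap.mkContinuous₂_norm_le _ (mul_nonneg h0
      (intervalIntegral.integral_nonneg (by positivity) fun h _ => norm_nonneg _)) _
  have h2 := (singTerm α ρ n).le_of_opNorm₂_le_of_le h1 le_rfl le_rfl (x := z) (y := G)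
  rw [norm_smul, Real.norm_of_nonneg (cw_pos α ρ n).le]
  refine (mul_le_mul_of_nonneg_left h2 (cw_pos α ρ n).le).trans ?_
  have h3 := cw_mul_le (α := α) (ρ := ρ) (integral_norm_singAmp_le (α := α) n)
  have h4 := mul_le_mul_of_nonneg_right h3 (mul_nonneg (norm_nonneg z) (norm_nonneg G))
  refine (le_of_eq ?_).trans (h4.trans (le_of_eq ?_)) <;> ring

theorem summable_singTerm (g : Summ ℕ) (G : Kern ρ) :
    Summable fun n => cw α ρ n • singTerm α ρ n (g n) G :=
  Summable.of_norm_bounded ((Summ.hasSum_norm g).summable.mul_right _)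
    fun n => norm_singTerm_le n (g n) G

variable (α ρ) in
/-- The operator `G ↦ ∫ G(x, h) (f'(x) - f'(x - h)) |2 sin (h/2)|^{-α} dh`. -/
def opS : Summ ℕ →L[ℝ] Kern ρ →L[ℝ] Wiener ρ :=
  LinearMap.mkContinuous₂
    (LinearMap.mk₂ ℝ (fun g G => ∑' n, cw α ρ n • singTerm α ρ n (g n) G)
      (fun g g' G => by
        rw [← (summable_singTerm g G).tsum_add (summable_singTerm g' G)]
        refine tsum_congr fun n => ?_
        change cw α ρ n • singTerm α ρ n (g n + g' n) G = _
        rw [map_add, add_apply, smul_add])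
      (fun c g G => by
        rw [← (summable_singTerm g G).tsum_const_smul]
        refine tsum_congr fun n => ?_
        change cw α ρ n • singTerm α ρ n (c • g n) G = _
        rw [map_smul, smul_apply, smul_comm])
      (fun g G G' => by
        rw [← (summable_singTerm g G).tsum_add (summable_singTerm g G')]
        refine tsum_congr fun n => ?_
        rw [map_add, smul_add])
      (fun c g G => by
        rw [← (summable_singTerm g G).tsum_const_smul]
        refine tsum_congr fun n => ?_
        rw [map_smul, smul_comm]))
    (singBound α) fun g G => by
      refine (tsum_of_norm_bounded ((Summ.hasSum_norm g).mul_right _)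
        fun n => norm_singTerm_le n (g n) G).trans (le_of_eq ?_)
      ring

theorem hasSum_opS (g : Summ ℕ) (G : Kern ρ) :
    HasSum (fun n => cw α ρ n • singTerm α ρ n (g n) G) (opS α ρ g G) :=
  (summable_singTerm g G).hasSum

/-- The `n`-th term of the singular difference quotient. -/
theorem hasSum_singAmp (g : Summ ℕ) (x h : ℝ) :
    HasSum (fun n : ℕ => cw α ρ n * (g n * singAmp α n h *
      Complex.exp (((n : ℂ) + 2) * x * Complex.I)).re)
      ((dprof α ρ g x - dprof α ρ g (x - h)) * chord h ^ (-α)) := by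
  have hs : ∀ y : ℝ, HasSum (fun n : ℕ => cw α ρ n * (g n * (((n : ℂ) + 2) * Complex.I) *
      Complex.exp (((n : ℂ) + 2) * y * Complex.I)).re) (dprof α ρ g y) := by
    intro y
    refine Summable.hasSum (Summable.of_norm_bounded (summable_cw_mul (α := α) (ρ := ρ) g)
      fun n => ?_)
    rw [norm_mul, Real.norm_of_nonneg (cw_pos α ρ n).le]
    refine mul_le_mul_of_nonneg_left ((Complex.abs_re_le_norm _).trans ?_) (cw_pos α ρ n).le
    rw [norm_mul, norm_mul, norm_exp_pos, norm_nat_add_two_mul_I, mul_one, mul_comm]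
  have h1 := ((hs x).sub (hs (x - h))).mul_right (chord h ^ (-α))
  refine Eq.mp ?_ h1
  refine congrArg (fun F : ℕ → ℝ => HasSum F _) ?_
  funext n
  rw [← exp_shift n h x, ← mul_sub, ← Complex.sub_re, mul_assoc, ← Complex.re_mul_ofReal, singAmp,
    phiShift, bcf_apply]
  congr 2; ring

theorem ev_singTerm (n : ℕ) (z : ℂ) (G : Kern ρ) (x : ℝ) :
    ev ρ x (singTerm α ρ n z G) = ∫ h in (0 : ℝ)..(2 * Real.pi), ev ρ x (G h) *
      ((z * singAmp α n h * Complex.exp (((n : ℂ) + 2) * x * Complex.I)).re : ℝ) := by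
  rw [singTerm_apply, ev_intervalIntegral (intervalIntegrable_singIntegrand n z G)]
  refine intervalIntegral.integral_congr fun h _ => ?_
  rw [map_mul, ev_wave]
  push_cast; rfl

/-- The kernel chord^{-α} is not integrable and the difference of derivatives is not estimated
pointwise. Instead the L¹ norms of the individual modes are summable against ‖g‖, which gives
integrability and the interchange of sum and integral together. -/
theorem singTerm_integrals (g : Summ ℕ) (G : Kern ρ) (x : ℝ) :
    IntervalIntegrable (fun h => ev ρ x (G h) *
      (((dprof α ρ g x - dprof α ρ g (x - h)) * chord h ^ (-α) : ℝ) : ℂ)) volume 0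
      (2 * Real.pi) ∧
    ev ρ x (opS α ρ g G) = ∫ h in (0 : ℝ)..(2 * Real.pi), ev ρ x (G h) *
      (((dprof α ρ g x - dprof α ρ g (x - h)) * chord h ^ (-α) : ℝ) : ℂ) := by
  set F : ℕ → ℝ → ℂ := fun n h => ev ρ x (G h) * ((cw α ρ n * (g n * singAmp α n h *
      Complex.exp (((n : ℂ) + 2) * x * Complex.I)).re : ℝ) : ℂ) with hFdef
  have hsum : ∀ h, HasSum (fun n => F n h) (ev ρ x (G h) *
      (((dprof α ρ g x - dprof α ρ g (x - h)) * chord h ^ (-α) : ℝ) : ℂ)) := fun h =>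
    ((hasSum_singAmp (α := α) (ρ := ρ) g x h).map Complex.ofRealCLM
      Complex.ofRealCLM.continuous).mul_left _
  have hFi : ∀ n, IntervalIntegrable (F n) volume 0 (2 * Real.pi) := by
    intro n
    have h1 := ((intervalIntegrable_singAmp (α := α) n).const_mul (g n)).mul_const
      (Complex.exp (((n : ℂ) + 2) * x * Complex.I))
    have h2 : IntervalIntegrable (fun h => ((cw α ρ n * (g n * singAmp α n h *
      Complex.exp (((n : ℂ) + 2) * x * Complex.I)).re : ℝ) : ℂ)) volume 0 (2 * Real.pi) :=
      ⟨(h1.1.re.const_mul _).ofReal, (h1.2.re.const_mul _).ofReal⟩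
    exact h2.continuousOn_mul (continuous_ev_kern G x).continuousOn
  have hFn : ∀ n h, ‖F n h‖ ≤ ‖G‖ * (cw α ρ n * ‖g n‖) * ‖singAmp α n h‖ := by
    intro n h
    have h1 : ‖ev ρ x (G h)‖ ≤ ‖G‖ :=
      ((evL ρ x).le_of_opNorm_le (norm_evL_le x) (G h)).trans (by
        rw [one_mul]; exact G.norm_coe_le_norm h)
    have h2 : ‖((cw α ρ n * (g n * singAmp α n h *
      Complex.exp (((n : ℂ) + 2) * x * Complex.I)).re : ℝ) : ℂ)‖ ≤
        cw α ρ n * (‖g n‖ * ‖singAmp α n h‖) := by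
      rw [Complex.norm_real, norm_mul, Real.norm_of_nonneg (cw_pos α ρ n).le]
      refine mul_le_mul_of_nonneg_left ((Complex.abs_re_le_norm _).trans ?_) (cw_pos α ρ n).le
      rw [norm_mul, norm_mul, norm_exp_pos, mul_one]
    rw [hFdef]
    refine (norm_mul_le _ _).trans ((mul_le_mul h1 h2 (norm_nonneg _) (norm_nonneg _)).trans
      (le_of_eq ?_))
    ring
  have hFs : Summable fun n => ∫ h in Ioc 0 (2 * Real.pi), ‖F n h‖ := by
    refine Summable.of_nonneg_of_le (fun n => integral_nonneg fun h => norm_nonneg _)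
      (fun n => ?_) ((Summ.hasSum_norm g).summable.mul_left (‖G‖ * singBound α))
    rw [← intervalIntegral.integral_of_le (by positivity)]
    have h1 := intervalIntegral.integral_mono_on (μ := volume) (by positivity : (0 : ℝ) ≤ 2 * Real.pi)
      (hFi n).norm ((intervalIntegrable_singAmp (α := α) n).norm.const_mul
        (‖G‖ * (cw α ρ n * ‖g n‖))) fun h _ => hFn n h
    rw [intervalIntegral.integral_const_mul] at h1
    refine h1.trans ?_
    have h2 := integral_norm_singAmp_le (α := α) n
    have h3 := cw_mul_le (α := α) (ρ := ρ) h2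
    have h4 : cw α ρ n * (∫ h in (0 : ℝ)..(2 * Real.pi), ‖singAmp α n h‖) ≤ singBound α := by
      refine le_trans (mul_le_mul_of_nonneg_left ?_ (cw_pos α ρ n).le) h3
      refine le_mul_of_one_le_left ?_ (one_le_pow₀ hρ.out)
      exact intervalIntegral.integral_nonneg (by positivity) fun h _ => norm_nonneg _
    calc ‖G‖ * (cw α ρ n * ‖g n‖) * ∫ h in (0 : ℝ)..(2 * Real.pi), ‖singAmp α n h‖
        = ‖G‖ * ‖g n‖ * (cw α ρ n * ∫ h in (0 : ℝ)..(2 * Real.pi), ‖singAmp α n h‖) := by ring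
      _ ≤ ‖G‖ * ‖g n‖ * singBound α := by gcongr
      _ = _ := by ring
  have hFi' : ∀ n, Integrable (F n) (volume.restrict (Ioc 0 (2 * Real.pi))) := fun n => by
    have := hFi n
    rwa [intervalIntegrable_iff_integrableOn_Ioc_of_le (by positivity)] at this
  have hm : AEStronglyMeasurable (fun h => ev ρ x (G h) *
      (((dprof α ρ g x - dprof α ρ g (x - h)) * chord h ^ (-α) : ℝ) : ℂ))
      (volume.restrict (Ioc 0 (2 * Real.pi))) := by
    rw [← restrict_Ioo_eq_restrict_Ioc]
    refine ContinuousOn.aestronglyMeasurable ?_ measurableSet_Ioo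
    refine ((continuous_ev_kern G x).continuousOn).mul
      (Complex.continuous_ofReal.comp_continuousOn (ContinuousOn.mul ?_ (continuousOn_chord_rpow _)))
    have := continuous_dprof (α := α) (ρ := ρ) g
    exact Continuous.continuousOn (by fun_prop)
  constructor
  · rw [intervalIntegrable_iff_integrableOn_Ioc_of_le (by positivity)]
    exact integrable_of_hasSum hFi' hFs hm (Eventually.of_forall hsum)
  · have h1 := hasSum_integral_of_summable_integral_norm hFi' hFs
    have h2 := (hasSum_opS (α := α) (ρ := ρ) g G).map (evL ρ x) (evL ρ x).continuous
    rw [intervalIntegral.integral_of_le (by positivity)]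
    have h3 : (fun h => ∑' n, F n h) = fun h => ev ρ x (G h) *
      (((dprof α ρ g x - dprof α ρ g (x - h)) * chord h ^ (-α) : ℝ) : ℂ) :=
      funext fun h => (hsum h).tsum_eq
    rw [h3] at h1
    refine h2.unique (Eq.mp ?_ h1)
    refine congrArg (fun F : ℕ → ℂ => HasSum F _) ?_
    funext n
    change _ = ev ρ x (cw α ρ n • singTerm α ρ n (g n) G)
    rw [map_smul, ev_singTerm, ← intervalIntegral.integral_smul,
      intervalIntegral.integral_of_le (by positivity)]
    refine integral_congr_ae (Eventually.of_forall fun h => ?_)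
    simp only [hFdef]
    rw [Complex.real_smul]
    push_cast
    ring

/-- As for regular weights, a factor depending only on h turns the singular operator into a
multiplier. -/
theorem singTerm_ker (φ : BoundedContinuousFunction ℝ ℝ) (n : ℕ) (z : ℂ) :
    singTerm α ρ n z (ker φ) =
      wave (n + 2) (z * ∫ h in (0 : ℝ)..(2 * Real.pi), (φ h : ℂ) * singAmp α n h) := by
  rw [singTerm_apply, ← intervalIntegral.integral_const_mul]
  have hi : IntervalIntegrable (fun h => z * ((φ h : ℂ) * singAmp α n h)) volume 0
      (2 * Real.pi) :=
    ((intervalIntegrable_singAmp n).continuousOn_mul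
      (Complex.continuous_ofReal.comp φ.continuous).continuousOn).const_mul z
  rw [← (wave (ρ := ρ) (n + 2)).intervalIntegral_comp_comm hi]
  refine intervalIntegral.integral_congr fun h _ => ?_
  rw [ker_apply, Algebra.algebraMap_eq_smul_one, smul_mul_assoc, one_mul, ← map_smul,
    Complex.real_smul]
  congr 1; ring

end

end

/-! ### The interactions of patches expanded in the algebra of kernels -/

noncomputable section

open MeasureTheory Wiener

/-- The cosine as a kernel. -/
def cosF : BoundedContinuousFunction ℝ ℝ := bcf Real.cos Real.continuous_cos 1 fun h => by
  rw [Real.norm_eq_abs]; exact Real.abs_cos_le_one h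

/-- The sine as a kernel. -/
def sinF : BoundedContinuousFunction ℝ ℝ := bcf Real.sin Real.continuous_sin 1 fun h => by
  rw [Real.norm_eq_abs]; exact Real.abs_sin_le_one h

/-- The kernel `cos (h / 2)`. -/
def cosHalf : BoundedContinuousFunction ℝ ℝ :=
  bcf (fun h => Real.cos (h / 2)) (by fun_prop) 1 fun h => by
    rw [Real.norm_eq_abs]; exact Real.abs_cos_le_one _

/-- The rotation `e^{-ih}` as a kernel. -/
def rotF : BoundedContinuousFunction ℝ ℂ :=
  bcf (fun h => Complex.exp (-(h * Complex.I))) (by fun_prop) 1 fun h => by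
    have := norm_exp_neg 1 (by simp) h
    rw [one_mul] at this
    exact this.le

section

variable {ρ : ℝ} [hρ : Fact (1 ≤ ρ)]

/-- Evaluation of a kernel at `(x, h)`. -/
def evK (x h : ℝ) : Kern ρ →ₐ[ℝ] ℂ :=
  (ev ρ x).comp
    { toFun := fun G => G h
      map_one' := rfl
      map_mul' := fun _ _ => rfl
      map_zero' := rfl
      map_add' := fun _ _ => rfl
      commutes' := fun _ => rfl }

theorem evK_apply (x h : ℝ) (G : Kern ρ) : evK x h G = ev ρ x (G h) := rfl

theorem norm_evK_le (x h : ℝ) (G : Kern ρ) : ‖evK x h G‖ ≤ ‖G‖ :=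
  ((evL ρ x).le_of_opNorm_le (norm_evL_le x) (G h)).trans (by
    rw [one_mul]; exact G.norm_coe_le_norm h)

theorem evK_smul (x h c : ℝ) (G : Kern ρ) : evK x h (c • G) = (c : ℂ) * evK x h G := by
  rw [map_smul, Complex.real_smul]

theorem evK_psi {α : ℝ} [hα : Fact (α ∈ Ioo (1 : ℝ) 2)] {x h : ℝ} {G : Kern ρ} (hG : ‖G‖ < 1)
    {t : ℝ} (ht : evK x h G = t) : |t| < 1 ∧ evK x h (psi α G) = (psi α t : ℝ) := by
  have h1 : |t| < 1 := by
    have := norm_evK_le x h G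
    rw [ht, Complex.norm_real, Real.norm_eq_abs] at this
    exact this.trans_lt hG
  exact ⟨h1, map_psi hα.out ((evL ρ x).comp (BoundedContinuousFunction.evalCLM ℝ h))
    (map_one (evK x h)) (map_mul (evK x h)) hG ht h1⟩

theorem evK_ker (φ : BoundedContinuousFunction ℝ ℝ) (x h : ℝ) :
    evK x h (ker (ρ := ρ) φ) = (φ h : ℂ) := ev_ker φ h x

theorem cosF_apply (h : ℝ) : cosF h = Real.cos h := rfl
theorem sinF_apply (h : ℝ) : sinF h = Real.sin h := rfl
theorem cosHalf_apply (h : ℝ) : cosHalf h = Real.cos (h / 2) := rfl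
theorem rotF_apply (h : ℝ) : rotF h = Complex.exp (-(h * Complex.I)) := rfl

theorem evK_waveK_one (z : ℂ) (x h : ℝ) : evK x h (waveK (ρ := ρ) 1 1 z) =
    ((z * Complex.exp (x * Complex.I)).re : ℝ) := by
  rw [evK_apply, waveK_apply, ev_wave]
  change (((z * 1 * _ : ℂ).re : ℝ) : ℂ) = _
  push_cast
  rw [mul_one, one_mul]

theorem evK_waveK_rot (z : ℂ) (x h : ℝ) : evK x h (waveK (ρ := ρ) 1 rotF z) =
    ((z * Complex.exp (((x - h : ℝ) : ℂ) * Complex.I)).re : ℝ) := by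
  rw [evK_apply, waveK_apply, ev_wave, rotF_apply, mul_assoc, ← Complex.exp_add]
  congr 5
  push_cast; ring

end

section

variable (α ρ : ℝ) [hα : Fact (α ∈ Ioo (1 : ℝ) 2)] [hρ : Fact (1 ≤ ρ)]

/-- The expansion of the squared chord of the boundary of a patch. -/
def selfBeta (η : ℝ) (g : Summ ℕ) : Kern ρ :=
  opF α ρ g + opFh α ρ g + η • (opF α ρ g * opFh α ρ g + opQ α ρ g * opQ α ρ g)

/-- The kernel `((1 + η β)^{-α/2} - 1) / (η β)`. -/
def selfP (η : ℝ) (g : Summ ℕ) : Kern ρ := psi α (η • selfBeta α ρ η g)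

/-- The kernel `(1 + η β)^{-α/2}`. -/
def selfB (η : ℝ) (g : Summ ℕ) : Kern ρ := 1 + η • (selfBeta α ρ η g * selfP α ρ η g)

/-- The kernel `R(x)`. -/
def radK (η : ℝ) (g : Summ ℕ) : Kern ρ := 1 + η • opF α ρ g

/-- The kernel `R(x - h)`. -/
def radKh (η : ℝ) (g : Summ ℕ) : Kern ρ := 1 + η • opFh α ρ g

/-- The regular kernel in the self-interaction. -/
def selfReg (η : ℝ) (g : Summ ℕ) : Kern ρ :=
  ker cosHalf * ((opF α ρ g + opFh α ρ g + η • (opF α ρ g * opFh α ρ g)) * selfB α ρ η g +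
      selfBeta α ρ η g * selfP α ρ η g +
      η • (opD α ρ g * opDh α ρ g * selfB α ρ η g)) +
    η • (ker cosF * opD α ρ g * opQ α ρ g * selfB α ρ η g)

/-- The self-interaction of a patch multiplied by `R`. -/
def selfH (η : ℝ) (g : Summ ℕ) : Wiener ρ :=
  intK (fun h => chord h ^ (1 - α)) (intervalIntegrable_chord_one_sub hα.out) (selfReg α ρ η g) -
    opS α ρ g (ker cosF * (radK α ρ η g * selfB α ρ η g))

/-- The difference quotient `(f(x) - f(x - h)) / (2 sin (h / 2))`. -/
def quot (g : Summ ℕ) (x h : ℝ) : ℝ := (ev ρ x (opQ α ρ g h)).re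

/-- The value of `selfBeta` at `(x, h)`. -/
def betaFun (η : ℝ) (g : Summ ℕ) (x h : ℝ) : ℝ :=
  prof α ρ g x + prof α ρ g (x - h) +
    η * (prof α ρ g x * prof α ρ g (x - h) + quot α ρ g x h * quot α ρ g x h)

variable {α ρ}

theorem evK_opF (g : Summ ℕ) (x h : ℝ) : evK x h (opF α ρ g) = prof α ρ g x := ev_opF g h x
theorem evK_opFh (g : Summ ℕ) (x h : ℝ) : evK x h (opFh α ρ g) = prof α ρ g (x - h) := ev_opFh g h x
theorem evK_opD (g : Summ ℕ) (x h : ℝ) : evK x h (opD α ρ g) = dprof α ρ g x := ev_opD g h x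
theorem evK_opDh (g : Summ ℕ) (x h : ℝ) : evK x h (opDh α ρ g) = dprof α ρ g (x - h) := ev_opDh g h x

theorem evK_opQ (g : Summ ℕ) (x h : ℝ) : evK x h (opQ α ρ g) = quot α ρ g x h := by
  obtain ⟨q, hq⟩ := exists_opQ_real (α := α) (ρ := ρ) g h x
  rw [evK_apply, quot, hq, Complex.ofReal_re]

theorem chord_mul_quot (g : Summ ℕ) (x h : ℝ) :
    chord h * quot α ρ g x h = prof α ρ g x - prof α ρ g (x - h) := by
  have h1 := chord_mul_ev_opQ (α := α) (ρ := ρ) g h x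
  rw [← evK_apply, evK_opQ] at h1
  exact_mod_cast h1

theorem evK_selfBeta (η : ℝ) (g : Summ ℕ) (x h : ℝ) :
    evK x h (selfBeta α ρ η g) = betaFun α ρ η g x h := by
  simp only [selfBeta, map_add, evK_smul, map_mul, evK_opF, evK_opFh, evK_opQ, betaFun]
  push_cast; ring

theorem evK_selfP {η : ℝ} {g : Summ ℕ} (hs : ‖η • selfBeta α ρ η g‖ < 1) (x h : ℝ) :
    |η * betaFun α ρ η g x h| < 1 ∧
      evK x h (selfP α ρ η g) = (psi α (η * betaFun α ρ η g x h) : ℝ) :=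
  evK_psi hs (by rw [evK_smul, evK_selfBeta]; push_cast; rfl)

theorem evK_selfB {η : ℝ} {g : Summ ℕ} (hs : ‖η • selfBeta α ρ η g‖ < 1) (x h : ℝ) :
    evK x h (selfB α ρ η g) = ((1 + η * betaFun α ρ η g x h) ^ (-(α / 2)) : ℝ) := by
  obtain ⟨h1, h2⟩ := evK_selfP hs x h
  rw [← one_add_mul_psi hα.out h1]
  simp only [selfB, map_add, map_one, evK_smul, map_mul, h2, evK_selfBeta]
  push_cast; ring

theorem evK_radK (η : ℝ) (g : Summ ℕ) (x h : ℝ) :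
    evK x h (radK α ρ η g) = (1 + η * prof α ρ g x : ℝ) := by
  simp only [radK, map_add, map_one, evK_smul, evK_opF]
  push_cast; ring

theorem evK_radKh (η : ℝ) (g : Summ ℕ) (x h : ℝ) :
    evK x h (radKh α ρ η g) = (1 + η * prof α ρ g (x - h) : ℝ) := by
  simp only [radKh, map_add, map_one, evK_smul, evK_opFh]
  push_cast; ring

/-- The value of `selfReg` at `(x, h)`. -/
theorem evK_selfReg {η : ℝ} {g : Summ ℕ} (hs : ‖η • selfBeta α ρ η g‖ < 1) (x h : ℝ) :
    evK x h (selfReg α ρ η g) = (Real.cos (h / 2) *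
      ((prof α ρ g x + prof α ρ g (x - h) + η * (prof α ρ g x * prof α ρ g (x - h))) *
          (1 + η * betaFun α ρ η g x h) ^ (-(α / 2)) +
        betaFun α ρ η g x h * psi α (η * betaFun α ρ η g x h) +
        η * (dprof α ρ g x * dprof α ρ g (x - h) * (1 + η * betaFun α ρ η g x h) ^ (-(α / 2)))) +
      η * (Real.cos h * dprof α ρ g x * quot α ρ g x h *
        (1 + η * betaFun α ρ η g x h) ^ (-(α / 2))) : ℝ) := by
  simp only [selfReg, map_add, map_mul, evK_smul, evK_ker, evK_opF, evK_opFh, evK_opD, evK_opDh,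
    evK_opQ, evK_selfB hs, evK_selfBeta, (evK_selfP hs x h).2, cosHalf_apply, cosF_apply]
  push_cast; ring

/-- The quadratic form in the denominator of the self-interaction. -/
theorem chord_sq_mul (η : ℝ) (g : Summ ℕ) (x h : ℝ) :
    (η * prof α ρ g x - η * prof α ρ g (x - h)) ^ 2 +
      (1 + η * prof α ρ g x) * (1 + η * prof α ρ g (x - h)) * chord h ^ 2 =
    chord h ^ 2 * (1 + η * betaFun α ρ η g x h) := by
  rw [← mul_sub, ← chord_mul_quot, betaFun]; ring

/-- The integrand of the self-interaction of a patch. -/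
def selfIntegrand (α η : ℝ) (f f' : ℝ → ℝ) (x y : ℝ) : ℝ :=
  (((1 + η * f x) * (1 + η * f y) + (η * f' x) * (η * f' y)) * Real.sin (x - y) +
    ((1 + η * f x) * (η * f' y) - (η * f' x) * (1 + η * f y)) * Real.cos (x - y)) /
  (((1 + η * f x) - (1 + η * f y)) ^ 2 + 4 * (1 + η * f x) * (1 + η * f y) *
    Real.sin ((x - y) / 2) ^ 2) ^ (α / 2)

/-- The squared distance is chord² (1 + ηβ), since R(x) - R(x-h) is divisible by the chord.
Replacing (1 + ηβ)^{-α/2} by 1 + ηβ ψ(ηβ) isolates the term of the disc. The rest carries a factor η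
and consists of a part of singularity chord^{1-α} and a part with f'(x) - f'(x-h) over chord^α. -/
theorem selfIntegrand_eq {η : ℝ} {g : Summ ℕ} (hs : ‖η • selfBeta α ρ η g‖ < 1) (x : ℝ) {h : ℝ}
    (hh : h ∈ Ioo 0 (2 * Real.pi)) :
    selfIntegrand α η (prof α ρ g) (dprof α ρ g) x (x - h) =
      chord h ^ (1 - α) * Real.cos (h / 2) +
      η * (chord h ^ (1 - α) * (evK x h (selfReg α ρ η g)).re -
      (Real.cos h * ((1 + η * prof α ρ g x) * (1 + η * betaFun α ρ η g x h) ^ (-(α / 2)))) *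
        ((dprof α ρ g x - dprof α ρ g (x - h)) * chord h ^ (-α))) := by
  obtain ⟨h1, -⟩ := evK_selfP hs x h
  have hB0 : 0 < 1 + η * betaFun α ρ η g x h := by linarith [(abs_lt.1 h1).1]
  have hc := chord_pos hh
  have hden : (((1 + η * prof α ρ g x) - (1 + η * prof α ρ g (x - h))) ^ 2 +
      4 * (1 + η * prof α ρ g x) * (1 + η * prof α ρ g (x - h)) *
        Real.sin ((x - (x - h)) / 2) ^ 2) = chord h ^ 2 * (1 + η * betaFun α ρ η g x h) := by
    rw [← chord_sq_mul, sub_sub_cancel, chord]; ring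
  have hpow : ((chord h ^ 2 * (1 + η * betaFun α ρ η g x h)) ^ (α / 2))⁻¹ =
      chord h ^ (-α) * (1 + η * betaFun α ρ η g x h) ^ (-(α / 2)) := by
    rw [← Real.rpow_neg (by positivity), Real.mul_rpow (by positivity) hB0.le,
      ← Real.rpow_natCast_mul hc.le]
    congr 2
    push_cast; ring
  have hq := chord_mul_quot (α := α) (ρ := ρ) g x h
  have hpsi := one_add_mul_psi hα.out h1
  rw [selfIntegrand, hden, div_eq_mul_inv, hpow, evK_selfReg hs, Complex.ofReal_re, sub_sub_cancel,
    sin_eq_chord, chord_rpow_one_sub hα.out hh]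
  set B := (1 + η * betaFun α ρ η g x h) ^ (-(α / 2))
  set u := chord h ^ (-α)
  set c := chord h
  set q := quot α ρ g x h
  have hf : prof α ρ g (x - h) = prof α ρ g x - c * q := by linarith
  rw [hf]
  linear_combination (-(c * u * Real.cos (h / 2))) * hpsi

/-- The factor of the perturbation of the radius. -/
def scale (α ε b : ℝ) : ℝ := ε * |ε| ^ α * b ^ (1 + α)

theorem scale_zero (α b : ℝ) : scale α 0 b = 0 := by rw [scale, zero_mul, zero_mul]

theorem integral_sub_left_of_periodic {F : ℝ → ℝ} (hF : Function.Periodic F (2 * Real.pi)) (x : ℝ) :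
    ∫ y in (0 : ℝ)..(2 * Real.pi), F y = ∫ h in (0 : ℝ)..(2 * Real.pi), F (x - h) := by
  rw [intervalIntegral.integral_comp_sub_left (fun y => F y), sub_zero]
  have := hF.intervalIntegral_add_eq (x - 2 * Real.pi) 0
  rw [zero_add, sub_add_cancel] at this
  exact this.symm

theorem periodic_selfIntegrand (α η : ℝ) {f f' : ℝ → ℝ} (hf : Function.Periodic f (2 * Real.pi))
    (hf' : Function.Periodic f' (2 * Real.pi)) (x : ℝ) :
    Function.Periodic (selfIntegrand α η f f' x) (2 * Real.pi) := fun y => by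
  rw [selfIntegrand, hf, hf', show x - (y + 2 * Real.pi) = x - y - 2 * Real.pi by ring,
    Real.sin_sub_two_pi, Real.cos_sub_two_pi,
    show (x - y - 2 * Real.pi) / 2 = (x - y) / 2 - Real.pi by ring, Real.sin_sub_pi, neg_sq]
  rfl

theorem selfReg_integrable {η : ℝ} {g : Summ ℕ} (hs : ‖η • selfBeta α ρ η g‖ < 1) (x : ℝ) :
    IntervalIntegrable (fun h => chord h ^ (1 - α) * (evK x h (selfReg α ρ η g)).re) volume 0
      (2 * Real.pi) :=
  intervalIntegrable_of_ev (ρ := ρ) (G := selfReg α ρ η g) (x := x)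
    (intervalIntegrable_chord_one_sub hα.out) fun h _ => by
    rw [← evK_apply, evK_selfReg hs, Complex.ofReal_re]

theorem evK_sing {η : ℝ} {g : Summ ℕ} (hs : ‖η • selfBeta α ρ η g‖ < 1) (x h : ℝ) :
    evK x h (ker cosF * (radK α ρ η g * selfB α ρ η g)) = ((Real.cos h *
      ((1 + η * prof α ρ g x) * (1 + η * betaFun α ρ η g x h) ^ (-(α / 2))) : ℝ) : ℂ) := by
  rw [map_mul, map_mul, evK_ker, evK_radK, evK_selfB hs, cosF_apply]
  push_cast; ring

theorem sing_integrals {η : ℝ} {g : Summ ℕ} (hs : ‖η • selfBeta α ρ η g‖ < 1) (x : ℝ) :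
    IntervalIntegrable (fun h => (Real.cos h *
      ((1 + η * prof α ρ g x) * (1 + η * betaFun α ρ η g x h) ^ (-(α / 2)))) *
        ((dprof α ρ g x - dprof α ρ g (x - h)) * chord h ^ (-α))) volume 0 (2 * Real.pi) ∧
    ev ρ x (opS α ρ g (ker cosF * (radK α ρ η g * selfB α ρ η g))) =
      ((∫ h in (0 : ℝ)..(2 * Real.pi), (Real.cos h *
      ((1 + η * prof α ρ g x) * (1 + η * betaFun α ρ η g x h) ^ (-(α / 2)))) *
        ((dprof α ρ g x - dprof α ρ g (x - h)) * chord h ^ (-α)) : ℝ) : ℂ) := by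
  obtain ⟨h1, h2⟩ := singTerm_integrals (α := α) (ρ := ρ) g
    (ker cosF * (radK α ρ η g * selfB α ρ η g)) x
  simp only [← evK_apply, evK_sing hs, ← Complex.ofReal_mul] at h1 h2
  rw [intervalIntegral.integral_ofReal] at h2
  refine ⟨?_, h2⟩
  have h3 : ∀ a : ℝ, RCLike.re (K := ℂ) (a : ℂ) = a := fun a => Complex.ofReal_re a
  have := And.intro h1.1.re h1.2.re
  simp only [h3] at this
  exact this

theorem ev_selfH {η : ℝ} {g : Summ ℕ} (hs : ‖η • selfBeta α ρ η g‖ < 1) (x : ℝ) :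
    ev ρ x (selfH α ρ η g) = ((∫ h in (0 : ℝ)..(2 * Real.pi),
      (chord h ^ (1 - α) * (evK x h (selfReg α ρ η g)).re - (Real.cos h *
      ((1 + η * prof α ρ g x) * (1 + η * betaFun α ρ η g x h) ^ (-(α / 2)))) *
        ((dprof α ρ g x - dprof α ρ g (x - h)) * chord h ^ (-α))) : ℝ) : ℂ) := by
  rw [selfH, map_sub, (sing_integrals hs x).2, intervalIntegral.integral_sub
    (selfReg_integrable hs x) (sing_integrals hs x).1, Complex.ofReal_sub]
  congr 1
  exact ev_intK_real _ fun h _ => by rw [← evK_apply, evK_selfReg hs, Complex.ofReal_re]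

/-- The disc term integrates to zero by `integral_cos_half`, so the whole integral is η times an
expression that makes sense at η = 0 as well. This is the continuous extension of the
self-interaction. -/
theorem integral_selfIntegrand {η : ℝ} {g : Summ ℕ} (hs : ‖η • selfBeta α ρ η g‖ < 1) (x : ℝ) :
    ((∫ y in (0 : ℝ)..(2 * Real.pi),
      selfIntegrand α η (prof α ρ g) (dprof α ρ g) x y : ℝ) : ℂ) =
      η * ev ρ x (selfH α ρ η g) := by
  rw [integral_sub_left_of_periodic (periodic_selfIntegrand α η (periodic_prof g)
    (periodic_dprof g) x) x, integral_congr_Ioo (by positivity)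
      (fun h hh => selfIntegrand_eq hs x hh), ev_selfH hs, ← Complex.ofReal_mul,
      intervalIntegral.integral_add, integral_cos_half hα.out, zero_add,
      intervalIntegral.integral_const_mul]
  · exact (intervalIntegrable_chord_one_sub hα.out).mul_continuousOn (by fun_prop)
  · exact ((selfReg_integrable hs x).sub (sing_integrals hs x).1).const_mul _

variable (α ρ) in
/-- The expansion of the squared distance of points on the boundaries of two patches. -/
def interTau (ε bi bj : ℝ) (z : ℂ) (gi gj : Summ ℕ) : Kern ρ :=
  (‖z‖ ^ 2)⁻¹ • ((2 : ℝ) • (bi • (radK α ρ (scale α ε bi) gi * waveK 1 1 z) -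
      bj • (radKh α ρ (scale α ε bj) gj * waveK 1 rotF z)) +
    ε • (bi ^ 2 • (radK α ρ (scale α ε bi) gi * radK α ρ (scale α ε bi) gi) +
      bj ^ 2 • (radKh α ρ (scale α ε bj) gj * radKh α ρ (scale α ε bj) gj) -
      (2 * bi * bj) • (radK α ρ (scale α ε bi) gi * radKh α ρ (scale α ε bj) gj * ker cosF)))

variable (α ρ) in
/-- The part of the numerator of the interaction which depends on the perturbations. -/
def interNum (ε bi bj : ℝ) (gi gj : Summ ℕ) : Kern ρ :=
  (bi ^ (1 + α) • opF α ρ gi + bj ^ (1 + α) • opFh α ρ gj +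
      (ε * |ε| ^ α * bi ^ (1 + α) * bj ^ (1 + α)) •
        (opF α ρ gi * opFh α ρ gj + opD α ρ gi * opDh α ρ gj)) * ker sinF +
    (bj ^ (1 + α) • (radK α ρ (scale α ε bi) gi * opDh α ρ gj) -
      bi ^ (1 + α) • (opD α ρ gi * radKh α ρ (scale α ε bj) gj)) * ker cosF

variable (α ρ) in
/-- The kernel of the interaction. -/
def interKern (ε bi bj : ℝ) (z : ℂ) (gi gj : Summ ℕ) : Kern ρ :=
  ker sinF * (interTau α ρ ε bi bj z gi gj * psi α (ε • interTau α ρ ε bi bj z gi gj)) +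
    |ε| ^ α • (interNum α ρ ε bi bj gi gj *
      (1 + ε • (interTau α ρ ε bi bj z gi gj * psi α (ε • interTau α ρ ε bi bj z gi gj))))

variable (α ρ) in
/-- The normalised interaction of two patches. -/
def interH (ε bi bj : ℝ) (z : ℂ) (gi gj : Summ ℕ) : Wiener ρ :=
  intK (fun _ => 1) (intervalIntegrable_const) (interKern α ρ ε bi bj z gi gj)

variable (α ρ) in
/-- The value of `interTau` at `(x, x - y)`. -/
def tauFun (ε bi bj : ℝ) (z : ℂ) (gi gj : Summ ℕ) (x y : ℝ) : ℝ :=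
  (‖z‖ ^ 2)⁻¹ * (2 * (bi * ((1 + scale α ε bi * prof α ρ gi x) *
      (z * Complex.exp (x * Complex.I)).re) -
      bj * ((1 + scale α ε bj * prof α ρ gj y) * (z * Complex.exp (y * Complex.I)).re)) +
    ε * (bi ^ 2 * (1 + scale α ε bi * prof α ρ gi x) ^ 2 +
      bj ^ 2 * (1 + scale α ε bj * prof α ρ gj y) ^ 2 -
      2 * bi * bj * ((1 + scale α ε bi * prof α ρ gi x) * (1 + scale α ε bj * prof α ρ gj y) *
        Real.cos (x - y))))

variable (α ρ) in
/-- The value of `interNum` at `(x, x - y)`. -/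
def numFun (ε bi bj : ℝ) (gi gj : Summ ℕ) (x y : ℝ) : ℝ :=
  (bi ^ (1 + α) * prof α ρ gi x + bj ^ (1 + α) * prof α ρ gj y +
      ε * |ε| ^ α * bi ^ (1 + α) * bj ^ (1 + α) *
        (prof α ρ gi x * prof α ρ gj y + dprof α ρ gi x * dprof α ρ gj y)) * Real.sin (x - y) +
    (bj ^ (1 + α) * ((1 + scale α ε bi * prof α ρ gi x) * dprof α ρ gj y) -
      bi ^ (1 + α) * (dprof α ρ gi x * (1 + scale α ε bj * prof α ρ gj y))) * Real.cos (x - y)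

theorem evK_interTau (ε bi bj : ℝ) (z : ℂ) (gi gj : Summ ℕ) (x h : ℝ) :
    evK x h (interTau α ρ ε bi bj z gi gj) = tauFun α ρ ε bi bj z gi gj x (x - h) := by
  simp only [interTau, evK_smul, map_add, map_sub, map_mul, evK_radK, evK_radKh, evK_waveK_one,
    evK_waveK_rot, evK_ker, cosF_apply, tauFun, sub_sub_cancel]
  push_cast; ring

theorem evK_interNum (ε bi bj : ℝ) (gi gj : Summ ℕ) (x h : ℝ) :
    evK x h (interNum α ρ ε bi bj gi gj) = numFun α ρ ε bi bj gi gj x (x - h) := by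
  simp only [interNum, evK_smul, map_add, map_sub, map_mul, evK_radK, evK_radKh, evK_opF, evK_opFh,
    evK_opD, evK_opDh, evK_ker, cosF_apply, sinF_apply, numFun, sub_sub_cancel]
  push_cast; ring

theorem evK_interKern {ε bi bj : ℝ} {z : ℂ} {gi gj : Summ ℕ}
    (hs : ‖ε • interTau α ρ ε bi bj z gi gj‖ < 1) (x h : ℝ) :
    |ε * tauFun α ρ ε bi bj z gi gj x (x - h)| < 1 ∧
    evK x h (interKern α ρ ε bi bj z gi gj) =
      ((Real.sin h * (tauFun α ρ ε bi bj z gi gj x (x - h) *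
          psi α (ε * tauFun α ρ ε bi bj z gi gj x (x - h))) +
        |ε| ^ α * (numFun α ρ ε bi bj gi gj x (x - h) *
          (1 + ε * (tauFun α ρ ε bi bj z gi gj x (x - h) *
            psi α (ε * tauFun α ρ ε bi bj z gi gj x (x - h))))) : ℝ) : ℂ) := by
  obtain ⟨h1, h2⟩ := evK_psi (α := α) (x := x) (h := h) hs
    (t := ε * tauFun α ρ ε bi bj z gi gj x (x - h))
    (by rw [evK_smul, evK_interTau]; push_cast; rfl)
  refine ⟨h1, ?_⟩
  simp only [interKern, evK_smul, map_add, map_mul, map_one, evK_interTau, evK_interNum, h2, evK_ker,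
    sinF_apply]
  push_cast; ring

theorem ev_interH {ε bi bj : ℝ} {z : ℂ} {gi gj : Summ ℕ}
    (hs : ‖ε • interTau α ρ ε bi bj z gi gj‖ < 1) (x : ℝ) :
    IntervalIntegrable (fun h => (evK x h (interKern α ρ ε bi bj z gi gj)).re) volume 0
      (2 * Real.pi) ∧
    ev ρ x (interH α ρ ε bi bj z gi gj) = ((∫ h in (0 : ℝ)..(2 * Real.pi),
      (evK x h (interKern α ρ ε bi bj z gi gj)).re : ℝ) : ℂ) := by
  have h0 : ∀ h ∈ Ioo 0 (2 * Real.pi), ev ρ x (interKern α ρ ε bi bj z gi gj h) =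
      (((evK x h (interKern α ρ ε bi bj z gi gj)).re : ℝ) : ℂ) := fun h _ => by
    rw [← evK_apply, (evK_interKern hs x h).2, Complex.ofReal_re]
  have h1 := intervalIntegrable_of_ev (κ := fun _ => 1) intervalIntegrable_const h0
  have h2 := ev_intK_real (κ := fun _ => 1) intervalIntegrable_const h0
  simp only [one_mul] at h1 h2
  exact ⟨h1, h2⟩

/-- The integrand of the interaction of two patches. -/
def interIntegrand (α : ℝ) (Ri Ri' Rj Rj' : ℝ → ℝ) (D : ℝ → ℝ → ℝ) (x y : ℝ) : ℝ :=
  ((Ri x * Rj y + Ri' x * Rj' y) * Real.sin (x - y) +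
    (Ri x * Rj' y - Ri' x * Rj y) * Real.cos (x - y)) / D x y ^ (α / 2)

theorem interIntegrand_eq {ε bi bj : ℝ} {z : ℂ} (hz : z ≠ 0) {gi gj : Summ ℕ}
    (hs : ‖ε • interTau α ρ ε bi bj z gi gj‖ < 1) (x h : ℝ) :
    interIntegrand α (fun x => 1 + scale α ε bi * prof α ρ gi x)
      (fun x => scale α ε bi * dprof α ρ gi x) (fun x => 1 + scale α ε bj * prof α ρ gj x)
      (fun x => scale α ε bj * dprof α ρ gj x)
      (fun x y => ‖z‖ ^ 2 * (1 + ε * tauFun α ρ ε bi bj z gi gj x y)) x (x - h) =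
    ‖z‖ ^ (-α) * (Real.sin h + ε * (evK x h (interKern α ρ ε bi bj z gi gj)).re) := by
  obtain ⟨h1, h2⟩ := evK_interKern hs x h
  have hB0 : 0 < 1 + ε * tauFun α ρ ε bi bj z gi gj x (x - h) := by linarith [(abs_lt.1 h1).1]
  have hn : 0 < ‖z‖ := norm_pos_iff.2 hz
  have hpow : ((‖z‖ ^ 2 * (1 + ε * tauFun α ρ ε bi bj z gi gj x (x - h))) ^ (α / 2))⁻¹ =
      ‖z‖ ^ (-α) * (1 + ε * tauFun α ρ ε bi bj z gi gj x (x - h)) ^ (-(α / 2)) := by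
    rw [← Real.rpow_neg (by positivity), Real.mul_rpow (by positivity) hB0.le,
      ← Real.rpow_natCast_mul hn.le]
    congr 2
    push_cast; ring
  rw [interIntegrand, div_eq_mul_inv, hpow, h2, Complex.ofReal_re, ← one_add_mul_psi hα.out h1,
    sub_sub_cancel, numFun, sub_sub_cancel]
  simp only [scale]
  ring

/-- The leading term sin h has mean zero, so a factor ε comes out and the quotient extends to ε = 0.
The separation ‖z‖^{-α} is factored out to keep the series argument small. -/
theorem integral_interIntegrand {ε bi bj : ℝ} {z : ℂ} (hz : z ≠ 0) {gi gj : Summ ℕ}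
    (hs : ‖ε • interTau α ρ ε bi bj z gi gj‖ < 1) (x : ℝ) :
    ((∫ y in (0 : ℝ)..(2 * Real.pi),
      interIntegrand α (fun x => 1 + scale α ε bi * prof α ρ gi x)
      (fun x => scale α ε bi * dprof α ρ gi x) (fun x => 1 + scale α ε bj * prof α ρ gj x)
      (fun x => scale α ε bj * dprof α ρ gj x)
      (fun x y => ‖z‖ ^ 2 * (1 + ε * tauFun α ρ ε bi bj z gi gj x y)) x y : ℝ) : ℂ) =
    ((‖z‖ ^ (-α) * ε : ℝ) : ℂ) * ev ρ x (interH α ρ ε bi bj z gi gj) := by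
  obtain ⟨h1, h2⟩ := ev_interH hs x
  rw [integral_sub_left_of_periodic (x := x)]
  · simp only [interIntegrand_eq hz hs]
    rw [h2, intervalIntegral.integral_const_mul, intervalIntegral.integral_add
      (Continuous.intervalIntegrable (by fun_prop) _ _) (h1.const_mul _),
      intervalIntegral.integral_const_mul, integral_sin]
    simp
    ring
  · intro y
    have e1 : Complex.exp (((y + 2 * Real.pi : ℝ) : ℂ) * Complex.I) =
        Complex.exp (y * Complex.I) := by
      push_cast
      rw [add_mul, Complex.exp_periodic]
    rw [interIntegrand, interIntegrand, tauFun, tauFun, e1, periodic_prof gj,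
      periodic_dprof gj, show x - (y + 2 * Real.pi) = x - y - 2 * Real.pi by ring,
      Real.sin_sub_two_pi, Real.cos_sub_two_pi]

end

end

/-! ### The contour functional as an element of the Wiener algebra -/

noncomputable section

open MeasureTheory Wiener

section

variable {N : ℕ}

/-- The conjugate of the complex number representing `w_i - w_j`. -/
def sepC (lam : Param N) (i j : Fin N) : ℂ :=
  ((lam (0, i) - lam (0, j) : ℝ) : ℂ) - ((lam (1, i) - lam (1, j) : ℝ) : ℂ) * Complex.I

theorem sepC_re (lam : Param N) (i j : Fin N) : (sepC lam i j).re = lam (0, i) - lam (0, j) := by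
  simp [sepC]

theorem sepC_im (lam : Param N) (i j : Fin N) : (sepC lam i j).im = -(lam (1, i) - lam (1, j)) := by
  simp [sepC]

theorem re_mul_exp (z : ℂ) (x : ℝ) :
    (z * Complex.exp (x * Complex.I)).re = z.re * Real.cos x - z.im * Real.sin x := by
  rw [Complex.mul_re, Complex.exp_ofReal_mul_I_re, Complex.exp_ofReal_mul_I_im]

theorem im_mul_exp (z : ℂ) (x : ℝ) :
    (z * Complex.exp (x * Complex.I)).im = z.re * Real.sin x + z.im * Real.cos x := by
  rw [Complex.mul_im, Complex.exp_ofReal_mul_I_re, Complex.exp_ofReal_mul_I_im]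

theorem Plane.norm_sq (p : Plane) : ‖p‖ ^ 2 = p 0 ^ 2 + p 1 ^ 2 := by
  rw [EuclideanSpace.norm_sq_eq, Fin.sum_univ_two]; simp

theorem Plane.inner_eq (p q : Plane) : inner ℝ p q = p 0 * q 0 + p 1 * q 1 := by
  rw [PiLp.inner_apply, Fin.sum_univ_two]; simp [mul_comm]

theorem sq_norm_complex (z : ℂ) : ‖z‖ ^ 2 = z.re ^ 2 + z.im ^ 2 := by
  rw [Complex.sq_norm, Complex.normSq_apply]; ring

theorem norm_sepC (lam : Param N) (i j : Fin N) : ‖sepC lam i j‖ = ‖pos lam i - pos lam j‖ := by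
  rw [← sq_eq_sq₀ (norm_nonneg _) (norm_nonneg _), sq_norm_complex, Plane.norm_sq, sepC_re, sepC_im]
  simp [pos]
  ring

theorem sepC_ne_zero {lam : Param N} (h : Function.Injective (pos lam)) {i j : Fin N} (hij : i ≠ j) :
    sepC lam i j ≠ 0 := by
  rw [← norm_pos_iff, norm_sepC, norm_pos_iff, sub_ne_zero]
  exact fun e => hij (h e)

theorem integral_sin_mul_rot (z : ℂ) (x : ℝ) :
    ∫ h in (0 : ℝ)..(2 * Real.pi), Real.sin h * (z * Complex.exp (((x - h : ℝ) : ℂ) * Complex.I)).re =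
      Real.pi * (z * Complex.exp (x * Complex.I)).im := by
  have e : ∀ h, Real.sin h * (z * Complex.exp (((x - h : ℝ) : ℂ) * Complex.I)).re =
      (z.re * Real.cos x - z.im * Real.sin x) * (Real.sin h * Real.cos h) +
      (z.re * Real.sin x + z.im * Real.cos x) * (Real.sin h ^ 2) := by
    intro h
    rw [re_mul_exp, Real.cos_sub, Real.sin_sub]; ring
  simp only [e]
  rw [intervalIntegral.integral_add (Continuous.intervalIntegrable (by fun_prop) _ _)
    (Continuous.intervalIntegrable (by fun_prop) _ _), intervalIntegral.integral_const_mul,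
    intervalIntegral.integral_const_mul, integral_sin_mul_cos₁, integral_sin_sq, im_mul_exp]
  simp
  ring

section

variable (α ρ : ℝ) [hα : Fact (α ∈ Ioo (1 : ℝ) 2)] [hρ : Fact (1 ≤ ρ)]

/-- The contour functional multiplied by the radius, in the Wiener algebra. -/
def totalH (b : Fin N → ℝ) (ε : ℝ) (g : Fin N → Summ ℕ) (lam : Param N) (i : Fin N) : Wiener ρ :=
  (kernelConst α / (2 * Real.pi)) • (strength lam i • selfH α ρ (scale α ε (b i)) (g i) +
    ∑ j ∈ Finset.univ.erase i, (strength lam j / b j * ‖sepC lam i j‖ ^ (-α)) •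
      interH α ρ ε (b i) (b j) (sepC lam i j) (g i) (g j))

/-- The smallness conditions under which the power series for the kernels converge. -/
structure Admissible (b : Fin N → ℝ) (ε : ℝ) (g : Fin N → Summ ℕ) (lam : Param N) : Prop where
  distinct : Function.Injective (pos lam)
  rad_lt : ∀ i, ‖scale α ε (b i) • opF α ρ (g i)‖ < 1
  self_lt : ∀ i, ‖scale α ε (b i) • selfBeta α ρ (scale α ε (b i)) (g i)‖ < 1
  inter_lt : ∀ i j, i ≠ j →
    ‖ε • interTau α ρ ε (b i) (b j) (sepC lam i j) (g i) (g j)‖ < 1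

variable {α ρ}

theorem psi_zero_real : psi α (0 : ℝ) = -(α / 2) := psi_zero hα.out

/-- At η = 0 one has β = f(x) + f(x-h) and ψ(0) = -α/2, which gives the factor 1 - α/2. The part
with f(x) drops out because chord^{1-α} cos(h/2) has mean zero. -/
theorem ev_selfH_zero (γ : ℝ) (g : Summ ℕ) (x : ℝ) :
    ((kernelConst α / (2 * Real.pi) * γ : ℝ) : ℂ) * ev ρ x (selfH α ρ 0 g) =
      (selfTermZero α γ (prof α ρ g) x : ℝ) := by
  have hs : ‖(0 : ℝ) • selfBeta α ρ 0 g‖ < 1 := by rw [zero_smul, norm_zero]; exact one_pos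
  have hsing := (sing_integrals hs x).1
  have hone := intervalIntegrable_chord_one_sub hα.out
  simp only [zero_mul, add_zero, Real.one_rpow, mul_one] at hsing
  rw [ev_selfH hs, ← Complex.ofReal_mul, selfTermZero]
  congr 1
  simp only [evK_selfReg hs, Complex.ofReal_re, zero_mul, add_zero, Real.one_rpow, mul_one,
    psi_zero_real, betaFun, deriv_prof]
  have hc := (continuous_prof (α := α) (ρ := ρ) g)
  have e1 : ∫ y in (0 : ℝ)..(2 * Real.pi), prof α ρ g (x - y) * Real.sin y /
      (4 * Real.sin (y / 2) ^ 2) ^ (α / 2) = ∫ h in (0 : ℝ)..(2 * Real.pi),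
        chord h ^ (1 - α) * Real.cos (h / 2) * prof α ρ g (x - h) := by
    refine integral_congr_Ioo (by positivity) fun h hh => ?_
    rw [four_sin_sq_rpow hh, sin_eq_chord, chord_rpow_one_sub hα.out hh, Real.rpow_neg (chord_pos hh).le]
    ring
  have e2 : ∫ y in (0 : ℝ)..(2 * Real.pi), (dprof α ρ g x - dprof α ρ g (x - y)) * Real.cos y /
      (4 * Real.sin (y / 2) ^ 2) ^ (α / 2) = ∫ h in (0 : ℝ)..(2 * Real.pi),
        Real.cos h * ((dprof α ρ g x - dprof α ρ g (x - h)) * chord h ^ (-α)) := by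
    refine integral_congr_Ioo (by positivity) fun h hh => ?_
    rw [four_sin_sq_rpow hh, Real.rpow_neg (chord_pos hh).le]
    ring
  have i1 : IntervalIntegrable (fun h => chord h ^ (1 - α) * Real.cos (h / 2)) volume 0
      (2 * Real.pi) := hone.mul_continuousOn (by fun_prop)
  have i2 : IntervalIntegrable (fun h => chord h ^ (1 - α) * Real.cos (h / 2) *
      prof α ρ g (x - h)) volume 0 (2 * Real.pi) := i1.mul_continuousOn (by fun_prop)
  have e3 : ∫ h in (0 : ℝ)..(2 * Real.pi), (chord h ^ (1 - α) * (Real.cos (h / 2) *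
      (prof α ρ g x + prof α ρ g (x - h) + (prof α ρ g x + prof α ρ g (x - h)) * -(α / 2))) -
      Real.cos h * ((dprof α ρ g x - dprof α ρ g (x - h)) * chord h ^ (-α))) =
      (1 - α / 2) * prof α ρ g x * (∫ h in (0 : ℝ)..(2 * Real.pi), chord h ^ (1 - α) * Real.cos (h / 2)) +
      (1 - α / 2) * (∫ h in (0 : ℝ)..(2 * Real.pi), chord h ^ (1 - α) * Real.cos (h / 2) *
        prof α ρ g (x - h)) - ∫ h in (0 : ℝ)..(2 * Real.pi),
        Real.cos h * ((dprof α ρ g x - dprof α ρ g (x - h)) * chord h ^ (-α)) := by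
    rw [← intervalIntegral.integral_const_mul, ← intervalIntegral.integral_const_mul,
      ← intervalIntegral.integral_add (i1.const_mul _) (i2.const_mul _),
      ← intervalIntegral.integral_sub ((i1.const_mul _).add (i2.const_mul _)) hsing]
    refine intervalIntegral.integral_congr fun h _ => ?_
    ring
  rw [e3, e1, e2, integral_cos_half hα.out]
  ring

/-- Only the part of the squared distance that varies with the second boundary point correlates with
sin h. It produces the point vortex velocity in the direction e^⊥. -/
theorem ev_interH_zero (bi bj : ℝ) (z : ℂ) (gi gj : Summ ℕ) (x : ℝ) :
    ev ρ x (interH α ρ 0 bi bj z gi gj) =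
      ((α * Real.pi * bj * (‖z‖ ^ 2)⁻¹ * (z * Complex.exp (x * Complex.I)).im : ℝ) : ℂ) := by
  have hs : ‖(0 : ℝ) • interTau α ρ 0 bi bj z gi gj‖ < 1 := by
    rw [zero_smul, norm_zero]; exact one_pos
  have hα0 : (0 : ℝ) ^ α = 0 := Real.zero_rpow (by linarith [hα.out.1])
  rw [(ev_interH hs x).2]
  congr 1
  simp only [(evK_interKern hs x _).2, Complex.ofReal_re, zero_mul, abs_zero, hα0, add_zero,
    psi_zero_real, tauFun, scale_zero, one_mul]
  have e : ∀ h, Real.sin h * ((‖z‖ ^ 2)⁻¹ * (2 * (bi * (z * Complex.exp (x * Complex.I)).re -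
      bj * (z * Complex.exp (((x - h : ℝ) : ℂ) * Complex.I)).re)) * -(α / 2)) =
      (-α * (‖z‖ ^ 2)⁻¹ * bi * (z * Complex.exp (x * Complex.I)).re) * Real.sin h +
      (α * (‖z‖ ^ 2)⁻¹ * bj) *
        (Real.sin h * (z * Complex.exp (((x - h : ℝ) : ℂ) * Complex.I)).re) := fun h => by ring
  simp only [e]
  rw [intervalIntegral.integral_add (Continuous.intervalIntegrable (by fun_prop) _ _)
    (Continuous.intervalIntegrable (by fun_prop) _ _), intervalIntegral.integral_const_mul,
    intervalIntegral.integral_const_mul, integral_sin_mul_rot, integral_sin]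
  simp
  ring

theorem deriv_radius (ε b : ℝ) (g : Summ ℕ) (x : ℝ) :
    deriv (radius α ε b (prof α ρ g)) x = scale α ε b * dprof α ρ g x := by
  have := ((hasDerivAt_prof (α := α) (ρ := ρ) g x).const_mul (scale α ε b)).const_add 1
  exact this.deriv

/-- The squared distance of w_i + εb_iR_i e(x) and w_j + εb_jR_j e(y), expanded around |w_i - w_j|².
-/
theorem norm_boundaryPoint_sub {ε bi bj : ℝ} {lam : Param N} {i j : Fin N}
    (hz : sepC lam i j ≠ 0) (gi gj : Summ ℕ) (x y : ℝ) :
    ‖boundaryPoint α ε bi (pos lam i) (prof α ρ gi) x -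
      boundaryPoint α ε bj (pos lam j) (prof α ρ gj) y‖ ^ 2 =
    ‖sepC lam i j‖ ^ 2 * (1 + ε * tauFun α ρ ε bi bj (sepC lam i j) gi gj x y) := by
  have hn : ‖sepC lam i j‖ ^ 2 ≠ 0 := pow_ne_zero _ (norm_ne_zero_iff.2 hz)
  have e : ‖sepC lam i j‖ ^ 2 * (1 + ε * tauFun α ρ ε bi bj (sepC lam i j) gi gj x y) =
      ‖sepC lam i j‖ ^ 2 + ε * ((‖sepC lam i j‖ ^ 2 * (‖sepC lam i j‖ ^ 2)⁻¹) *
      (2 * (bi * ((1 + scale α ε bi * prof α ρ gi x) *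
      (sepC lam i j * Complex.exp (x * Complex.I)).re) -
      bj * ((1 + scale α ε bj * prof α ρ gj y) * (sepC lam i j * Complex.exp (y * Complex.I)).re)) +
    ε * (bi ^ 2 * (1 + scale α ε bi * prof α ρ gi x) ^ 2 +
      bj ^ 2 * (1 + scale α ε bj * prof α ρ gj y) ^ 2 -
      2 * bi * bj * ((1 + scale α ε bi * prof α ρ gi x) * (1 + scale α ε bj * prof α ρ gj y) *
        Real.cos (x - y))))) := by rw [tauFun]; ring
  rw [e, mul_inv_cancel₀ hn, one_mul, sq_norm_complex, Plane.norm_sq, re_mul_exp, re_mul_exp, sepC_re,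
    sepC_im, Real.cos_sub]
  simp only [boundaryPoint, radius, pos, radial, scale, PiLp.sub_apply, PiLp.add_apply,
    PiLp.smul_apply, smul_eq_mul]
  simp
  have h1 := Real.sin_sq_add_cos_sq x
  have h2 := Real.sin_sq_add_cos_sq y
  set Ri := 1 + ε * |ε| ^ α * bi ^ (1 + α) * prof α ρ gi x
  set Rj := 1 + ε * |ε| ^ α * bj ^ (1 + α) * prof α ρ gj y
  linear_combination (ε * bi * Ri) ^ 2 * h1 + (ε * bj * Rj) ^ 2 * h2

theorem radius_pos {b : Fin N → ℝ} {ε : ℝ} {g : Fin N → Summ ℕ} {lam : Param N}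
    (h : Admissible α ρ b ε g lam) (i : Fin N) (x : ℝ) : 0 < radius α ε (b i) (prof α ρ (g i)) x := by
  have h1 : evK x 0 (scale α ε (b i) • opF α ρ (g i)) =
      ((scale α ε (b i) * prof α ρ (g i) x : ℝ) : ℂ) := by
    rw [evK_smul, evK_opF]; push_cast; rfl
  have h2 := (norm_evK_le x 0 (scale α ε (b i) • opF α ρ (g i))).trans_lt (h.rad_lt i)
  rw [h1, Complex.norm_real, Real.norm_eq_abs, abs_lt] at h2
  have := h2.1
  change 0 < 1 + scale α ε (b i) * prof α ρ (g i) x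
  linarith

theorem radius_mul_selfTerm {ε b γ : ℝ} (hb : 0 < b) (hε : ε ≠ 0) {g : Summ ℕ}
    (hs : ‖scale α ε b • selfBeta α ρ (scale α ε b) g‖ < 1) {x : ℝ}
    (hR : 0 < radius α ε b (prof α ρ g) x) :
    ((radius α ε b (prof α ρ g) x * selfTerm α ε b γ (prof α ρ g) x : ℝ) : ℂ) =
      ((kernelConst α / (2 * Real.pi) * γ : ℝ) : ℂ) * ev ρ x (selfH α ρ (scale α ε b) g) := by
  have hη : scale α ε b ≠ 0 := by
    have : 0 < |ε| := abs_pos.2 hε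
    rw [scale]; positivity
  have h1 := integral_selfIntegrand hs x
  have h2 : ∫ y in (0 : ℝ)..(2 * Real.pi),
      crossTerm (radius α ε b (prof α ρ g)) (radius α ε b (prof α ρ g)) x y /
        ((radius α ε b (prof α ρ g) x - radius α ε b (prof α ρ g) y) ^ 2
          + 4 * radius α ε b (prof α ρ g) x * radius α ε b (prof α ρ g) y *
            Real.sin ((x - y) / 2) ^ 2) ^ (α / 2) =
      ∫ y in (0 : ℝ)..(2 * Real.pi),
        selfIntegrand α (scale α ε b) (prof α ρ g) (dprof α ρ g) x y := by
    refine intervalIntegral.integral_congr fun y _ => ?_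
    simp only [crossTerm, deriv_radius]
    rfl
  rw [selfTerm, h2]
  have h3 : radius α ε b (prof α ρ g) x * (kernelConst α * γ / (2 * Real.pi * (ε * |ε| ^ α) *
      b ^ (1 + α) * radius α ε b (prof α ρ g) x) * ∫ y in (0 : ℝ)..(2 * Real.pi),
        selfIntegrand α (scale α ε b) (prof α ρ g) (dprof α ρ g) x y) =
      (kernelConst α / (2 * Real.pi) * γ) * ((scale α ε b)⁻¹ * ∫ y in (0 : ℝ)..(2 * Real.pi),
        selfIntegrand α (scale α ε b) (prof α ρ g) (dprof α ρ g) x y) := by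
    have : 0 < |ε| := abs_pos.2 hε
    rw [scale]
    field_simp
  have hη' : ((scale α ε b : ℝ) : ℂ) ≠ 0 := by exact_mod_cast hη
  rw [h3, Complex.ofReal_mul, Complex.ofReal_mul (scale α ε b)⁻¹, h1, Complex.ofReal_inv,
    inv_mul_cancel_left₀ hη']

theorem integral_crossTerm {ε : ℝ} {b : Fin N → ℝ} {lam : Param N} {i j : Fin N}
    {g : Fin N → Summ ℕ} (hz : sepC lam i j ≠ 0)
    (hs : ‖ε • interTau α ρ ε (b i) (b j) (sepC lam i j) (g i) (g j)‖ < 1) (x : ℝ) :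
    ((∫ y in (0 : ℝ)..(2 * Real.pi),
        crossTerm (radius α ε (b i) (prof α ρ (g i))) (radius α ε (b j) (prof α ρ (g j))) x y /
          ‖boundaryPoint α ε (b i) (pos lam i) (prof α ρ (g i)) x
            - boundaryPoint α ε (b j) (pos lam j) (prof α ρ (g j)) y‖ ^ α : ℝ) : ℂ) =
      ((‖sepC lam i j‖ ^ (-α) * ε : ℝ) : ℂ) *
        ev ρ x (interH α ρ ε (b i) (b j) (sepC lam i j) (g i) (g j)) := by
  rw [← integral_interIntegrand hz hs]
  congr 1
  refine intervalIntegral.integral_congr fun y _ => ?_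
  simp only [crossTerm, deriv_radius, interIntegrand]
  rw [← norm_boundaryPoint_sub hz, ← Real.rpow_natCast_mul (norm_nonneg _)]
  congr 2
  push_cast; ring

/-- The functional in the Wiener algebra represents the contour functional. -/
theorem ev_totalH {b : Fin N → ℝ} (hb : ∀ i, 0 < b i) {ε : ℝ} {g : Fin N → Summ ℕ} {lam : Param N}
    (h : Admissible α ρ b ε g lam) (i : Fin N) (x : ℝ) :
    ev ρ x (totalH α ρ b ε g lam i) = ((radius α ε (b i) (prof α ρ (g i)) x *
      functional α b ε (fun j => prof α ρ (g j)) lam i x : ℝ) : ℂ) := by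
  have hR := radius_pos h i x
  rw [totalH, map_smul, map_add, map_smul, map_sum, Complex.real_smul, Complex.real_smul]
  have hz : ∀ j ∈ Finset.univ.erase i, sepC lam i j ≠ 0 := fun j hj =>
    sepC_ne_zero h.distinct (Finset.ne_of_mem_erase hj).symm
  by_cases hε : ε = 0
  · subst hε
    have hr : radius α 0 (b i) (prof α ρ (g i)) x = 1 := by simp [radius]
    rw [functional, if_pos rfl, hr, one_mul, scale_zero, Complex.ofReal_add, ← ev_selfH_zero]
    rw [mul_add, ← mul_assoc, Complex.ofReal_mul]
    congr 1
    rw [pointVortexMap, inner_neg_left, inner_smul_left, sum_inner]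
    simp only [map_smul, Complex.real_smul, ev_interH_zero, ← Complex.ofReal_mul,
      ← Complex.ofReal_sum]
    congr 1
    rw [Finset.mul_sum, conj_trivial, Finset.mul_sum, ← Finset.sum_neg_distrib]
    refine Finset.sum_congr rfl fun j hj => ?_
    have hn : 0 < ‖sepC lam i j‖ := norm_pos_iff.2 (hz j hj)
    have hbj := (hb j).ne'
    rw [inner_smul_left, conj_trivial, ← norm_sepC, Real.rpow_add hn, Real.rpow_neg hn.le,
      Plane.inner_eq, im_mul_exp, sepC_re, sepC_im]
    have : 0 < ‖sepC lam i j‖ ^ α := by positivity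
    have hpi := Real.pi_ne_zero
    simp only [Real.rpow_ofNat, pos, angular, PiLp.sub_apply]
    simp
    field_simp
    ring
  · rw [functional, if_neg hε, mul_add (radius _ _ _ _ _), Complex.ofReal_add,
      radius_mul_selfTerm (hb i) hε (h.self_lt i) hR, mul_add, ← mul_assoc, Complex.ofReal_mul]
    congr 1
    have e1 : radius α ε (b i) (prof α ρ (g i)) x *
        interactionTerm α b ε (fun j => prof α ρ (g j)) lam i x =
        kernelConst α / (2 * Real.pi) * ∑ j ∈ Finset.univ.erase i, strength lam j / b j *
          (ε⁻¹ * ∫ y in (0 : ℝ)..(2 * Real.pi),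
            crossTerm (radius α ε (b i) (prof α ρ (g i))) (radius α ε (b j) (prof α ρ (g j))) x y /
            ‖boundaryPoint α ε (b i) (pos lam i) (prof α ρ (g i)) x
            - boundaryPoint α ε (b j) (pos lam j) (prof α ρ (g j)) y‖ ^ α) := by
      rw [interactionTerm, ← mul_assoc, Finset.mul_sum, Finset.mul_sum]
      refine Finset.sum_congr rfl fun j _ => ?_
      have hpi := Real.pi_ne_zero
      field_simp
    rw [e1, Complex.ofReal_mul, Complex.ofReal_sum]
    congr 1
    refine Finset.sum_congr rfl fun j hj => ?_
    have hε' : (ε : ℂ) ≠ 0 := by exact_mod_cast hε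
    rw [map_smul, Complex.real_smul, Complex.ofReal_mul _ (_ * _), Complex.ofReal_mul ε⁻¹,
      integral_crossTerm (hz j hj) (h.inter_lt i j (Finset.ne_of_mem_erase hj).symm)]
    push_cast
    field_simp

end

end

end

/-! ### Continuous differentiability and the smallness conditions near ε = 0 -/

noncomputable section

open MeasureTheory Wiener

/-- The only place that limits the regularity in ε; the exponent has to exceed 1. -/
theorem contDiff_abs_rpow {α : ℝ} (hα : 1 < α) : ContDiff ℝ 1 fun ε : ℝ => |ε| ^ α :=
  contDiff_norm_rpow (E := ℝ) hα

section

variable {α ρ : ℝ} [hα : Fact (α ∈ Ioo (1 : ℝ) 2)] [hρ : Fact (1 ≤ ρ)]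
variable {E : Type*} [NormedAddCommGroup E] [NormedSpace ℝ E] {v : E}

theorem contDiffAt_scale {ε : E → ℝ} (hε : ContDiffAt ℝ 1 ε v) (b : ℝ) :
    ContDiffAt ℝ 1 (fun e => scale α (ε e) b) v :=
  (hε.mul ((contDiff_abs_rpow hα.out.1).contDiffAt.comp v hε)).mul contDiffAt_const

theorem contDiffAt_radK {η : E → ℝ} {G : E → Summ ℕ} (hη : ContDiffAt ℝ 1 η v)
    (hG : ContDiffAt ℝ 1 G v) : ContDiffAt ℝ 1 (fun e => radK α ρ (η e) (G e)) v :=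
  contDiffAt_const.add (hη.smul ((opF α ρ).contDiff.contDiffAt.comp v hG))

theorem contDiffAt_radKh {η : E → ℝ} {G : E → Summ ℕ} (hη : ContDiffAt ℝ 1 η v)
    (hG : ContDiffAt ℝ 1 G v) : ContDiffAt ℝ 1 (fun e => radKh α ρ (η e) (G e)) v :=
  contDiffAt_const.add (hη.smul ((opFh α ρ).contDiff.contDiffAt.comp v hG))

theorem contDiffAt_selfBeta {η : E → ℝ} {G : E → Summ ℕ} (hη : ContDiffAt ℝ 1 η v)
    (hG : ContDiffAt ℝ 1 G v) : ContDiffAt ℝ 1 (fun e => selfBeta α ρ (η e) (G e)) v := by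
  have hF := (opF α ρ).contDiff.contDiffAt.comp v hG
  have hFh := (opFh α ρ).contDiff.contDiffAt.comp v hG
  have hQ := (opQ α ρ).contDiff.contDiffAt.comp v hG
  exact (hF.add hFh).add (hη.smul ((hF.mul hFh).add (hQ.mul hQ)))

/-- Differentiability is only claimed at points with η = 0. There the argument of the series is 0,
its centre, whatever the profile is. -/
theorem contDiffAt_selfP {η : E → ℝ} {G : E → Summ ℕ} (hη : ContDiffAt ℝ 1 η v)
    (hG : ContDiffAt ℝ 1 G v) (h0 : η v = 0) :
    ContDiffAt ℝ 1 (fun e => selfP α ρ (η e) (G e)) v := by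
  have h1 : η v • selfBeta α ρ (η v) (G v) = 0 := by rw [h0, zero_smul]
  have h2 := contDiffAt_psi (A := Kern ρ) hα.out
  rw [← h1] at h2
  exact h2.comp v (hη.smul (contDiffAt_selfBeta hη hG))

theorem contDiffAt_selfB {η : E → ℝ} {G : E → Summ ℕ} (hη : ContDiffAt ℝ 1 η v)
    (hG : ContDiffAt ℝ 1 G v) (h0 : η v = 0) :
    ContDiffAt ℝ 1 (fun e => selfB α ρ (η e) (G e)) v :=
  contDiffAt_const.add (hη.smul ((contDiffAt_selfBeta hη hG).mul (contDiffAt_selfP hη hG h0)))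

theorem contDiffAt_selfReg {η : E → ℝ} {G : E → Summ ℕ} (hη : ContDiffAt ℝ 1 η v)
    (hG : ContDiffAt ℝ 1 G v) (h0 : η v = 0) :
    ContDiffAt ℝ 1 (fun e => selfReg α ρ (η e) (G e)) v := by
  have hF := (opF α ρ).contDiff.contDiffAt.comp v hG
  have hFh := (opFh α ρ).contDiff.contDiffAt.comp v hG
  have hD := (opD α ρ).contDiff.contDiffAt.comp v hG
  have hDh := (opDh α ρ).contDiff.contDiffAt.comp v hG
  have hQ := (opQ α ρ).contDiff.contDiffAt.comp v hG
  have hB := contDiffAt_selfB (α := α) (ρ := ρ) hη hG h0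
  have hP := contDiffAt_selfP (α := α) (ρ := ρ) hη hG h0
  have hb := contDiffAt_selfBeta (α := α) (ρ := ρ) hη hG
  exact (contDiffAt_const.mul ((((hF.add hFh).add (hη.smul (hF.mul hFh))).mul hB).add
    (hb.mul hP) |>.add (hη.smul ((hD.mul hDh).mul hB)))).add
    (hη.smul (((contDiffAt_const.mul hD).mul hQ).mul hB))

theorem contDiffAt_selfH {η : E → ℝ} {G : E → Summ ℕ} (hη : ContDiffAt ℝ 1 η v)
    (hG : ContDiffAt ℝ 1 G v) (h0 : η v = 0) :
    ContDiffAt ℝ 1 (fun e => selfH α ρ (η e) (G e)) v :=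
  ((intK _ _).contDiff.contDiffAt.comp v (contDiffAt_selfReg hη hG h0)).sub
    (((opS α ρ).contDiff.contDiffAt.comp v hG).clm_apply
      (contDiffAt_const.mul ((contDiffAt_radK hη hG).mul (contDiffAt_selfB hη hG h0))))

variable {ε : E → ℝ} {z : E → ℂ} {gi gj : E → Summ ℕ}

theorem contDiffAt_interTau (hε : ContDiffAt ℝ 1 ε v) (hz : ContDiffAt ℝ 1 z v)
    (hgi : ContDiffAt ℝ 1 gi v) (hgj : ContDiffAt ℝ 1 gj v) (hz0 : z v ≠ 0) (bi bj : ℝ) :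
    ContDiffAt ℝ 1 (fun e => interTau α ρ (ε e) bi bj (z e) (gi e) (gj e)) v := by
  have hRi := contDiffAt_radK (α := α) (ρ := ρ) (contDiffAt_scale (α := α) hε bi) hgi
  have hRj := contDiffAt_radKh (α := α) (ρ := ρ) (contDiffAt_scale (α := α) hε bj) hgj
  have hn : ContDiffAt ℝ 1 (fun e => (‖z e‖ ^ 2)⁻¹) v :=
    (hz.norm_sq ℝ).inv (pow_ne_zero _ (norm_ne_zero_iff.2 hz0))
  have hw := (waveK (ρ := ρ) 1 1).contDiff.contDiffAt.comp v hz
  have hw' := (waveK (ρ := ρ) 1 rotF).contDiff.contDiffAt.comp v hz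
  exact hn.smul ((((contDiffAt_const (c := (2 : ℝ))).smul
    (((contDiffAt_const (c := bi)).smul (hRi.mul hw)).sub
      ((contDiffAt_const (c := bj)).smul (hRj.mul hw')))).add
    (hε.smul ((((contDiffAt_const (c := bi ^ 2)).smul (hRi.mul hRi)).add
      ((contDiffAt_const (c := bj ^ 2)).smul (hRj.mul hRj))).sub
      ((contDiffAt_const (c := 2 * bi * bj)).smul ((hRi.mul hRj).mul contDiffAt_const))))))

theorem contDiffAt_interNum (hε : ContDiffAt ℝ 1 ε v)
    (hgi : ContDiffAt ℝ 1 gi v) (hgj : ContDiffAt ℝ 1 gj v) (bi bj : ℝ) :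
    ContDiffAt ℝ 1 (fun e => interNum α ρ (ε e) bi bj (gi e) (gj e)) v := by
  have hRi := contDiffAt_radK (α := α) (ρ := ρ) (contDiffAt_scale (α := α) hε bi) hgi
  have hRj := contDiffAt_radKh (α := α) (ρ := ρ) (contDiffAt_scale (α := α) hε bj) hgj
  have hF := (opF α ρ).contDiff.contDiffAt.comp v hgi
  have hFh := (opFh α ρ).contDiff.contDiffAt.comp v hgj
  have hD := (opD α ρ).contDiff.contDiffAt.comp v hgi
  have hDh := (opDh α ρ).contDiff.contDiffAt.comp v hgj
  have ha := (contDiff_abs_rpow hα.out.1).contDiffAt.comp v hε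
  exact (((((contDiffAt_const (c := bi ^ (1 + α))).smul hF).add
    ((contDiffAt_const (c := bj ^ (1 + α))).smul hFh)).add
    ((((hε.mul ha).mul contDiffAt_const).mul contDiffAt_const).smul
      ((hF.mul hFh).add (hD.mul hDh)))).mul contDiffAt_const).add
    ((((contDiffAt_const (c := bj ^ (1 + α))).smul (hRi.mul hDh)).sub
      ((contDiffAt_const (c := bi ^ (1 + α))).smul (hD.mul hRj))).mul contDiffAt_const)

theorem contDiffAt_interH (hε : ContDiffAt ℝ 1 ε v) (hz : ContDiffAt ℝ 1 z v)
    (hgi : ContDiffAt ℝ 1 gi v) (hgj : ContDiffAt ℝ 1 gj v) (h0 : ε v = 0) (hz0 : z v ≠ 0)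
    (bi bj : ℝ) :
    ContDiffAt ℝ 1 (fun e => interH α ρ (ε e) bi bj (z e) (gi e) (gj e)) v := by
  have hT := contDiffAt_interTau (α := α) (ρ := ρ) hε hz hgi hgj hz0 bi bj
  have hN := contDiffAt_interNum (α := α) (ρ := ρ) hε hgi hgj bi bj
  have ha := (contDiff_abs_rpow hα.out.1).contDiffAt.comp v hε
  have h1 : ε v • interTau α ρ (ε v) bi bj (z v) (gi v) (gj v) = 0 := by rw [h0, zero_smul]
  have h2 := contDiffAt_psi (A := Kern ρ) hα.out
  rw [← h1] at h2
  have hP := hT.mul (h2.comp v (hε.smul hT))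
  exact (intK (ρ := ρ) (fun _ => 1) intervalIntegrable_const).contDiff.contDiffAt.comp v
    ((contDiffAt_const.mul hP).add (ha.smul (hN.mul (contDiffAt_const.add (hε.smul hP)))))

variable {N : ℕ}

theorem contDiffAt_sepC {lam : E → Param N} (hl : ContDiffAt ℝ 1 lam v) (i j : Fin N) :
    ContDiffAt ℝ 1 (fun e => sepC (lam e) i j) v := by
  have hc : ∀ c, ContDiffAt ℝ 1 (fun e => ((lam e c : ℝ) : ℂ)) v := fun c =>
    Complex.ofRealCLM.contDiff.contDiffAt.comp v (contDiffAt_pi.1 hl c)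
  have := ((hc (0, i)).sub (hc (0, j))).sub (((hc (1, i)).sub (hc (1, j))).mul
    (contDiffAt_const (c := Complex.I)))
  refine this.congr_of_eventuallyEq (Eventually.of_forall fun e => ?_)
  simp only [sepC, Complex.ofReal_sub]

theorem contDiffAt_totalH {b : Fin N → ℝ} {g : E → Fin N → Summ ℕ} {lam : E → Param N}
    (hε : ContDiffAt ℝ 1 ε v) (hg : ContDiffAt ℝ 1 g v) (hl : ContDiffAt ℝ 1 lam v)
    (h0 : ε v = 0) (hd : Function.Injective (pos (lam v))) (i : Fin N) :
    ContDiffAt ℝ 1 (fun e => totalH α ρ b (ε e) (g e) (lam e) i) v := by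
  have hs : ∀ j, ContDiffAt ℝ 1 (fun e => strength (lam e) j) v := fun j =>
    contDiffAt_pi.1 hl (2, j)
  have h1 := contDiffAt_selfH (α := α) (ρ := ρ) (contDiffAt_scale (α := α) hε (b i))
    (contDiffAt_pi.1 hg i) (by rw [h0, scale_zero])
  refine ContDiffAt.smul (contDiffAt_const (c := kernelConst α / (2 * Real.pi)))
    (ContDiffAt.add ((hs i).smul h1) (ContDiffAt.sum fun j hj => ?_))
  have hz := sepC_ne_zero hd (Finset.ne_of_mem_erase hj).symm
  have hzc := contDiffAt_sepC hl i j
  exact (((hs j).div_const _).mul ((hzc.norm ℝ hz).rpow_const_of_ne (norm_ne_zero_iff.2 hz))).smul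
    (contDiffAt_interH hε hzc (contDiffAt_pi.1 hg i) (contDiffAt_pi.1 hg j) h0 hz _ _)

theorem contDiff_glue (S : Finset (Coord N)) (lam : Param N) : ContDiff ℝ 1 (glue S lam) := by
  refine contDiff_pi.2 fun c => ?_
  by_cases hc : c ∈ S
  · simp only [glue, dif_pos hc]
    exact contDiff_apply ℝ ℝ _
  · simp only [glue, dif_neg hc]
    exact contDiff_const

theorem glue_freePart (S : Finset (Coord N)) (lam : Param N) : glue S lam (freePart S lam) = lam := by
  funext c
  by_cases hc : c ∈ S
  · rw [glue, dif_pos hc]; rfl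
  · rw [glue, dif_neg hc]

theorem selfBeta_zero (η : ℝ) : selfBeta α ρ η 0 = 0 := by
  simp [selfBeta]

/-- The smallness conditions hold near the unperturbed configuration. -/
theorem eventually_admissible (b : Fin N → ℝ) {lam : Param N}
    (hd : Function.Injective (pos lam)) (S : Finset (Coord N)) :
    ∀ᶠ p : ℝ × (Fin N → Summ ℕ) × (S → ℝ) in 𝓝 (0, 0, freePart S lam),
      Admissible α ρ b p.1 p.2.1 (glue S lam p.2.2) := by
  have hε : ContDiffAt ℝ 1 (fun p : ℝ × (Fin N → Summ ℕ) × (S → ℝ) => p.1)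
    (0, 0, freePart S lam) := contDiffAt_fst
  have hg : ContDiffAt ℝ 1 (fun p : ℝ × (Fin N → Summ ℕ) × (S → ℝ) => p.2.1)
    (0, 0, freePart S lam) := contDiffAt_fst.comp _ contDiffAt_snd
  have hl : ContDiffAt ℝ 1 (fun p : ℝ × (Fin N → Summ ℕ) × (S → ℝ) => glue S lam p.2.2)
    (0, 0, freePart S lam) :=
    (contDiff_glue S lam).contDiffAt.comp _ (contDiffAt_snd.comp _ contDiffAt_snd)
  have hgl := glue_freePart S lam
  have e1 : ∀ᶠ p : ℝ × (Fin N → Summ ℕ) × (S → ℝ) in 𝓝 (0, 0, freePart S lam),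
      ∀ i j, i ≠ j → sepC (glue S lam p.2.2) i j ≠ 0 := by
    refine eventually_all.2 fun i => eventually_all.2 fun j => ?_
    by_cases hij : i = j
    · exact Eventually.of_forall fun _ h => absurd hij h
    · refine ((contDiffAt_sepC hl i j).continuousAt.eventually_ne ?_).mono fun p hp _ => hp
      simp only [hgl]
      exact sepC_ne_zero hd hij
  have small : ∀ F : ℝ × (Fin N → Summ ℕ) × (S → ℝ) → Kern ρ,
      ContinuousAt F (0, 0, freePart S lam) → F (0, 0, freePart S lam) = 0 →
      ∀ᶠ p in 𝓝 (0, 0, freePart S lam), ‖F p‖ < 1 := fun F hF h0 =>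
    hF.norm.eventually_lt continuousAt_const (by rw [h0, norm_zero]; exact one_pos)
  have e2 := eventually_all.2 fun i => small (fun p => scale α p.1 (b i) • opF α ρ (p.2.1 i))
    ((contDiffAt_scale hε (b i)).smul ((opF α ρ).contDiff.contDiffAt.comp _
      (contDiffAt_pi.1 hg i))).continuousAt (by simp [scale_zero])
  have e3 := eventually_all.2 fun i => small
    (fun p => scale α p.1 (b i) • selfBeta α ρ (scale α p.1 (b i)) (p.2.1 i))
    ((contDiffAt_scale hε (b i)).smul (contDiffAt_selfBeta (contDiffAt_scale hε (b i))
      (contDiffAt_pi.1 hg i))).continuousAt (by simp [scale_zero])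
  have e4 : ∀ᶠ p : ℝ × (Fin N → Summ ℕ) × (S → ℝ) in 𝓝 (0, 0, freePart S lam), ∀ i j, i ≠ j →
      ‖p.1 • interTau α ρ p.1 (b i) (b j) (sepC (glue S lam p.2.2) i j) (p.2.1 i) (p.2.1 j)‖ < 1 := by
    refine eventually_all.2 fun i => eventually_all.2 fun j => ?_
    by_cases hij : i = j
    · exact Eventually.of_forall fun _ h => absurd hij h
    · refine (small (fun p => p.1 • interTau α ρ p.1 (b i) (b j) (sepC (glue S lam p.2.2) i j)
        (p.2.1 i) (p.2.1 j)) (hε.smul (contDiffAt_interTau hε (contDiffAt_sepC hl i j)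
          (contDiffAt_pi.1 hg i) (contDiffAt_pi.1 hg j) ?_ _ _)).continuousAt
          (by simp)).mono fun p hp _ => hp
      simp only [hgl]
      exact sepC_ne_zero hd hij
  filter_upwards [e1, e2, e3, e4] with p h1 h2 h3 h4
  refine ⟨fun i j hij => ?_, h2, h3, h4⟩
  by_contra hne
  have := h1 i j hne
  rw [← norm_pos_iff, norm_sepC, norm_pos_iff, sub_ne_zero] at this
  exact this hij

end

end

/-! ### The linearisation at discs -/

noncomputable section

open MeasureTheory Wiener

namespace Summ

/-- The diagonal operator with the multipliers `m n`. -/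
def diag (m : ℕ → ℂ) (C : ℝ) (hm : ∀ n, ‖m n‖ ≤ C) : Summ ℕ →L[ℝ] Summ ℕ :=
  lift (fun n => single n ∘L ContinuousLinearMap.mul ℝ ℂ (m n)) C fun n => by
    refine ContinuousLinearMap.opNorm_le_bound _ ((norm_nonneg _).trans (hm n)) fun z => ?_
    rw [ContinuousLinearMap.comp_apply, norm_single_apply, ContinuousLinearMap.mul_apply', norm_mul]
    exact mul_le_mul_of_nonneg_right (hm n) (norm_nonneg z)

theorem diag_single (m : ℕ → ℂ) (C : ℝ) (hm : ∀ n, ‖m n‖ ≤ C) (n : ℕ) (z : ℂ) :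
    diag m C hm (single n z) = single n (m n * z) := lift_single _ n z

theorem diag_comp_diag {m m' : ℕ → ℂ} {C C' : ℝ} (hm : ∀ n, ‖m n‖ ≤ C) (hm' : ∀ n, ‖m' n‖ ≤ C')
    (h : ∀ n, m n * m' n = 1) :
    diag m C hm ∘L diag m' C' hm' = ContinuousLinearMap.id ℝ (Summ ℕ) :=
  clm_ext fun n z => by
    rw [ContinuousLinearMap.comp_apply, diag_single, diag_single, ← mul_assoc, h, one_mul]; rfl

end Summ

section

variable (α ρ : ℝ) [hα : Fact (α ∈ Ioo (1 : ℝ) 2)] [hρ : Fact (1 ≤ ρ)]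

/-- The linearised self-interaction. -/
def selfLin : Summ ℕ →L[ℝ] Wiener ρ :=
  intK (ρ := ρ) (fun h => chord h ^ (1 - α)) (intervalIntegrable_chord_one_sub hα.out) ∘L
    (ContinuousLinearMap.mul ℝ (Kern ρ) ((1 - α / 2) • ker cosHalf) ∘L (opF α ρ + opFh α ρ)) -
  (opS α ρ).flip (ker cosF)

variable {α ρ}

theorem selfLin_apply (g : Summ ℕ) : selfLin α ρ g =
    intK (fun h => chord h ^ (1 - α)) (intervalIntegrable_chord_one_sub hα.out)
      ((1 - α / 2) • ker cosHalf * (opF α ρ g + opFh α ρ g)) - opS α ρ g (ker cosF) := rfl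

theorem selfH_zero (g : Summ ℕ) : selfH α ρ 0 g = selfLin α ρ g := by
  have hP : selfP α ρ 0 g = algebraMap ℝ (Kern ρ) (-(α / 2)) := by
    rw [selfP, zero_smul, psi_zero hα.out]
  have hB : selfB α ρ 0 g = 1 := by rw [selfB, zero_smul, add_zero]
  have hb : selfBeta α ρ 0 g = opF α ρ g + opFh α ρ g := by rw [selfBeta, zero_smul, add_zero]
  rw [selfLin_apply, selfH, selfReg, hP, hB, hb, radK]
  simp only [zero_smul, add_zero, mul_one]
  congr 2
  rw [Algebra.algebraMap_eq_smul_one, mul_smul_comm, mul_one, mul_add, mul_smul_comm, smul_mul_assoc,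
    sub_smul, one_smul, neg_smul, sub_eq_add_neg]

theorem opF_single (n : ℕ) (z : ℂ) :
    opF α ρ (Summ.single n z) = cw α ρ n • waveK (n + 2) 1 z := by
  rw [opF, liftK, Summ.lift_single]; rfl

theorem opFh_single (n : ℕ) (z : ℂ) :
    opFh α ρ (Summ.single n z) = cw α ρ n • waveK (n + 2) (phiShift n) z := by
  rw [opFh, liftK, Summ.lift_single]; rfl

theorem opS_single (n : ℕ) (z : ℂ) (G : Kern ρ) :
    opS α ρ (Summ.single n z) G = cw α ρ n • singTerm α ρ n z G := by
  refine (hasSum_opS (Summ.single n z) G).unique ?_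
  have := hasSum_ite_eq n (cw α ρ n • singTerm α ρ n z G)
  refine this.congr_fun ?_ |> id
  intro j
  by_cases hj : j = n
  · subst hj; simp [Summ.single_apply]
  · simp [Summ.single_apply, hj]

/-- The weights depend on h alone, so `symbol_eq` gives the multiplier. The summand coming from f(x)
contributes the vanishing integral of chord^{1-α} cos(h/2). -/
theorem selfLin_single (n : ℕ) (z : ℂ) : selfLin α ρ (Summ.single n z) =
    wave (n + 2) ((cw α ρ n : ℂ) * (z * (-(((n + 2 : ℕ) : ℂ) * Complex.I) *
      ((moment α (n + 2) - moment α 1 : ℝ) : ℂ)))) := by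
  have hs := symbol_eq hα.out (n + 2)
  have hc0 := integral_cos_half hα.out
  have i1 : ∫ h in (0 : ℝ)..(2 * Real.pi), ((chord h ^ (1 - α) * cosHalf h : ℝ) : ℂ) *
      (1 : BoundedContinuousFunction ℝ ℂ) h = 0 := by
    have : ∀ h, ((chord h ^ (1 - α) * cosHalf h : ℝ) : ℂ) *
      (1 : BoundedContinuousFunction ℝ ℂ) h = ((chord h ^ (1 - α) * Real.cos (h / 2) : ℝ) : ℂ) :=
      fun h => mul_one _
    simp only [this]
    rw [intervalIntegral.integral_ofReal, hc0, Complex.ofReal_zero]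
  have i2 : ∫ h in (0 : ℝ)..(2 * Real.pi), ((chord h ^ (1 - α) * cosHalf h : ℝ) : ℂ) * phiShift n h =
      ∫ h in (0 : ℝ)..(2 * Real.pi), ((chord h ^ (1 - α) * Real.cos (h / 2) : ℝ) : ℂ) *
        Complex.exp (-(((n + 2 : ℕ) : ℂ) * h * Complex.I)) := by
    simp only [phiShift_eq]; rfl
  have i3 : ∫ h in (0 : ℝ)..(2 * Real.pi), (cosF h : ℂ) * singAmp α n h =
      ((n + 2 : ℕ) : ℂ) * Complex.I * (∫ h in (0 : ℝ)..(2 * Real.pi), (Real.cos h : ℂ) *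
      (((1 : ℂ) - Complex.exp (-(((n + 2 : ℕ) : ℂ) * h * Complex.I))) * (chord h ^ (-α) : ℝ))) := by
    rw [← intervalIntegral.integral_const_mul]
    refine intervalIntegral.integral_congr fun h _ => ?_
    simp only [singAmp, phiShift_eq, cosF_apply]
    push_cast; ring
  rw [selfLin_apply, opF_single, opFh_single, opS_single, singTerm_ker, ← smul_add, mul_smul_comm,
    map_smul, smul_mul_assoc, map_smul, mul_add, map_add, intK_ker_mul_waveK, intK_ker_mul_waveK,
    i1, i2, i3, mul_zero, map_zero, zero_add, ← smul_sub, ← map_smul, ← map_sub, ← map_smul, ← hs]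
  congr 1
  simp only [Complex.real_smul]
  ring

variable (α) in
/-- The multipliers of the linearised self-interaction. -/
def mult (n : ℕ) : ℂ :=
  -((((n : ℝ) + 2) ^ (1 - α) * (moment α (n + 2) - moment α 1) / 2 : ℝ) : ℂ) * Complex.I

theorem high_selfLin_single (n : ℕ) (z : ℂ) :
    high (selfLin α ρ (Summ.single n z)) = Summ.single n (mult α n * z) := by
  have h1 : 0 < ρ := lt_of_lt_of_le one_pos hρ.out
  rw [selfLin_single, high_wave]
  congr 1
  have hn : (0 : ℝ) < (n : ℝ) + 2 := by positivity
  have h2 : ρ ^ (n + 2) * (cw α ρ n * ((n : ℝ) + 2)) = ((n : ℝ) + 2) ^ (1 - α) := by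
    rw [cw, Real.rpow_sub hn, Real.rpow_one]
    field_simp
  rw [mult, ← h2]
  push_cast
  ring

/-- Profiles start at mode two and multipliers preserve modes. Hence mode one of the functional at ε
= 0 depends on the vortex parameters only. -/
theorem coef_one_selfLin (g : Summ ℕ) : coef 1 (selfLin α ρ g) = 0 := by
  have : coef 1 ∘L selfLin α ρ = 0 := Summ.clm_ext fun n z => by
    rw [ContinuousLinearMap.comp_apply, selfLin_single, coef_wave _ _ _ one_pos,
      if_neg (by push_cast; omega)]
    rfl
  exact congrArg (fun T => T g) this

variable (α) in
-- The lower bound is the spectral gap. The upper bound is free: the multipliers do not depend on ρ,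
-- and each is the norm of the image of a unit vector under one bounded operator, taken at ρ = 1.
theorem exists_mult_bounds : ∃ c C : ℝ, 0 < c ∧ ∀ n, c ≤ ‖mult α n‖ ∧ ‖mult α n‖ ≤ C := by
  obtain ⟨c, hc, h⟩ := exists_moment_sub_ge hα.out
  have : Fact ((1 : ℝ) ≤ 1) := ⟨le_rfl⟩
  refine ⟨c / 2, ‖high ∘L selfLin α 1‖, by positivity, fun n => ⟨?_, ?_⟩⟩
  · have hn : (0 : ℝ) < (n : ℝ) + 2 := by positivity
    have h1 := h (n + 2) (by omega)
    rw [mult, norm_mul, norm_neg, Complex.norm_I, mul_one, Complex.norm_real]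
    refine le_trans ?_ (le_abs_self _)
    have h2 : ((n : ℝ) + 2) ^ (1 - α) * ((n : ℝ) + 2) ^ (α - 1) = 1 := by
      rw [← Real.rpow_add hn]; simp
    have h3 : (((n + 2 : ℕ) : ℝ)) = (n : ℝ) + 2 := by push_cast; rfl
    rw [h3] at h1
    have h4 := mul_le_mul_of_nonneg_left h1 (Real.rpow_nonneg hn.le (1 - α))
    have h5 : ((n : ℝ) + 2) ^ (1 - α) * (c * ((n : ℝ) + 2) ^ (α - 1)) = c := by
      rw [mul_left_comm, h2, mul_one]
    linarith
  · have h1 := (high ∘L selfLin α 1).le_opNorm (Summ.single n 1)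
    rw [ContinuousLinearMap.comp_apply, high_selfLin_single, Summ.norm_single_apply,
      Summ.norm_single_apply, mul_one, norm_one, mul_one] at h1
    exact h1

theorem mult_ne_zero (n : ℕ) : mult α n ≠ 0 := by
  obtain ⟨c, C, hc, h⟩ := exists_mult_bounds α
  exact norm_pos_iff.1 (hc.trans_le (h n).1)

variable (α) in
theorem exists_multDiag_inverse : ∃ T : Summ ℕ →L[ℝ] Summ ℕ,
    (∀ n z, T (Summ.single n z) = Summ.single n (mult α n * z)) ∧ ∃ T' : Summ ℕ →L[ℝ] Summ ℕ,
    T ∘L T' = ContinuousLinearMap.id ℝ _ ∧ T' ∘L T = ContinuousLinearMap.id ℝ _ := by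
  obtain ⟨c, C, hc, h⟩ := exists_mult_bounds α
  have h' : ∀ n, ‖(mult α n)⁻¹‖ ≤ c⁻¹ := fun n => by
    rw [norm_inv]; exact inv_anti₀ hc (h n).1
  refine ⟨Summ.diag (mult α) C fun n => (h n).2, fun n z => Summ.diag_single _ _ _ n z,
    Summ.diag _ _ h', Summ.diag_comp_diag _ _ fun n => mul_inv_cancel₀ (mult_ne_zero n),
    Summ.diag_comp_diag _ _ fun n => inv_mul_cancel₀ (mult_ne_zero n)⟩

/-- The linearised self-interaction on the modes of index at least two is invertible. -/
theorem high_selfLin_inverse : ∃ T' : Summ ℕ →L[ℝ] Summ ℕ,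
    (high ∘L selfLin α ρ) ∘L T' = ContinuousLinearMap.id ℝ _ ∧
      T' ∘L (high ∘L selfLin α ρ) = ContinuousLinearMap.id ℝ _ := by
  obtain ⟨T, hT, T', h1, h2⟩ := exists_multDiag_inverse α
  have : high ∘L selfLin α ρ = T := Summ.clm_ext fun n z => by
    rw [ContinuousLinearMap.comp_apply, high_selfLin_single, hT]
  rw [this]
  exact ⟨T', h1, h2⟩

theorem kernelConst_pos : 0 < kernelConst α := by
  have h1 := hα.out.1
  have h2 := hα.out.2
  have := Real.Gamma_pos_of_pos (s := α / 2) (by linarith)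
  have := Real.Gamma_pos_of_pos (s := (2 - α) / 2) (by linarith)
  unfold kernelConst
  positivity

/-- The complex number `p₁ + i p₀`. -/
def angC (p : Plane) : ℂ := ⟨p 1, p 0⟩

theorem re_angC_mul_exp (p : Plane) (x : ℝ) :
    (angC p * Complex.exp (x * Complex.I)).re = inner ℝ p (angular x) := by
  rw [re_mul_exp, Plane.inner_eq]
  simp [angC, angular]
  ring

/-- The component `p` of the mode of index one `p · e^⊥`. -/
def modeOne : Wiener ρ →L[ℝ] Plane :=
  LinearMap.toContinuousLinearMap
    { toFun := fun z : ℂ => (!₂[2 * z.im, 2 * z.re] : Plane)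
      map_add' := fun z w => by ext i; fin_cases i <;> simp <;> ring
      map_smul' := fun c z => by ext i; fin_cases i <;> simp <;> ring } ∘L coef 1

theorem modeOne_apply (a : Wiener ρ) :
    modeOne a = (!₂[2 * (coef 1 a).im, 2 * (coef 1 a).re] : Plane) := rfl

theorem modeOne_wave (p : Plane) : modeOne (wave (ρ := ρ) 1 (angC p)) = p := by
  rw [modeOne_apply, coef_wave _ _ _ one_pos, if_pos Nat.cast_one.symm]
  ext i
  fin_cases i <;> simp [angC] <;> ring

theorem modeOne_selfLin (g : Summ ℕ) : modeOne (selfLin α ρ g) = 0 := by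
  rw [modeOne_apply, coef_one_selfLin]
  ext i
  fin_cases i <;> simp

variable {N : ℕ}

theorem admissible_zero (b : Fin N → ℝ) (g : Fin N → Summ ℕ) {lam : Param N}
    (hd : Function.Injective (pos lam)) : Admissible α ρ b 0 g lam :=
  ⟨hd, fun i => by simp [scale_zero], fun i => by simp [scale_zero], fun i j _ => by simp⟩

/-- The radius is 1 at ε = 0, so the functional is the sum of a linear operator in the profiles and
a first mode carrying P_i. This decoupling is what makes the linearisation block diagonal. -/
theorem totalH_zero {b : Fin N → ℝ} (hb : ∀ i, 0 < b i) (g : Fin N → Summ ℕ) {lam : Param N}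
    (hd : Function.Injective (pos lam)) (i : Fin N) :
    totalH α ρ b 0 g lam i = (kernelConst α / (2 * Real.pi) * strength lam i) • selfLin α ρ (g i) +
      wave 1 (angC (pointVortexMap α lam i)) := by
  refine ext_evL fun x => ?_
  rw [← ev_eq, ← ev_eq, ev_totalH hb (admissible_zero b g hd), map_add, map_smul, Complex.real_smul, ← selfH_zero,
    ev_selfH_zero, ev_wave, functional, if_pos rfl]
  have h1 : radius α 0 (b i) (prof α ρ (g i)) x = 1 := by simp [radius]
  have h2 := re_angC_mul_exp (pointVortexMap α lam i) x
  rw [h1, one_mul, Complex.ofReal_add]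
  congr 2
  rw [← h2]
  congr 3
  push_cast
  rw [one_mul]

end

section

variable {N : ℕ} {α : ℝ} {lam : Param N} {S : Finset (Coord N)}

/-- The range has dimension 2N - 3, which is also the number of free coordinates, so rank-nullity
gives injectivity. -/
theorem exists_partialDeriv_leftInverse (hS : IsNondegenerate α lam S) :
    ∃ A : (Fin N → Plane) →L[ℝ] (S → ℝ),
      A ∘L partialDeriv α S lam = ContinuousLinearMap.id ℝ _ := by
  set D := (partialDeriv α S lam).toLinearMap
  have h1 := Submodule.finrank_quotient_add_finrank (LinearMap.range D)
  have h2 := LinearMap.finrank_range_add_finrank_ker D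
  rw [hS.codim_range] at h1
  have h3 : Module.finrank ℝ (Fin N → Plane) = 2 * N := by
    rw [Module.finrank_pi_fintype]; simp [mul_comm]
  have h4 : Module.finrank ℝ (S → ℝ) = S.card := by simp
  have h5 := hS.card_free
  have h6 : Module.finrank ℝ (LinearMap.ker D) = 0 := by omega
  have h7 : LinearMap.ker D = ⊥ := Submodule.finrank_eq_zero.1 h6
  obtain ⟨A, hA⟩ := LinearMap.exists_leftInverse_of_injective D h7
  refine ⟨LinearMap.toContinuousLinearMap A, ?_⟩
  ext1 μ
  exact congrArg (fun T => T μ) hA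

end

end

/-! ### The contour map and its derivative at the equilibrium -/

noncomputable section

open MeasureTheory Wiener

/-- The derivative of the power series at its centre is the coefficient of the linear term. -/
theorem hasDerivAt_psi_comp {A : Type*} [NormedCommRing A] [NormedAlgebra ℝ A] [CompleteSpace A]
    [NormOneClass A] {α : ℝ} (hα : α ∈ Ioo (1 : ℝ) 2) {F : ℝ → A} {F' : A} {t : ℝ}
    (hF : HasDerivAt F F' t) (h0 : F t = 0) :
    HasDerivAt (fun s => psi α (F s)) (binomCoeff α 1 • F') t := by
  have h1 : (1 : ENNReal) ≤ (FormalMultilinearSeries.ofScalars A (binomCoeff α)).radius := by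
    have := (FormalMultilinearSeries.ofScalars A (binomCoeff α)).le_radius_of_bound (r := 1) 1
      (fun n => by
        rw [FormalMultilinearSeries.ofScalars_norm, NNReal.coe_one, one_pow, mul_one]
        exact abs_choose_le_one hα _)
    simpa using this
  have h2 := (FormalMultilinearSeries.ofScalars A (binomCoeff α)).hasFPowerSeriesOnBall
    (lt_of_lt_of_le one_pos h1)
  have h3 : (FormalMultilinearSeries.ofScalars A (binomCoeff α)).sum = (psi α : A → A) :=
    FormalMultilinearSeries.ofScalarsSum_eq_tsum (binomCoeff α)
  rw [h3] at h2
  have h4 := h2.hasFPowerSeriesAt.hasFDerivAt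
  rw [← h0] at h4
  refine (h4.comp_hasDerivAt t hF).congr_deriv ?_
  rw [continuousMultilinearCurryFin1_apply, FormalMultilinearSeries.ofScalars]
  simp

section

variable {N : ℕ}

variable (α ρ : ℝ) [hα : Fact (α ∈ Ioo (1 : ℝ) 2)] [hρ : Fact (1 ≤ ρ)]

/-- The contour equation reduced by the projection `A` of the mode of index one. -/
def contourMap (b : Fin N → ℝ) (lam : Param N) (S : Finset (Coord N))
    (A : (Fin N → Plane) →L[ℝ] (S → ℝ)) (p : ℝ × (Fin N → Summ ℕ) × (S → ℝ)) :
    (Fin N → Summ ℕ) × (S → ℝ) :=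
  (fun i => high (totalH α ρ b p.1 p.2.1 (glue S lam p.2.2) i),
    A fun i => modeOne (totalH α ρ b p.1 p.2.1 (glue S lam p.2.2) i))

/-- The derivative of the contour map in the unknowns. -/
def contourDeriv (lam : Param N) (S : Finset (Coord N)) :
    ((Fin N → Summ ℕ) × (S → ℝ)) →L[ℝ] ((Fin N → Summ ℕ) × (S → ℝ)) :=
  ContinuousLinearMap.prodMap (ContinuousLinearMap.pi fun i =>
    (kernelConst α / (2 * Real.pi) * strength lam i) •
      ((high ∘L selfLin α ρ) ∘L ContinuousLinearMap.proj i)) (ContinuousLinearMap.id ℝ _)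

variable {α ρ} {b : Fin N → ℝ} {lam : Param N} {S : Finset (Coord N)}
  {A : (Fin N → Plane) →L[ℝ] (S → ℝ)}

theorem contDiffAt_contourMap (hd : Function.Injective (pos lam)) :
    ContDiffAt ℝ 1 (contourMap α ρ b lam S A) (0, 0, freePart S lam) := by
  have hl : ContDiffAt ℝ 1 (fun p : ℝ × (Fin N → Summ ℕ) × (S → ℝ) => glue S lam p.2.2)
    (0, 0, freePart S lam) :=
    (contDiff_glue S lam).contDiffAt.comp _ (contDiffAt_snd.comp _ contDiffAt_snd)
  have h : ∀ i, ContDiffAt ℝ 1 (fun p : ℝ × (Fin N → Summ ℕ) × (S → ℝ) =>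
      totalH α ρ b p.1 p.2.1 (glue S lam p.2.2) i) (0, 0, freePart S lam) := fun i =>
    contDiffAt_totalH contDiffAt_fst (contDiffAt_fst.comp _ contDiffAt_snd) hl rfl
      (by simpa only [glue_freePart] using hd) i
  exact (contDiffAt_pi.2 fun i => high.contDiff.contDiffAt.comp _ (h i)).prodMk
    (A.contDiff.contDiffAt.comp _ (contDiffAt_pi.2 fun i => modeOne.contDiff.contDiffAt.comp _ (h i)))

theorem high_totalH_zero (hb : ∀ i, 0 < b i) (g : Fin N → Summ ℕ)
    (hd : Function.Injective (pos lam)) (i : Fin N) : high (totalH α ρ b 0 g lam i) =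
      (kernelConst α / (2 * Real.pi) * strength lam i) • high (selfLin α ρ (g i)) := by
  rw [totalH_zero hb g hd, map_add, map_smul, high_wave_one, add_zero]

theorem modeOne_totalH_zero (hb : ∀ i, 0 < b i) (g : Fin N → Summ ℕ)
    (hd : Function.Injective (pos lam)) (i : Fin N) : modeOne (totalH α ρ b 0 g lam i) =
      pointVortexMap α lam i := by
  rw [totalH_zero hb g hd, map_add, map_smul, modeOne_selfLin, smul_zero, zero_add, modeOne_wave]

theorem contourMap_base (hb : ∀ i, 0 < b i) (hlam : IsStationary α lam) :
    contourMap α ρ b lam S A (0, 0, freePart S lam) = 0 := by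
  have e : (fun i => pointVortexMap α lam i) = 0 := funext hlam.equilibrium
  refine Prod.ext (funext fun i => ?_) ?_
  · change high (totalH α ρ b 0 0 (glue S lam (freePart S lam)) i) = 0
    rw [glue_freePart, high_totalH_zero hb 0 hlam.distinct, Pi.zero_apply, map_zero, map_zero,
      smul_zero]
  · change A (fun i => modeOne (totalH α ρ b 0 0 (glue S lam (freePart S lam)) i)) = 0
    simp only [glue_freePart, modeOne_totalH_zero (α := α) (ρ := ρ) hb 0 hlam.distinct]
    rw [e, map_zero]

/-- Near the equilibrium P is mode one of the functional at ε = 0 with zero profiles, so its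
differentiability is inherited. The values b_i = 1 and ρ = 1 are arbitrary. -/
theorem hasFDerivAt_pointVortexMap (α : ℝ) [hα : Fact (α ∈ Ioo (1 : ℝ) 2)]
    (hd : Function.Injective (pos lam)) :
    HasFDerivAt (fun μ : S → ℝ => pointVortexMap α (glue S lam μ)) (partialDeriv α S lam)
      (freePart S lam) := by
  have : Fact ((1 : ℝ) ≤ 1) := ⟨le_rfl⟩
  refine DifferentiableAt.hasFDerivAt ?_
  have h1 : ∀ i, ContDiffAt ℝ 1 (fun μ : S → ℝ =>
      totalH α 1 (fun _ : Fin N => 1) 0 0 (glue S lam μ) i) (freePart S lam) := fun i =>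
    contDiffAt_totalH (g := fun _ => 0) contDiffAt_const contDiffAt_const
      (contDiff_glue S lam).contDiffAt rfl
      (by simpa only [glue_freePart] using hd) i
  have h2 := (contDiffAt_pi.2 fun i => modeOne.contDiff.contDiffAt.comp _ (h1 i)).differentiableAt
    one_ne_zero
  refine h2.congr_of_eventuallyEq ?_
  have hc : Tendsto (fun μ : S → ℝ => ((0 : ℝ), (0 : Fin N → Summ ℕ), μ)) (𝓝 (freePart S lam))
      (𝓝 (0, 0, freePart S lam)) := Continuous.tendsto (by fun_prop) _
  filter_upwards [hc.eventually (eventually_admissible (α := α) (ρ := 1) (fun _ => 1) hd S)] with μ hμ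
  funext i
  exact (modeOne_totalH_zero (fun _ => one_pos) 0 hμ.distinct i).symm

/-- At ε = 0 the high modes are linear in the profiles, with coefficients proportional to the
strengths, and mode one is P. Composition with the left inverse A makes the parameter block the
identity. -/
theorem fderiv_contourMap_inr (hb : ∀ i, 0 < b i) (hlam : IsStationary α lam)
    (hA : A ∘L partialDeriv α S lam = ContinuousLinearMap.id ℝ _) :
    fderiv ℝ (contourMap α ρ b lam S A) (0, 0, freePart S lam) ∘L
      ContinuousLinearMap.inr ℝ ℝ ((Fin N → Summ ℕ) × (S → ℝ)) = contourDeriv α ρ lam S := by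
  have h1 := ((contDiffAt_contourMap (α := α) (ρ := ρ) (b := b) (S := S) (A := A)
    hlam.distinct).differentiableAt one_ne_zero).hasFDerivAt
  have h2 := h1.comp ((0, freePart S lam) : (Fin N → Summ ℕ) × (S → ℝ))
    (hasFDerivAt_prodMk_right (0 : ℝ) ((0, freePart S lam) : (Fin N → Summ ℕ) × (S → ℝ)))
  refine h2.unique ?_
  have hp : HasFDerivAt (fun q : (Fin N → Summ ℕ) × (S → ℝ) =>
      A (pointVortexMap α (glue S lam q.2))) (ContinuousLinearMap.snd ℝ (Fin N → Summ ℕ) (S → ℝ))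
      (0, freePart S lam) := by
    have h3 := A.hasFDerivAt.comp (freePart S lam)
      (hasFDerivAt_pointVortexMap (S := S) α hlam.distinct)
    rw [hA] at h3
    have h4 : HasFDerivAt (fun q : (Fin N → Summ ℕ) × (S → ℝ) => q.2)
      (ContinuousLinearMap.snd ℝ (Fin N → Summ ℕ) (S → ℝ)) (0, freePart S lam) := hasFDerivAt_snd
    exact (HasFDerivAt.comp (g := fun μ : S → ℝ => A (pointVortexMap α (glue S lam μ)))
      (f := fun q : (Fin N → Summ ℕ) × (S → ℝ) => q.2)
      ((0, freePart S lam) : (Fin N → Summ ℕ) × (S → ℝ)) h3 h4).congr_fderiv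
      (ContinuousLinearMap.id_comp _)
  have key : ∀ (T : Summ ℕ →L[ℝ] Summ ℕ) (i : Fin N),
      HasFDerivAt (fun q : (Fin N → Summ ℕ) × (S → ℝ) => T (q.1 i))
        ((T ∘L ContinuousLinearMap.proj i) ∘L
          ContinuousLinearMap.fst ℝ (Fin N → Summ ℕ) (S → ℝ)) (0, freePart S lam) := fun T i =>
    ((T ∘L (ContinuousLinearMap.proj i : (Fin N → Summ ℕ) →L[ℝ] Summ ℕ)) ∘L
          ContinuousLinearMap.fst ℝ (Fin N → Summ ℕ) (S → ℝ)).hasFDerivAt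
  have hq : ∀ i, HasFDerivAt (fun q : (Fin N → Summ ℕ) × (S → ℝ) =>
      (kernelConst α / (2 * Real.pi) * strength (glue S lam q.2) i) •
        (high ∘L selfLin α ρ) (q.1 i))
      (((kernelConst α / (2 * Real.pi) * strength lam i) •
      ((high ∘L selfLin α ρ) ∘L ContinuousLinearMap.proj i)) ∘L
        ContinuousLinearMap.fst ℝ (Fin N → Summ ℕ) (S → ℝ)) (0, freePart S lam) := by
    intro i
    have hc : DifferentiableAt ℝ (fun q : (Fin N → Summ ℕ) × (S → ℝ) =>
        kernelConst α / (2 * Real.pi) * strength (glue S lam q.2) i) (0, freePart S lam) := by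
      have h4 : ContDiffAt ℝ 1 (fun q : (Fin N → Summ ℕ) × (S → ℝ) => glue S lam q.2)
          (0, freePart S lam) := (contDiff_glue S lam).contDiffAt.comp _ contDiffAt_snd
      exact (contDiffAt_const.mul (contDiffAt_pi.1 h4 (2, i))).differentiableAt one_ne_zero
    have hf : HasFDerivAt (fun q : (Fin N → Summ ℕ) × (S → ℝ) => (high ∘L selfLin α ρ) (q.1 i))
        (((high ∘L selfLin α ρ) ∘L ContinuousLinearMap.proj i) ∘L
          ContinuousLinearMap.fst ℝ (Fin N → Summ ℕ) (S → ℝ)) (0, freePart S lam) :=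
      key (high ∘L selfLin α ρ) i
    refine (hc.hasFDerivAt.smul hf).congr_fderiv ?_
    -- In the product rule the derivative of the strength multiplies the operator applied to the
    -- zero profile, hence disappears.
    have e : (high ∘L selfLin α ρ) (((0, freePart S lam) : (Fin N → Summ ℕ) × (S → ℝ)).1 i) = 0 := by
      simp
    rw [e, ContinuousLinearMap.smulRight_zero, add_zero]
    simp only [glue_freePart]
    rfl
  have h5 := (hasFDerivAt_pi.2 hq).prodMk hp
  have hc : Tendsto (fun q : (Fin N → Summ ℕ) × (S → ℝ) => ((0 : ℝ), (0 : Fin N → Summ ℕ), q.2))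
      (𝓝 (0, freePart S lam)) (𝓝 (0, 0, freePart S lam)) := Continuous.tendsto (by fun_prop) _
  refine (h5.congr_of_eventuallyEq ?_).congr_fderiv ?_
  · filter_upwards [hc.eventually (eventually_admissible (α := α) (ρ := ρ) b hlam.distinct S)]
      with q hq
    refine Prod.ext (funext fun i => high_totalH_zero hb q.1 hq.distinct i) ?_
    change A (fun i => modeOne (totalH α ρ b 0 q.1 (glue S lam q.2) i)) = _
    simp only [modeOne_totalH_zero hb q.1 hq.distinct]
  · rfl

theorem isInvertible_contourDeriv (hlam : IsStationary α lam) :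
    (contourDeriv α ρ lam S).IsInvertible := by
  obtain ⟨T', h1, h2⟩ := high_selfLin_inverse (α := α) (ρ := ρ)
  have hc : ∀ i, kernelConst α / (2 * Real.pi) * strength lam i ≠ 0 := fun i =>
    mul_ne_zero (div_ne_zero kernelConst_pos.ne' (by positivity)) (hlam.strength_ne_zero i)
  refine ContinuousLinearMap.IsInvertible.of_inverse
    (g := ContinuousLinearMap.prodMap (ContinuousLinearMap.pi fun i =>
      (kernelConst α / (2 * Real.pi) * strength lam i)⁻¹ •
        (T' ∘L ContinuousLinearMap.proj i)) (ContinuousLinearMap.id ℝ _)) ?_ ?_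
  · refine ContinuousLinearMap.ext fun p => Prod.ext (funext fun i => ?_) rfl
    change (kernelConst α / (2 * Real.pi) * strength lam i) • (high ∘L selfLin α ρ)
      ((kernelConst α / (2 * Real.pi) * strength lam i)⁻¹ • T' (p.1 i)) = p.1 i
    rw [map_smul, smul_smul, mul_inv_cancel₀ (hc i), one_smul]
    exact congrArg (fun T => T (p.1 i)) h1
  · refine ContinuousLinearMap.ext fun p => Prod.ext (funext fun i => ?_) rfl
    change (kernelConst α / (2 * Real.pi) * strength lam i)⁻¹ • T'
      ((kernelConst α / (2 * Real.pi) * strength lam i) • (high ∘L selfLin α ρ) (p.1 i)) = p.1 i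
    rw [map_smul, smul_smul, inv_mul_cancel₀ (hc i), one_smul]
    exact congrArg (fun T => T (p.1 i)) h2

/-! ### The derivative of the contour map in `ε` -/

variable (ρ) in
/-- The value of `interTau` for unperturbed discs at `ε = 0`. -/
def tauZero (bi bj : ℝ) (z : ℂ) : Kern ρ :=
  (‖z‖ ^ 2)⁻¹ • ((2 : ℝ) • (bi • waveK 1 1 z - bj • waveK 1 rotF z))

variable (ρ) in
/-- The derivative in `ε` of `interTau` for unperturbed discs. -/
def tauOne (bi bj : ℝ) (z : ℂ) : Kern ρ :=
  (‖z‖ ^ 2)⁻¹ • (bi ^ 2 • 1 + bj ^ 2 • 1 - (2 * bi * bj) • ker cosF)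

theorem interTau_zero (ε bi bj : ℝ) (z : ℂ) :
    interTau α ρ ε bi bj z 0 0 = tauZero ρ bi bj z + ε • tauOne ρ bi bj z := by
  simp only [interTau, radK, radKh, map_zero, smul_zero, add_zero, one_mul, tauZero, tauOne]
  rw [smul_add, smul_comm ε]

theorem interKern_zero (ε bi bj : ℝ) (z : ℂ) : interKern α ρ ε bi bj z 0 0 =
    ker sinF * ((tauZero ρ bi bj z + ε • tauOne ρ bi bj z) *
      psi α (ε • (tauZero ρ bi bj z + ε • tauOne ρ bi bj z))) := by
  rw [interKern, interTau_zero]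
  simp [interNum]

/-- With τ = τ₀ + ετ₁, the derivative of τ ψ(ετ) at 0 is ψ(0) τ₁ + c₁ τ₀², where c₁ is the linear
coefficient of ψ. Against sin h only the mixed term of τ₀² survives; it is proportional to the
product of the real and imaginary parts of z e^{ix}, which is pure mode two. -/
theorem hasDerivAt_interH_zero (bi bj : ℝ) (z : ℂ) :
    HasDerivAt (fun ε => interH α ρ ε bi bj z 0 0)
      (wave 2 ((4 * Real.pi * binomCoeff α 1 * bi * bj * (‖z‖ ^ 4)⁻¹ : ℝ) * (Complex.I * z ^ 2)))
      0 := by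
  have h1 : HasDerivAt (fun ε : ℝ => tauZero ρ bi bj z + ε • tauOne ρ bi bj z)
      (tauOne ρ bi bj z) 0 := by
    have := ((hasDerivAt_id (0 : ℝ)).smul_const (tauOne ρ bi bj z)).const_add (tauZero ρ bi bj z)
    rw [one_smul] at this
    exact this
  have h2 : HasDerivAt (fun ε : ℝ => ε • (tauZero ρ bi bj z + ε • tauOne ρ bi bj z))
      (tauZero ρ bi bj z) 0 := by
    have := (hasDerivAt_id (0 : ℝ)).smul h1
    refine this.congr_deriv ?_
    simp
  have h3 := hasDerivAt_psi_comp (A := Kern ρ) hα.out h2 (zero_smul _ _)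
  have h4 := (intK (ρ := ρ) (fun _ => 1) intervalIntegrable_const).hasFDerivAt.comp_hasDerivAt
    (0 : ℝ) ((h1.mul h3).const_mul (ker sinF))
  have h5 : (fun ε => interH α ρ ε bi bj z 0 0) =
      (intK (ρ := ρ) (fun _ => 1) intervalIntegrable_const) ∘ fun ε : ℝ =>
        ker sinF * ((tauZero ρ bi bj z + ε • tauOne ρ bi bj z) *
      psi α (ε • (tauZero ρ bi bj z + ε • tauOne ρ bi bj z))) := by
    funext ε
    rw [interH, interKern_zero]; rfl
  rw [h5]
  refine h4.congr_deriv (ext_evL fun x => ?_)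
  rw [← ev_eq, ← ev_eq, zero_smul, zero_smul, add_zero, psi_zero hα.out, ev_wave]
  have e0 : ∀ h, evK x h (tauZero ρ bi bj z) = (((‖z‖ ^ 2)⁻¹ * (2 *
      (bi * (z * Complex.exp (x * Complex.I)).re -
        bj * (z * Complex.exp (((x - h : ℝ) : ℂ) * Complex.I)).re)) : ℝ) : ℂ) := fun h => by
    simp only [tauZero, evK_smul, map_sub, evK_waveK_one, evK_waveK_rot]
    push_cast; ring
  have e1 : ∀ h, evK x h (tauOne ρ bi bj z) = (((‖z‖ ^ 2)⁻¹ * (bi ^ 2 + bj ^ 2 -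
      2 * bi * bj * Real.cos h) : ℝ) : ℂ) := fun h => by
    simp only [tauOne, evK_smul, map_sub, map_add, map_one, evK_ker, cosF_apply]
    push_cast; ring
  rw [ev_intK_real (r := fun h => Real.sin h * ((‖z‖ ^ 2)⁻¹ * (bi ^ 2 + bj ^ 2 -
      2 * bi * bj * Real.cos h) * -(α / 2) + binomCoeff α 1 * ((‖z‖ ^ 2)⁻¹ * (2 *
      (bi * (z * Complex.exp (x * Complex.I)).re -
        bj * (z * Complex.exp (((x - h : ℝ) : ℂ) * Complex.I)).re))) ^ 2)) _ fun h _ => ?_]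
  · congr 1
    -- The integrand is sorted by its dependence on h: sin, sin·cos, sin times the rotated wave,
    -- sin·cos² and sin²·cos. Only the third has a nonzero integral.
    have e2 : ∀ h, 1 * (Real.sin h * ((‖z‖ ^ 2)⁻¹ * (bi ^ 2 + bj ^ 2 -
      2 * bi * bj * Real.cos h) * -(α / 2) + binomCoeff α 1 * ((‖z‖ ^ 2)⁻¹ * (2 *
      (bi * (z * Complex.exp (x * Complex.I)).re -
        bj * (z * Complex.exp (((x - h : ℝ) : ℂ) * Complex.I)).re))) ^ 2)) =
        ((‖z‖ ^ 2)⁻¹ * (bi ^ 2 + bj ^ 2) * -(α / 2) + 4 * binomCoeff α 1 * ((‖z‖ ^ 2)⁻¹) ^ 2 *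
          (bi * (z * Complex.exp (x * Complex.I)).re) ^ 2 + 4 * binomCoeff α 1 * ((‖z‖ ^ 2)⁻¹) ^ 2 *
          bj ^ 2 * (z.re * Real.sin x + z.im * Real.cos x) ^ 2) * Real.sin h +
        ((‖z‖ ^ 2)⁻¹ * (2 * bi * bj) * (α / 2) + 8 * binomCoeff α 1 * ((‖z‖ ^ 2)⁻¹) ^ 2 *
          bj ^ 2 * (0 : ℝ)) * (Real.sin h * Real.cos h) +
        (-8 * binomCoeff α 1 * ((‖z‖ ^ 2)⁻¹) ^ 2 * bi * bj * (z * Complex.exp (x * Complex.I)).re) *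
          (Real.sin h * (z * Complex.exp (((x - h : ℝ) : ℂ) * Complex.I)).re) +
        (4 * binomCoeff α 1 * ((‖z‖ ^ 2)⁻¹) ^ 2 * bj ^ 2 *
          ((z.re * Real.cos x - z.im * Real.sin x) ^ 2 -
            (z.re * Real.sin x + z.im * Real.cos x) ^ 2)) * (Real.sin h ^ 1 * Real.cos h ^ 2) +
        (8 * binomCoeff α 1 * ((‖z‖ ^ 2)⁻¹) ^ 2 * bj ^ 2 *
          ((z.re * Real.cos x - z.im * Real.sin x) *
            (z.re * Real.sin x + z.im * Real.cos x))) * (Real.sin h ^ 2 * Real.cos h ^ 1) := by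
      intro h
      have hs := Real.sin_sq h
      simp only [re_mul_exp, Real.cos_sub, Real.sin_sub]
      linear_combination (4 * binomCoeff α 1 * ((‖z‖ ^ 2)⁻¹) ^ 2 * bj ^ 2 * Real.sin h *
        (z.re * Real.sin x + z.im * Real.cos x) ^ 2) * hs
    simp only [e2]
    rw [intervalIntegral.integral_add (Continuous.intervalIntegrable (by fun_prop) _ _)
        (Continuous.intervalIntegrable (by fun_prop) _ _),
      intervalIntegral.integral_add (Continuous.intervalIntegrable (by fun_prop) _ _)
        (Continuous.intervalIntegrable (by fun_prop) _ _),
      intervalIntegral.integral_add (Continuous.intervalIntegrable (by fun_prop) _ _)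
        (Continuous.intervalIntegrable (by fun_prop) _ _),
      intervalIntegral.integral_add (Continuous.intervalIntegrable (by fun_prop) _ _)
        (Continuous.intervalIntegrable (by fun_prop) _ _), intervalIntegral.integral_const_mul,
      intervalIntegral.integral_const_mul, intervalIntegral.integral_const_mul,
      intervalIntegral.integral_const_mul, intervalIntegral.integral_const_mul,
      integral_sin_mul_rot, integral_sin, integral_sin_mul_cos₁]
    have j1 : ∫ h in (0 : ℝ)..(2 * Real.pi), Real.sin h ^ 1 * Real.cos h ^ 2 = 0 := by
      have := integral_sin_pow_odd_mul_cos_pow (a := 0) (b := 2 * Real.pi) 0 2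
      simp only [mul_zero, zero_add, Real.cos_zero, Real.cos_two_pi,
        intervalIntegral.integral_same] at this
      exact this
    have j2 : ∫ h in (0 : ℝ)..(2 * Real.pi), Real.sin h ^ 2 * Real.cos h ^ 1 = 0 := by
      have := integral_sin_pow_mul_cos_pow_odd (a := 0) (b := 2 * Real.pi) 2 0
      simp only [mul_zero, zero_add, Real.sin_zero, Real.sin_two_pi,
        intervalIntegral.integral_same] at this
      exact this
    rw [j1, j2]
    have e3 : Complex.exp (((2 : ℕ) : ℂ) * x * Complex.I) = Complex.exp (x * Complex.I) ^ 2 := by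
      rw [← Complex.exp_nat_mul]; congr 1; ring
    have e4 : (((4 * Real.pi * binomCoeff α 1 * bi * bj * (‖z‖ ^ 4)⁻¹ : ℝ) : ℂ) *
        (Complex.I * z ^ 2) * Complex.exp (((2 : ℕ) : ℂ) * x * Complex.I)).re =
        (4 * Real.pi * binomCoeff α 1 * bi * bj * (‖z‖ ^ 4)⁻¹) *
        (-(2 * (z * Complex.exp (x * Complex.I)).re * (z * Complex.exp (x * Complex.I)).im)) := by
      rw [e3, show ((4 * Real.pi * binomCoeff α 1 * bi * bj * (‖z‖ ^ 4)⁻¹ : ℝ) : ℂ) *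
        (Complex.I * z ^ 2) * Complex.exp (x * Complex.I) ^ 2 =
        ((4 * Real.pi * binomCoeff α 1 * bi * bj * (‖z‖ ^ 4)⁻¹ : ℝ) : ℂ) *
          (Complex.I * (z * Complex.exp (x * Complex.I)) ^ 2) by ring, Complex.re_ofReal_mul, sq]
      simp only [Complex.mul_re, Complex.mul_im, Complex.I_re, Complex.I_im]
      ring
    rw [e4]
    have e5 : (‖z‖ ^ 4)⁻¹ = ((‖z‖ ^ 2)⁻¹) ^ 2 := by rw [inv_pow, ← pow_mul]
    rw [e5]
    simp
    ring
  · rw [← evK_apply, map_mul, map_add, map_mul, map_mul, evK_ker, e0, e1, AlgHom.commutes, evK_smul,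
      e0, sinF_apply]
    change (Real.sin h : ℂ) * (_ * ((-(α / 2) : ℝ) : ℂ) + _) = _
    push_cast
    ring

end

end

/-! ### The first-order expansion and the implicit branch -/

noncomputable section

open MeasureTheory Wiener

section

variable {N : ℕ}

variable (α ρ : ℝ) [hα : Fact (α ∈ Ioo (1 : ℝ) 2)] [hρ : Fact (1 ≤ ρ)]

/-- The amplitude of the second mode in the derivative of the contour map. -/
def forcing (b : Fin N → ℝ) (lam : Param N) (i : Fin N) : ℂ :=
  ∑ j ∈ Finset.univ.erase i, ((2 * kernelConst α * binomCoeff α 1 * b i * strength lam j *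
    (‖sepC lam i j‖ ^ (-α) * (‖sepC lam i j‖ ^ 4)⁻¹) : ℝ) : ℂ) * (Complex.I * sepC lam i j ^ 2)

/-- The derivative of the profiles along the branch. -/
def firstCoord (b : Fin N → ℝ) (lam : Param N) (i : Fin N) : Summ ℕ :=
  Summ.single 0 (-(((kernelConst α / (2 * Real.pi) * strength lam i : ℝ) : ℂ) * mult α 0)⁻¹ *
    ((ρ ^ 2 : ℝ) * (forcing α b lam i / 2)))

variable {α ρ} {b : Fin N → ℝ} {lam : Param N} {S : Finset (Coord N)}
  {A : (Fin N → Plane) →L[ℝ] (S → ℝ)}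

theorem selfH_map_zero (η : ℝ) : selfH α ρ η 0 = 0 := by
  simp [selfH, selfReg, selfBeta_zero]

/-- Unperturbed discs have no self-interaction for any ε, so only the mutual interactions
contribute; the factors b_j and π cancel. -/
theorem hasDerivAt_totalH_zero (hb : ∀ i, 0 < b i) (i : Fin N) :
    HasDerivAt (fun ε => totalH α ρ b ε 0 lam i) (wave 2 (forcing α b lam i)) 0 := by
  have h1 : ∀ j, HasDerivAt (fun ε => interH α ρ ε (b i) (b j) (sepC lam i j)
      ((0 : Fin N → Summ ℕ) i) ((0 : Fin N → Summ ℕ) j)) _ 0 :=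
    fun j => hasDerivAt_interH_zero (α := α) (ρ := ρ) (b i) (b j) (sepC lam i j)
  have h2 := (HasDerivAt.fun_sum fun j (_ : j ∈ Finset.univ.erase i) =>
    (h1 j).const_smul (strength lam j / b j * ‖sepC lam i j‖ ^ (-α))).const_smul
      (kernelConst α / (2 * Real.pi))
  have h3 : (fun ε => totalH α ρ b ε 0 lam i) = fun ε => (kernelConst α / (2 * Real.pi)) •
      ∑ j ∈ Finset.univ.erase i, (strength lam j / b j * ‖sepC lam i j‖ ^ (-α)) •
      interH α ρ ε (b i) (b j) (sepC lam i j) ((0 : Fin N → Summ ℕ) i) ((0 : Fin N → Summ ℕ) j) := by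
    funext ε
    rw [totalH, Pi.zero_apply, selfH_map_zero, smul_zero, zero_add]
  rw [h3]
  refine h2.congr_deriv ?_
  rw [forcing, map_sum, Finset.smul_sum]
  refine Finset.sum_congr rfl fun j _ => ?_
  rw [← map_smul, ← map_smul]
  congr 1
  have hbj : ((b j : ℝ) : ℂ) ≠ 0 := by exact_mod_cast (hb j).ne'
  have hpi : (Real.pi : ℂ) ≠ 0 := by exact_mod_cast Real.pi_ne_zero
  simp only [Complex.real_smul]
  push_cast
  field_simp
  ring

/-- The forcing consists of mode two alone, so the component in the parameters is zero. This is why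
λ₁ moves only by o(ε). -/
theorem fderiv_contourMap_inl (hb : ∀ i, 0 < b i) (hlam : IsStationary α lam) :
    fderiv ℝ (contourMap α ρ b lam S A) (0, 0, freePart S lam) (1, 0) =
      (fun i => high (wave (ρ := ρ) 2 (forcing α b lam i)), 0) := by
  have h1 := ((contDiffAt_contourMap (α := α) (ρ := ρ) (b := b) (S := S) (A := A)
    hlam.distinct).differentiableAt one_ne_zero).hasFDerivAt
  have h2 : HasDerivAt (fun ε : ℝ => (ε, ((0 : Fin N → Summ ℕ), freePart S lam))) (1, 0) (0 : ℝ) :=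
    (hasDerivAt_id (0 : ℝ)).prodMk (hasDerivAt_const _ _)
  have h3 := h1.comp_hasDerivAt (0 : ℝ) h2
  refine h3.unique ?_
  have h4 : ∀ i, HasDerivAt (fun ε => totalH α ρ b ε 0 (glue S lam (freePart S lam)) i)
      (wave 2 (forcing α b lam i)) 0 := fun i => by
    rw [glue_freePart]; exact hasDerivAt_totalH_zero hb i
  have h5 := (hasDerivAt_pi.2 fun i => high.hasFDerivAt.comp_hasDerivAt (0 : ℝ) (h4 i)).prodMk
    (A.hasFDerivAt.comp_hasDerivAt (0 : ℝ) (hasDerivAt_pi.2 fun i =>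
      modeOne.hasFDerivAt.comp_hasDerivAt (0 : ℝ) (h4 i)))
  refine h5.congr_deriv (Prod.ext rfl ?_)
  have h6 : (fun i => modeOne (wave (ρ := ρ) 2 (forcing α b lam i))) = 0 := by
    funext i
    rw [modeOne_apply, coef_wave _ _ _ one_pos, if_neg (by norm_num)]
    ext k
    fin_cases k <;> simp
  change A (fun i => modeOne (wave (ρ := ρ) 2 (forcing α b lam i))) = 0
  rw [h6, map_zero]

/-- The linear equation for the tangent of the branch. It is solved by dividing the second mode by
its multiplier. -/
theorem contourDeriv_firstCoord (hlam : IsStationary α lam) :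
    contourDeriv α ρ lam S (firstCoord α ρ b lam, 0) =
      -(fun i => high (wave (ρ := ρ) 2 (forcing α b lam i)), 0) := by
  refine Prod.ext (funext fun i => ?_) ?_
  · have hc : ((kernelConst α / (2 * Real.pi) * strength lam i : ℝ) : ℂ) * mult α 0 ≠ 0 := by
      refine mul_ne_zero ?_ (mult_ne_zero 0)
      exact_mod_cast mul_ne_zero (div_ne_zero kernelConst_pos.ne' (by positivity))
        (hlam.strength_ne_zero i)
    change (kernelConst α / (2 * Real.pi) * strength lam i) • high (selfLin α ρ (firstCoord α ρ b lam i))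
      = -high (wave (0 + 2) (forcing α b lam i))
    rw [firstCoord, high_selfLin_single, high_wave, ← map_smul, ← map_neg, Complex.real_smul,
      ← mul_assoc, ← mul_assoc]
    congr 1
    rw [mul_neg, mul_inv_cancel₀ hc, neg_one_mul]
  · change (0 : S → ℝ) = -0
    rw [neg_zero]

theorem prof_single (n : ℕ) (w : ℂ) (x : ℝ) : prof α ρ (Summ.single n w) x =
    cw α ρ n * (w * Complex.exp (((n : ℂ) + 2) * x * Complex.I)).re := by
  rw [prof, tsum_eq_single n fun m hm => ?_, Summ.single_apply_self]
  rw [Summ.single_apply, if_neg hm]; simp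

/-- The kernel constant and the normalising factors ρ² and 2^α cancel. The spectral gap 1/(K_2 -
K_1) becomes Ξ_α by `xiConst_mul_gap`, and Re(z² e^{2ix}) is the difference of the squares of the
components along e and e^⊥. -/
theorem prof_firstCoord (hlam : IsStationary α lam) (i : Fin N) (x : ℝ) :
    prof α ρ (firstCoord α ρ b lam i) x = firstOrder α b lam i x := by
  have hρ0 : (ρ : ℂ) ≠ 0 := by exact_mod_cast (lt_of_lt_of_le one_pos hρ.out).ne'
  have hγ := hlam.strength_ne_zero i
  have hC := (kernelConst_pos (α := α)).ne'
  have hΔ : moment α 2 - moment α 1 ≠ 0 :=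
    (sub_pos.2 (moment_strictMono hα.out one_lt_two)).ne'
  have h2 : ((2 : ℝ) ^ α) ≠ 0 := by positivity
  have hxi := xiConst_mul_gap hα.out
  have e1 : ∀ z : ℂ, (z ^ 2 * Complex.exp (((0 : ℕ) + 2 : ℂ) * x * Complex.I)).re =
      (z * Complex.exp (x * Complex.I)).re ^ 2 - (z * Complex.exp (x * Complex.I)).im ^ 2 := by
    intro z
    have : Complex.exp (((0 : ℕ) + 2 : ℂ) * x * Complex.I) = Complex.exp (x * Complex.I) ^ 2 := by
      rw [← Complex.exp_nat_mul]; congr 1; push_cast; ring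
    rw [this, ← mul_pow, sq, Complex.mul_re]; ring
  have e2 : (-(((kernelConst α / (2 * Real.pi) * strength lam i : ℝ) : ℂ) * mult α 0)⁻¹ *
    ((ρ ^ 2 : ℝ) * (forcing α b lam i / 2))) = ∑ j ∈ Finset.univ.erase i,
      ((ρ ^ 2 * 2 ^ α * Real.pi * 2 * binomCoeff α 1 * b i * (moment α 2 - moment α 1)⁻¹ *
      (strength lam j / strength lam i) * (‖sepC lam i j‖ ^ (-α) * (‖sepC lam i j‖ ^ 4)⁻¹) : ℝ) : ℂ) *
        sepC lam i j ^ 2 := by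
    have hm : mult α 0 = -((2 * (2 ^ α)⁻¹ * (moment α 2 - moment α 1) / 2 : ℝ) : ℂ) * Complex.I := by
      rw [mult]
      congr 4
      rw [Nat.cast_zero, zero_add, Real.rpow_sub two_pos, Real.rpow_one]
      ring
    rw [forcing, hm, Finset.sum_div, Finset.mul_sum, Finset.mul_sum]
    refine Finset.sum_congr rfl fun j _ => ?_
    have c1 : (strength lam i : ℂ) ≠ 0 := by exact_mod_cast hγ
    have c2 : (kernelConst α : ℂ) ≠ 0 := by exact_mod_cast hC
    have c3 : ((moment α 2 - moment α 1 : ℝ) : ℂ) ≠ 0 := by exact_mod_cast hΔ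
    have c4 : (((2 : ℝ) ^ α : ℝ) : ℂ) ≠ 0 := by exact_mod_cast h2
    have c5 : (Real.pi : ℂ) ≠ 0 := by exact_mod_cast Real.pi_ne_zero
    simp only [Complex.ofReal_mul, Complex.ofReal_div, Complex.ofReal_inv, Complex.ofReal_ofNat]
    field_simp
  rw [firstCoord, prof_single, e2, Finset.sum_mul, Complex.re_sum, firstOrder, Finset.mul_sum,
    Finset.mul_sum]
  refine Finset.sum_congr rfl fun j hj => ?_
  have hz := sepC_ne_zero hlam.distinct (Finset.ne_of_mem_erase hj).symm
  have hn : 0 < ‖sepC lam i j‖ := norm_pos_iff.2 hz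
  rw [mul_assoc (Complex.ofReal _), Complex.re_ofReal_mul, e1, cw, binomCoeff_one]
  have hd : ‖pos lam j - pos lam i‖ = ‖sepC lam i j‖ := by rw [norm_sepC, norm_sub_rev]
  have i1 : inner ℝ (pos lam j - pos lam i) (radial x) =
      -(sepC lam i j * Complex.exp (x * Complex.I)).re := by
    rw [Plane.inner_eq, re_mul_exp, sepC_re, sepC_im]
    simp [pos, radial]; ring
  have i2 : inner ℝ (pos lam j - pos lam i) (angular x) =
      (sepC lam i j * Complex.exp (x * Complex.I)).im := by
    rw [Plane.inner_eq, im_mul_exp, sepC_re, sepC_im]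
    simp [pos, angular]; ring
  have hxi' : xiConst α = Real.pi * α * (α + 2) / (moment α 2 - moment α 1) := by
    rw [eq_div_iff hΔ]; exact hxi
  rw [hd, i1, i2, Real.rpow_add hn, Real.rpow_neg hn.le, hxi', Nat.cast_zero, zero_add]
  have h4 : ‖sepC lam i j‖ ^ (4 : ℝ) = ‖sepC lam i j‖ ^ 4 := by norm_cast
  have hρ1 : ρ ≠ 0 := by exact_mod_cast hρ0
  have h5 : ‖sepC lam i j‖ ^ α ≠ 0 := by positivity
  rw [h4]
  field_simp
  ring

/-- The branch of zeros of the contour map. -/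
theorem exists_branch (α ρ : ℝ) [hα : Fact (α ∈ Ioo (1 : ℝ) 2)] [hρ : Fact (1 ≤ ρ)]
    (hb : ∀ i, 0 < b i) (hlam : IsStationary α lam)
    (hA : A ∘L partialDeriv α S lam = ContinuousLinearMap.id ℝ _) :
    ∃ c : ℝ → (Fin N → Summ ℕ) × (S → ℝ), ContDiffAt ℝ 1 c 0 ∧ c 0 = (0, freePart S lam) ∧
      HasDerivAt c (firstCoord α ρ b lam, 0) 0 ∧
      (∀ᶠ ε in 𝓝 (0 : ℝ), contourMap α ρ b lam S A (ε, c ε) = 0) ∧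
      ∀ᶠ p in 𝓝 ((0 : ℝ), (0 : Fin N → Summ ℕ), freePart S lam),
        contourMap α ρ b lam S A p = 0 → c p.1 = p.2 := by
  have hcd := contDiffAt_contourMap (α := α) (ρ := ρ) (b := b) (S := S) (A := A) hlam.distinct
  have hinr := fderiv_contourMap_inr (α := α) (ρ := ρ) hb hlam hA
  have hinv := isInvertible_contourDeriv (α := α) (ρ := ρ) (S := S) hlam
  have hinv' : (fderiv ℝ (contourMap α ρ b lam S A) (0, 0, freePart S lam) ∘L
      ContinuousLinearMap.inr ℝ ℝ ((Fin N → Summ ℕ) × (S → ℝ))).IsInvertible := by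
    rw [hinr]; exact hinv
  have h0 := contourMap_base (α := α) (ρ := ρ) (S := S) (A := A) hb hlam
  refine ⟨hcd.implicitFunction one_ne_zero hinv', hcd.contDiffAt_implicitFunction one_ne_zero hinv',
    hcd.implicitFunction_apply_self one_ne_zero hinv', ?_, ?_, ?_⟩
  · have h1 := (hcd.hasStrictFDerivAt_implicitFunction one_ne_zero hinv').hasFDerivAt.hasDerivAt
    refine h1.congr_deriv ?_
    rw [hinr]
    obtain ⟨e, he⟩ := hinv
    have h2 := contourDeriv_firstCoord (α := α) (ρ := ρ) (b := b) (S := S) hlam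
    rw [← he] at h2 ⊢
    rw [ContinuousLinearMap.inverse_equiv]
    change -(e.symm (fderiv ℝ (contourMap α ρ b lam S A) (0, 0, freePart S lam) (1, 0))) = _
    rw [fderiv_contourMap_inl hb hlam, ← map_neg, ← h2]
    exact e.symm_apply_apply _
  · have h1 := hcd.eventually_apply_implicitFunction one_ne_zero hinv'
    rw [h0] at h1
    exact h1
  · have h1 := hcd.eventually_apply_eq_iff_implicitFunction one_ne_zero hinv'
    rw [h0] at h1
    exact h1.mono fun p hp => hp.1

end

end

noncomputable section

open MeasureTheory Wiener

/-! ### Conservation laws for interacting closed curves -/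

theorem integral_swap {F : ℝ → ℝ → ℝ} (hF : Continuous (Function.uncurry F)) :
    ∫ x in (0 : ℝ)..(2 * Real.pi), ∫ y in (0 : ℝ)..(2 * Real.pi), F x y =
      ∫ y in (0 : ℝ)..(2 * Real.pi), ∫ x in (0 : ℝ)..(2 * Real.pi), F x y := by
  have h0 : (0 : ℝ) ≤ 2 * Real.pi := by positivity
  simp only [intervalIntegral.integral_of_le h0]
  refine integral_integral_swap ?_
  rw [Measure.prod_restrict]
  have h1 : IntegrableOn (Function.uncurry F) (Icc 0 (2 * Real.pi) ×ˢ Icc 0 (2 * Real.pi))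
      (volume.prod volume) := hF.continuousOn.integrableOn_compact (isCompact_Icc.prod isCompact_Icc)
  exact h1.mono_set (prod_mono Ioc_subset_Icc_self Ioc_subset_Icc_self)

/-- A closed curve of class `C¹` in the plane, parametrised on the circle. -/
structure ClosedCurve where
  X : ℝ → ℝ
  Y : ℝ → ℝ
  X' : ℝ → ℝ
  Y' : ℝ → ℝ
  hX : ∀ x, HasDerivAt X (X' x) x
  hY : ∀ x, HasDerivAt Y (Y' x) x
  cX' : Continuous X'
  cY' : Continuous Y'
  pX : Function.Periodic X (2 * Real.pi)
  pY : Function.Periodic Y (2 * Real.pi)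
  pX' : Function.Periodic X' (2 * Real.pi)
  pY' : Function.Periodic Y' (2 * Real.pi)

namespace ClosedCurve

variable (z ζ : ClosedCurve)

theorem cX : Continuous z.X := continuous_iff_continuousAt.2 fun x => (z.hX x).continuousAt

theorem cY : Continuous z.Y := continuous_iff_continuousAt.2 fun x => (z.hY x).continuousAt

/-- The cross product of the tangent vectors. -/
def cross (x y : ℝ) : ℝ := z.X' x * ζ.Y' y - z.Y' x * ζ.X' y

/-- The squared distance. -/
def sqDist (x y : ℝ) : ℝ := (z.X x - ζ.X y) ^ 2 + (z.Y x - ζ.Y y) ^ 2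

theorem cross_swap (x y : ℝ) : cross ζ z y x = -cross z ζ x y := by rw [cross, cross]; ring

theorem sqDist_swap (x y : ℝ) : sqDist ζ z y x = sqDist z ζ x y := by rw [sqDist, sqDist]; ring

theorem sqDist_nonneg (x y : ℝ) : 0 ≤ sqDist z ζ x y := by rw [sqDist]; positivity

theorem continuous_cross : Continuous (Function.uncurry (cross z ζ)) := by
  have := z.cX'; have := z.cY'; have := ζ.cX'; have := ζ.cY'
  simp only [Function.uncurry_def, cross]
  fun_prop

theorem continuous_sqDist : Continuous (Function.uncurry (sqDist z ζ)) := by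
  have := z.cX; have := z.cY; have := ζ.cX; have := ζ.cY
  simp only [Function.uncurry_def, sqDist]
  fun_prop

theorem hasDerivAt_sqDist (x y : ℝ) : HasDerivAt (fun x => sqDist z ζ x y)
    (2 * ((z.X x - ζ.X y) * z.X' x + (z.Y x - ζ.Y y) * z.Y' x)) x := by
  have h1 := (((z.hX x).sub_const (ζ.X y)).pow 2).add (((z.hY x).sub_const (ζ.Y y)).pow 2)
  refine h1.congr_deriv ?_
  push_cast; ring

theorem hasDerivAt_sqDist_right (x y : ℝ) : HasDerivAt (fun y => sqDist z ζ x y)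
    (-(2 * ((z.X x - ζ.X y) * ζ.X' y + (z.Y x - ζ.Y y) * ζ.Y' y))) y := by
  have h1 := hasDerivAt_sqDist ζ z y x
  simp only [sqDist_swap] at h1
  refine h1.congr_deriv ?_
  ring

theorem integral_deriv_eq_zero {F F' : ℝ → ℝ} (hF : ∀ x, HasDerivAt F (F' x) x)
    (hc : Continuous F') (hp : F (2 * Real.pi) = F 0) :
    ∫ x in (0 : ℝ)..(2 * Real.pi), F' x = 0 := by
  rw [intervalIntegral.integral_eq_sub_of_hasDerivAt (fun x _ => hF x) (hc.intervalIntegrable _ _),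
    hp, sub_self]

/-- Stokes' theorem on the torus. -/
theorem stokes {G K : ℝ → ℝ} (hG : ∀ x y, HasDerivAt G (K (sqDist z ζ x y)) (sqDist z ζ x y))
    (hK : Continuous fun p : ℝ × ℝ => K (sqDist z ζ p.1 p.2)) (a b k l : ℝ) :
    ∫ x in (0 : ℝ)..(2 * Real.pi), ∫ y in (0 : ℝ)..(2 * Real.pi),
      (2 * K (sqDist z ζ x y) * ((z.X x - ζ.X y) * (a + k * z.X x + l * ζ.X y) +
        (z.Y x - ζ.Y y) * (b + k * z.Y x + l * ζ.Y y)) + (k - l) * G (sqDist z ζ x y)) *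
        cross z ζ x y = 0 := by
  have c1 := z.cX'; have c2 := z.cY'; have c3 := ζ.cX'; have c4 := ζ.cY'
  have c5 := z.cX; have c6 := z.cY; have c7 := ζ.cX; have c8 := ζ.cY
  have hGc : Continuous fun p : ℝ × ℝ => G (sqDist z ζ p.1 p.2) :=
    continuous_iff_continuousAt.2 fun p => ContinuousAt.comp (g := G)
      (f := fun p : ℝ × ℝ => sqDist z ζ p.1 p.2) (hG p.1 p.2).continuousAt
      (continuous_sqDist z ζ).continuousAt
  -- Put V = (a, b) + kz + lζ. `DA` is the x-derivative of -G V × ζ' and `DB` the y-derivative of G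
  -- V × z'. Each tangent vector is constant in the variable of differentiation, so no second
  -- derivatives of the curves occur. The difference `DB - DA` is the integrand, and each piece
  -- integrates to zero over a period.
  set DA : ℝ → ℝ → ℝ := fun x y => K (sqDist z ζ x y) *
      (2 * ((z.X x - ζ.X y) * z.X' x + (z.Y x - ζ.Y y) * z.Y' x)) *
        ((a + k * z.X x + l * ζ.X y) * (-ζ.Y' y) - (b + k * z.Y x + l * ζ.Y y) * (-ζ.X' y)) +
      G (sqDist z ζ x y) * (k * z.X' x * (-ζ.Y' y) - k * z.Y' x * (-ζ.X' y)) with hDA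
  set DB : ℝ → ℝ → ℝ := fun x y => K (sqDist z ζ x y) *
      (-(2 * ((z.X x - ζ.X y) * ζ.X' y + (z.Y x - ζ.Y y) * ζ.Y' y))) *
        ((a + k * z.X x + l * ζ.X y) * z.Y' x - (b + k * z.Y x + l * ζ.Y y) * z.X' x) +
      G (sqDist z ζ x y) * (l * ζ.X' y * z.Y' x - l * ζ.Y' y * z.X' x) with hDB
  have hA : Continuous (Function.uncurry DA) := by
    simp only [Function.uncurry_def, hDA]
    exact ((hK.mul (by fun_prop)).mul (by fun_prop)).add (hGc.mul (by fun_prop))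
  have hB : Continuous (Function.uncurry DB) := by
    simp only [Function.uncurry_def, hDB]
    exact ((hK.mul (by fun_prop)).mul (by fun_prop)).add (hGc.mul (by fun_prop))
  have e : ∀ x y, (2 * K (sqDist z ζ x y) * ((z.X x - ζ.X y) * (a + k * z.X x + l * ζ.X y) +
        (z.Y x - ζ.Y y) * (b + k * z.Y x + l * ζ.Y y)) + (k - l) * G (sqDist z ζ x y)) *
        cross z ζ x y = DB x y - DA x y := by
    intro x y
    simp only [hDA, hDB, cross]
    ring
  simp only [e]
  have hAx : ∀ y, ∫ x in (0 : ℝ)..(2 * Real.pi), DA x y = 0 := by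
    intro y
    refine integral_deriv_eq_zero (F := fun x => G (sqDist z ζ x y) *
      ((a + k * z.X x + l * ζ.X y) * (-ζ.Y' y) - (b + k * z.Y x + l * ζ.Y y) * (-ζ.X' y)))
      (fun x => ?_) (hA.comp (by fun_prop : Continuous fun x : ℝ => (x, y))) ?_
    · have h1 := (hG x y).comp x (hasDerivAt_sqDist z ζ x y)
      have h2 := (((((z.hX x).const_mul k).const_add a).add_const (l * ζ.X y)).mul_const
        (-ζ.Y' y)).sub (((((z.hY x).const_mul k).const_add b).add_const (l * ζ.Y y)).mul_const
        (-ζ.X' y))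
      exact h1.mul h2
    · have := z.pX 0; have := z.pY 0
      simp only [sqDist, zero_add] at *
      simp only [*]
  have hBy : ∀ x, ∫ y in (0 : ℝ)..(2 * Real.pi), DB x y = 0 := by
    intro x
    refine integral_deriv_eq_zero (F := fun y => G (sqDist z ζ x y) *
      ((a + k * z.X x + l * ζ.X y) * z.Y' x - (b + k * z.Y x + l * ζ.Y y) * z.X' x))
      (fun y => ?_) (hB.comp (by fun_prop : Continuous fun y : ℝ => (x, y))) ?_
    · have h1 := (hG x y).comp y (hasDerivAt_sqDist_right z ζ x y)
      have h2 := ((((ζ.hX y).const_mul l).const_add (a + k * z.X x)).mul_const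
        (z.Y' x)).sub ((((ζ.hY y).const_mul l).const_add (b + k * z.Y x)).mul_const (z.X' x))
      exact h1.mul h2
    · have := ζ.pX 0; have := ζ.pY 0
      simp only [sqDist, zero_add] at *
      simp only [*]
  have hI : ∀ F : ℝ → ℝ → ℝ, Continuous (Function.uncurry F) → ∀ x,
      IntervalIntegrable (fun y => F x y) volume 0 (2 * Real.pi) := fun F hF x =>
    (hF.comp (by fun_prop : Continuous fun y : ℝ => (x, y))).intervalIntegrable _ _
  have e2 : ∀ x, ∫ y in (0 : ℝ)..(2 * Real.pi), (DB x y - DA x y) =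
      -∫ y in (0 : ℝ)..(2 * Real.pi), DA x y := fun x => by
    rw [intervalIntegral.integral_sub (hI DB hB x) (hI DA hA x), hBy, zero_sub]
  simp only [e2]
  rw [intervalIntegral.integral_neg, integral_swap hA]
  simp only [hAx]
  simp

/-- The regularised interaction of two curves. -/
def regKernel (α δ : ℝ) (x y : ℝ) : ℝ := cross z ζ x y * (sqDist z ζ x y + δ) ^ (-(α / 2))

theorem continuous_regKernel (α : ℝ) {δ : ℝ} (hδ : 0 < δ) :
    Continuous (Function.uncurry (regKernel z ζ α δ)) := by
  have h1 := continuous_cross z ζ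
  have h2 := continuous_sqDist z ζ
  refine h1.mul ((h2.add continuous_const).rpow_const fun p => Or.inl ?_)
  have := sqDist_nonneg z ζ p.1 p.2
  exact (by linarith : 0 < sqDist z ζ p.1 p.2 + δ).ne'

theorem regKernel_swap (α δ x y : ℝ) : regKernel ζ z α δ y x = -regKernel z ζ α δ x y := by
  rw [regKernel, regKernel, cross_swap, sqDist_swap, neg_mul]

/-- With k = l the undifferentiated term of Stokes' formula disappears. The scalar product is φ(z) -
φ(ζ) for φ = ax + by + k|·|², so φ may be evaluated on either curve under the double integral. -/
theorem stokes_regKernel {α δ : ℝ} (hα : α ∈ Ioo (1 : ℝ) 2) (hδ : 0 < δ) (a b k : ℝ) :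
    ∫ x in (0 : ℝ)..(2 * Real.pi), ∫ y in (0 : ℝ)..(2 * Real.pi),
      ((z.X x - ζ.X y) * (a + k * z.X x + k * ζ.X y) +
        (z.Y x - ζ.Y y) * (b + k * z.Y x + k * ζ.Y y)) * regKernel z ζ α δ x y = 0 := by
  have h1 : (1 - α / 2) ≠ 0 := by linarith [hα.2]
  have h := stokes z ζ (K := fun s => (s + δ) ^ (-(α / 2)))
    (G := fun s => (s + δ) ^ (1 - α / 2) / (1 - α / 2)) (fun x y => ?_) ?_ a b k k
  · have e : ∀ x y, ((z.X x - ζ.X y) * (a + k * z.X x + k * ζ.X y) +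
        (z.Y x - ζ.Y y) * (b + k * z.Y x + k * ζ.Y y)) * regKernel z ζ α δ x y = (1 / 2) *
      ((2 * (sqDist z ζ x y + δ) ^ (-(α / 2)) * ((z.X x - ζ.X y) * (a + k * z.X x + k * ζ.X y) +
        (z.Y x - ζ.Y y) * (b + k * z.Y x + k * ζ.Y y)) + (k - k) *
        ((sqDist z ζ x y + δ) ^ (1 - α / 2) / (1 - α / 2))) * cross z ζ x y) := fun x y => by
      rw [regKernel]; ring
    simp only [e, intervalIntegral.integral_const_mul]
    rw [h, mul_zero]
  · have hp : 0 < sqDist z ζ x y + δ := by linarith [sqDist_nonneg z ζ x y]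
    have := (((hasDerivAt_id (sqDist z ζ x y)).add_const δ).rpow_const (p := 1 - α / 2)
      (Or.inl hp.ne')).div_const (1 - α / 2)
    refine this.congr_deriv ?_
    simp only [id_eq]
    rw [show 1 - α / 2 - 1 = -(α / 2) by ring, one_mul, mul_div_cancel_left₀ _ h1]
  · refine ((continuous_sqDist z ζ).add continuous_const).rpow_const fun p => Or.inl ?_
    have := sqDist_nonneg z ζ p.1 p.2
    exact (by linarith : 0 < sqDist z ζ p.1 p.2 + δ).ne'

/-- The flux through the first curve induced by the second one. -/
def flux (α : ℝ) (x : ℝ) : ℝ :=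
  ∫ y in (0 : ℝ)..(2 * Real.pi), cross z ζ x y * (sqDist z ζ x y) ^ (-(α / 2))

/-- Stokes with V = z - ζ and G = s^{-α/2}: the two terms of the integrand combine to (2 - α)
s^{-α/2} z' × ζ'. Separation of the curves makes regularisation unnecessary. -/
theorem integral_flux_of_separated {α : ℝ} (hα : α ∈ Ioo (1 : ℝ) 2)
    (hs : ∀ x y, 0 < sqDist z ζ x y) : ∫ x in (0 : ℝ)..(2 * Real.pi), flux z ζ α x = 0 := by
  have h := stokes z ζ (K := fun s => -(α / 2) * s ^ (-(α / 2) - 1))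
    (G := fun s => s ^ (-(α / 2))) (fun x y => ?_) ?_ 0 0 1 (-1)
  · have e : ∀ x y, cross z ζ x y * (sqDist z ζ x y) ^ (-(α / 2)) = (2 - α)⁻¹ *
      ((2 * (-(α / 2) * sqDist z ζ x y ^ (-(α / 2) - 1)) *
        ((z.X x - ζ.X y) * (0 + 1 * z.X x + -1 * ζ.X y) +
        (z.Y x - ζ.Y y) * (0 + 1 * z.Y x + -1 * ζ.Y y)) + (1 - -1) *
        sqDist z ζ x y ^ (-(α / 2))) * cross z ζ x y) := fun x y => by
      have h2 : (2 - α) ≠ 0 := by linarith [hα.2]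
      have h3 : sqDist z ζ x y ^ (-(α / 2)) = sqDist z ζ x y ^ (-(α / 2) - 1) * sqDist z ζ x y := by
        rw [← Real.rpow_add_one (hs x y).ne']; congr 1; ring
      have h4 : (z.X x - ζ.X y) * (0 + 1 * z.X x + -1 * ζ.X y) +
        (z.Y x - ζ.Y y) * (0 + 1 * z.Y x + -1 * ζ.Y y) = sqDist z ζ x y := by rw [sqDist]; ring
      rw [h4, h3]
      field_simp
      ring
    simp only [flux, e, intervalIntegral.integral_const_mul]
    rw [h, mul_zero]
  · exact Real.hasDerivAt_rpow_const (Or.inl (hs x y).ne')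
  · exact continuous_const.mul ((continuous_sqDist z ζ).rpow_const fun p => Or.inl (hs p.1 p.2).ne')

/-- The regularised flux. -/
def regFlux (α δ : ℝ) (x : ℝ) : ℝ := ∫ y in (0 : ℝ)..(2 * Real.pi), regKernel z ζ α δ x y

theorem continuous_regFlux (α : ℝ) {δ : ℝ} (hδ : 0 < δ) : Continuous (regFlux z ζ α δ) :=
  intervalIntegral.continuous_parametric_intervalIntegral_of_continuous'
    (continuous_regKernel z ζ α hδ) _ _

/-- The interaction of two curves is dominated by the singular kernel. -/
def Dominated (α C : ℝ) : Prop := ∀ x, ∀ h ∈ Ioo 0 (2 * Real.pi), 0 < sqDist z ζ x (x - h) ∧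
  |cross z ζ x (x - h)| * sqDist z ζ x (x - h) ^ (-(α / 2)) ≤ C * chord h ^ (1 - α)

variable {z ζ}

theorem periodic_regKernel (α δ x : ℝ) : Function.Periodic (regKernel z ζ α δ x) (2 * Real.pi) :=
  fun y => by rw [regKernel, regKernel, cross, cross, sqDist, sqDist, ζ.pX, ζ.pY, ζ.pX', ζ.pY']

theorem regFlux_eq (α δ x : ℝ) :
    regFlux z ζ α δ x = ∫ h in (0 : ℝ)..(2 * Real.pi), regKernel z ζ α δ x (x - h) :=
  integral_sub_left_of_periodic (periodic_regKernel α δ x) x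

theorem flux_eq (α x : ℝ) : flux z ζ α x = ∫ h in (0 : ℝ)..(2 * Real.pi),
    cross z ζ x (x - h) * sqDist z ζ x (x - h) ^ (-(α / 2)) :=
  integral_sub_left_of_periodic (F := fun y => cross z ζ x y * sqDist z ζ x y ^ (-(α / 2)))
    (fun y => by simp only [cross, sqDist]; rw [ζ.pX, ζ.pY, ζ.pX', ζ.pY']) x

/-- Adding δ to the squared distance only lowers the negative power, so the bound of the singular
kernel serves uniformly in δ. -/
theorem abs_regKernel_le {α C δ : ℝ} (hα : α ∈ Ioo (1 : ℝ) 2) (hd : Dominated z ζ α C) (hδ : 0 ≤ δ)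
    (x : ℝ) {h : ℝ} (hh : h ∈ Ioo 0 (2 * Real.pi)) :
    |regKernel z ζ α δ x (x - h)| ≤ C * chord h ^ (1 - α) := by
  obtain ⟨h1, h2⟩ := hd x h hh
  refine le_trans ?_ h2
  rw [regKernel, abs_mul, abs_of_nonneg (Real.rpow_nonneg (by linarith) _)]
  refine mul_le_mul_of_nonneg_left ?_ (abs_nonneg _)
  exact Real.rpow_le_rpow_of_nonpos h1 (by linarith) (by linarith [hα.1])

theorem abs_regFlux_le {α C δ : ℝ} (hα : α ∈ Ioo (1 : ℝ) 2) (hd : Dominated z ζ α C) (hδ : 0 < δ)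
    (x : ℝ) : |regFlux z ζ α δ x| ≤ C * ∫ h in (0 : ℝ)..(2 * Real.pi), chord h ^ (1 - α) := by
  rw [regFlux_eq, ← intervalIntegral.integral_const_mul, ← Real.norm_eq_abs]
  have hi := (intervalIntegrable_chord_one_sub hα).const_mul C
  refine intervalIntegral.norm_integral_le_of_norm_le (by positivity) ?_ hi
  have : ∀ᵐ h : ℝ ∂volume, h ≠ 2 * Real.pi := by simp [ae_iff, measure_singleton]
  filter_upwards [this] with h hne hh
  exact abs_regKernel_le hα hd hδ.le x ⟨hh.1, lt_of_le_of_ne hh.2 hne⟩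

theorem tendsto_regFlux {α C : ℝ} (hα : α ∈ Ioo (1 : ℝ) 2) (hd : Dominated z ζ α C) (x : ℝ) :
    Tendsto (fun n : ℕ => regFlux z ζ α (1 / ((n : ℝ) + 1)) x) atTop (𝓝 (flux z ζ α x)) := by
  simp only [regFlux_eq]
  rw [flux_eq]
  have hne : ∀ᵐ h : ℝ ∂volume, h ≠ 2 * Real.pi := by simp [ae_iff, measure_singleton]
  refine intervalIntegral.tendsto_integral_filter_of_dominated_convergence
    (fun h => C * chord h ^ (1 - α)) (Eventually.of_forall fun n => ?_)
    (Eventually.of_forall fun n => ?_) ((intervalIntegrable_chord_one_sub hα).const_mul C) ?_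
  · have hc := continuous_regKernel z ζ α (δ := 1 / ((n : ℝ) + 1)) (by positivity)
    exact (hc.comp (by fun_prop : Continuous fun h : ℝ => (x, x - h))).aestronglyMeasurable
  · filter_upwards [hne] with h hne hh
    rw [uIoc_of_le (by positivity)] at hh
    exact abs_regKernel_le hα hd (by positivity) x ⟨hh.1, lt_of_le_of_ne hh.2 hne⟩
  · filter_upwards [hne] with h hne hh
    rw [uIoc_of_le (by positivity)] at hh
    have h1 := (hd x h ⟨hh.1, lt_of_le_of_ne hh.2 hne⟩).1
    have h2 : Tendsto (fun n : ℕ => sqDist z ζ x (x - h) + 1 / ((n : ℝ) + 1)) atTop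
        (𝓝 (sqDist z ζ x (x - h))) := by
      have := tendsto_one_div_add_atTop_nhds_zero_nat (𝕜 := ℝ)
      simpa using this.const_add (sqDist z ζ x (x - h))
    exact (h2.rpow_const (Or.inl h1.ne')).const_mul _

theorem tendsto_integral_mul_regFlux {α C : ℝ} (hα : α ∈ Ioo (1 : ℝ) 2) (hd : Dominated z ζ α C)
    {ψ : ℝ → ℝ} (hψ : Continuous ψ) :
    Tendsto (fun n : ℕ => ∫ x in (0 : ℝ)..(2 * Real.pi), ψ x * regFlux z ζ α (1 / ((n : ℝ) + 1)) x)
      atTop (𝓝 (∫ x in (0 : ℝ)..(2 * Real.pi), ψ x * flux z ζ α x)) := by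
  refine intervalIntegral.tendsto_integral_filter_of_dominated_convergence
    (fun x => |ψ x| * (C * ∫ h in (0 : ℝ)..(2 * Real.pi), chord h ^ (1 - α)))
    (Eventually.of_forall fun n => ?_) (Eventually.of_forall fun n => ?_) ?_ ?_
  · exact (hψ.mul (continuous_regFlux z ζ α (by positivity))).aestronglyMeasurable
  · refine Eventually.of_forall fun x _ => ?_
    rw [norm_mul, Real.norm_eq_abs, Real.norm_eq_abs]
    exact mul_le_mul_of_nonneg_left (abs_regFlux_le hα hd (by positivity) x) (abs_nonneg _)
  · exact (hψ.abs.mul continuous_const).intervalIntegrable _ _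
  · exact Eventually.of_forall fun x _ => (tendsto_regFlux hα hd x).const_mul _

/-- The regularised kernel is antisymmetric under exchange of its two points and continuous, so its
double integral is zero. Dominated convergence removes δ. -/
theorem integral_flux_self {α C : ℝ} (hα : α ∈ Ioo (1 : ℝ) 2) (hd : Dominated z z α C) :
    ∫ x in (0 : ℝ)..(2 * Real.pi), flux z z α x = 0 := by
  have h1 := tendsto_integral_mul_regFlux hα hd (continuous_const (y := (1 : ℝ)))
  simp only [one_mul] at h1
  refine tendsto_nhds_unique h1 (tendsto_const_nhds.congr fun n => ?_)
  simp only [regFlux]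
  have h3 : ∫ y in (0 : ℝ)..(2 * Real.pi), ∫ x in (0 : ℝ)..(2 * Real.pi),
      regKernel z z α (1 / ((n : ℝ) + 1)) x y = -∫ y in (0 : ℝ)..(2 * Real.pi),
        ∫ x in (0 : ℝ)..(2 * Real.pi), regKernel z z α (1 / ((n : ℝ) + 1)) y x := by
    rw [← intervalIntegral.integral_neg]
    refine intervalIntegral.integral_congr fun y _ => ?_
    rw [← intervalIntegral.integral_neg]
    refine intervalIntegral.integral_congr fun x _ => ?_
    exact regKernel_swap z z _ _ y x
  have h4 := integral_swap (continuous_regKernel z z α (δ := 1 / ((n : ℝ) + 1)) (by positivity))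
  rw [h3] at h4
  linarith

variable {N : ℕ}

/-- A conservation law for a system of curves. -/
theorem sum_integral_mul_flux {α C : ℝ} (hα : α ∈ Ioo (1 : ℝ) 2) {c : Fin N → ClosedCurve}
    (hd : ∀ i j, Dominated (c i) (c j) α C) (p : Fin N → ℝ) (a b k : ℝ) :
    ∑ i, ∑ j, p i * p j * ∫ x in (0 : ℝ)..(2 * Real.pi),
      (a * (c i).X x + b * (c i).Y x + k * ((c i).X x ^ 2 + (c i).Y x ^ 2)) *
        flux (c i) (c j) α x = 0 := by
  set ψ : Fin N → ℝ → ℝ := fun i x =>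
    a * (c i).X x + b * (c i).Y x + k * ((c i).X x ^ 2 + (c i).Y x ^ 2) with hψdef
  have hψ : ∀ i, Continuous (ψ i) := fun i => by
    have := (c i).cX; have := (c i).cY
    simp only [hψdef]; fun_prop
  have h1 : Tendsto (fun n : ℕ => ∑ i, ∑ j, p i * p j * ∫ x in (0 : ℝ)..(2 * Real.pi),
      ψ i x * regFlux (c i) (c j) α (1 / ((n : ℝ) + 1)) x) atTop
      (𝓝 (∑ i, ∑ j, p i * p j * ∫ x in (0 : ℝ)..(2 * Real.pi), ψ i x * flux (c i) (c j) α x)) :=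
    tendsto_finsetSum _ fun i _ => tendsto_finsetSum _ fun j _ =>
      (tendsto_integral_mul_regFlux hα (hd i j) (hψ i)).const_mul _
  refine tendsto_nhds_unique h1 (tendsto_const_nhds.congr fun n => ?_)
  set δ : ℝ := 1 / ((n : ℝ) + 1)
  have hδ : 0 < δ := by positivity
  have hc : ∀ i j, Continuous (Function.uncurry (regKernel (c i) (c j) α δ)) := fun i j =>
    continuous_regKernel _ _ α hδ
  have hc1 : ∀ i j, Continuous (Function.uncurry fun x y => ψ i x * regKernel (c i) (c j) α δ x y) :=
    fun i j => ((hψ i).comp continuous_fst).mul (hc i j)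
  have hc2 : ∀ i j, Continuous (Function.uncurry fun x y => ψ j y * regKernel (c i) (c j) α δ x y) :=
    fun i j => ((hψ j).comp continuous_snd).mul (hc i j)
  have e1 : ∀ i j, ∫ x in (0 : ℝ)..(2 * Real.pi), ψ i x * regFlux (c i) (c j) α δ x =
      ∫ x in (0 : ℝ)..(2 * Real.pi), ∫ y in (0 : ℝ)..(2 * Real.pi),
        ψ i x * regKernel (c i) (c j) α δ x y := fun i j => by
    simp only [intervalIntegral.integral_const_mul]; rfl
  have e2 : ∀ i j, ∫ x in (0 : ℝ)..(2 * Real.pi), ∫ y in (0 : ℝ)..(2 * Real.pi),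
        ψ i x * regKernel (c i) (c j) α δ x y =
      ∫ x in (0 : ℝ)..(2 * Real.pi), ∫ y in (0 : ℝ)..(2 * Real.pi),
        ψ j y * regKernel (c i) (c j) α δ x y := by
    intro i j
    have h3 := stokes_regKernel (c i) (c j) hα hδ a b k
    have e3 : ∀ x y, (((c i).X x - (c j).X y) * (a + k * (c i).X x + k * (c j).X y) +
        ((c i).Y x - (c j).Y y) * (b + k * (c i).Y x + k * (c j).Y y)) *
          regKernel (c i) (c j) α δ x y = ψ i x * regKernel (c i) (c j) α δ x y -
            ψ j y * regKernel (c i) (c j) α δ x y := fun x y => by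
      simp only [hψdef]; ring
    have hI : ∀ F : ℝ → ℝ → ℝ, Continuous (Function.uncurry F) → ∀ x,
      IntervalIntegrable (fun y => F x y) volume 0 (2 * Real.pi) := fun F hF x =>
        (hF.comp (by fun_prop : Continuous fun y : ℝ => (x, y))).intervalIntegrable _ _
    simp only [e3] at h3
    have e4 : ∀ x, ∫ y in (0 : ℝ)..(2 * Real.pi), (ψ i x * regKernel (c i) (c j) α δ x y -
            ψ j y * regKernel (c i) (c j) α δ x y) = (∫ y in (0 : ℝ)..(2 * Real.pi),
            ψ i x * regKernel (c i) (c j) α δ x y) - ∫ y in (0 : ℝ)..(2 * Real.pi),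
            ψ j y * regKernel (c i) (c j) α δ x y := fun x =>
      intervalIntegral.integral_sub (hI _ (hc1 i j) x) (hI _ (hc2 i j) x)
    simp only [e4] at h3
    rw [intervalIntegral.integral_sub
      (Continuous.intervalIntegrable
        (intervalIntegral.continuous_parametric_intervalIntegral_of_continuous' (hc1 i j) _ _) _ _)
      (Continuous.intervalIntegrable
        (intervalIntegral.continuous_parametric_intervalIntegral_of_continuous' (hc2 i j) _ _) _ _)]
      at h3
    linarith
  -- Moving the weight to the other curve by `stokes_regKernel` and then exchanging the variables
  -- changes the sign, so the pairs (i, j) and (j, i) cancel; the diagonal terms cancel with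
  -- themselves.
  have e5 : ∀ i j, ∫ x in (0 : ℝ)..(2 * Real.pi), ψ i x * regFlux (c i) (c j) α δ x =
      -∫ x in (0 : ℝ)..(2 * Real.pi), ψ j x * regFlux (c j) (c i) α δ x := by
    intro i j
    rw [e1, e1, e2, integral_swap (hc2 i j), ← intervalIntegral.integral_neg]
    refine intervalIntegral.integral_congr fun y _ => ?_
    rw [← intervalIntegral.integral_neg]
    refine intervalIntegral.integral_congr fun x _ => ?_
    rw [regKernel_swap (c i) (c j)]
    ring
  have e6 : ∑ i, ∑ j, p i * p j * ∫ x in (0 : ℝ)..(2 * Real.pi), ψ i x * regFlux (c i) (c j) α δ x =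
      -∑ i, ∑ j, p i * p j * ∫ x in (0 : ℝ)..(2 * Real.pi),
        ψ i x * regFlux (c i) (c j) α δ x := by
    conv_lhs => rw [Finset.sum_comm]
    rw [← Finset.sum_neg_distrib]
    refine Finset.sum_congr rfl fun i _ => ?_
    rw [← Finset.sum_neg_distrib]
    refine Finset.sum_congr rfl fun j _ => ?_
    rw [e5 j i]; ring
  linarith

end ClosedCurve

end

/-! ### Boundaries of patches as closed curves -/

noncomputable section

open MeasureTheory Wiener

/-- By periodicity the increment is at most L min(h, 2π - h), and Jordan's inequality bounds this
arc length by (π/2) chord. -/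
theorem abs_sub_le_chord {F F' : ℝ → ℝ} {L : ℝ} (hF : ∀ x, HasDerivAt F (F' x) x)
    (hL : ∀ x, |F' x| ≤ L) (hp : Function.Periodic F (2 * Real.pi)) (x : ℝ) {h : ℝ}
    (hh : h ∈ Ioo 0 (2 * Real.pi)) : |F x - F (x - h)| ≤ L * (Real.pi / 2) * chord h := by
  have hL0 : 0 ≤ L := (abs_nonneg _).trans (hL 0)
  have hlip : ∀ a b, |F a - F b| ≤ L * |a - b| := fun a b => by
    have := Convex.norm_image_sub_le_of_norm_hasDerivWithin_le (f := F) (f' := F') (C := L)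
      (fun y _ => (hF y).hasDerivWithinAt) (fun y _ => hL y) convex_univ (mem_univ b) (mem_univ a)
    exact this
  have hpi := Real.pi_pos
  have key : ∀ t, 0 ≤ t → t ≤ Real.pi → L * t ≤ L * (Real.pi / 2) * chord t := by
    intro t h0 h1
    have := chord_ge h0 h1
    have h2 : t = Real.pi / 2 * (2 / Real.pi * t) := by field_simp
    calc L * t = L * (Real.pi / 2) * (2 / Real.pi * t) := by rw [mul_assoc, ← h2]
      _ ≤ _ := mul_le_mul_of_nonneg_left this (by positivity)
  rcases le_total h Real.pi with h1 | h1
  · refine (hlip x (x - h)).trans ?_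
    rw [sub_sub_cancel, abs_of_pos hh.1]
    exact key h hh.1.le h1
  · have e : F (x - h) = F (x + (2 * Real.pi - h)) := by
      rw [← hp (x - h)]; congr 1; ring
    rw [e, ← chord_reflect]
    refine (hlip _ _).trans ?_
    rw [show x - (x + (2 * Real.pi - h)) = -(2 * Real.pi - h) by ring, abs_neg,
      abs_of_pos (by linarith [hh.2])]
    exact key _ (by linarith [hh.2]) (by linarith)

instance factOneLeTwo : Fact ((1 : ℝ) ≤ 2) := ⟨one_le_two⟩

section

variable {α : ℝ} [hα : Fact (α ∈ Ioo (1 : ℝ) 2)]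

/-- This is where ρ = 2 enters: 2^{n+2} ≥ n+2 pays for one derivative and (n+2)^α for another.
Profiles are thus C² with bounds by ‖g‖. -/
theorem cw_mul_sq_le (n : ℕ) : cw α 2 n * ((n : ℝ) + 2) ^ 2 ≤ 1 := by
  have hn : (1 : ℝ) ≤ (n : ℝ) + 2 := by linarith [n.cast_nonneg (α := ℝ)]
  have h1 := le_rpow (α := α) n
  have h2 : (n : ℝ) + 2 ≤ 2 ^ (n + 2) := by
    have := (n + 2).lt_two_pow_self.le
    exact_mod_cast this
  have h3 : ((n : ℝ) + 2) ^ 2 ≤ ((n : ℝ) + 2) ^ α * 2 ^ (n + 2) := by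
    rw [sq]; exact mul_le_mul h1 h2 (by positivity) (by positivity)
  rw [cw, ← mul_inv, inv_mul_le_iff₀ (by positivity), mul_one]
  exact h3

variable (α) in
/-- The second derivative of `prof g`. -/
def ddprof (g : Summ ℕ) (x : ℝ) : ℝ :=
  ∑' n : ℕ, cw α 2 n * (g n * (((n : ℂ) + 2) * Complex.I) * (((n : ℂ) + 2) * Complex.I) *
    Complex.exp (((n : ℂ) + 2) * x * Complex.I)).re

theorem norm_ddprof_term_le (g : Summ ℕ) (n : ℕ) (x : ℝ) :
    ‖cw α 2 n * (g n * (((n : ℂ) + 2) * Complex.I) * (((n : ℂ) + 2) * Complex.I) *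
    Complex.exp (((n : ℂ) + 2) * x * Complex.I)).re‖ ≤ ‖g n‖ := by
  rw [norm_mul, Real.norm_of_nonneg (cw_pos α 2 n).le]
  refine (mul_le_mul_of_nonneg_left (Complex.abs_re_le_norm _) (cw_pos α 2 n).le).trans ?_
  rw [norm_mul, norm_mul, norm_mul, norm_exp_pos, norm_nat_add_two_mul_I, mul_one]
  have := mul_le_mul_of_nonneg_right (cw_mul_sq_le (α := α) n) (norm_nonneg (g n))
  rw [one_mul] at this
  refine le_trans (le_of_eq ?_) this
  ring

theorem norm_dprof_term_le (g : Summ ℕ) (n : ℕ) (x : ℝ) :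
    ‖cw α 2 n * (g n * (((n : ℂ) + 2) * Complex.I) *
    Complex.exp (((n : ℂ) + 2) * x * Complex.I)).re‖ ≤ ‖g n‖ := by
  rw [norm_mul, Real.norm_of_nonneg (cw_pos α 2 n).le]
  refine (mul_le_mul_of_nonneg_left (Complex.abs_re_le_norm _) (cw_pos α 2 n).le).trans ?_
  rw [norm_mul, norm_mul, norm_exp_pos, norm_nat_add_two_mul_I, mul_one]
  have h1 : cw α 2 n * ((n : ℝ) + 2) ≤ 1 := by
    refine le_trans (mul_le_mul_of_nonneg_left ?_ (cw_pos α 2 n).le) (cw_mul_sq_le (α := α) n)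
    have hn : (1 : ℝ) ≤ (n : ℝ) + 2 := by linarith [n.cast_nonneg (α := ℝ)]
    exact le_self_pow₀ hn two_ne_zero
  have := mul_le_mul_of_nonneg_right h1 (norm_nonneg (g n))
  rw [one_mul] at this
  refine le_trans (le_of_eq ?_) this
  ring

theorem norm_prof_term_le (g : Summ ℕ) (n : ℕ) (x : ℝ) :
    ‖cw α 2 n * (g n * Complex.exp (((n : ℂ) + 2) * x * Complex.I)).re‖ ≤ ‖g n‖ := by
  rw [norm_mul, Real.norm_of_nonneg (cw_pos α 2 n).le]
  refine (mul_le_mul_of_nonneg_left (Complex.abs_re_le_norm _) (cw_pos α 2 n).le).trans ?_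
  rw [norm_mul, norm_exp_pos, mul_one]
  have hn : (1 : ℝ) ≤ (n : ℝ) + 2 := by linarith [n.cast_nonneg (α := ℝ)]
  have h1 : cw α 2 n ≤ 1 := by
    refine le_trans ?_ (cw_mul_sq_le (α := α) n)
    exact le_mul_of_one_le_right (cw_pos α 2 n).le (one_le_pow₀ hn)
  exact mul_le_of_le_one_left (norm_nonneg _) h1

theorem abs_ddprof_le (g : Summ ℕ) (x : ℝ) : |ddprof α g x| ≤ ‖g‖ :=
  tsum_of_norm_bounded (Summ.hasSum_norm g) fun n => norm_ddprof_term_le g n x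

theorem abs_dprof_le (g : Summ ℕ) (x : ℝ) : |dprof α 2 g x| ≤ ‖g‖ :=
  tsum_of_norm_bounded (Summ.hasSum_norm g) fun n => norm_dprof_term_le g n x

theorem abs_prof_le (g : Summ ℕ) (x : ℝ) : |prof α 2 g x| ≤ ‖g‖ :=
  tsum_of_norm_bounded (Summ.hasSum_norm g) fun n => norm_prof_term_le g n x

theorem hasDerivAt_dprof (g : Summ ℕ) (x : ℝ) : HasDerivAt (dprof α 2 g) (ddprof α g x) x :=
  hasDerivAt_tsum (Summ.hasSum_norm g).summable
    (fun n y => hasDerivAt_re_term n (g n * (((n : ℂ) + 2) * Complex.I)) (cw α 2 n) y)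
    (fun n y => norm_ddprof_term_le g n y) (y₀ := 0)
    (Summable.of_norm_bounded (Summ.hasSum_norm g).summable fun n => norm_dprof_term_le g n 0) x

/-- The boundary of a patch as a closed curve. -/
def patchCurve (α ε b : ℝ) [Fact (α ∈ Ioo (1 : ℝ) 2)] (w : Plane) (g : Summ ℕ) : ClosedCurve where
  X x := w 0 + ε * b * ((1 + scale α ε b * prof α 2 g x) * Real.cos x)
  Y x := w 1 + ε * b * ((1 + scale α ε b * prof α 2 g x) * Real.sin x)
  X' x := ε * b * (scale α ε b * dprof α 2 g x * Real.cos x +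
    (1 + scale α ε b * prof α 2 g x) * -Real.sin x)
  Y' x := ε * b * (scale α ε b * dprof α 2 g x * Real.sin x +
    (1 + scale α ε b * prof α 2 g x) * Real.cos x)
  hX x := (((((hasDerivAt_prof g x).const_mul (scale α ε b)).const_add 1).mul
    (Real.hasDerivAt_cos x)).const_mul (ε * b)).const_add (w 0)
  hY x := (((((hasDerivAt_prof g x).const_mul (scale α ε b)).const_add 1).mul
    (Real.hasDerivAt_sin x)).const_mul (ε * b)).const_add (w 1)
  cX' := by
    have := continuous_prof (α := α) (ρ := 2) g
    have := continuous_dprof (α := α) (ρ := 2) g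
    fun_prop
  cY' := by
    have := continuous_prof (α := α) (ρ := 2) g
    have := continuous_dprof (α := α) (ρ := 2) g
    fun_prop
  pX x := by simp only [periodic_prof g x, Real.cos_add_two_pi]
  pY x := by simp only [periodic_prof g x, Real.sin_add_two_pi]
  pX' x := by
    simp only [periodic_prof g x, periodic_dprof g x, Real.sin_add_two_pi, Real.cos_add_two_pi]
  pY' x := by
    simp only [periodic_prof g x, periodic_dprof g x, Real.sin_add_two_pi, Real.cos_add_two_pi]

theorem cross_patchCurve (ε bi bj : ℝ) (wi wj : Plane) (gi gj : Summ ℕ) (x y : ℝ) :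
    (patchCurve α ε bi wi gi).cross (patchCurve α ε bj wj gj) x y =
      -(ε ^ 2 * bi * bj * crossTerm (radius α ε bi (prof α 2 gi)) (radius α ε bj (prof α 2 gj)) x y) := by
  simp only [ClosedCurve.cross, patchCurve, crossTerm, deriv_radius, Real.sin_sub, Real.cos_sub]
  change _ = -(ε ^ 2 * bi * bj * (((1 + scale α ε bi * prof α 2 gi x) *
    (1 + scale α ε bj * prof α 2 gj y) + _) * _ + ((1 + scale α ε bi * prof α 2 gi x) * _ -
      _ * (1 + scale α ε bj * prof α 2 gj y)) * _))
  ring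

theorem sqDist_patchCurve (ε bi bj : ℝ) (wi wj : Plane) (gi gj : Summ ℕ) (x y : ℝ) :
    (patchCurve α ε bi wi gi).sqDist (patchCurve α ε bj wj gj) x y =
      ‖boundaryPoint α ε bi wi (prof α 2 gi) x - boundaryPoint α ε bj wj (prof α 2 gj) y‖ ^ 2 := by
  rw [Plane.norm_sq]
  simp only [ClosedCurve.sqDist, patchCurve, boundaryPoint, radius, scale, radial]
  simp
  ring

theorem sqDist_patchCurve_self (ε b : ℝ) (w : Plane) (g : Summ ℕ) (x y : ℝ) :
    (patchCurve α ε b w g).sqDist (patchCurve α ε b w g) x y =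
      (ε * b) ^ 2 * ((radius α ε b (prof α 2 g) x - radius α ε b (prof α 2 g) y) ^ 2
          + 4 * radius α ε b (prof α 2 g) x * radius α ε b (prof α 2 g) y *
            Real.sin ((x - y) / 2) ^ 2) := by
  have h0 : Real.cos (x - y) = 1 - 2 * Real.sin ((x - y) / 2) ^ 2 := by
    have := Real.cos_sq' ((x - y) / 2)
    have h2 := Real.cos_two_mul ((x - y) / 2)
    rw [show 2 * ((x - y) / 2) = x - y by ring] at h2
    rw [h2, this]; ring
  have h1 : 2 * Real.sin ((x - y) / 2) ^ 2 = 1 - Real.cos (x - y) := by linarith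
  have hs := Real.sin_sq_add_cos_sq x
  have ht := Real.sin_sq_add_cos_sq y
  have e : (ε * b) ^ 2 * ((radius α ε b (prof α 2 g) x - radius α ε b (prof α 2 g) y) ^ 2
          + 4 * radius α ε b (prof α 2 g) x * radius α ε b (prof α 2 g) y *
            Real.sin ((x - y) / 2) ^ 2) = (ε * b) ^ 2 * ((radius α ε b (prof α 2 g) x -
            radius α ε b (prof α 2 g) y) ^ 2
          + 2 * radius α ε b (prof α 2 g) x * radius α ε b (prof α 2 g) y *
            (2 * Real.sin ((x - y) / 2) ^ 2)) := by ring
  rw [e, h1, Real.cos_sub]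
  change (w 0 + ε * b * (radius α ε b (prof α 2 g) x * Real.cos x) -
    (w 0 + ε * b * (radius α ε b (prof α 2 g) y * Real.cos y))) ^ 2 +
    (w 1 + ε * b * (radius α ε b (prof α 2 g) x * Real.sin x) -
    (w 1 + ε * b * (radius α ε b (prof α 2 g) y * Real.sin y))) ^ 2 = _
  linear_combination ((ε * b) ^ 2 * radius α ε b (prof α 2 g) x ^ 2) * hs +
    ((ε * b) ^ 2 * radius α ε b (prof α 2 g) y ^ 2) * ht

variable {N : ℕ} {b : Fin N → ℝ} {ε : ℝ} {g : Fin N → Summ ℕ} {lam : Param N}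

theorem radius_le (ε b : ℝ) (g : Summ ℕ) (x : ℝ) :
    |radius α ε b (prof α 2 g) x| ≤ 1 + |scale α ε b| * ‖g‖ := by
  change |1 + scale α ε b * prof α 2 g x| ≤ _
  refine (abs_add_le _ _).trans ?_
  rw [abs_one, abs_mul]
  exact add_le_add_right (mul_le_mul_of_nonneg_left (abs_prof_le g x) (abs_nonneg _)) 1

theorem abs_deriv_radius_le (ε b : ℝ) (g : Summ ℕ) (x : ℝ) :
    |deriv (radius α ε b (prof α 2 g)) x| ≤ |scale α ε b| * ‖g‖ := by
  rw [deriv_radius, abs_mul]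
  exact mul_le_mul_of_nonneg_left (abs_dprof_le g x) (abs_nonneg _)

theorem abs_crossTerm_le (ε bi bj : ℝ) (gi gj : Summ ℕ) (x y : ℝ) :
    |crossTerm (radius α ε bi (prof α 2 gi)) (radius α ε bj (prof α 2 gj)) x y| ≤
      4 * ((1 + |scale α ε bi| * ‖gi‖) * (1 + |scale α ε bj| * ‖gj‖)) := by
  have h1 := radius_le (α := α) ε bi gi x
  have h2 := radius_le (α := α) ε bj gj y
  have h3 := (abs_deriv_radius_le (α := α) ε bi gi x).trans (le_add_of_nonneg_left zero_le_one)
  have h4 := (abs_deriv_radius_le (α := α) ε bj gj y).trans (le_add_of_nonneg_left zero_le_one)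
  have hs := Real.abs_sin_le_one (x - y)
  have hc := Real.abs_cos_le_one (x - y)
  set Mi := 1 + |scale α ε bi| * ‖gi‖
  set Mj := 1 + |scale α ε bj| * ‖gj‖
  have hm : ∀ p q : ℝ, |p| ≤ Mi → |q| ≤ Mj → |p * q| ≤ Mi * Mj := fun p q hp hq => by
    rw [abs_mul]; exact mul_le_mul hp hq (abs_nonneg _) ((abs_nonneg _).trans hp)
  have hM : 0 ≤ Mi * Mj := (abs_nonneg _).trans (hm _ _ h1 h2)
  rw [crossTerm]
  have a1 : |(radius α ε bi (prof α 2 gi) x * radius α ε bj (prof α 2 gj) y +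
      deriv (radius α ε bi (prof α 2 gi)) x * deriv (radius α ε bj (prof α 2 gj)) y) *
      Real.sin (x - y)| ≤ 2 * (Mi * Mj) := by
    rw [abs_mul]
    refine (mul_le_of_le_one_right (abs_nonneg _) hs).trans ((abs_add_le _ _).trans ?_)
    linarith [hm _ _ h1 h2, hm _ _ h3 h4]
  have a2 : |(radius α ε bi (prof α 2 gi) x * deriv (radius α ε bj (prof α 2 gj)) y -
      deriv (radius α ε bi (prof α 2 gi)) x * radius α ε bj (prof α 2 gj) y) *
      Real.cos (x - y)| ≤ 2 * (Mi * Mj) := by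
    rw [abs_mul]
    refine (mul_le_of_le_one_right (abs_nonneg _) hc).trans ((abs_sub _ _).trans ?_)
    linarith [hm _ _ h1 h4, hm _ _ h3 h2]
  exact (abs_add_le _ _).trans (by linarith)

/-- Tangent vectors of the same curve become parallel on the diagonal: every term contains sin h or
an increment of R or R', and each of these is at most a multiple of the chord. -/
theorem abs_crossTerm_self_le (ε b : ℝ) (g : Summ ℕ) :
    ∃ C, ∀ x, ∀ h ∈ Ioo 0 (2 * Real.pi),
      |crossTerm (radius α ε b (prof α 2 g)) (radius α ε b (prof α 2 g)) x (x - h)| ≤ C * chord h := by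
  have hR : ∀ x, HasDerivAt (radius α ε b (prof α 2 g)) (scale α ε b * dprof α 2 g x) x := fun x =>
    ((hasDerivAt_prof g x).const_mul (scale α ε b)).const_add 1
  have hR' : ∀ x, HasDerivAt (fun x => scale α ε b * dprof α 2 g x) (scale α ε b * ddprof α g x) x :=
    fun x => (hasDerivAt_dprof g x).const_mul (scale α ε b)
  set m := |scale α ε b| * ‖g‖
  have hm0 : 0 ≤ m := by positivity
  have b0 : ∀ x, |radius α ε b (prof α 2 g) x| ≤ 1 + m := radius_le ε b g
  have b1 : ∀ x, |scale α ε b * dprof α 2 g x| ≤ m := fun x => by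
    rw [abs_mul]; exact mul_le_mul_of_nonneg_left (abs_dprof_le g x) (abs_nonneg _)
  have b2 : ∀ x, |scale α ε b * ddprof α g x| ≤ m := fun x => by
    rw [abs_mul]; exact mul_le_mul_of_nonneg_left (abs_ddprof_le g x) (abs_nonneg _)
  refine ⟨(1 + m) * (1 + m) + m * m + ((1 + m) * (m * (Real.pi / 2)) + m * (m * (Real.pi / 2))),
    fun x h hh => ?_⟩
  have l1 := abs_sub_le_chord hR b1 (fun y => by simp only [radius, periodic_prof g y]) x hh
  have l2 := abs_sub_le_chord hR' b2 (fun y => by simp only [periodic_dprof g y]) x hh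
  have hc0 := (chord_pos hh).le
  have ec : crossTerm (radius α ε b (prof α 2 g)) (radius α ε b (prof α 2 g)) x (x - h) =
      (radius α ε b (prof α 2 g) x * radius α ε b (prof α 2 g) (x - h) +
        scale α ε b * dprof α 2 g x * (scale α ε b * dprof α 2 g (x - h))) * (chord h * Real.cos (h / 2)) +
      (-(radius α ε b (prof α 2 g) x * (scale α ε b * dprof α 2 g x -
        scale α ε b * dprof α 2 g (x - h))) + scale α ε b * dprof α 2 g x *
        (radius α ε b (prof α 2 g) x - radius α ε b (prof α 2 g) (x - h))) * Real.cos h := by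
    rw [crossTerm, deriv_radius, deriv_radius, sub_sub_cancel, sin_eq_chord]; ring
  rw [ec]
  have k1 : ∀ p q A B : ℝ, |p| ≤ A → |q| ≤ B → |p * q| ≤ A * B := fun p q A B hp hq => by
    rw [abs_mul]; exact mul_le_mul hp hq (abs_nonneg _) ((abs_nonneg _).trans hp)
  have t1 : |chord h * Real.cos (h / 2)| ≤ chord h := by
    rw [abs_mul, abs_of_nonneg hc0]
    exact mul_le_of_le_one_right hc0 (Real.abs_cos_le_one _)
  have t2 := k1 _ _ _ _ ((abs_add_le _ _).trans (add_le_add (k1 _ _ _ _ (b0 x) (b0 (x - h)))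
    (k1 _ _ _ _ (b1 x) (b1 (x - h))))) t1
  have t3 := (abs_add_le (-(radius α ε b (prof α 2 g) x * (scale α ε b * dprof α 2 g x -
        scale α ε b * dprof α 2 g (x - h)))) (scale α ε b * dprof α 2 g x *
        (radius α ε b (prof α 2 g) x - radius α ε b (prof α 2 g) (x - h))))
  rw [abs_neg] at t3
  have t4 := t3.trans (add_le_add (k1 _ _ _ _ (b0 x) l2) (k1 _ _ _ _ (b1 x) l1))
  have t5 := k1 _ _ _ _ t4 (Real.abs_cos_le_one h)
  refine (abs_add_le _ _).trans ((add_le_add t2 t5).trans (le_of_eq ?_))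
  ring

theorem inter_sqDist_ge (h : Admissible α 2 b ε g lam) {i j : Fin N} (hij : i ≠ j) :
    ∃ c > 0, ∀ x y, c ≤ (patchCurve α ε (b i) (pos lam i) (g i)).sqDist
      (patchCurve α ε (b j) (pos lam j) (g j)) x y := by
  have hz := sepC_ne_zero h.distinct hij
  have hn : 0 < ‖sepC lam i j‖ ^ 2 := by have := norm_pos_iff.2 hz; positivity
  refine ⟨‖sepC lam i j‖ ^ 2 * (1 - ‖ε • interTau α 2 ε (b i) (b j) (sepC lam i j) (g i) (g j)‖),
    mul_pos hn (sub_pos.2 (h.inter_lt i j hij)), fun x y => ?_⟩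
  rw [sqDist_patchCurve, norm_boundaryPoint_sub hz]
  refine mul_le_mul_of_nonneg_left ?_ hn.le
  have h1 := norm_evK_le x (x - y) (ε • interTau α 2 ε (b i) (b j) (sepC lam i j) (g i) (g j))
  rw [evK_smul, evK_interTau, sub_sub_cancel, ← Complex.ofReal_mul, Complex.norm_real,
    Real.norm_eq_abs] at h1
  linarith [neg_abs_le (ε * tauFun α 2 ε (b i) (b j) (sepC lam i j) (g i) (g j) x y)]

/-- On a single boundary the squared distance is at least a multiple of chord² and the cross product
is at most a multiple of the chord, which leaves chord^{1-α}. Distinct boundaries are at positive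
distance and the kernel is bounded. -/
theorem dominated_patchCurve (hb : ∀ i, 0 < b i) (hε : ε ≠ 0) (h : Admissible α 2 b ε g lam)
    (i j : Fin N) : ∃ C, (patchCurve α ε (b i) (pos lam i) (g i)).Dominated
      (patchCurve α ε (b j) (pos lam j) (g j)) α C := by
  have h12 := hα.out
  by_cases hij : i = j
  · subst hij
    obtain ⟨C, hC⟩ := abs_crossTerm_self_le (α := α) ε (b i) (g i)
    set η := scale α ε (b i)
    set c := (ε * b i) ^ 2 * (1 - ‖η • selfBeta α 2 η (g i)‖) with hc
    have hεb : 0 < (ε * b i) ^ 2 := by have := (hb i).ne'; positivity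
    have hc0 : 0 < c := mul_pos hεb (sub_pos.2 (h.self_lt i))
    refine ⟨ε ^ 2 * b i * b i * C * c ^ (-(α / 2)), fun x t ht => ?_⟩
    have hct := chord_pos ht
    have e1 : (patchCurve α ε (b i) (pos lam i) (g i)).sqDist (patchCurve α ε (b i) (pos lam i) (g i))
        x (x - t) = (ε * b i) ^ 2 * (chord t ^ 2 * (1 + η * betaFun α 2 η (g i) x t)) := by
      rw [sqDist_patchCurve_self, ← chord_sq_mul, sub_sub_cancel, chord]
      change _ = (ε * b i) ^ 2 * ((η * prof α 2 (g i) x - η * prof α 2 (g i) (x - t)) ^ 2 +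
        radius α ε (b i) (prof α 2 (g i)) x * radius α ε (b i) (prof α 2 (g i)) (x - t) * _)
      have : radius α ε (b i) (prof α 2 (g i)) x - radius α ε (b i) (prof α 2 (g i)) (x - t) =
          η * prof α 2 (g i) x - η * prof α 2 (g i) (x - t) := by
        change 1 + η * _ - (1 + η * _) = _
        ring
      rw [this]; ring
    have h1 := norm_evK_le x t (η • selfBeta α 2 η (g i))
    rw [evK_smul, evK_selfBeta, ← Complex.ofReal_mul, Complex.norm_real, Real.norm_eq_abs] at h1
    have h2 : c * chord t ^ 2 ≤ (patchCurve α ε (b i) (pos lam i) (g i)).sqDist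
        (patchCurve α ε (b i) (pos lam i) (g i)) x (x - t) := by
      rw [e1, hc, mul_assoc, mul_comm (1 - _)]
      refine mul_le_mul_of_nonneg_left (mul_le_mul_of_nonneg_left ?_ (by positivity)) hεb.le
      linarith [neg_abs_le (η * betaFun α 2 η (g i) x t)]
    have h3 : 0 < c * chord t ^ 2 := by positivity
    refine ⟨h3.trans_le h2, ?_⟩
    have h4 := Real.rpow_le_rpow_of_nonpos h3 h2 (by linarith [h12.1] : -(α / 2) ≤ 0)
    have h5 : (c * chord t ^ 2) ^ (-(α / 2)) = c ^ (-(α / 2)) * chord t ^ (-α) := by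
      rw [Real.mul_rpow hc0.le (by positivity), ← Real.rpow_natCast_mul hct.le]
      congr 2
      push_cast; ring
    rw [h5] at h4
    have hbi := hb i
    have h6 : |(patchCurve α ε (b i) (pos lam i) (g i)).cross (patchCurve α ε (b i) (pos lam i) (g i))
        x (x - t)| ≤ ε ^ 2 * b i * b i * (C * chord t) := by
      rw [cross_patchCurve, abs_neg, abs_mul, abs_of_nonneg (by positivity)]
      exact mul_le_mul_of_nonneg_left (hC x t ht) (by positivity)
    refine (mul_le_mul h6 h4 (Real.rpow_nonneg (h3.trans_le h2).le _)
      ((abs_nonneg _).trans h6)).trans (le_of_eq ?_)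
    rw [chord_rpow_one_sub h12 ht]; ring
  · obtain ⟨c, hc0, hc⟩ := inter_sqDist_ge h hij
    set M := 4 * ((1 + |scale α ε (b i)| * ‖g i‖) * (1 + |scale α ε (b j)| * ‖g j‖))
    have hM : 0 ≤ M := by positivity
    -- The factor 2^{α-1} compensates chord^{1-α} ≥ 2^{1-α}, valid since the chord is at most 2.
    refine ⟨ε ^ 2 * b i * b j * M * c ^ (-(α / 2)) * 2 ^ (α - 1), fun x t ht => ⟨hc0.trans_le (hc _ _), ?_⟩⟩
    have hct := chord_pos ht
    have hbi := hb i
    have hbj := hb j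
    have h4 := Real.rpow_le_rpow_of_nonpos hc0 (hc x (x - t)) (by linarith [h12.1] : -(α / 2) ≤ 0)
    have h6 : |(patchCurve α ε (b i) (pos lam i) (g i)).cross (patchCurve α ε (b j) (pos lam j) (g j))
        x (x - t)| ≤ ε ^ 2 * b i * b j * M := by
      rw [cross_patchCurve, abs_neg, abs_mul, abs_of_nonneg (by positivity)]
      exact mul_le_mul_of_nonneg_left (abs_crossTerm_le _ _ _ _ _ _ _) (by positivity)
    have h7 := mul_le_mul h6 h4 (Real.rpow_nonneg (hc0.trans_le (hc _ _)).le _) (by positivity)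
    refine h7.trans ?_
    rw [mul_assoc (_ * _) ((2 : ℝ) ^ _)]
    refine le_mul_of_one_le_right (by positivity) ?_
    have h8 : chord t ≤ 2 := by
      rw [chord]; linarith [Real.sin_le_one (t / 2)]
    have h9 := Real.rpow_le_rpow_of_nonpos hct h8 (by linarith [h12.1] : 1 - α ≤ 0)
    have h10 : (2 : ℝ) ^ (α - 1) * 2 ^ (1 - α) = 1 := by
      rw [← Real.rpow_add two_pos]; simp
    exact h10.ge.trans (mul_le_mul_of_nonneg_left h9 (by positivity))

theorem exists_dominated (hb : ∀ i, 0 < b i) (hε : ε ≠ 0) (h : Admissible α 2 b ε g lam) :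
    ∃ C, ∀ i j, (patchCurve α ε (b i) (pos lam i) (g i)).Dominated
      (patchCurve α ε (b j) (pos lam j) (g j)) α C := by
  choose C hC using fun i j => dominated_patchCurve hb hε h i j
  refine ⟨∑ i, ∑ j, |C i j|, fun i j x t ht => ⟨(hC i j x t ht).1, ((hC i j x t ht).2).trans ?_⟩⟩
  refine mul_le_mul_of_nonneg_right ?_ (Real.rpow_nonneg (chord_pos ht).le _)
  refine (le_abs_self _).trans ?_
  refine (Finset.single_le_sum (f := fun j => |C i j|) (fun j _ => abs_nonneg _)
    (Finset.mem_univ j)).trans ?_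
  exact Finset.single_le_sum (f := fun i => ∑ j, |C i j|)
    (fun i _ => Finset.sum_nonneg fun j _ => abs_nonneg _) (Finset.mem_univ i)

/-- The contour functional as a sum of fluxes. -/
theorem radius_mul_functional (hb : ∀ i, 0 < b i) (hε : ε ≠ 0) (h : Admissible α 2 b ε g lam)
    (i : Fin N) (x : ℝ) :
    strength lam i / b i * (radius α ε (b i) (prof α 2 (g i)) x *
      functional α b ε (fun j => prof α 2 (g j)) lam i x) =
    -(kernelConst α / (2 * Real.pi * ε ^ 3)) * ∑ j, strength lam i / b i ^ 2 *
      (strength lam j / b j ^ 2) * (patchCurve α ε (b i) (pos lam i) (g i)).flux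
        (patchCurve α ε (b j) (pos lam j) (g j)) α x := by
  have hR := radius_pos h i x
  have hbi := hb i
  have hpi := Real.pi_ne_zero
  have hae : 0 < |ε| := abs_pos.2 hε
  -- The kernel of the contour equation is the cross product of the tangents up to the factor -ε²
  -- b_i b_j. After multiplication by γ_i/b_i the coefficients become the symmetric products
  -- (γ_i/b_i²)(γ_j/b_j²) required by the conservation laws.
  have hfl : ∀ j, (patchCurve α ε (b i) (pos lam i) (g i)).flux
        (patchCurve α ε (b j) (pos lam j) (g j)) α x = -(ε ^ 2 * b i * b j) *
      ∫ y in (0 : ℝ)..(2 * Real.pi),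
        crossTerm (radius α ε (b i) (prof α 2 (g i))) (radius α ε (b j) (prof α 2 (g j))) x y /
          ‖boundaryPoint α ε (b i) (pos lam i) (prof α 2 (g i)) x
            - boundaryPoint α ε (b j) (pos lam j) (prof α 2 (g j)) y‖ ^ α := by
    intro j
    rw [← intervalIntegral.integral_const_mul]
    refine intervalIntegral.integral_congr fun y _ => ?_
    rw [cross_patchCurve, sqDist_patchCurve, ← Real.rpow_natCast_mul (norm_nonneg _),
      show ((2 : ℕ) : ℝ) * -(α / 2) = -α by push_cast; ring, Real.rpow_neg (norm_nonneg _)]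
    ring
  have hself : radius α ε (b i) (prof α 2 (g i)) x *
      selfTerm α ε (b i) (strength lam i) (prof α 2 (g i)) x =
      kernelConst α / (2 * Real.pi * ε) * (strength lam i / b i *
      ∫ y in (0 : ℝ)..(2 * Real.pi),
        crossTerm (radius α ε (b i) (prof α 2 (g i))) (radius α ε (b i) (prof α 2 (g i))) x y /
          ‖boundaryPoint α ε (b i) (pos lam i) (prof α 2 (g i)) x
            - boundaryPoint α ε (b i) (pos lam i) (prof α 2 (g i)) y‖ ^ α) := by
    have e1 : ∀ y, crossTerm (radius α ε (b i) (prof α 2 (g i))) (radius α ε (b i) (prof α 2 (g i))) x y /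
          ‖boundaryPoint α ε (b i) (pos lam i) (prof α 2 (g i)) x
            - boundaryPoint α ε (b i) (pos lam i) (prof α 2 (g i)) y‖ ^ α =
        (|ε| ^ α * b i ^ α)⁻¹ *
        (crossTerm (radius α ε (b i) (prof α 2 (g i))) (radius α ε (b i) (prof α 2 (g i))) x y /
        ((radius α ε (b i) (prof α 2 (g i)) x - radius α ε (b i) (prof α 2 (g i)) y) ^ 2
          + 4 * radius α ε (b i) (prof α 2 (g i)) x * radius α ε (b i) (prof α 2 (g i)) y *
            Real.sin ((x - y) / 2) ^ 2) ^ (α / 2)) := by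
      intro y
      have hRy := radius_pos h i y
      have e2 : ‖boundaryPoint α ε (b i) (pos lam i) (prof α 2 (g i)) x
            - boundaryPoint α ε (b i) (pos lam i) (prof α 2 (g i)) y‖ ^ α =
          (‖boundaryPoint α ε (b i) (pos lam i) (prof α 2 (g i)) x
            - boundaryPoint α ε (b i) (pos lam i) (prof α 2 (g i)) y‖ ^ 2) ^ (α / 2) := by
        rw [← Real.rpow_natCast_mul (norm_nonneg _)]
        congr 1; push_cast; ring
      have e3 : ((ε * b i) ^ 2) ^ (α / 2) = |ε| ^ α * b i ^ α := by
        rw [← sq_abs, abs_mul, abs_of_pos hbi, ← Real.rpow_natCast_mul (by positivity),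
          Real.mul_rpow hae.le hbi.le]
        congr 2 <;> · push_cast; ring
      rw [e2, ← sqDist_patchCurve, sqDist_patchCurve_self, Real.mul_rpow (by positivity)
        (by positivity), e3]
      ring
    simp only [e1]
    rw [intervalIntegral.integral_const_mul, selfTerm, Real.rpow_add hbi, Real.rpow_one]
    have h1 : 0 < |ε| ^ α := by positivity
    have h2 : 0 < b i ^ α := by positivity
    have gen : ∀ I : ℝ, radius α ε (b i) (prof α 2 (g i)) x * (kernelConst α * strength lam i /
        (2 * Real.pi * (ε * |ε| ^ α) * (b i * b i ^ α) * radius α ε (b i) (prof α 2 (g i)) x) * I) =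
        kernelConst α / (2 * Real.pi * ε) * (strength lam i / b i * ((|ε| ^ α * b i ^ α)⁻¹ * I)) := by
      intro I; field_simp
    exact gen _
  rw [functional, if_neg hε, mul_add (radius _ _ _ _ _), hself, interactionTerm]
  simp only [hfl]
  rw [← Finset.add_sum_erase _ _ (Finset.mem_univ i)]
  have e4 : radius α ε (b i) (prof α 2 (g i)) x * (kernelConst α / (2 * Real.pi * ε *
      radius α ε (b i) (prof α 2 (g i)) x) * ∑ j ∈ Finset.univ.erase i, strength lam j / b j *
      ∫ y in (0 : ℝ)..(2 * Real.pi),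
        crossTerm (radius α ε (b i) (prof α 2 (g i))) (radius α ε (b j) (prof α 2 (g j))) x y /
          ‖boundaryPoint α ε (b i) (pos lam i) (prof α 2 (g i)) x
            - boundaryPoint α ε (b j) (pos lam j) (prof α 2 (g j)) y‖ ^ α) =
      kernelConst α / (2 * Real.pi * ε) * ∑ j ∈ Finset.univ.erase i, strength lam j / b j *
      ∫ y in (0 : ℝ)..(2 * Real.pi),
        crossTerm (radius α ε (b i) (prof α 2 (g i))) (radius α ε (b j) (prof α 2 (g j))) x y /
          ‖boundaryPoint α ε (b i) (pos lam i) (prof α 2 (g i)) x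
            - boundaryPoint α ε (b j) (pos lam j) (prof α 2 (g j)) y‖ ^ α := by
    field_simp
  rw [e4, mul_add, mul_add, Finset.mul_sum, Finset.mul_sum, Finset.mul_sum]
  congr 1
  · field_simp
  · refine Finset.sum_congr rfl fun j _ => ?_
    have hbj := hb j
    field_simp

end

end

/-! ### Conservation laws for the contour functional -/

noncomputable section

open MeasureTheory Wiener

namespace ClosedCurve

variable {z ζ : ClosedCurve}

/-- Pointwise limit of the continuous regularised fluxes, which are bounded uniformly. -/
theorem intervalIntegrable_flux {α C : ℝ} (hα : α ∈ Ioo (1 : ℝ) 2) (hd : Dominated z ζ α C) :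
    IntervalIntegrable (flux z ζ α) volume 0 (2 * Real.pi) := by
  have hm : AEStronglyMeasurable (flux z ζ α) (volume.restrict (uIoc 0 (2 * Real.pi))) :=
    aestronglyMeasurable_of_tendsto_ae (u := atTop)
      (f := fun n : ℕ => regFlux z ζ α (1 / ((n : ℝ) + 1)))
      (fun n => (continuous_regFlux z ζ α (by positivity)).aestronglyMeasurable)
      (Eventually.of_forall fun x => tendsto_regFlux hα hd x)
  refine (intervalIntegrable_const (c := C * ∫ h in (0 : ℝ)..(2 * Real.pi),
    chord h ^ (1 - α))).mono_fun hm (Eventually.of_forall fun x => ?_)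
  refine le_trans (le_of_tendsto (tendsto_regFlux hα hd x).norm
    (Eventually.of_forall fun n => ?_)) (le_abs_self _)
  exact abs_regFlux_le hα hd (by positivity) x

end ClosedCurve

section

variable {α : ℝ} [hα : Fact (α ∈ Ioo (1 : ℝ) 2)] {N : ℕ} {b : Fin N → ℝ} {ε : ℝ}
  {g : Fin N → Summ ℕ} {lam : Param N}

variable (α) in
/-- The contour functional multiplied by the radius. -/
def weighted (b : Fin N → ℝ) (ε : ℝ) (g : Fin N → Summ ℕ) (lam : Param N) (i : Fin N) (x : ℝ) : ℝ :=
  radius α ε (b i) (prof α 2 (g i)) x * functional α b ε (fun j => prof α 2 (g j)) lam i x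

theorem ev_totalH_eq_weighted (hb : ∀ i, 0 < b i) (h : Admissible α 2 b ε g lam) (i : Fin N) (x : ℝ) :
    ev 2 x (totalH α 2 b ε g lam i) = (weighted α b ε g lam i x : ℝ) := ev_totalH hb h i x

theorem continuous_weighted (hb : ∀ i, 0 < b i) (h : Admissible α 2 b ε g lam) (i : Fin N) :
    Continuous (weighted α b ε g lam i) := by
  have h1 := Complex.continuous_re.comp (continuous_ev (totalH α 2 b ε g lam i))
  refine h1.congr fun x => ?_
  simp [ev_totalH_eq_weighted hb h]

/-- Integration of the contour functional against a continuous function. -/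
theorem integral_mul_weighted (hb : ∀ i, 0 < b i) (hε : ε ≠ 0) (h : Admissible α 2 b ε g lam)
    {ψ : ℝ → ℝ} (hψ : Continuous ψ) (i : Fin N) :
    strength lam i / b i * ∫ x in (0 : ℝ)..(2 * Real.pi), ψ x * weighted α b ε g lam i x =
    -(kernelConst α / (2 * Real.pi * ε ^ 3)) * ∑ j, strength lam i / b i ^ 2 *
      (strength lam j / b j ^ 2) * ∫ x in (0 : ℝ)..(2 * Real.pi), ψ x *
        (patchCurve α ε (b i) (pos lam i) (g i)).flux
        (patchCurve α ε (b j) (pos lam j) (g j)) α x := by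
  obtain ⟨C, hC⟩ := exists_dominated hb hε h
  have hint : ∀ j, IntervalIntegrable (fun x => strength lam i / b i ^ 2 *
      (strength lam j / b j ^ 2) * (ψ x * (patchCurve α ε (b i) (pos lam i) (g i)).flux
        (patchCurve α ε (b j) (pos lam j) (g j)) α x)) volume 0 (2 * Real.pi) := fun j =>
    ((ClosedCurve.intervalIntegrable_flux hα.out (hC i j)).continuousOn_mul
      hψ.continuousOn).const_mul _
  simp only [← intervalIntegral.integral_const_mul]
  rw [← intervalIntegral.integral_finsetSum fun j _ => hint j,
    ← intervalIntegral.integral_const_mul]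
  refine intervalIntegral.integral_congr fun x _ => ?_
  have := radius_mul_functional hb hε h i x
  calc strength lam i / b i * (ψ x * weighted α b ε g lam i x) =
      ψ x * (strength lam i / b i * weighted α b ε g lam i x) := by ring
    _ = _ := by
      rw [weighted, this, mul_left_comm, Finset.mul_sum]
      congr 1
      exact Finset.sum_congr rfl fun j _ => by ring

/-- Each flux has mean zero, by antisymmetry for j = i and by Stokes for j ≠ i. This disposes of
mode zero of the contour equation. -/
theorem integral_weighted (hb : ∀ i, 0 < b i) (hε : ε ≠ 0) (h : Admissible α 2 b ε g lam)
    (hγ : ∀ i, strength lam i ≠ 0) (i : Fin N) :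
    ∫ x in (0 : ℝ)..(2 * Real.pi), weighted α b ε g lam i x = 0 := by
  have h1 := integral_mul_weighted hb hε h (continuous_const (y := (1 : ℝ))) i
  obtain ⟨C, hC⟩ := exists_dominated hb hε h
  simp only [one_mul] at h1
  rw [Finset.sum_eq_zero fun j _ => ?_, mul_zero] at h1
  · exact (mul_eq_zero.1 h1).resolve_left (div_ne_zero (hγ i) (hb i).ne')
  · by_cases hij : i = j
    · subst hij
      rw [ClosedCurve.integral_flux_self hα.out (hC i i), mul_zero]
    · obtain ⟨c, hc0, hc⟩ := inter_sqDist_ge h hij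
      rw [ClosedCurve.integral_flux_of_separated _ _ hα.out fun x y => hc0.trans_le (hc x y), mul_zero]

/-- The law for systems of curves with charges γ_i/b_i², tested with affine functions and |z|²;
these are the Euclidean symmetries of the kernel. -/
theorem sum_integral_weighted (hb : ∀ i, 0 < b i) (hε : ε ≠ 0) (h : Admissible α 2 b ε g lam)
    (p q k : ℝ) :
    ∑ i, strength lam i / b i * ∫ x in (0 : ℝ)..(2 * Real.pi),
      (p * (patchCurve α ε (b i) (pos lam i) (g i)).X x +
       q * (patchCurve α ε (b i) (pos lam i) (g i)).Y x +
       k * ((patchCurve α ε (b i) (pos lam i) (g i)).X x ^ 2 +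
        (patchCurve α ε (b i) (pos lam i) (g i)).Y x ^ 2)) * weighted α b ε g lam i x = 0 := by
  obtain ⟨C, hC⟩ := exists_dominated hb hε h
  have h1 := ClosedCurve.sum_integral_mul_flux hα.out (c := fun i =>
    patchCurve α ε (b i) (pos lam i) (g i)) hC (fun i => strength lam i / b i ^ 2) p q k
  have h2 : ∀ i, Continuous fun x => p * (patchCurve α ε (b i) (pos lam i) (g i)).X x +
       q * (patchCurve α ε (b i) (pos lam i) (g i)).Y x +
       k * ((patchCurve α ε (b i) (pos lam i) (g i)).X x ^ 2 +
        (patchCurve α ε (b i) (pos lam i) (g i)).Y x ^ 2) := fun i => by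
    have := (patchCurve α ε (b i) (pos lam i) (g i)).cX
    have := (patchCurve α ε (b i) (pos lam i) (g i)).cY
    fun_prop
  rw [Finset.sum_congr rfl fun i _ => integral_mul_weighted hb hε h (h2 i) i, ← Finset.mul_sum, h1,
    mul_zero]

/-- The linear conservation laws. -/
theorem sum_linear_weighted (hb : ∀ i, 0 < b i) (hε : ε ≠ 0) (h : Admissible α 2 b ε g lam)
    (hγ : ∀ i, strength lam i ≠ 0) (p q : ℝ) :
    ∑ i, strength lam i * ∫ x in (0 : ℝ)..(2 * Real.pi),
      (1 + scale α ε (b i) * prof α 2 (g i) x) * (p * Real.cos x + q * Real.sin x) *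
        weighted α b ε g lam i x = 0 := by
  have h1 := sum_integral_weighted hb hε h p q 0
  have h2 : ∀ i, strength lam i / b i * ∫ x in (0 : ℝ)..(2 * Real.pi),
      (p * (patchCurve α ε (b i) (pos lam i) (g i)).X x +
       q * (patchCurve α ε (b i) (pos lam i) (g i)).Y x +
       0 * ((patchCurve α ε (b i) (pos lam i) (g i)).X x ^ 2 +
        (patchCurve α ε (b i) (pos lam i) (g i)).Y x ^ 2)) * weighted α b ε g lam i x =
      ε * (strength lam i * ∫ x in (0 : ℝ)..(2 * Real.pi),
        (1 + scale α ε (b i) * prof α 2 (g i) x) * (p * Real.cos x + q * Real.sin x) *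
        weighted α b ε g lam i x) := by
    intro i
    have hw := continuous_weighted hb h i
    have hp := continuous_prof (α := α) (ρ := 2) (g i)
    -- The centre w_i multiplies the mean of the functional, which is zero. The remainder has a
    -- common factor ε that can be cancelled, leaving a law that stays nontrivial as ε → 0.
    have e : ∀ x, (p * (patchCurve α ε (b i) (pos lam i) (g i)).X x +
       q * (patchCurve α ε (b i) (pos lam i) (g i)).Y x +
       0 * ((patchCurve α ε (b i) (pos lam i) (g i)).X x ^ 2 +
        (patchCurve α ε (b i) (pos lam i) (g i)).Y x ^ 2)) * weighted α b ε g lam i x =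
        (p * pos lam i 0 + q * pos lam i 1) * weighted α b ε g lam i x +
        (ε * b i) * ((1 + scale α ε (b i) * prof α 2 (g i) x) * (p * Real.cos x + q * Real.sin x) *
        weighted α b ε g lam i x) := fun x => by simp only [patchCurve]; ring
    simp only [e]
    rw [intervalIntegral.integral_add (Continuous.intervalIntegrable (by fun_prop) _ _)
      (Continuous.intervalIntegrable (by fun_prop) _ _), intervalIntegral.integral_const_mul,
      intervalIntegral.integral_const_mul, integral_weighted hb hε h hγ]
    have := (hb i).ne'
    field_simp
    ring
  rw [Finset.sum_congr rfl fun i _ => h2 i, ← Finset.mul_sum] at h1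
  exact (mul_eq_zero.1 h1).resolve_left hε

/-- The quadratic conservation law. -/
theorem sum_quadratic_weighted (hb : ∀ i, 0 < b i) (hε : ε ≠ 0) (h : Admissible α 2 b ε g lam)
    (hγ : ∀ i, strength lam i ≠ 0) :
    ∑ i, strength lam i * ∫ x in (0 : ℝ)..(2 * Real.pi),
      ((1 + scale α ε (b i) * prof α 2 (g i) x) *
        (2 * pos lam i 0 * Real.cos x + 2 * pos lam i 1 * Real.sin x) +
        ε * b i * (1 + scale α ε (b i) * prof α 2 (g i) x) ^ 2) *
        weighted α b ε g lam i x = 0 := by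
  have h1 := sum_integral_weighted hb hε h 0 0 1
  have h2 : ∀ i, strength lam i / b i * ∫ x in (0 : ℝ)..(2 * Real.pi),
      (0 * (patchCurve α ε (b i) (pos lam i) (g i)).X x +
       0 * (patchCurve α ε (b i) (pos lam i) (g i)).Y x +
       1 * ((patchCurve α ε (b i) (pos lam i) (g i)).X x ^ 2 +
        (patchCurve α ε (b i) (pos lam i) (g i)).Y x ^ 2)) * weighted α b ε g lam i x =
      ε * (strength lam i * ∫ x in (0 : ℝ)..(2 * Real.pi),
        ((1 + scale α ε (b i) * prof α 2 (g i) x) *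
        (2 * pos lam i 0 * Real.cos x + 2 * pos lam i 1 * Real.sin x) +
        ε * b i * (1 + scale α ε (b i) * prof α 2 (g i) x) ^ 2) *
        weighted α b ε g lam i x) := by
    intro i
    have hw := continuous_weighted hb h i
    have hp := continuous_prof (α := α) (ρ := 2) (g i)
    have e : ∀ x, (0 * (patchCurve α ε (b i) (pos lam i) (g i)).X x +
       0 * (patchCurve α ε (b i) (pos lam i) (g i)).Y x +
       1 * ((patchCurve α ε (b i) (pos lam i) (g i)).X x ^ 2 +
        (patchCurve α ε (b i) (pos lam i) (g i)).Y x ^ 2)) * weighted α b ε g lam i x =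
        (pos lam i 0 ^ 2 + pos lam i 1 ^ 2) * weighted α b ε g lam i x +
        (ε * b i) * (((1 + scale α ε (b i) * prof α 2 (g i) x) *
        (2 * pos lam i 0 * Real.cos x + 2 * pos lam i 1 * Real.sin x) +
        ε * b i * (1 + scale α ε (b i) * prof α 2 (g i) x) ^ 2) *
        weighted α b ε g lam i x) := fun x => by
      simp only [patchCurve]
      linear_combination (ε ^ 2 * b i ^ 2 * (1 + scale α ε (b i) * prof α 2 (g i) x) ^ 2 *
        weighted α b ε g lam i x) * Real.sin_sq_add_cos_sq x
    simp only [e]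
    rw [intervalIntegral.integral_add (Continuous.intervalIntegrable (by fun_prop) _ _)
      (Continuous.intervalIntegrable (by fun_prop) _ _), intervalIntegral.integral_const_mul,
      intervalIntegral.integral_const_mul, integral_weighted hb hε h hγ]
    have := (hb i).ne'
    field_simp
    ring
  rw [Finset.sum_congr rfl fun i _ => h2 i, ← Finset.mul_sum] at h1
  exact (mul_eq_zero.1 h1).resolve_left hε

end

end

/-! ### Linear and angular momentum of point vortices -/

noncomputable section

open MeasureTheory Wiener

section

variable {N : ℕ}

/-- Linear and angular momentum of velocities `q_i` of point vortices. -/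
def momentum (lam : Param N) : (Fin N → Plane) →ₗ[ℝ] (Fin 3 → ℝ) where
  toFun q := ![∑ i, strength lam i * q i 1, ∑ i, strength lam i * q i 0,
    ∑ i, strength lam i * (pos lam i 0 * q i 1 - pos lam i 1 * q i 0)]
  map_add' p q := by
    ext k
    fin_cases k <;> simp [← Finset.sum_add_distrib] <;>
      exact Finset.sum_congr rfl fun i _ => by ring
  map_smul' c q := by
    ext k
    fin_cases k <;> simp [Finset.mul_sum] <;>
      exact Finset.sum_congr rfl fun i _ => by ring

theorem momentum_single [DecidableEq (Fin N)] (lam : Param N) (i : Fin N) (v : Plane) :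
    momentum lam (Pi.single i v) = strength lam i • ![v 1, v 0, pos lam i 0 * v 1 - pos lam i 1 * v 0] := by
  have h : ∀ (c : Fin N → Plane → ℝ), (∀ j, c j 0 = 0) →
      ∑ j, strength lam j * c j ((Pi.single i v : Fin N → Plane) j) = strength lam i * c i v := by
    intro c hc
    rw [Finset.sum_eq_single i (fun j _ hj => by rw [Pi.single_eq_of_ne hj, hc, mul_zero])
      (fun hi => absurd (Finset.mem_univ i) hi), Pi.single_eq_same]
  ext k
  fin_cases k
  · exact h (fun _ p => p 1) fun _ => rfl
  · exact h (fun _ p => p 0) fun _ => rfl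
  · exact h (fun j p => pos lam j 0 * p 1 - pos lam j 1 * p 0) fun _ => by simp

/-- A velocity at w_i adjusts the linear momentum. An opposite pair of momenta at w_i and w_j
perpendicular to d = w_j - w_i then changes only the angular momentum, by τ|d|², which fixes τ. -/
theorem momentum_surjective {lam : Param N} (hd : Function.Injective (pos lam))
    (hγ : ∀ i, strength lam i ≠ 0) {i j : Fin N} (hij : i ≠ j) :
    Function.Surjective (momentum lam) := by
  classical
  intro t
  set d0 := pos lam j 0 - pos lam i 0 with hd0
  set d1 := pos lam j 1 - pos lam i 1 with hd1
  have hne : d0 ^ 2 + d1 ^ 2 ≠ 0 := by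
    intro h0
    have e0 : d0 = 0 := by nlinarith [sq_nonneg d0, sq_nonneg d1]
    have e1 : d1 = 0 := by nlinarith [sq_nonneg d0, sq_nonneg d1]
    refine hij (hd ?_).symm
    ext k
    fin_cases k
    · exact sub_eq_zero.1 e0
    · exact sub_eq_zero.1 e1
  set τ := (t 2 - (pos lam i 0 * t 0 - pos lam i 1 * t 1)) / (d0 ^ 2 + d1 ^ 2) with hτ
  have hτ' : τ * (d0 ^ 2 + d1 ^ 2) = t 2 - (pos lam i 0 * t 0 - pos lam i 1 * t 1) :=
    div_mul_cancel₀ _ hne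
  refine ⟨Pi.single i (!₂[(strength lam i)⁻¹ * (t 1 + τ * d1), (strength lam i)⁻¹ * (t 0 - τ * d0)]) +
    Pi.single j (!₂[(strength lam j)⁻¹ * (-τ * d1), (strength lam j)⁻¹ * (τ * d0)]), ?_⟩
  rw [map_add, momentum_single, momentum_single]
  have hi := hγ i
  have hj := hγ j
  ext k
  fin_cases k
  · simp
    field_simp
    ring
  · simp
    field_simp
    ring
  · simp
    field_simp
    rw [hd0, hd1] at *
    linear_combination hτ'

variable (α : ℝ)

/-- The velocities of point vortices have zero total momentum. -/
theorem momentum_pointVortexMap (lam : Param N) : momentum lam (pointVortexMap α lam) = 0 := by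
  -- Action equals reaction: after weighting by γ_i every pair term is antisymmetric, including the
  -- torque, because the force is parallel to w_i - w_j.
  have anti : ∀ F : Fin N → Fin N → ℝ, (∀ i j, F j i = -F i j) →
      ∑ i, ∑ j ∈ Finset.univ.erase i, F i j = 0 := by
    intro F hF
    have h0 : ∀ i, ∑ j ∈ Finset.univ.erase i, F i j = ∑ j, F i j := fun i => by
      rw [← Finset.add_sum_erase _ _ (Finset.mem_univ i)]
      have := hF i i
      linarith
    simp only [h0]
    have h1 : ∑ i, ∑ j, F i j = -∑ i, ∑ j, F i j := by
      conv_lhs => rw [Finset.sum_comm]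
      simp only [← Finset.sum_neg_distrib]
      exact Finset.sum_congr rfl fun i _ => Finset.sum_congr rfl fun j _ => hF i j
    linarith
  have comp : ∀ i (k : Fin 2), pointVortexMap α lam i k = -((α * kernelConst α / 2) *
      ∑ j ∈ Finset.univ.erase i, strength lam j / ‖pos lam i - pos lam j‖ ^ (α + 2) *
        (pos lam i k - pos lam j k)) := by
    intro i k
    simp [pointVortexMap, PiLp.neg_apply, PiLp.smul_apply]
  have hs : ∀ i j, ‖pos lam j - pos lam i‖ = ‖pos lam i - pos lam j‖ := fun i j => norm_sub_rev _ _
  ext k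
  fin_cases k
  · change ∑ i, strength lam i * pointVortexMap α lam i 1 = 0
    rw [← anti (fun i j => -(α * kernelConst α / 2) * (strength lam i * strength lam j /
      ‖pos lam i - pos lam j‖ ^ (α + 2) * (pos lam i 1 - pos lam j 1))) fun i j => by rw [hs]; ring]
    refine Finset.sum_congr rfl fun i _ => ?_
    rw [comp, ← Finset.mul_sum, neg_mul, mul_neg, mul_left_comm, Finset.mul_sum]
    congr 2
    exact Finset.sum_congr rfl fun j _ => by ring
  · change ∑ i, strength lam i * pointVortexMap α lam i 0 = 0
    rw [← anti (fun i j => -(α * kernelConst α / 2) * (strength lam i * strength lam j /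
      ‖pos lam i - pos lam j‖ ^ (α + 2) * (pos lam i 0 - pos lam j 0))) fun i j => by rw [hs]; ring]
    refine Finset.sum_congr rfl fun i _ => ?_
    rw [comp, ← Finset.mul_sum, neg_mul, mul_neg, mul_left_comm, Finset.mul_sum]
    congr 2
    exact Finset.sum_congr rfl fun j _ => by ring
  · change ∑ i, strength lam i * (pos lam i 0 * pointVortexMap α lam i 1 -
      pos lam i 1 * pointVortexMap α lam i 0) = 0
    rw [← anti (fun i j => -(α * kernelConst α / 2) * (strength lam i * strength lam j /
      ‖pos lam i - pos lam j‖ ^ (α + 2) * (pos lam i 1 * pos lam j 0 - pos lam i 0 * pos lam j 1)))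
      fun i j => by rw [hs]; ring]
    refine Finset.sum_congr rfl fun i _ => ?_
    rw [comp, comp, ← Finset.mul_sum]
    have e : ∀ A B c : ℝ, strength lam i * (pos lam i 0 * -(c * A) - pos lam i 1 * -(c * B)) =
      -c * (strength lam i * (pos lam i 0 * A - pos lam i 1 * B)) := fun A B c => by ring
    rw [e, Finset.mul_sum, Finset.mul_sum, ← Finset.sum_sub_distrib, Finset.mul_sum]
    congr 1
    exact Finset.sum_congr rfl fun j _ => by ring

variable {α} [hα : Fact (α ∈ Ioo (1 : ℝ) 2)] {lam : Param N} {S : Finset (Coord N)}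

/-- Differentiate the identity that the total momentum of P(λ) vanishes. Terms in which the
strengths or positions are differentiated multiply P, which is zero at the equilibrium. -/
theorem momentum_partialDeriv (hlam : IsStationary α lam) (v : S → ℝ) :
    momentum lam (partialDeriv α S lam v) = 0 := by
  have hP := hasFDerivAt_pointVortexMap (S := S) α hlam.distinct
  have hPi : ∀ i (k : Fin 2), HasFDerivAt (fun μ : S → ℝ => pointVortexMap α (glue S lam μ) i k)
      (EuclideanSpace.proj k ∘L ContinuousLinearMap.proj i ∘L partialDeriv α S lam)
      (freePart S lam) := fun i k =>
    ((EuclideanSpace.proj (𝕜 := ℝ) k : Plane →L[ℝ] ℝ) ∘L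
      (ContinuousLinearMap.proj i : (Fin N → Plane) →L[ℝ] Plane)).hasFDerivAt.comp _ hP
  have h0 : ∀ i (k : Fin 2), pointVortexMap α (glue S lam (freePart S lam)) i k = 0 := fun i k => by
    rw [glue_freePart, hlam.equilibrium i]; rfl
  have hc : ∀ c, DifferentiableAt ℝ (fun μ : S → ℝ => glue S lam μ c) (freePart S lam) := fun c =>
    (contDiff_pi.1 (contDiff_glue S lam) c).differentiable one_ne_zero _
  have key : ∀ x y : Fin N → (S → ℝ) → ℝ, (∀ i, DifferentiableAt ℝ (x i) (freePart S lam)) →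
      (∀ i, DifferentiableAt ℝ (y i) (freePart S lam)) →
      (∀ μ : S → ℝ, ∑ i, (x i μ * pointVortexMap α (glue S lam μ) i 1 +
        y i μ * pointVortexMap α (glue S lam μ) i 0) = 0) →
      ∑ i, (x i (freePart S lam) * partialDeriv α S lam v i 1 +
        y i (freePart S lam) * partialDeriv α S lam v i 0) = 0 := by
    intro x y hx hy hz
    have h1 := HasFDerivAt.fun_sum fun i (_ : i ∈ Finset.univ) =>
      ((hx i).hasFDerivAt.mul (hPi i 1)).add ((hy i).hasFDerivAt.mul (hPi i 0))
    have h2 : HasFDerivAt (fun _ : S → ℝ => (0 : ℝ)) (0 : (S → ℝ) →L[ℝ] ℝ) (freePart S lam) :=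
      hasFDerivAt_const _ _
    have h3 := h1.unique (h2.congr_of_eventuallyEq (Eventually.of_forall hz))
    have h4 := congrArg (fun T : (S → ℝ) →L[ℝ] ℝ => T v) h3
    simp only [h0, zero_smul, add_zero] at h4
    simpa [sum_apply] using h4
  have hm : ∀ (μ : S → ℝ) k, momentum (glue S lam μ) (pointVortexMap α (glue S lam μ)) k = 0 :=
    fun μ k => by rw [momentum_pointVortexMap]; rfl
  have hg := glue_freePart S lam
  have hg' : ∀ c, glue S lam (freePart S lam) c = lam c := fun c => by rw [hg]
  ext k
  fin_cases k
  · have h := key (fun i μ => glue S lam μ (2, i)) (fun _ _ => 0) (fun i => hc _)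
      (fun _ => differentiableAt_const _) fun μ => by
        refine Eq.trans (Finset.sum_congr rfl fun i _ => ?_) (hm μ 0)
        simp [strength]
    change ∑ i, strength lam i * partialDeriv α S lam v i 1 = 0
    refine Eq.trans (Finset.sum_congr rfl fun i _ => ?_) h
    simp [strength, hg']
  · have h := key (fun _ _ => 0) (fun i μ => glue S lam μ (2, i))
      (fun _ => differentiableAt_const _) (fun i => hc _) fun μ => by
        refine Eq.trans (Finset.sum_congr rfl fun i _ => ?_) (hm μ 1)
        simp [strength]
    change ∑ i, strength lam i * partialDeriv α S lam v i 0 = 0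
    refine Eq.trans (Finset.sum_congr rfl fun i _ => ?_) h
    simp [strength, hg']
  · have h := key (fun i μ => glue S lam μ (2, i) * glue S lam μ (0, i))
      (fun i μ => -(glue S lam μ (2, i) * glue S lam μ (1, i)))
      (fun i => (hc _).mul (hc _)) (fun i => ((hc _).mul (hc _)).neg) fun μ => by
        refine Eq.trans (Finset.sum_congr rfl fun i _ => ?_) (hm μ 2)
        simp [strength, pos]
        ring
    change ∑ i, strength lam i * (pos lam i 0 * partialDeriv α S lam v i 1 -
      pos lam i 1 * partialDeriv α S lam v i 0) = 0
    refine Eq.trans (Finset.sum_congr rfl fun i _ => ?_) h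
    simp [strength, pos, hg']
    ring

/-- At a nondegenerate equilibrium, velocities with zero total momentum are in the range of the
partial derivative. -/
theorem exists_partialDeriv_eq (hlam : IsStationary α lam) (hS : IsNondegenerate α lam S)
    {q : Fin N → Plane} (hq : momentum lam q = 0) : ∃ v, partialDeriv α S lam v = q := by
  have hN : 2 ≤ N := by have := hS.card_free; omega
  have hsur := momentum_surjective hlam.distinct hlam.strength_ne_zero
    (i := ⟨0, by omega⟩) (j := ⟨1, by omega⟩) (by simp)
  -- Both spaces have dimension 2N - 3: the range by nondegeneracy, the kernel because the three
  -- momenta are independent. The latter needs two distinct vortices, and N ≥ 2 follows from the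
  -- count of free coordinates.
  have hle : LinearMap.range (partialDeriv α S lam).toLinearMap ≤ LinearMap.ker (momentum lam) := by
    rintro _ ⟨v, rfl⟩
    exact momentum_partialDeriv hlam v
  have h1 := Submodule.finrank_quotient_add_finrank
    (LinearMap.range (partialDeriv α S lam).toLinearMap)
  have h2 := LinearMap.finrank_range_add_finrank_ker (momentum lam)
  rw [LinearMap.range_eq_top.2 hsur, finrank_top, Module.finrank_fin_fun] at h2
  rw [hS.codim_range] at h1
  have h3 := Submodule.eq_of_le_of_finrank_eq hle (by omega)
  have h4 : q ∈ LinearMap.range (partialDeriv α S lam).toLinearMap := by rw [h3]; exact hq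
  exact h4

end

end

/-! ### Recovery of the three missing equations -/

noncomputable section

open MeasureTheory Wiener

section

variable {ρ : ℝ} [hρ : Fact (1 ≤ ρ)]

/-- The complex number `p₁ + i p₀` as a linear map. -/
def angCL : Plane →L[ℝ] ℂ :=
  LinearMap.toContinuousLinearMap
    { toFun := angC
      map_add' := fun _ _ => rfl
      map_smul' := fun c p => by apply Complex.ext <;> simp [angC] }

/-- The mean of `a` times the mode `p · e^⊥`. -/
def modeMean : Wiener ρ →L[ℝ] Plane →L[ℝ] ℝ :=
  (ContinuousLinearMap.compL ℝ Plane (Wiener ρ) ℝ) (Complex.reCLM ∘L coef 0) ∘L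
    (((ContinuousLinearMap.compL ℝ Plane (Wiener ρ) (Wiener ρ)).flip (wave 1 ∘L angCL)) ∘L
      ContinuousLinearMap.mul ℝ (Wiener ρ))

theorem modeMean_apply (a : Wiener ρ) (p : Plane) :
    modeMean a p = (coef 0 (a * wave 1 (angC p))).re := rfl

theorem modeMean_eq_integral {a : Wiener ρ} {f : ℝ → ℝ} (ha : ∀ x, ev ρ x a = (f x : ℝ))
    {H : Wiener ρ} {p : Plane} (hH : H = wave 1 (angC p)) {w : ℝ → ℝ}
    (hw : ∀ x, ev ρ x H = (w x : ℝ)) :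
    2 * Real.pi * modeMean a p = ∫ x in (0 : ℝ)..(2 * Real.pi), f x * w x := by
  have h := integral_ev (a * H)
  have e : ∀ x, ev ρ x (a * H) = ((f x * w x : ℝ) : ℂ) := fun x => by
    rw [map_mul, ha, hw]; push_cast; rfl
  simp only [e] at h
  rw [intervalIntegral.integral_ofReal, hH] at h
  have h' := congrArg Complex.re h
  rw [Complex.ofReal_re] at h'
  rw [h', modeMean_apply]
  rw [show (2 * Real.pi : ℂ) = ((2 * Real.pi : ℝ) : ℂ) by push_cast; rfl, Complex.re_ofReal_mul]

variable (ρ) in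
/-- The cosine in the Wiener algebra. -/
def cosW : Wiener ρ := wave 1 1

variable (ρ) in
/-- The sine in the Wiener algebra. -/
def sinW : Wiener ρ := wave 1 (-Complex.I)

theorem ev_cosW (x : ℝ) : ev ρ x (cosW ρ) = (Real.cos x : ℝ) := by
  rw [cosW, ev_wave, Nat.cast_one, one_mul, one_mul, Complex.exp_ofReal_mul_I_re]

theorem ev_sinW (x : ℝ) : ev ρ x (sinW ρ) = (Real.sin x : ℝ) := by
  rw [sinW, ev_wave, Nat.cast_one, one_mul]
  simp [Complex.exp_ofReal_mul_I_re, Complex.exp_ofReal_mul_I_im]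

theorem wave_angC (p : Plane) : wave (ρ := ρ) 1 (angC p) = p 1 • cosW ρ - p 0 • sinW ρ := by
  refine ext_evL fun x => ?_
  rw [← ev_eq, ← ev_eq, map_sub, map_smul, map_smul, ev_cosW, ev_sinW, ev_wave, Nat.cast_one, one_mul,
    re_mul_exp]
  simp [angC]

theorem modeMean_cosW (p : Plane) : modeMean (cosW ρ) p = p 1 / 2 := by
  have h := modeMean_eq_integral (ev_cosW (ρ := ρ)) (p := p) rfl (w := fun x => p 1 * Real.cos x - p 0 * Real.sin x)
    fun x => by
      rw [wave_angC, map_sub, map_smul, map_smul, ev_cosW, ev_sinW]; simp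
  have e : ∀ x, Real.cos x * (p 1 * Real.cos x - p 0 * Real.sin x) =
      p 1 * Real.cos x ^ 2 - p 0 * (Real.sin x * Real.cos x) := fun x => by ring
  simp only [e] at h
  rw [intervalIntegral.integral_sub (Continuous.intervalIntegrable (by fun_prop) _ _)
    (Continuous.intervalIntegrable (by fun_prop) _ _), intervalIntegral.integral_const_mul,
    intervalIntegral.integral_const_mul, integral_sin_mul_cos₁, integral_cos_sq] at h
  simp at h
  have hpi := Real.pi_pos
  have : 2 * Real.pi * (modeMean (cosW ρ) p - p 1 / 2) = 0 := by linarith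
  have := (mul_eq_zero.1 this).resolve_left (by positivity)
  linarith

theorem modeMean_sinW (p : Plane) : modeMean (sinW ρ) p = -(p 0 / 2) := by
  have h := modeMean_eq_integral (ev_sinW (ρ := ρ)) (p := p) rfl (w := fun x => p 1 * Real.cos x - p 0 * Real.sin x)
    fun x => by
      rw [wave_angC, map_sub, map_smul, map_smul, ev_cosW, ev_sinW]; simp
  have e : ∀ x, Real.sin x * (p 1 * Real.cos x - p 0 * Real.sin x) =
      p 1 * (Real.sin x * Real.cos x) - p 0 * Real.sin x ^ 2 := fun x => by ring
  simp only [e] at h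
  rw [intervalIntegral.integral_sub (Continuous.intervalIntegrable (by fun_prop) _ _)
    (Continuous.intervalIntegrable (by fun_prop) _ _), intervalIntegral.integral_const_mul,
    intervalIntegral.integral_const_mul, integral_sin_mul_cos₁, integral_sin_sq] at h
  simp at h
  have hpi := Real.pi_pos
  have : 2 * Real.pi * (modeMean (sinW ρ) p + p 0 / 2) = 0 := by linarith
  have := (mul_eq_zero.1 this).resolve_left (by positivity)
  linarith

end

section

variable {α : ℝ} [hα : Fact (α ∈ Ioo (1 : ℝ) 2)] {N : ℕ} {b : Fin N → ℝ} {ε : ℝ}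
  {g : Fin N → Summ ℕ} {lam : Param N} {S : Finset (Coord N)}

variable (α) in
/-- The radius in the Wiener algebra. -/
def radW (b ε : ℝ) (g : Summ ℕ) : Wiener 2 := radK α 2 (scale α ε b) g 0

theorem ev_radW (b ε : ℝ) (g : Summ ℕ) (x : ℝ) :
    ev 2 x (radW α b ε g) = ((1 + scale α ε b * prof α 2 g x : ℝ) : ℂ) := evK_radK _ g x 0

variable (α) in
/-- The weights of the linear and angular momentum. -/
def momentWeight (b : Fin N → ℝ) (ε : ℝ) (g : Fin N → Summ ℕ) (lam : Param N) (i : Fin N) :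
    Fin 3 → Wiener 2 :=
  ![(2 * strength lam i) • (radW α (b i) ε (g i) * cosW 2),
    -(2 * strength lam i) • (radW α (b i) ε (g i) * sinW 2),
    strength lam i • (radW α (b i) ε (g i) * ((2 * pos lam i 0) • cosW 2 + (2 * pos lam i 1) • sinW 2) +
      (ε * b i) • (radW α (b i) ε (g i) * radW α (b i) ε (g i)))]

/-- The momentum of the remaining modes of index one. -/
def momentMap (a : Fin N → Fin 3 → Wiener 2) : (Fin N → Plane) →L[ℝ] (Fin 3 → ℝ) :=
  ∑ i, ∑ k, ContinuousLinearMap.single ℝ (fun _ : Fin 3 => ℝ) k ∘L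
    (modeMean (a i k) ∘L ContinuousLinearMap.proj i)

theorem momentMap_apply (a : Fin N → Fin 3 → Wiener 2) (q : Fin N → Plane) (k : Fin 3) :
    momentMap a q k = ∑ i, modeMean (a i k) (q i) := by
  simp only [momentMap, sum_apply, Finset.sum_apply]
  refine Finset.sum_congr rfl fun i _ => ?_
  rw [Finset.sum_eq_single k (fun l _ hl => ?_) fun h => absurd (Finset.mem_univ k) h]
  · exact Pi.single_eq_same (M := fun _ : Fin 3 => ℝ) k _
  · exact Pi.single_eq_of_ne (M := fun _ : Fin 3 => ℝ) hl.symm _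

theorem continuous_momentMap : Continuous fun a : Fin N → Fin 3 → Wiener 2 => momentMap a := by
  unfold momentMap
  refine continuous_finsetSum _ fun i _ => continuous_finsetSum _ fun k _ => ?_
  exact continuous_const.clm_comp (((modeMean (ρ := 2)).continuous.comp
    ((continuous_apply k).comp (continuous_apply i))).clm_comp continuous_const)

/-- At ε = 0 the radii are 1 and the quadratic term drops out. The factors 2 in the weights
compensate the mean value 1/2 of cos² and sin². -/
theorem momentMap_base (b : Fin N → ℝ) (g : Fin N → Summ ℕ) (lam : Param N) (q : Fin N → Plane) :
    momentMap (momentWeight α b 0 g lam) q = momentum lam q := by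
  have hr : ∀ i, radW α (b i) 0 (g i) = 1 := fun i => by
    rw [radW, radK, scale_zero, zero_smul, add_zero]; rfl
  ext k
  rw [momentMap_apply]
  fin_cases k
  · refine Finset.sum_congr rfl fun i _ => ?_
    change modeMean ((2 * strength lam i) • (radW α (b i) 0 (g i) * cosW 2)) (q i) = _
    rw [hr, one_mul, map_smul]
    change _ * modeMean (cosW 2) (q i) = _
    rw [modeMean_cosW]; ring
  · refine Finset.sum_congr rfl fun i _ => ?_
    change modeMean (-(2 * strength lam i) • (radW α (b i) 0 (g i) * sinW 2)) (q i) = _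
    rw [hr, one_mul, map_smul]
    change _ * modeMean (sinW 2) (q i) = _
    rw [modeMean_sinW]; ring
  · refine Finset.sum_congr rfl fun i _ => ?_
    change modeMean (strength lam i • (radW α (b i) 0 (g i) * ((2 * pos lam i 0) • cosW 2 +
      (2 * pos lam i 1) • sinW 2) + ((0 : ℝ) * b i) • (radW α (b i) 0 (g i) * radW α (b i) 0 (g i))))
      (q i) = _
    rw [hr, one_mul, zero_mul, zero_smul, add_zero, map_smul, map_add, map_smul, map_smul]
    change _ * (_ * modeMean (cosW 2) (q i) + _ * modeMean (sinW 2) (q i)) = _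
    rw [modeMean_cosW, modeMean_sinW]; ring

/-- The mean is zero by conservation of area flux, the modes above one by hypothesis, and negative
modes are conjugates since the functional is real. Only N vectors in the plane remain undetermined.
-/
theorem eq_wave_modeOne (hb : ∀ i, 0 < b i) (hε : ε ≠ 0) (h : Admissible α 2 b ε g lam)
    (hγ : ∀ i, strength lam i ≠ 0) (hh : ∀ i, high (totalH α 2 b ε g lam i) = 0) (i : Fin N) :
    totalH α 2 b ε g lam i = wave 1 (angC (modeOne (totalH α 2 b ε g lam i))) := by
  have h1 := eq_wave_one (totalH α 2 b ε g lam i) (fun x => by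
    rw [ev_totalH hb h, Complex.ofReal_im]) ?_ (coef_high_eq_zero (hh i))
  · have h2 : angC (modeOne (totalH α 2 b ε g lam i)) = 2 * coef 1 (totalH α 2 b ε g lam i) := by
      rw [modeOne_apply]
      apply Complex.ext <;> simp [angC]
    rw [h2]; exact h1
  · have h3 := integral_ev (totalH α 2 b ε g lam i)
    simp only [ev_totalH_eq_weighted hb h] at h3
    rw [intervalIntegral.integral_ofReal, integral_weighted hb hε h hγ, Complex.ofReal_zero] at h3
    exact (mul_eq_zero.1 h3.symm).resolve_left (by simp [Real.pi_ne_zero])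

/-- The conservation laws for the modes of index one. -/
theorem momentMap_modeOne (hb : ∀ i, 0 < b i) (hε : ε ≠ 0) (h : Admissible α 2 b ε g lam)
    (hγ : ∀ i, strength lam i ≠ 0) (hh : ∀ i, high (totalH α 2 b ε g lam i) = 0) :
    momentMap (momentWeight α b ε g lam) (fun i => modeOne (totalH α 2 b ε g lam i)) = 0 := by
  have key : ∀ (k : Fin 3) (f : Fin N → ℝ → ℝ),
      (∀ i x, ev 2 x (momentWeight α b ε g lam i k) = (strength lam i * f i x : ℝ)) →
      ∑ i, strength lam i * ∫ x in (0 : ℝ)..(2 * Real.pi), f i x * weighted α b ε g lam i x = 0 →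
      momentMap (momentWeight α b ε g lam) (fun i => modeOne (totalH α 2 b ε g lam i)) k = 0 := by
    intro k f hf h0
    have h1 : 2 * Real.pi * momentMap (momentWeight α b ε g lam)
        (fun i => modeOne (totalH α 2 b ε g lam i)) k = 0 := by
      rw [momentMap_apply, Finset.mul_sum, ← h0]
      refine Finset.sum_congr rfl fun i _ => ?_
      rw [modeMean_eq_integral (hf i) (eq_wave_modeOne hb hε h hγ hh i)
        (ev_totalH_eq_weighted hb h i), ← intervalIntegral.integral_const_mul]
      simp only [mul_assoc]
    exact (mul_eq_zero.1 h1).resolve_left (by positivity)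
  ext k
  fin_cases k
  · refine key 0 _ (fun i x => ?_) (sum_linear_weighted hb hε h hγ 2 0)
    change ev 2 x ((2 * strength lam i) • (radW α (b i) ε (g i) * cosW 2)) = _
    rw [map_smul, map_mul, ev_radW, ev_cosW, Complex.real_smul]
    push_cast; ring
  · refine key 1 _ (fun i x => ?_) (sum_linear_weighted hb hε h hγ 0 (-2))
    change ev 2 x (-(2 * strength lam i) • (radW α (b i) ε (g i) * sinW 2)) = _
    rw [map_smul, map_mul, ev_radW, ev_sinW, Complex.real_smul]
    push_cast; ring
  · refine key 2 _ (fun i x => ?_) (sum_quadratic_weighted hb hε h hγ)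
    change ev 2 x (strength lam i • (radW α (b i) ε (g i) * ((2 * pos lam i 0) • cosW 2 +
      (2 * pos lam i 1) • sinW 2) + (ε * b i) • (radW α (b i) ε (g i) * radW α (b i) ε (g i)))) = _
    simp only [map_smul, map_add, map_mul, ev_radW, ev_cosW, ev_sinW, Complex.real_smul]
    push_cast; ring

variable {A : (Fin N → Plane) →L[ℝ] (S → ℝ)}

theorem continuousAt_momentWeight (b : Fin N → ℝ) (S : Finset (Coord N)) (lam : Param N) :
    ContinuousAt (fun p : ℝ × (Fin N → Summ ℕ) × (S → ℝ) =>
      momentWeight α b p.1 p.2.1 (glue S lam p.2.2)) (0, 0, freePart S lam) := by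
  have hl : Continuous fun p : ℝ × (Fin N → Summ ℕ) × (S → ℝ) => glue S lam p.2.2 :=
    (contDiff_glue S lam).continuous.comp (continuous_snd.comp continuous_snd)
  have hc : ∀ c, Continuous fun p : ℝ × (Fin N → Summ ℕ) × (S → ℝ) => glue S lam p.2.2 c := fun c =>
    (continuous_apply c).comp hl
  have hr : ∀ i, ContinuousAt (fun p : ℝ × (Fin N → Summ ℕ) × (S → ℝ) => radW α (b i) p.1 (p.2.1 i))
      (0, 0, freePart S lam) := fun i =>
    (BoundedContinuousFunction.evalCLM ℝ (0 : ℝ)).continuous.continuousAt.comp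
      (contDiffAt_radK (α := α) (ρ := 2) (contDiffAt_scale (α := α) contDiffAt_fst (b i))
        (contDiffAt_pi.1 (contDiffAt_fst.comp _ contDiffAt_snd) i)).continuousAt
  refine continuousAt_pi.2 fun i => continuousAt_pi.2 fun k => ?_
  have h0 : ContinuousAt (fun p : ℝ × (Fin N → Summ ℕ) × (S → ℝ) => glue S lam p.2.2 (0, i))
    (0, 0, freePart S lam) := (hc _).continuousAt
  have h1 : ContinuousAt (fun p : ℝ × (Fin N → Summ ℕ) × (S → ℝ) => glue S lam p.2.2 (1, i))
    (0, 0, freePart S lam) := (hc _).continuousAt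
  have h2 : ContinuousAt (fun p : ℝ × (Fin N → Summ ℕ) × (S → ℝ) => glue S lam p.2.2 (2, i))
    (0, 0, freePart S lam) := (hc _).continuousAt
  fin_cases k
  · exact (continuousAt_const.mul h2).smul ((hr i).mul continuousAt_const)
  · exact (continuousAt_const.mul h2).neg.smul ((hr i).mul continuousAt_const)
  · exact h2.smul (((hr i).mul (((continuousAt_const.mul h0).smul continuousAt_const).add
      ((continuousAt_const.mul h1).smul continuousAt_const))).add
      ((continuousAt_fst.mul continuousAt_const).smul ((hr i).mul (hr i))))

/-- Near the equilibrium, zeros of the contour map are zeros of the contour functional. -/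
theorem eventually_totalH_eq_zero (hb : ∀ i, 0 < b i) (hlam : IsStationary α lam)
    (hS : IsNondegenerate α lam S) (hA : A ∘L partialDeriv α S lam = ContinuousLinearMap.id ℝ _) :
    ∀ᶠ p : ℝ × (Fin N → Summ ℕ) × (S → ℝ) in 𝓝 (0, 0, freePart S lam), p.1 ≠ 0 →
      contourMap α 2 b lam S A p = 0 → ∀ i, totalH α 2 b p.1 p.2.1 (glue S lam p.2.2) i = 0 := by
  -- The projected equations together with the three momenta. At the base point a vector without
  -- momentum lies in the range of D, where A is a left inverse, so the joint map is injective;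
  -- injectivity is an open condition and persists nearby.
  set B : ℝ × (Fin N → Summ ℕ) × (S → ℝ) → (Fin N → Plane) →L[ℝ] (S → ℝ) × (Fin 3 → ℝ) := fun p =>
    ContinuousLinearMap.inl ℝ _ _ ∘L A + ContinuousLinearMap.inr ℝ _ _ ∘L
      momentMap (momentWeight α b p.1 p.2.1 (glue S lam p.2.2)) with hB
  have hBa : ∀ p q, B p q = (A q, momentMap (momentWeight α b p.1 p.2.1 (glue S lam p.2.2)) q) :=
    fun p q => by simp [hB]
  have hBc : ContinuousAt B (0, 0, freePart S lam) :=
    continuousAt_const.add (continuousAt_const.clm_comp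
      (continuous_momentMap.continuousAt.comp (continuousAt_momentWeight b S lam)))
  have hB0 : Function.Injective (B (0, 0, freePart S lam)) := by
    refine (injective_iff_map_eq_zero _).2 fun q hq => ?_
    rw [hBa, glue_freePart, momentMap_base] at hq
    obtain ⟨v, rfl⟩ := exists_partialDeriv_eq hlam hS (Prod.ext_iff.1 hq).2
    have h1 : (A ∘L partialDeriv α S lam) v = 0 := (Prod.ext_iff.1 hq).1
    rw [hA] at h1
    rw [show v = 0 from h1, map_zero]
  have hev := hBc.eventually (ContinuousLinearMap.isOpen_injective.mem_nhds hB0)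
  have hst : ∀ᶠ p : ℝ × (Fin N → Summ ℕ) × (S → ℝ) in 𝓝 (0, 0, freePart S lam),
      ∀ i, strength (glue S lam p.2.2) i ≠ 0 := by
    refine eventually_all.2 fun i => ?_
    have hl : Continuous fun p : ℝ × (Fin N → Summ ℕ) × (S → ℝ) => glue S lam p.2.2 :=
      (contDiff_glue S lam).continuous.comp (continuous_snd.comp continuous_snd)
    have hc : Continuous fun p : ℝ × (Fin N → Summ ℕ) × (S → ℝ) => glue S lam p.2.2 (2, i) :=
      (continuous_apply ((2, i) : Coord N)).comp hl
    refine hc.continuousAt.eventually_ne ?_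
    simp only [glue_freePart]
    exact hlam.strength_ne_zero i
  filter_upwards [hev, hst, eventually_admissible (α := α) (ρ := 2) b hlam.distinct S] with p h1 h2 h3 hp hz i
  have hh : ∀ i, high (totalH α 2 b p.1 p.2.1 (glue S lam p.2.2) i) = 0 := fun i =>
    congrFun (Prod.ext_iff.1 hz).1 i
  have hA0 : A (fun i => modeOne (totalH α 2 b p.1 p.2.1 (glue S lam p.2.2) i)) = 0 :=
    (Prod.ext_iff.1 hz).2
  -- A annihilates the first modes because the reduced equation holds, and the momenta annihilate
  -- them by conservation. The latter uses ε ≠ 0.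
  have hq : (fun i => modeOne (totalH α 2 b p.1 p.2.1 (glue S lam p.2.2) i)) = 0 :=
    h1 (by rw [hBa, hA0, momentMap_modeOne hb hp h3 h2 hh, map_zero]; rfl)
  have hq' : modeOne (totalH α 2 b p.1 p.2.1 (glue S lam p.2.2) i) = 0 := congrFun hq i
  rw [eq_wave_modeOne hb hp h3 h2 hh i, hq']
  have : angC 0 = 0 := angCL.map_zero
  rw [this, map_zero]

end

end

/-! ### Strict convexity and disjointness of the patches -/

noncomputable section

open MeasureTheory Wiener

theorem norm_radial (x : ℝ) : ‖radial x‖ = 1 := by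
  have h := Plane.norm_sq (radial x)
  have h1 : (radial x) 0 ^ 2 + (radial x) 1 ^ 2 = 1 := by
    simp [radial]
  rw [h1] at h
  nlinarith [norm_nonneg (radial x)]

theorem exists_polar (p : Plane) : ∃ x, p = ‖p‖ • radial x := by
  set z : ℂ := ⟨p 0, p 1⟩ with hz
  have hn : ‖z‖ = ‖p‖ := by
    have h1 := sq_norm_complex z
    have h2 := Plane.norm_sq p
    have : ‖z‖ ^ 2 = ‖p‖ ^ 2 := by rw [h1, h2]
    exact (pow_left_inj₀ (norm_nonneg _) (norm_nonneg _) two_ne_zero).1 this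
  refine ⟨z.arg, ?_⟩
  ext k
  fin_cases k
  · have := Complex.norm_mul_cos_arg z
    rw [hn] at this
    simpa [radial] using this.symm
  · have := Complex.norm_mul_sin_arg z
    rw [hn] at this
    simpa [radial] using this.symm

/-- Sturm comparison with the trigonometric functions. -/
theorem trig_lt_of_pos {v v' v'' : ℝ → ℝ} (hv : ∀ x, HasDerivAt v (v' x) x)
    (hv' : ∀ x, HasDerivAt v' (v'' x) x) (hpos : ∀ x, 0 < v x + v'' x) (θ : ℝ) {t : ℝ} (h0 : 0 < t)
    (h1 : t ≤ Real.pi) : v θ * Real.cos t + v' θ * Real.sin t < v (θ + t) := by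
  set w : ℝ → ℝ := fun s => v (θ + s) - v θ * Real.cos s - v' θ * Real.sin s with hw
  set w' : ℝ → ℝ := fun s => v' (θ + s) + v θ * Real.sin s - v' θ * Real.cos s with hw'
  set φ : ℝ → ℝ := fun s => w' s * Real.sin (t - s) + w s * Real.cos (t - s) with hφ
  have d1 : ∀ s, HasDerivAt w (w' s) s := fun s => by
    have := (((hv (θ + s)).comp_const_add θ s).sub ((Real.hasDerivAt_cos s).const_mul (v θ))).sub
      ((Real.hasDerivAt_sin s).const_mul (v' θ))
    refine this.congr_deriv ?_
    simp only [hw']; ring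
  have d2 : ∀ s, HasDerivAt w' (v'' (θ + s) + v θ * Real.cos s + v' θ * Real.sin s) s := fun s => by
    have := (((hv' (θ + s)).comp_const_add θ s).add ((Real.hasDerivAt_sin s).const_mul (v θ))).sub
      ((Real.hasDerivAt_cos s).const_mul (v' θ))
    refine this.congr_deriv ?_
    ring
  have d3 : ∀ s, HasDerivAt φ ((v (θ + s) + v'' (θ + s)) * Real.sin (t - s)) s := fun s => by
    have hs := (hasDerivAt_id s).const_sub t
    have := ((d2 s).mul hs.sin).add ((d1 s).mul hs.cos)
    refine this.congr_deriv ?_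
    simp only [hw, id]
    ring
  have hmono : StrictMonoOn φ (Icc 0 t) := by
    refine strictMonoOn_of_deriv_pos (convex_Icc 0 t)
      (fun s _ => (d3 s).continuousAt.continuousWithinAt) fun s hs => ?_
    rw [interior_Icc] at hs
    rw [(d3 s).deriv]
    exact mul_pos (hpos _) (Real.sin_pos_of_pos_of_lt_pi (by linarith [hs.2]) (by linarith [hs.1]))
  have h2 := hmono (left_mem_Icc.2 h0.le) (right_mem_Icc.2 h0.le) h0
  simp only [hφ, hw, hw', add_zero, sub_zero, sub_self, Real.sin_zero, Real.cos_zero, mul_zero,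
    mul_one] at h2
  linarith

/-- The comparison on (0, π] is extended to all angles by reducing x to a period centred at θ and
reflecting when x precedes θ. Equality leaves only the direction θ itself. -/
theorem trig_le_of_pos {v v' v'' : ℝ → ℝ} (hv : ∀ x, HasDerivAt v (v' x) x)
    (hv' : ∀ x, HasDerivAt v' (v'' x) x) (hpos : ∀ x, 0 < v x + v'' x)
    (hp : Function.Periodic v (2 * Real.pi)) (θ x : ℝ) :
    radial x = radial θ ∧ v x = v θ * Real.cos (x - θ) + v' θ * Real.sin (x - θ) ∨
      v θ * Real.cos (x - θ) + v' θ * Real.sin (x - θ) < v x := by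
  have hpi := Real.pi_pos
  set y := toIocMod Real.two_pi_pos (θ - Real.pi) x with hy
  have hmem := toIocMod_mem_Ioc Real.two_pi_pos (θ - Real.pi) x
  rw [← hy] at hmem
  obtain ⟨n, hn⟩ : ∃ n : ℤ, x = y + n * (2 * Real.pi) :=
    ⟨toIocDiv Real.two_pi_pos (θ - Real.pi) x, by
      rw [hy, ← zsmul_eq_mul, toIocMod_add_toIocDiv_zsmul]⟩
  have e1 : v x = v y := by rw [hn]; exact hp.int_mul n y
  have e2 : Real.cos (x - θ) = Real.cos (y - θ) := by
    rw [hn, show y + n * (2 * Real.pi) - θ = y - θ + n * (2 * Real.pi) by ring,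
      Real.cos_add_int_mul_two_pi]
  have e3 : Real.sin (x - θ) = Real.sin (y - θ) := by
    rw [hn, show y + n * (2 * Real.pi) - θ = y - θ + n * (2 * Real.pi) by ring,
      Real.sin_add_int_mul_two_pi]
  have e4 : radial x = radial y := by
    rw [hn, radial, radial, Real.cos_add_int_mul_two_pi, Real.sin_add_int_mul_two_pi]
  rw [e1, e2, e3, e4]
  rcases lt_trichotomy y θ with h | h | h
  · right
    have hv1 : ∀ x, HasDerivAt (fun x => v (-x)) (-v' (-x)) x := fun x => by
      have := (hv (-x)).comp x (hasDerivAt_neg x)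
      exact this.congr_deriv (mul_neg_one _)
    have hv2 : ∀ x, HasDerivAt (fun x => -v' (-x)) (v'' (-x)) x := fun x => by
      have := ((hv' (-x)).comp x (hasDerivAt_neg x)).neg
      exact this.congr_deriv (by ring)
    have := trig_lt_of_pos hv1 hv2 (fun x => hpos (-x)) (-θ) (t := θ - y) (by linarith)
      (by linarith [hmem.1])
    rw [neg_neg, show -(-θ + (θ - y)) = y by ring, show θ - y = -(y - θ) by ring, Real.cos_neg,
      Real.sin_neg] at this
    linarith
  · left
    rw [h]; simp
  · right
    have := trig_lt_of_pos hv hv' hpos θ (t := y - θ) (by linarith) (by linarith [hmem.2])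
    rwa [add_sub_cancel] at this

/-- A domain bounded by a polar curve of positive curvature is strictly convex. -/
theorem strictConvex_closure_starDomain {R R' R'' : ℝ → ℝ} (hR : ∀ x, HasDerivAt R (R' x) x)
    (hR' : ∀ x, HasDerivAt R' (R'' x) x) (hp : Function.Periodic R (2 * Real.pi))
    (hpos : ∀ x, 0 < R x) (hcurv : ∀ x, 0 < R x ^ 2 + 2 * R' x ^ 2 - R x * R'' x) :
    StrictConvex ℝ (closure (starDomain R)) := by
  -- In terms of v = 1/R, the curvature numerator divided by R³ is v + v'', and tangent lines become
  -- trigonometric functions. This is the setting of the Sturm comparison.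
  set v : ℝ → ℝ := fun x => (R x)⁻¹ with hv
  set v' : ℝ → ℝ := fun x => -R' x / R x ^ 2 with hv'
  set v'' : ℝ → ℝ := fun x => (2 * R' x ^ 2 - R x * R'' x) / R x ^ 3 with hv''
  have d1 : ∀ x, HasDerivAt v (v' x) x := fun x => (hR x).inv (hpos x).ne'
  have d2 : ∀ x, HasDerivAt v' (v'' x) x := fun x => by
    have h0 := (hpos x).ne'
    have := ((hR' x).neg).div ((hR x).pow 2) (pow_ne_zero 2 h0)
    refine this.congr_deriv ?_
    simp only [hv'', Pi.neg_apply, Pi.pow_apply]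
    field_simp
    push_cast
    ring
  have hk : ∀ x, 0 < v x + v'' x := fun x => by
    have h0 := hpos x
    have : v x + v'' x = (R x ^ 2 + 2 * R' x ^ 2 - R x * R'' x) / R x ^ 3 := by
      simp only [hv, hv'']; field_simp; ring
    rw [this]
    exact div_pos (hcurv x) (by positivity)
  have hpv : Function.Periodic v (2 * Real.pi) := fun x => by simp only [hv, hp x]
  -- The normal of the tangent line at R(θ)e(θ), scaled so that this line is {p : p · n(θ) = 1}.
  set n : ℝ → Plane := fun θ => v θ • radial θ + v' θ • angular θ with hn
  have hnc : Continuous n := by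
    have c1 : Continuous v := continuous_iff_continuousAt.2 fun x => (d1 x).continuousAt
    have c2 : Continuous v' := continuous_iff_continuousAt.2 fun x => (d2 x).continuousAt
    have c3 : Continuous radial := by unfold radial; fun_prop
    have c4 : Continuous angular := by unfold angular; fun_prop
    exact (c1.smul c3).add (c2.smul c4)
  have hin : ∀ r x θ, inner ℝ (r • radial x) (n θ) =
      r * (v θ * Real.cos (x - θ) + v' θ * Real.sin (x - θ)) := fun r x θ => by
    rw [Plane.inner_eq, Real.cos_sub, Real.sin_sub]
    simp [hn, radial, angular]
    ring
  have hself : ∀ r x, inner ℝ (r • radial x) (n x) = r * v x := fun r x => by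
    rw [hin]; simp
  have hRv : ∀ x, R x * v x = 1 := fun x => mul_inv_cancel₀ (hpos x).ne'
  set K : Set Plane := {p | ∀ θ, inner ℝ p (n θ) ≤ 1} with hK
  -- supporting lines
  have hsup : ∀ r x θ, 0 ≤ r → r ≤ R x → inner ℝ (r • radial x) (n θ) < 1 ∨
      r • radial x = R θ • radial θ := by
    intro r x θ h0 hr
    have hvx : r * v x ≤ 1 := by
      rw [← hRv x]; exact mul_le_mul_of_nonneg_right hr (inv_nonneg.2 (hpos x).le)
    rw [hin]
    rcases trig_le_of_pos d1 d2 hk hpv θ x with ⟨h1, h2⟩ | h1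
    · rw [← h2]
      rcases hvx.lt_or_eq with h3 | h3
      · exact Or.inl h3
      · right
        have hvv : v x = v θ := by
          have e : Real.cos (x - θ) = 1 ∧ Real.sin (x - θ) = 0 := by
            have c := congrArg (fun p : Plane => p 0) h1
            have s := congrArg (fun p : Plane => p 1) h1
            simp [radial] at c s
            have := Real.sin_sq_add_cos_sq θ
            rw [Real.cos_sub, Real.sin_sub, c, s]
            constructor <;> linarith
          rw [h2, e.1, e.2]; ring
        rw [h1]
        congr 1
        have h4 : R x = R θ := inv_injective hvv
        have h5 : r = R x := mul_right_cancel₀ (inv_pos.2 (hpos x)).ne' (h3.trans (hRv x).symm)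
        rw [h5, h4]
    · left
      rcases h0.eq_or_lt with h2 | h2
      · rw [← h2, zero_mul]; exact one_pos
      · exact (mul_lt_mul_of_pos_left h1 h2).trans_le hvx
  have hpolar : ∀ p ∈ K, ∃ x r, 0 ≤ r ∧ r ≤ R x ∧ p = r • radial x := by
    intro p hp
    obtain ⟨x, hx⟩ := exists_polar p
    refine ⟨x, ‖p‖, norm_nonneg p, ?_, hx⟩
    have h1 := hp x
    rw [hx, hself, ← hRv x] at h1
    exact le_of_mul_le_mul_right h1 (inv_pos.2 (hpos x))
  have hcl : closure (starDomain R) = K := by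
    refine Subset.antisymm (closure_minimal ?_ ?_) ?_
    · rintro p ⟨x, r, h0, h1, rfl⟩ θ
      rcases hsup r x θ h0 h1.le with h | h
      · exact h.le
      · rw [h, hself, hRv]
    · rw [hK, ofPred_forall]
      exact isClosed_iInter fun θ => isClosed_le (by fun_prop) continuous_const
    · intro p hp
      obtain ⟨x, r, h0, h1, rfl⟩ := hpolar p hp
      have hc : Continuous fun t : ℝ => (t * r) • radial x := by fun_prop
      have h2 : (1 : ℝ) ∈ closure (Ico (0 : ℝ) 1) := by
        rw [closure_Ico zero_ne_one]; exact ⟨zero_le_one, le_rfl⟩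
      have h3 := map_mem_closure (t := starDomain R) hc h2 fun t ht => ⟨x, t * r, mul_nonneg ht.1 h0, ?_, rfl⟩
      · simpa using h3
      · rcases h0.eq_or_lt with h4 | h4
        · rw [← h4, mul_zero]; exact hpos x
        · exact (mul_lt_of_lt_one_left h4 ht.2).trans_le h1
  rw [hcl]
  intro p hp q hq hpq a c ha hc hac
  -- Each supporting line meets the set only at its point of tangency, so two different points
  -- cannot both lie on it, and the combination is strictly inside.
  have hlt : ∀ θ, inner ℝ (a • p + c • q) (n θ) < 1 := by
    intro θ
    rw [inner_add_left, real_inner_smul_left, real_inner_smul_left]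
    have hp1 := hp θ
    have hq1 := hq θ
    obtain ⟨x, r, h0, h1, rfl⟩ := hpolar p hp
    obtain ⟨y, s, h2, h3, rfl⟩ := hpolar q hq
    rcases hsup r x θ h0 h1 with h4 | h4
    · nlinarith
    · rcases hsup s y θ h2 h3 with h5 | h5
      · nlinarith
      · exact absurd (h4.trans h5.symm) hpq
  rw [mem_interior_iff_mem_nhds]
  have hvp : ∀ y, 0 < v y := fun y => inv_pos.2 (hpos y)
  clear_value n K v v' v''
  -- Compactness of the circle of directions makes the strict inequalities uniform, which turns them
  -- into an interior point.
  have hev : ∀ᶠ z in 𝓝 (a • p + c • q), ∀ θ ∈ Icc 0 (2 * Real.pi), inner ℝ z (n θ) < 1 := by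
    refine isCompact_Icc.eventually_forall_of_forall_eventually fun θ _ => ?_
    have hcont : Continuous fun z : Plane × ℝ => (inner ℝ z.1 (n z.2) : ℝ) :=
      continuous_fst.inner (hnc.comp continuous_snd)
    exact (hcont.tendsto (a • p + c • q, θ)).eventually_lt_const (hlt θ)
  rw [hK]
  filter_upwards [hev] with z hz
  obtain ⟨x, hx⟩ := exists_polar z
  set y := toIcoMod Real.two_pi_pos 0 x with hy
  have hmem := toIcoMod_mem_Ico Real.two_pi_pos 0 x
  rw [← hy, zero_add] at hmem
  obtain ⟨m, hm⟩ : ∃ n : ℤ, x = y + n * (2 * Real.pi) :=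
    ⟨toIcoDiv Real.two_pi_pos 0 x, by
      rw [hy, ← zsmul_eq_mul, toIcoMod_add_toIcoDiv_zsmul]⟩
  have e4 : radial x = radial y := by
    rw [hm, radial, radial, Real.cos_add_int_mul_two_pi, Real.sin_add_int_mul_two_pi]
  have h1 := hz y ⟨hmem.1, hmem.2.le⟩
  rw [hx, e4, hself, ← hRv y] at h1
  have h2 := lt_of_mul_lt_mul_right h1 (hvp y).le
  intro θ
  rw [hx, e4]
  rcases hsup ‖z‖ y θ (norm_nonneg z) h2.le with h | h
  · exact h.le
  · rw [h, hself, hRv]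

theorem closure_patch_subset {α ε b M : ℝ} {f : ℝ → ℝ} (w : Plane) (hM : ∀ x, radius α ε b f x ≤ M) :
    closure (patch α ε b w f) ⊆ Metric.closedBall w (|ε * b| * M) := by
  refine closure_minimal ?_ Metric.isClosed_closedBall
  rintro _ ⟨_, ⟨x, r, h0, h1, rfl⟩, rfl⟩
  rw [mem_closedBall_iff_norm, add_sub_cancel_left, norm_smul, norm_smul, norm_radial, mul_one,
    Real.norm_eq_abs, Real.norm_of_nonneg h0]
  exact mul_le_mul_of_nonneg_left (h1.le.trans (hM x)) (abs_nonneg _)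

section

variable {α : ℝ} [hα : Fact (α ∈ Ioo (1 : ℝ) 2)] {N : ℕ}

theorem strictConvex_of_small {ε b : ℝ} {g : Summ ℕ} (h : |scale α ε b| * ‖g‖ ≤ 1 / 4) :
    StrictConvex ℝ (closure (starDomain (radius α ε b (prof α 2 g)))) := by
  have b0 : ∀ x, |scale α ε b * prof α 2 g x| ≤ 1 / 4 := fun x => by
    rw [abs_mul]; exact (mul_le_mul_of_nonneg_left (abs_prof_le g x) (abs_nonneg _)).trans h
  have b2 : ∀ x, |scale α ε b * ddprof α g x| ≤ 1 / 4 := fun x => by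
    rw [abs_mul]; exact (mul_le_mul_of_nonneg_left (abs_ddprof_le g x) (abs_nonneg _)).trans h
  refine strictConvex_closure_starDomain (R' := fun x => scale α ε b * dprof α 2 g x)
    (R'' := fun x => scale α ε b * ddprof α g x)
    (fun x => ((hasDerivAt_prof g x).const_mul (scale α ε b)).const_add 1)
    (fun x => (hasDerivAt_dprof g x).const_mul (scale α ε b))
    (fun x => by simp only [radius, periodic_prof g x]) (fun x => ?_) fun x => ?_
  · change 0 < 1 + scale α ε b * prof α 2 g x
    linarith [neg_le_of_abs_le (b0 x)]
  · change 0 < (1 + scale α ε b * prof α 2 g x) ^ 2 + _ -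
      (1 + scale α ε b * prof α 2 g x) * (scale α ε b * ddprof α g x)
    have h1 := abs_le.1 (b0 x)
    have h2 := abs_le.1 (b2 x)
    nlinarith [sq_nonneg (scale α ε b * dprof α 2 g x)]

/-- Near the unperturbed configuration, the patches are strictly convex and disjoint. -/
theorem eventually_geometry (b : Fin N → ℝ) {lam : Param N} (hd : Function.Injective (pos lam))
    (S : Finset (Coord N)) :
    ∀ᶠ p : ℝ × (Fin N → Summ ℕ) × (S → ℝ) in 𝓝 (0, 0, freePart S lam),
      (∀ i x, 0 < radius α p.1 (b i) (prof α 2 (p.2.1 i)) x) ∧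
      (∀ i, StrictConvex ℝ (closure (starDomain (radius α p.1 (b i) (prof α 2 (p.2.1 i)))))) ∧
      Pairwise fun i j : Fin N => Disjoint
        (closure (patch α p.1 (b i) (pos (glue S lam p.2.2) i) (prof α 2 (p.2.1 i))))
        (closure (patch α p.1 (b j) (pos (glue S lam p.2.2) j) (prof α 2 (p.2.1 j)))) := by
  have hsc : ∀ᶠ p : ℝ × (Fin N → Summ ℕ) × (S → ℝ) in 𝓝 (0, 0, freePart S lam),
      ∀ i, |scale α p.1 (b i)| * ‖p.2.1 i‖ < 1 / 4 := by
    refine eventually_all.2 fun i => ?_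
    have h1 : ContinuousAt (fun p : ℝ × (Fin N → Summ ℕ) × (S → ℝ) => |scale α p.1 (b i)| * ‖p.2.1 i‖)
        (0, 0, freePart S lam) :=
      (contDiffAt_scale (α := α) contDiffAt_fst (b i)).continuousAt.abs.mul
        ((continuous_apply i).comp (continuous_fst.comp continuous_snd)).continuousAt.norm
    refine h1.eventually (gt_mem_nhds ?_)
    simp
  have hsep : ∀ᶠ p : ℝ × (Fin N → Summ ℕ) × (S → ℝ) in 𝓝 (0, 0, freePart S lam),
      ∀ i j, i ≠ j → |p.1 * b i| * 2 + |p.1 * b j| * 2 < ‖sepC (glue S lam p.2.2) i j‖ := by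
    refine eventually_all.2 fun i => eventually_all.2 fun j => ?_
    by_cases hij : i = j
    · exact Eventually.of_forall fun _ h => absurd hij h
    have hl : ContDiffAt ℝ 1 (fun p : ℝ × (Fin N → Summ ℕ) × (S → ℝ) => glue S lam p.2.2)
      (0, 0, freePart S lam) :=
      (contDiff_glue S lam).contDiffAt.comp _ (contDiffAt_snd.comp _ contDiffAt_snd)
    have h1 : ContinuousAt (fun p : ℝ × (Fin N → Summ ℕ) × (S → ℝ) =>
        |p.1 * b i| * 2 + |p.1 * b j| * 2) (0, 0, freePart S lam) := by fun_prop
    refine (h1.eventually_lt (contDiffAt_sepC hl i j).continuousAt.norm ?_).mono fun p hp _ => hp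
    simp only [glue_freePart, zero_mul, abs_zero, add_zero, norm_pos_iff]
    exact sepC_ne_zero hd hij
  filter_upwards [hsc, hsep] with p h1 h2
  have hb : ∀ i x, |scale α p.1 (b i) * prof α 2 (p.2.1 i) x| ≤ 1 / 4 := fun i x => by
    rw [abs_mul]
    exact (mul_le_mul_of_nonneg_left (abs_prof_le _ x) (abs_nonneg _)).trans (h1 i).le
  refine ⟨fun i x => ?_, fun i => strictConvex_of_small (h1 i).le, fun i j hij => ?_⟩
  · change 0 < 1 + scale α p.1 (b i) * prof α 2 (p.2.1 i) x
    linarith [neg_le_of_abs_le (hb i x)]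
  · have hR : ∀ i x, radius α p.1 (b i) (prof α 2 (p.2.1 i)) x ≤ 2 := fun i x => by
      change 1 + scale α p.1 (b i) * prof α 2 (p.2.1 i) x ≤ 2
      linarith [le_of_abs_le (hb i x)]
    refine (Metric.closedBall_disjoint_closedBall ?_).mono (closure_patch_subset _ (hR i))
      (closure_patch_subset _ (hR j))
    have := h2 i j hij
    rwa [norm_sepC, ← dist_eq_norm] at this

end

end

/-! ### Passage between summable coordinates and the Sobolev space -/

noncomputable section

open MeasureTheory Wiener

/-- The complex number `z` as the pair of coefficients of `Re (z e^{inx})`. -/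
def wavePair : ℂ →L[ℝ] Plane :=
  LinearMap.toContinuousLinearMap
    { toFun := fun z => (!₂[z.re, -z.im] : Plane)
      map_add' := fun z w => by ext i; fin_cases i <;> simp; ring
      map_smul' := fun c z => by ext i; fin_cases i <;> simp }

theorem wavePair_apply (z : ℂ) : wavePair z = (!₂[z.re, -z.im] : Plane) := rfl

/-- The complex amplitude of a pair of coefficients. -/
def pairWave (p : Plane) : ℂ := ⟨p 0, -p 1⟩

theorem norm_pairWave (p : Plane) : ‖pairWave p‖ = ‖p‖ := by
  have h1 := sq_norm_complex (pairWave p)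
  have h2 := Plane.norm_sq p
  refine (pow_left_inj₀ (norm_nonneg _) (norm_nonneg _) two_ne_zero).1 ?_
  rw [h1, h2, pairWave]; ring

section

variable (α s : ℝ) [hα : Fact (α ∈ Ioo (1 : ℝ) 2)]

/-- For ρ = 2 the factor 2^{-(n+2)} beats any power of n, so analytic profiles embed in the Sobolev
space of any order. -/
theorem exists_rpow_mul_cw_le : ∃ C, ∀ n : ℕ, ((n : ℝ) + 2) ^ s * cw α 2 n ≤ C := by
  have h1 : Tendsto (fun x : ℝ => x ^ s * Real.exp (-Real.log 2 * x)) atTop (𝓝 0) :=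
    tendsto_rpow_mul_exp_neg_mul_atTop_nhds_zero s _ (Real.log_pos one_lt_two)
  have h2 : Tendsto (fun n : ℕ => (n : ℝ) + 2) atTop atTop :=
    tendsto_atTop_add_const_right _ _ tendsto_natCast_atTop_atTop
  obtain ⟨C, hC⟩ := (h1.comp h2).bddAbove_range
  refine ⟨C, fun n => le_trans ?_ (hC (mem_range_self n))⟩
  have hn : (1 : ℝ) ≤ (n : ℝ) + 2 := by linarith [n.cast_nonneg (α := ℝ)]
  have e : Real.exp (-Real.log 2 * ((n : ℝ) + 2)) = (2 ^ (n + 2))⁻¹ := by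
    rw [neg_mul, Real.exp_neg, ← Real.rpow_def_of_pos two_pos, ← Real.rpow_natCast]
    push_cast; rfl
  simp only [Function.comp_apply, e, cw]
  refine mul_le_mul_of_nonneg_left ?_ (by positivity)
  refine mul_le_of_le_one_left (by positivity) (inv_le_one_of_one_le₀ ?_)
  exact hn.trans (le_rpow n)

/-- The map from analytic profiles to the Sobolev space. -/
def toSobolev : Summ ℕ →L[ℝ] XSpace s :=
  Summ.lift (fun n => (((n : ℝ) + 2) ^ s * cw α 2 n) •
    (lp.singleContinuousLinearMap ℝ (fun _ : ℕ => Plane) 2 n ∘L wavePair))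
    ((exists_rpow_mul_cw_le α s).choose * ‖wavePair‖) fun n => by
    have hc := cw_pos α 2 n
    rw [norm_smul, Real.norm_of_nonneg (by positivity)]
    refine mul_le_mul ((exists_rpow_mul_cw_le α s).choose_spec n) ?_ (norm_nonneg _)
      ((by positivity : (0 : ℝ) ≤ _).trans ((exists_rpow_mul_cw_le α s).choose_spec n))
    refine ContinuousLinearMap.opNorm_le_bound _ (norm_nonneg _) fun z => ?_
    refine le_trans (le_of_eq ?_) (wavePair.le_opNorm z)
    exact lp.norm_single (E := fun _ : ℕ => Plane) (p := 2) (by norm_num) n (wavePair z)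

variable {α s}

theorem toSobolev_apply (g : Summ ℕ) (n : ℕ) :
    toSobolev α s g n = (((n : ℝ) + 2) ^ s * cw α 2 n) • wavePair (g n) := by
  have h : lp.evalCLM ℝ (fun _ : ℕ => Plane) 2 n ∘L toSobolev α s =
      (((n : ℝ) + 2) ^ s * cw α 2 n) • (wavePair ∘L lp.evalCLM ℝ (fun _ : ℕ => ℂ) 1 n) := by
    refine Summ.clm_ext fun m z => ?_
    rw [ContinuousLinearMap.comp_apply, toSobolev, Summ.lift_single]
    have e1 : lp.evalCLM ℝ (fun _ : ℕ => ℂ) 1 n (Summ.single m z) = if n = m then z else 0 :=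
      Summ.single_apply m n z
    simp only [smul_apply, ContinuousLinearMap.comp_apply, map_smul, e1]
    have e2 : lp.evalCLM ℝ (fun _ : ℕ => Plane) 2 n
        (lp.singleContinuousLinearMap ℝ (fun _ : ℕ => Plane) 2 m (wavePair z)) =
        if n = m then wavePair z else 0 := by
      change (lp.single 2 m (wavePair z) : XSpace s) n = _
      rw [lp.single_apply, Pi.single_apply]
    rw [e2]
    split_ifs with h
    · rw [h]
    · rw [map_zero, smul_zero, smul_zero]
  exact congrArg (fun T : Summ ℕ →L[ℝ] Plane => T g) h

theorem toFun_toSobolev (g : Summ ℕ) (x : ℝ) : toFun s (toSobolev α s g) x = prof α 2 g x := by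
  rw [toFun, prof]
  refine tsum_congr fun n => ?_
  have hn : (0 : ℝ) < (n : ℝ) + 2 := by positivity
  have h1 : ((n : ℝ) + 2) ^ (-s) * ((n : ℝ) + 2) ^ s = 1 := by
    rw [← Real.rpow_add hn]; simp
  have e : ((n : ℂ) + 2) * x * Complex.I = (((n : ℝ) + 2) * x : ℝ) * Complex.I := by push_cast; rfl
  rw [toSobolev_apply, wavePair_apply, e, re_mul_exp]
  simp only [PiLp.smul_apply, smul_eq_mul]
  simp
  linear_combination (cw α 2 n * ((g n).re * Real.cos (((n : ℝ) + 2) * x) -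
    (g n).im * Real.sin (((n : ℝ) + 2) * x))) * h1

instance factOneLeOne : Fact ((1 : ℝ) ≤ 1) := ⟨le_rfl⟩

/-- Cauchy-Schwarz: the powers have exponent α - s = 1 - k ≤ -2, hence are square summable. Sobolev
profiles thus have coordinates in ℓ¹ for ρ = 1. -/
theorem summable_wave_amplitude {k : ℕ} (hk : 3 ≤ k) (hs : s = k + α - 1) (c : XSpace s) :
    Summable (fun n : ℕ => ((n : ℝ) + 2) ^ (α - s) * ‖c n‖) ∧
      ∑' n : ℕ, ((n : ℝ) + 2) ^ (α - s) * ‖c n‖ ≤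
        (∑' n : ℕ, (((n : ℝ) + 2) ^ (α - s)) ^ (2 : ℝ)) ^ (1 / (2 : ℝ)) * ‖c‖ := by
  have h1 : Summable fun n : ℕ => (((n : ℝ) + 2) ^ (α - s)) ^ (2 : ℝ) := by
    have h2 := (summable_nat_add_iff 2).2 (Real.summable_one_div_nat_pow.2 one_lt_two)
    refine Summable.of_nonneg_of_le (fun n => by positivity) (fun n => ?_) h2
    have hn : (1 : ℝ) ≤ (n : ℝ) + 2 := by linarith [n.cast_nonneg (α := ℝ)]
    have hk' : (3 : ℝ) ≤ k := by exact_mod_cast hk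
    rw [← Real.rpow_mul (by positivity)]
    refine (Real.rpow_le_rpow_of_exponent_le hn (by rw [hs]; linarith : (α - s) * 2 ≤ -2)).trans ?_
    rw [Real.rpow_neg (by positivity), one_div]
    push_cast
    norm_num
  have h2 : HasSum (fun n => ‖c n‖ ^ (2 : ℝ)) (‖c‖ ^ (2 : ℝ)) := by
    simpa using lp.hasSum_norm (p := 2) (by norm_num) c
  have hh := Real.HolderConjugate.two_two
  refine ⟨Real.summable_mul_of_Lp_Lq_of_nonneg hh (fun n => by positivity)
    (fun n => norm_nonneg _) h1 h2.summable, ?_⟩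
  have h3 := Real.inner_le_Lp_mul_Lq_tsum_of_nonneg hh (f := fun n : ℕ => ((n : ℝ) + 2) ^ (α - s))
    (g := fun n => ‖c n‖) (fun n => by positivity) (fun n => norm_nonneg _) h1 h2.summable
  rw [h2.tsum_eq, ← Real.rpow_mul (norm_nonneg c), mul_one_div_cancel two_ne_zero, Real.rpow_one] at h3
  exact h3

variable (α s) in
/-- The map from the Sobolev space to the space of profiles with summable coefficients. -/
def ofSobolev {k : ℕ} (hk : 3 ≤ k) (hs : s = k + α - 1) : XSpace s →L[ℝ] Summ ℕ :=
  LinearMap.mkContinuous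
    { toFun := fun c => ⟨fun n => ((((n : ℝ) + 2) ^ (α - s) : ℝ) : ℂ) * pairWave (c n), by
        refine memℓp_gen ((summable_wave_amplitude hk hs c).1.congr fun n => ?_)
        rw [ENNReal.toReal_one, Real.rpow_one, norm_mul, norm_pairWave, Complex.norm_real,
          Real.norm_of_nonneg (by positivity)]⟩
      map_add' := fun c d => by
        refine lp.ext (funext fun n => ?_)
        change _ * pairWave (c n + d n) = _ * pairWave (c n) + _ * pairWave (d n)
        rw [← mul_add]
        congr 1
        apply Complex.ext <;> simp [pairWave]; ring
      map_smul' := fun r c => by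
        refine lp.ext (funext fun n => ?_)
        change _ * pairWave (r • c n) = r • (_ * pairWave (c n))
        rw [← mul_smul_comm]
        congr 1
        apply Complex.ext <;> simp [pairWave] }
    ((∑' n : ℕ, (((n : ℝ) + 2) ^ (α - s)) ^ (2 : ℝ)) ^ (1 / (2 : ℝ))) fun c => by
      refine le_trans (le_of_eq ?_) (summable_wave_amplitude hk hs c).2
      rw [← (Summ.hasSum_norm _).tsum_eq]
      refine tsum_congr fun n => ?_
      change ‖((((n : ℝ) + 2) ^ (α - s) : ℝ) : ℂ) * pairWave (c n)‖ = _
      rw [norm_mul, norm_pairWave, Complex.norm_real, Real.norm_of_nonneg (by positivity)]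

theorem ofSobolev_apply {k : ℕ} (hk : 3 ≤ k) (hs : s = k + α - 1) (c : XSpace s) (n : ℕ) :
    ofSobolev α s hk hs c n = ((((n : ℝ) + 2) ^ (α - s) : ℝ) : ℂ) * pairWave (c n) := rfl

theorem ofSobolev_injective {k : ℕ} (hk : 3 ≤ k) (hs : s = k + α - 1) :
    Function.Injective (ofSobolev α s hk hs) := by
  intro c d h
  refine lp.ext (funext fun n => ?_)
  have h1 : ofSobolev α s hk hs c n = ofSobolev α s hk hs d n := by rw [h]
  rw [ofSobolev_apply, ofSobolev_apply] at h1
  have h0 : (0 : ℝ) < ((n : ℝ) + 2) ^ (α - s) := by positivity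
  have h2 := mul_left_cancel₀ (Complex.ofReal_ne_zero.2 h0.ne') h1
  ext k
  fin_cases k
  · exact congrArg Complex.re h2
  · exact neg_injective (congrArg Complex.im h2)

theorem prof_ofSobolev {k : ℕ} (hk : 3 ≤ k) (hs : s = k + α - 1) (c : XSpace s) (x : ℝ) :
    prof α 1 (ofSobolev α s hk hs c) x = toFun s c x := by
  rw [toFun, prof]
  refine tsum_congr fun n => ?_
  have hn : (0 : ℝ) < (n : ℝ) + 2 := by positivity
  have h1 : cw α 1 n * ((n : ℝ) + 2) ^ (α - s) = ((n : ℝ) + 2) ^ (-s) := by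
    rw [cw, one_pow, inv_one, mul_one, ← Real.rpow_neg hn.le, ← Real.rpow_add hn]
    congr 1; ring
  have e : ((n : ℂ) + 2) * x * Complex.I = (((n : ℝ) + 2) * x : ℝ) * Complex.I := by push_cast; rfl
  rw [ofSobolev_apply, mul_assoc, Complex.re_ofReal_mul, e, re_mul_exp, ← mul_assoc, h1]
  simp [pairWave]

end

end

/-! ### Existence and uniqueness of the branch -/

noncomputable section

open MeasureTheory Wiener

section

variable {α : ℝ} [hα : Fact (α ∈ Ioo (1 : ℝ) 2)] {N : ℕ} {b : Fin N → ℝ} {lam : Param N}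
  {S : Finset (Coord N)} {A : (Fin N → Plane) →L[ℝ] (S → ℝ)}

theorem totalH_eq_zero_iff {ρ : ℝ} [hρ : Fact (1 ≤ ρ)] (hb : ∀ i, 0 < b i) {ε : ℝ}
    {g : Fin N → Summ ℕ} (h : Admissible α ρ b ε g lam) (i : Fin N) :
    totalH α ρ b ε g lam i = 0 ↔ ∀ x, functional α b ε (fun j => prof α ρ (g j)) lam i x = 0 := by
  constructor
  · intro h0 x
    have h1 := ev_totalH hb h i x
    rw [h0, map_zero] at h1
    have h2 := Complex.ofReal_eq_zero.1 h1.symm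
    exact (mul_eq_zero.1 h2).resolve_left (radius_pos h i x).ne'
  · intro h0
    refine ext_evL fun x => ?_
    rw [← ev_eq, ← ev_eq, ev_totalH hb h, h0, mul_zero, map_zero, Complex.ofReal_zero]

theorem contourMap_eq_zero {ρ : ℝ} [hρ : Fact (1 ≤ ρ)] (hb : ∀ i, 0 < b i)
    {p : ℝ × (Fin N → Summ ℕ) × (S → ℝ)} (h : Admissible α ρ b p.1 p.2.1 (glue S lam p.2.2))
    (h0 : ∀ i x, functional α b p.1 (fun j => prof α ρ (p.2.1 j)) (glue S lam p.2.2) i x = 0) :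
    contourMap α ρ b lam S A p = 0 := by
  have h1 : ∀ i, totalH α ρ b p.1 p.2.1 (glue S lam p.2.2) i = 0 := fun i =>
    (totalH_eq_zero_iff hb h i).2 (h0 i)
  have h2 : (fun i => modeOne (totalH α ρ b p.1 p.2.1 (glue S lam p.2.2) i)) = 0 :=
    funext fun i => by rw [h1, map_zero]; rfl
  refine Prod.ext (funext fun i => ?_) ?_
  · change high (totalH α ρ b p.1 p.2.1 (glue S lam p.2.2) i) = 0
    rw [h1, map_zero]
  · change A (fun i => modeOne (totalH α ρ b p.1 p.2.1 (glue S lam p.2.2) i)) = 0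
    rw [h2, map_zero]

/-- In the limit `ε = 0`, the patches are discs. -/
theorem eq_zero_of_functional_zero {ρ : ℝ} [hρ : Fact (1 ≤ ρ)] (hb : ∀ i, 0 < b i)
    (hlam : IsStationary α lam) {g : Fin N → Summ ℕ}
    (h0 : ∀ i x, functional α b 0 (fun j => prof α ρ (g j)) lam i x = 0) : g = 0 := by
  obtain ⟨T', -, hT⟩ := high_selfLin_inverse (α := α) (ρ := ρ)
  funext i
  have h1 := (totalH_eq_zero_iff hb (admissible_zero (α := α) (ρ := ρ) b g hlam.distinct) i).2 (h0 i)
  have h2 := high_totalH_zero (α := α) (ρ := ρ) hb g hlam.distinct i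
  rw [h1, map_zero] at h2
  have hc : kernelConst α / (2 * Real.pi) * strength lam i ≠ 0 :=
    mul_ne_zero (div_ne_zero kernelConst_pos.ne' (by positivity)) (hlam.strength_ne_zero i)
  have h3 := (smul_eq_zero.1 h2.symm).resolve_left hc
  have h4 := congrArg (fun T : Summ ℕ →L[ℝ] Summ ℕ => T (g i)) hT
  change T' (high (selfLin α ρ (g i))) = g i at h4
  rw [h3, map_zero] at h4
  exact h4.symm

theorem exists_Ioo_of_eventually {P : ℝ → Prop} (h : ∀ᶠ x in 𝓝 (0 : ℝ), P x) :
    ∃ δ > 0, ∀ x ∈ Ioo (-δ) δ, P x := by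
  obtain ⟨δ, hδ, hP⟩ := Metric.eventually_nhds_iff.1 h
  exact ⟨δ, hδ, fun x hx => hP (by rw [dist_zero_right, Real.norm_eq_abs]; exact abs_lt.2 hx)⟩

/-- Two continuous maps on a preconnected space that coincide somewhere and that coincide near each
point where they coincide are equal. -/
theorem eq_of_locally_eq {X Y : Type*} [TopologicalSpace X] [PreconnectedSpace X]
    [TopologicalSpace Y] [T2Space Y] {u v : X → Y} (hu : Continuous u) (hv : Continuous v) {x₀ : X}
    (h0 : u x₀ = v x₀) (h : ∀ x, u x = v x → ∀ᶠ y in 𝓝 x, u y = v y) : u = v := by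
  have hc : IsClopen {x | u x = v x} := ⟨isClosed_eq hu hv, isOpen_iff_mem_nhds.2 h⟩
  rcases isClopen_iff.1 hc with h1 | h1
  · exact absurd h0 (eq_empty_iff_forall_notMem.1 h1 x₀)
  · exact funext (eq_univ_iff_forall.1 h1)

/-- The existence of a branch of solutions with all its properties. -/
theorem exists_solution (hb : ∀ i, 0 < b i) (hlam : IsStationary α lam)
    (hS : IsNondegenerate α lam S) (hA : A ∘L partialDeriv α S lam = ContinuousLinearMap.id ℝ _) :
    ∃ c : ℝ → (Fin N → Summ ℕ) × (S → ℝ), c 0 = (0, freePart S lam) ∧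
      HasDerivAt c (firstCoord α 2 b lam, 0) 0 ∧
      ∀ᶠ ε in 𝓝 (0 : ℝ), ContDiffAt ℝ 1 c ε ∧
        (∀ i x, functional α b ε (fun j => prof α 2 ((c ε).1 j)) (glue S lam (c ε).2) i x = 0) ∧
        (∀ i x, 0 < radius α ε (b i) (prof α 2 ((c ε).1 i)) x) ∧
        (∀ i, StrictConvex ℝ (closure (starDomain (radius α ε (b i) (prof α 2 ((c ε).1 i)))))) ∧
        Pairwise fun i j : Fin N => Disjoint
          (closure (patch α ε (b i) (pos (glue S lam (c ε).2) i) (prof α 2 ((c ε).1 i))))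
          (closure (patch α ε (b j) (pos (glue S lam (c ε).2) j) (prof α 2 ((c ε).1 j)))) := by
  obtain ⟨c, hc, h0, hd, hz, -⟩ := exists_branch α 2 hb hlam hA
  refine ⟨c, h0, hd, ?_⟩
  have ht : Tendsto (fun ε => (ε, c ε)) (𝓝 0) (𝓝 (0, 0, freePart S lam)) := by
    have := tendsto_id.prodMk_nhds hc.continuousAt.tendsto
    rwa [h0] at this
  filter_upwards [hc.eventually (by simp), hz, ht.eventually (eventually_totalH_eq_zero hb hlam hS hA),
    ht.eventually (eventually_admissible (α := α) (ρ := 2) b hlam.distinct S),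
    ht.eventually (eventually_geometry (α := α) b hlam.distinct S)] with ε h1 h2 h3 h4 h5
  refine ⟨h1, fun i => (totalH_eq_zero_iff hb h4 i).1 ?_, h5⟩
  -- The conservation laws carry negative powers of ε. At ε = 0 the equation holds directly, since
  -- the profiles vanish and the vortices are in equilibrium.
  by_cases hε : ε = 0
  · subst hε
    rw [h0, glue_freePart, totalH_zero hb 0 hlam.distinct, hlam.equilibrium]
    have : angC 0 = 0 := angCL.map_zero
    rw [this, map_zero, Pi.zero_apply, map_zero, smul_zero, add_zero]
  · exact h3 hε h2 i

end

end

end GSQG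

open GSQG in
theorem theorem4p4 (α : ℝ) (hα : α ∈ Set.Ioo (1 : ℝ) 2) (k : ℕ) (hk : 3 ≤ k)
    (N : ℕ) (b : Fin N → ℝ) (hb : ∀ i, 0 < b i)
    (lam : GSQG.Param N) (hlam : GSQG.IsStationary α lam)
    (S : Finset (GSQG.Coord N)) (hS : GSQG.IsNondegenerate α lam S) :
    ∃ ε₁ : ℝ, 0 < ε₁ ∧
      ∃ (f : ℝ → Fin N → GSQG.XSpace (k + α - 1)) (lam₁ : ℝ → S → ℝ),
        GSQG.IsSolutionCurve α (k + α - 1) b S lam ε₁ f lam₁ ∧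
        -- uniqueness of the curve
        (∀ (g : ℝ → Fin N → GSQG.XSpace (k + α - 1)) (mu : ℝ → S → ℝ),
          GSQG.IsSolutionCurve α (k + α - 1) b S lam ε₁ g mu →
          ∀ ε ∈ Set.Ioo (-ε₁) ε₁, g ε = f ε ∧ mu ε = lam₁ ε) ∧
        -- asymptotic expansions
        ((fun ε : ℝ => lam₁ ε - GSQG.freePart S lam) =o[𝓝 0] fun ε : ℝ => ε) ∧
        (∃ f' : Fin N → GSQG.XSpace (k + α - 1),
          (∀ i x, GSQG.toFun (k + α - 1) (f' i) x = GSQG.firstOrder α b lam i x) ∧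
          (fun ε : ℝ => f ε - ε • f') =o[𝓝 0] fun ε : ℝ => ε) ∧
        -- geometry of the patches
        ∀ ε ∈ Set.Ioo (-ε₁) ε₁, ε ≠ 0 →
          (∀ i x, 0 < GSQG.radius α ε (b i) (GSQG.toFun (k + α - 1) (f ε i)) x) ∧
          (∀ i, StrictConvex ℝ (closure (GSQG.starDomain
            (GSQG.radius α ε (b i) (GSQG.toFun (k + α - 1) (f ε i)))))) ∧
          Pairwise fun i j : Fin N =>
            Disjoint
              (closure (GSQG.patch α ε (b i) (GSQG.pos (GSQG.glue S lam (lam₁ ε)) i)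
                (GSQG.toFun (k + α - 1) (f ε i))))
              (closure (GSQG.patch α ε (b j) (GSQG.pos (GSQG.glue S lam (lam₁ ε)) j)
                (GSQG.toFun (k + α - 1) (f ε j)))) := by
  have : Fact (α ∈ Ioo (1 : ℝ) 2) := ⟨hα⟩
  obtain ⟨A, hA⟩ := exists_partialDeriv_leftInverse hS
  obtain ⟨c, h0, hd, hev⟩ := exists_solution hb hlam hS hA
  -- The branch for ρ = 2 is the solution. The one for ρ = 1 serves only for its local uniqueness,
  -- in a space large enough to contain every Sobolev competitor.
  obtain ⟨c', -, -, -, -, huniq⟩ := exists_branch α 1 hb hlam hA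
  set s : ℝ := k + α - 1 with hs
  set T : (Fin N → Summ ℕ) →L[ℝ] (Fin N → XSpace s) :=
    ContinuousLinearMap.pi fun i => toSobolev α s ∘L ContinuousLinearMap.proj i with hT
  set T' : (Fin N → XSpace s) →L[ℝ] (Fin N → Summ ℕ) :=
    ContinuousLinearMap.pi fun i => ofSobolev α s hk hs ∘L ContinuousLinearMap.proj i with hT'
  have hT'inj : Function.Injective T' := fun u v huv =>
    funext fun i => ofSobolev_injective hk hs (congrFun huv i)
  have hprof : ∀ u : Fin N → XSpace s, (fun j => prof α 1 (T' u j)) = fun j => toFun s (u j) :=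
    fun u => funext fun j => funext fun x => prof_ofSobolev hk hs (u j) x
  have htoFun : ∀ (g : Fin N → Summ ℕ) j, toFun s (T g j) = prof α 2 (g j) := fun g j =>
    funext fun x => toFun_toSobolev (g j) x
  -- local uniqueness in the large space
  have hQ : ∀ᶠ p : ℝ × (Fin N → Summ ℕ) × (S → ℝ) in 𝓝 (0, 0, freePart S lam),
      (∀ i x, functional α b p.1 (fun j => prof α 1 (p.2.1 j)) (glue S lam p.2.2) i x = 0) →
        c' p.1 = p.2 := by
    filter_upwards [huniq, eventually_admissible (α := α) (ρ := 1) b hlam.distinct S] with p h1 h2 h3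
    exact h1 (contourMap_eq_zero hb h2 h3)
  have hc0 : ContinuousAt c 0 := hd.continuousAt
  have ht : Tendsto (fun ε => (ε, T' (T (c ε).1), (c ε).2)) (𝓝 0) (𝓝 (0, 0, freePart S lam)) := by
    have h1 : ContinuousAt (fun ε => (ε, T' (T (c ε).1), (c ε).2)) 0 :=
      continuousAt_id.prodMk (((T'.continuous.comp T.continuous).continuousAt.comp hc0.fst).prodMk
        hc0.snd)
    have h2 := h1.tendsto
    rwa [h0, map_zero, map_zero] at h2
  have hball : ∀ᶠ ε in 𝓝 (0 : ℝ), ‖T (c ε).1‖ < 1 := by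
    have h1 : ContinuousAt (fun ε => ‖T (c ε).1‖) 0 :=
      (T.continuous.continuousAt.comp hc0.fst).norm
    refine h1.eventually (gt_mem_nhds ?_)
    simp only [h0, map_zero, norm_zero, zero_lt_one]
  -- The interval is chosen so that local uniqueness holds in a whole neighbourhood of every point
  -- of the branch, not only at the points themselves.
  obtain ⟨ε₁, hε₁, hP⟩ := exists_Ioo_of_eventually
    (hev.and (hball.and (ht.eventually (eventually_eventually_nhds.2 hQ))))
  have hmem0 : (0 : ℝ) ∈ Ioo (-ε₁) ε₁ := ⟨by linarith, hε₁⟩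
  have hsol : IsSolutionCurve α s b S lam ε₁ (fun ε => T (c ε).1) (fun ε => (c ε).2) := by
    refine ⟨fun ε hε => ?_, fun ε hε => (hP ε hε).2.1, by rw [h0], fun ε hε i x => ?_⟩
    · have h1 := (hP ε hε).1.1
      exact ((T.contDiff.contDiffAt.comp ε h1.fst).prodMk h1.snd).contDiffWithinAt
    · have h1 := (hP ε hε).1.2.1 i x
      simp only [htoFun]
      exact h1
  refine ⟨ε₁, hε₁, fun ε => T (c ε).1, fun ε => (c ε).2, hsol, fun g mu hg => ?_, ?_,
    ⟨T (firstCoord α 2 b lam), fun i x => ?_, ?_⟩, fun ε hε _ => ?_⟩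
  · have hpre : PreconnectedSpace (Ioo (-ε₁) ε₁) := Subtype.preconnectedSpace isPreconnected_Ioo
    have hu : Continuous fun ε : Ioo (-ε₁) ε₁ => (g ε, mu ε) :=
      continuousOn_iff_continuous_domRestrict.1 hg.contDiffOn.continuousOn
    have hv : Continuous fun ε : Ioo (-ε₁) ε₁ => (T (c ε).1, (c ε).2) :=
      continuousOn_iff_continuous_domRestrict.1 hsol.contDiffOn.continuousOn
    have hzero : ∀ (u : ℝ → Fin N → XSpace s) (ν : ℝ → S → ℝ), IsSolutionCurve α s b S lam ε₁ u ν →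
        ∀ ε ∈ Ioo (-ε₁) ε₁, ∀ i x,
          functional α b ε (fun j => prof α 1 (T' (u ε) j)) (glue S lam (ν ε)) i x = 0 :=
      fun u ν h ε hε i x => by rw [hprof]; exact h.zero ε hε i x
    -- A solution curve prescribes only the parameters at ε = 0. That its profiles vanish there
    -- follows from injectivity of the linearised self-interaction.
    have hinit : g 0 = T (c 0).1 := by
      rw [h0, map_zero]
      refine hT'inj ?_
      rw [map_zero]
      refine eq_zero_of_functional_zero (α := α) (ρ := 1) hb hlam fun i x => ?_
      have := hzero g mu hg 0 hmem0 i x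
      rwa [hg.initial, glue_freePart] at this
    -- A competitor need not stay near the equilibrium a priori. Wherever it meets the branch,
    -- continuity keeps both in the region of local uniqueness, so the set of coincidence is open as
    -- well as closed.
    have heq := eq_of_locally_eq hu hv (x₀ := ⟨0, hmem0⟩)
      (Prod.ext hinit (by change mu 0 = (c 0).2; rw [hg.initial, h0])) fun ε hε => by
        have hw : ∀ w : Ioo (-ε₁) ε₁ → (Fin N → XSpace s) × (S → ℝ), Continuous w →
            w ε = (T (c ε).1, (c ε).2) → ∀ᶠ δ : Ioo (-ε₁) ε₁ in 𝓝 ε,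
            (∀ i x, functional α b δ (fun j => prof α 1 (T' (w δ).1 j)) (glue S lam (w δ).2) i x = 0) →
              c' δ = (T' (w δ).1, (w δ).2) := by
          intro w hw hwε
          have h1 : Continuous fun δ : Ioo (-ε₁) ε₁ => ((δ : ℝ), T' (w δ).1, (w δ).2) :=
            continuous_subtype_val.prodMk ((T'.continuous.comp hw.fst).prodMk hw.snd)
          have h2 := (hP ε ε.2).2.2
          have h3 := h1.tendsto ε
          rw [hwε] at h3
          exact h3.eventually h2
        filter_upwards [hw _ hu hε, hw _ hv rfl] with δ h1 h2
        have e1 := h1 (hzero g mu hg δ δ.2)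
        have e2 := h2 (hzero _ _ hsol δ δ.2)
        have e3 := e1.symm.trans e2
        exact Prod.ext (hT'inj (Prod.ext_iff.1 e3).1) (Prod.ext_iff.1 e3).2
    intro ε hε
    exact Prod.ext_iff.1 (congrFun heq ⟨ε, hε⟩)
  · have h1 := (hasDerivAt_iff_isLittleO.1 hd.snd)
    simp only [h0, sub_zero, smul_zero] at h1
    exact h1
  · rw [htoFun]
    exact prof_firstCoord hlam i x
  · have h1 := (hasDerivAt_iff_isLittleO.1 (T.hasFDerivAt.comp_hasDerivAt (0 : ℝ) hd.fst))
    simp only [Function.comp_apply, h0, map_zero, sub_zero] at h1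
    exact h1
  · obtain ⟨h1, h2, h3⟩ := (hP ε hε).1.2.2
    simp only [htoFun]
    exact ⟨h1, h2, h3⟩
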